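/- Let $k\ge 1$ and let $\mathbb S_k=\mathbb Z^2\times\{0,\dots,k\}$ be the slab, viewed as a graph in which two vertices are adjacent when their Euclidean distance is $1$. For $p\in[0,1]$ let $\mathbf P_p$ be Bernoulli bond percolation on $\mathbb S_k$: each edge is open with probability $p$, independently of the others. For $T\subset\mathbb Z^2$ write $\overline T=T\times\{0,\dots,k\}$. For $c\in\mathbb Z^2$ put $B_n(c)=c+[-n,n]^2$ and $A_{m,n}(c)=B_n(c)\setminus B_m(c)$ (intervals are intervals of integers), and omit $c$ when $c=0$. For $A,B,S\subset\mathbb S_k$ write $A\leftrightarrow_S B$ for the event that a path of open edges with all its vertices in $S$ connects $A\cap S$ to $B\cap S$. Let $f_p(a,b)$ be the $\mathbf P_p$-probability of $\overline{\{0\}\times[0,b]}\leftrightarrow_{\overline{[0,a]\times[0,b]}}\overline{\{a\}\times[0,b]}$. Order the vertices of $\mathbb S_k$ by $x\prec y$ if $|x|<|y|$ (Euclidean norm), or $|x|=|y|$ and $x$ precedes $y$ lexicographically in the three coordinates. A circuit is a closed path $\Gamma(1),\dots,\Gamma(r)=\Gamma(1)$ in $\mathbb S_k$ of at least three edges with $\Gamma(1),\dots,\Gamma(r-1)$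 distinct, considered up to cyclic permutation and reversal; it is represented by the sequence for which $\Gamma(1)\prec\Gamma(i)$ for $1<i<r$ and $\Gamma(2)\prec\Gamma(r-1)$. Circuits are ordered lexicographically by these sequences of vertices. A circuit in $\overline{A_{m,n}(c)}$ surrounds $\overline{B_m(c)}$ if its projection to $\mathbb Z^2$ has non-zero winding number around $c$. For $n\ge m$ let $\Gamma_1$ be the minimal open circuit in $\overline{A_{m,n}}$ surrounding $\overline{B_m}$, and $\Gamma_2$ the minimal open circuit in $\overline{A_{m,n}((3n,0))}$ surrounding $\overline{B_m((3n,0))}$, each identified with its set of vertices and taken to be $\emptyset$ if there is no such circuit. Let $a_p(m,n)=\mathbf P_p[\Gamma_1\ne\emptyset]$. **Theorem.** Fix $\varepsilon>0$ and $k\ge1$. There is a continuous, strictly increasing function $h_1:[0,1]\to[0,1]$ with $h_1(0)=0$ and $h_1(1)=1$, depending only on $\varepsilon$ and $k$, such that for every $p\in[\varepsilon,1-\varepsilon]$ and all integers $n\ge m\ge3$, $$\mathbf P_p\big[\Gamma_1\leftrightarrow_R\Gamma_2\big]\;\ge\; h_1\big(f_p(3n,2m)\,a_p(m,n)^2\big),\qquad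 R=\overline{[0,3n]\times[-m,m]}.$$ -/

import Mathlib

open MeasureTheory ProbabilityTheory

noncomputable section

namespace Slab

/-- Vertices of the slab `ℤ² × {0, …, k}`; `x.1` is the projection of `x` to `ℤ²`. -/
abbrev Vertex (k : ℕ) : Type := (ℤ × ℤ) × Fin (k + 1)

/-- The slab graph: two vertices are adjacent when their Euclidean distance is `1`. -/
def graph (k : ℕ) : SimpleGraph (Vertex k) where
  Adj x y :=
    (x.1.1 - y.1.1) ^ 2 + (x.1.2 - y.1.2) ^ 2 + ((x.2.val : ℤ) - (y.2.val : ℤ)) ^ 2 = 1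
  symm := ⟨fun x y h => by rw [← h]; ring⟩
  loopless := ⟨fun x h => by simp at h⟩

/-- Percolation configurations: `ω e = true` means that the edge `e` is open. -/
abbrev Config (k : ℕ) : Type := (graph k).edgeSet → Bool

/-- Bernoulli bond percolation on the slab: every edge is open with probability `p`,
independently of the others. -/
def perc (k : ℕ) (p : unitInterval) : Measure (Config k) :=
  Measure.infinitePi fun _ => bernoulliMeasure true false p

/-- The graph formed by the open edges of `ω`. -/
def openGraph {k : ℕ} (ω : Config k) : SimpleGraph (Vertex k) :=
  SimpleGraph.fromEdgeSet {e | ∃ h : e ∈ (graph k).edgeSet, ω ⟨e, h⟩ = true}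

/-- `Connected ω A S B`: some path of open edges inside `S` connects `A ∩ S` to `B ∩ S`. -/
def Connected {k : ℕ} (ω : Config k) (A S B : Set (Vertex k)) : Prop :=
  ∃ a ∈ A ∩ S, ∃ b ∈ B ∩ S, ∃ w : (openGraph ω).Walk a b, ∀ x ∈ w.support, x ∈ S

/-- For `T ⊆ ℤ²`, the set `T × {0, …, k}`. -/
def lift (k : ℕ) (T : Set (ℤ × ℤ)) : Set (Vertex k) := {x | x.1 ∈ T}

/-- The planar box `c + [-n, n]²`. -/
def box (n : ℕ) (c : ℤ × ℤ) : Set (ℤ × ℤ) :=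
  {z | |z.1 - c.1| ≤ (n : ℤ) ∧ |z.2 - c.2| ≤ (n : ℤ)}

/-- The planar annulus of points of the box of radius `n` outside the box of radius `m`. -/
def annulus (m n : ℕ) (c : ℤ × ℤ) : Set (ℤ × ℤ) := box n c \ box m c

/-- The crossing probability `f_p(m, n)`: the probability that `[0, m] × [0, n] × {0, …, k}`
contains an open path from its side over `{0} × [0, n]` to its side over `{m} × [0, n]`. -/
def crossProb (k : ℕ) (p : unitInterval) (m n : ℕ) : ℝ :=
  (perc k p).real {ω | Connected ω (lift k ({0} ×ˢ Set.Icc 0 (n : ℤ)))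
    (lift k (Set.Icc 0 (m : ℤ) ×ˢ Set.Icc 0 (n : ℤ))) (lift k ({(m : ℤ)} ×ˢ Set.Icc 0 (n : ℤ)))}

/-- The square of the Euclidean norm of a vertex. -/
def normSq {k : ℕ} (x : Vertex k) : ℤ := x.1.1 ^ 2 + x.1.2 ^ 2 + (x.2.val : ℤ) ^ 2

/-- The total order on vertices: first by Euclidean norm, then lexicographically in the
three coordinates. -/
def Prec {k : ℕ} (x y : Vertex k) : Prop :=
  normSq x < normSq y ∨ (normSq x = normSq y ∧
    (x.1.1 < y.1.1 ∨ (x.1.1 = y.1.1 ∧ (x.1.2 < y.1.2 ∨ (x.1.2 = y.1.2 ∧ x.2 < y.2)))))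

/-- A circuit of the slab, up to cyclic permutation and reversal: it is represented by the
closed path that starts at its smallest vertex and whose second vertex precedes its
last but one. -/
structure Circuit (k : ℕ) where
  base : Vertex k
  walk : (graph k).Walk base base
  isCycle : walk.IsCycle
  base_min : ∀ x ∈ walk.support, x ≠ base → Prec base x
  orientation : Prec walk.snd walk.penultimate

namespace Circuit

variable {k : ℕ}

/-- The set of vertices of a circuit. -/
def verts (γ : Circuit k) : Set (Vertex k) := {x | x ∈ γ.walk.support}

/-- All edges of the circuit are open. -/
def IsOpen (ω : Config k) (γ : Circuit k) : Prop :=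
  ∀ e ∈ γ.walk.edges, e ∈ (openGraph ω).edgeSet

/-- The lexicographic order on circuits induced by the order on vertices. -/
def Lt (γ γ' : Circuit k) : Prop := List.Lex Prec γ.walk.support γ'.walk.support

end Circuit

/-- A point of `ℤ²` as a complex number. -/
def toComplex (z : ℤ × ℤ) : ℂ := ⟨(z.1 : ℝ), (z.2 : ℝ)⟩

/-- The winding number around `c` of the projection of a circuit to the plane: the sum over the
steps of the circuit of the signed angles seen from `c`, divided by `2π`. It is meant for
circuits whose projection avoids `c`. -/
def Circuit.windingNumber {k : ℕ} (γ : Circuit k) (c : ℤ × ℤ) : ℝ :=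
  (γ.walk.darts.map fun d =>
    Complex.arg ((toComplex d.snd.1 - toComplex c) / (toComplex d.fst.1 - toComplex c))).sum
      / (2 * Real.pi)

/-- `γ` is an open circuit in the annulus `A_{m,n}(c) × {0, …, k}` that surrounds
the box `B_m(c) × {0, …, k}`. -/
def IsOpenSurrounding {k : ℕ} (ω : Config k) (m n : ℕ) (c : ℤ × ℤ) (γ : Circuit k) : Prop :=
  γ.IsOpen ω ∧ γ.verts ⊆ lift k (annulus m n c) ∧ γ.windingNumber c ≠ 0

/-- `γ` is the minimal open circuit in the annulus that surrounds the inner box. -/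
def IsMinimalCircuit {k : ℕ} (ω : Config k) (m n : ℕ) (c : ℤ × ℤ) (γ : Circuit k) : Prop :=
  IsOpenSurrounding ω m n c γ ∧ ∀ γ', IsOpenSurrounding ω m n c γ' → γ' = γ ∨ γ.Lt γ'

/-- The vertex set of the minimal open circuit in `A_{m,n}(c) × {0, …, k}` that surrounds
`B_m(c) × {0, …, k}`; it is empty if there is no such circuit. -/
def minCircuit {k : ℕ} (ω : Config k) (m n : ℕ) (c : ℤ × ℤ) : Set (Vertex k) :=
  {x | ∃ γ, IsMinimalCircuit ω m n c γ ∧ x ∈ γ.verts}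

/-- The probability that there is an open circuit in `A_{m,n} × {0, …, k}` that surrounds
`B_m × {0, …, k}`, the annulus being centred at the origin. -/
def circuitProb (k : ℕ) (p : unitInterval) (m n : ℕ) : ℝ :=
  (perc k p).real {ω | (minCircuit ω m n (0, 0)).Nonempty}

/-- The class of continuous, strictly increasing bijections of `[0, 1]`. -/
structure IsGluingFunction (h : ℝ → ℝ) : Prop where
  continuousOn : ContinuousOn h (Set.Icc 0 1)
  strictMonoOn : StrictMonoOn h (Set.Icc 0 1)
  map_zero : h 0 = 0
  map_one : h 1 = 1

end Slab

end

/-! ### Construction of the gluing function from two estimates. -/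

namespace Slab

/-! Write $x=f_p(3n,2m)\,a_p(m,n)^2$ and let $y$ be the probability of connection. Two estimates
that depend only on $\varepsilon$ and $k$ suffice: $y\ge cx$ with $c>0$
(`exists_mul_le_connectionProb`), and $y\to1$ uniformly as $x\to1$ (`connectionProb_near_one`).
`exists_isGluingFunction_le` draws a continuous strictly increasing function below all such pairs.

The basic tool is gluing. A path that has to cross a circuit need not meet it in the slab, but the
projections meet, so path and circuit share a column, and an open vertical bridge in this column
joins them. The bridge is built by a map between configurations that modifies boundedly many edges.
By finite energy such a map is cheap if every result has few preimages (`surgery_bound`), that is,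
if the column of the bridge can be read off from the result. For this the path is a greedy path,
determined by the open edges and by independent auxiliary bits that favour ordered pairs of
neighbours. The bits at the foot of the bridge are reset so that the greedy path is the same after
the surgery (`FullGreedy.transfer`). Once the path is known, the bridge is recognised because the
circuit was not joined to the start of the path before (`IsSurgery.decode`). Of the minimality of
the circuit only an abstract selection rule is kept (`Family`). With Harris' inequality, gluing a
crossing of $R$ to $\Gamma_2$ and then $\Gamma_2$ to $\Gamma_1$ gives the linear bound.

If there are $g$ free shapes over disjoint regions, then $r$ bridges can be built at once in $\binom
gr$ ways, and if at most $t$ shapes were attached to the start, then a result comes from at most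
$\binom{r+t}r$ choices (`multi_surgery`). Hence it is improbable that a connection which has to
cross many shapes is joined to few of them (`two_sided_surgery`).

The second estimate is reduced to `Setup.exists_bound`: if a set $T$ far to the right is joined to
the left side of $R$ with probability close to $1$, then it is joined to a selected shape $S$ that
surrounds the box, whenever there is one. Suppose not, and follow a sequence of counterexamples
along an ultrafilter. Then $m\to\infty$, and by the square root trick $T$ is very likely joined to
one bin of the left side, at each scale $m/4^l$. This makes crossings of almost squares very likely
at every scale. A chord from a bin, glued to a pair of paths with neighbouring projections, yields
an arch with both feet on the left side; interlacing translates of arches are glued to longer ones,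
and so rectangles are crossed in the long direction, and half-annuli contain arches, with
probability bounded below. A small bin is therefore screened, with high probability, by any
prescribed number $N$ of disjoint arches at larger scales.

Now let $T$ be joined to the bin but not to $S$. Explore the cluster of $T$ off the columns of $S$.
A connection from $T$ to the bin leaves this cluster through an edge to a column of $S$, an entry.
If all open entries are joined to at most $t$ arches, then two-sided surgery applies. Otherwise some
columns of $S$ contain an entry joined to more than $t$ arches and to an open entry. If there are
many such columns, opening any one of them is a surgery with at most $N/(t+1)$ columns leading to
the same result, because different preimages use disjoint sets of more than $t$ arches
(`IsOpening.disjoint`). If there are few, closing all their entries leads to the first case, and the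
closed columns are determined by a subset of at most $N/(t+1)$ strong components (`few_active`). As
$N/(t+1)$ stays bounded while $N$ and $t$ grow, the cost of these operations is fixed before the
remaining errors are made small.

The estimate is used twice: in the mirror image it joins the left side of $R$ to $\Gamma_2$, and
then, with the edges over the right annulus frozen and $T=\Gamma_2$, it joins $\Gamma_2$ to
$\Gamma_1$. -/

/-- A family of pairs `(x, y)` with `y ≥ c x`, in which `y` tends to `1` uniformly as `x` tends
to `1`, lies above the graph of a gluing function. -/
theorem exists_isGluingFunction_le {S : Set (ℝ × ℝ)} {c : ℝ} (hc : 0 < c) (hc1 : c ≤ 1)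
    (hS : ∀ z ∈ S, z.1 ∈ Set.Icc (0 : ℝ) 1)
    (hlow : ∀ z ∈ S, c * z.1 ≤ z.2)
    (hnear : ∀ η > (0 : ℝ), ∃ δ > (0 : ℝ), ∀ z ∈ S, 1 - δ ≤ z.1 → 1 - η ≤ z.2) :
    ∃ h : ℝ → ℝ, IsGluingFunction h ∧ ∀ z ∈ S, h z.1 ≤ z.2 := by
  have hnear' : ∀ η > (0 : ℝ), ∃ δ > (0 : ℝ), δ ≤ 1 ∧ ∀ z ∈ S, 1 - δ ≤ z.1 → 1 - η ≤ z.2 := by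
    intro η hη
    obtain ⟨δ, hδ, h⟩ := hnear η hη
    exact ⟨min δ 1, lt_min hδ one_pos, min_le_right _ _, fun z hz hz1 =>
      h z hz (by linarith [min_le_left δ 1])⟩
  -- The tolerance $2^{-(n+1)}$ equals the weight of the $n$-th ramp below, so that $1$ minus the
  -- tolerance is the sum of the weights of the ramps up to the $n$-th.
  choose δ hδ hδ1 hδS using fun n : ℕ => hnear' ((1 / 2 : ℝ) ^ (n + 1)) (by positivity)
  set ψ : ℕ → ℝ → ℝ := fun n x => max 0 ((x - (1 - δ n)) / δ n)
  have hψ0 : ∀ n x, 0 ≤ ψ n x := fun n x => le_max_left _ _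
  have hψ1 : ∀ n x, x ≤ 1 → ψ n x ≤ 1 := fun n x hx =>
    max_le zero_le_one ((div_le_one (hδ n)).2 (by linarith))
  have hψmono : ∀ n, Monotone (ψ n) := fun n x y hxy =>
    max_le_max le_rfl (div_le_div_of_nonneg_right (by linarith) (hδ n).le)
  have hgeo : HasSum (fun n : ℕ => (1 / 2 : ℝ) ^ (n + 1)) 1 := by
    have h := (hasSum_geometric_of_lt_one (by norm_num : (0 : ℝ) ≤ 1 / 2) (by norm_num)).mul_left
      (1 / 2 : ℝ)
    have h1 : (1 / 2 : ℝ) * (1 - 1 / 2)⁻¹ = 1 := by norm_num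
    rw [h1] at h
    simpa only [pow_succ'] using h
  have hsumm : ∀ x ≤ (1 : ℝ), Summable fun n => (1 / 2 : ℝ) ^ (n + 1) * ψ n x := fun x hx =>
    Summable.of_nonneg_of_le (fun n => mul_nonneg (by positivity) (hψ0 n x))
      (fun n => mul_le_of_le_one_right (by positivity) (hψ1 n x hx)) hgeo.summable
  set g : ℝ → ℝ := fun x => ∑' n, (1 / 2 : ℝ) ^ (n + 1) * ψ n x
  have hg0 : ∀ x, 0 ≤ g x := fun x => tsum_nonneg fun n => mul_nonneg (by positivity) (hψ0 n x)
  have hg1 : g 1 = 1 := by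
    have : ∀ n, ψ n 1 = 1 := fun n => by
      simp only [ψ, sub_sub_cancel, div_self (hδ n).ne']; norm_num
    simp only [g, this, mul_one]
    exact hgeo.tsum_eq
  have hgstrict : ∀ x y, x < y → y ≤ 1 → 0 < g x → g x < g y := by
    intro x y hxy hy hgx
    have hex : ∃ n, 0 < ψ n x := by
      by_contra! hcon
      have : g x = 0 := by
        have h0 : ∀ n, ψ n x = 0 := fun n => le_antisymm (hcon n) (hψ0 n x)
        simp [g, h0]
      linarith
    obtain ⟨n, hn⟩ := hex
    refine Summable.tsum_lt_tsum (i := n)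
      (fun m => mul_le_mul_of_nonneg_left (hψmono m hxy.le) (by positivity)) ?_
      (hsumm x (hxy.le.trans hy)) (hsumm y hy)
    refine mul_lt_mul_of_pos_left ?_ (by positivity)
    have hx' : 0 < (x - (1 - δ n)) / δ n := by
      by_contra! hcon
      simp only [ψ, max_eq_left hcon, lt_irrefl] at hn
    calc ψ n x = (x - (1 - δ n)) / δ n := max_eq_right hx'.le
      _ < (y - (1 - δ n)) / δ n := div_lt_div_of_pos_right (by linarith) (hδ n)
      _ ≤ ψ n y := le_max_right _ _
  have hgcont : ContinuousOn g (Set.Iic 1) := by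
    refine continuousOn_tsum (u := fun n : ℕ => (1 / 2 : ℝ) ^ (n + 1)) (fun n => ?_)
      hgeo.summable (fun n x hx => ?_)
    · exact Continuous.continuousOn (by fun_prop)
    · rw [Real.norm_of_nonneg (mul_nonneg (by positivity) (hψ0 n x))]
      exact mul_le_of_le_one_right (by positivity) (hψ1 n x hx)
  have hgS : ∀ z ∈ S, g z.1 ≤ z.2 := by
    intro z hz
    have hz1 := (hS z hz).2
    have hz2 : 0 ≤ z.2 := (mul_nonneg hc.le (hS z hz).1).trans (hlow z hz)
    refine Summable.tsum_le_of_sum_range_le (hsumm _ hz1) fun N => ?_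
    induction N with
    | zero => simpa using hz2
    | succ N ih =>
      -- Either the $N$-th ramp is reached, and then $y$ exceeds the sum of all weights up to $N$,
      -- or its term vanishes and the induction hypothesis suffices.
      by_cases hN : 1 - δ N ≤ z.1
      · calc ∑ n ∈ Finset.range (N + 1), (1 / 2 : ℝ) ^ (n + 1) * ψ n z.1
            ≤ ∑ n ∈ Finset.range (N + 1), (1 / 2 : ℝ) ^ (n + 1) :=
              Finset.sum_le_sum fun n _ =>
                mul_le_of_le_one_right (by positivity) (hψ1 n _ hz1)
          _ = 1 - (1 / 2) ^ (N + 1) := by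
              have : ∀ M : ℕ, ∑ n ∈ Finset.range M, (1 / 2 : ℝ) ^ (n + 1) = 1 - (1 / 2) ^ M := by
                intro M
                induction M with
                | zero => simp
                | succ M ihM => rw [Finset.sum_range_succ, ihM]; ring
              exact this _
          _ ≤ z.2 := hδS N z hz hN
      · have : ψ N z.1 = 0 := max_eq_left
          (div_nonpos_of_nonpos_of_nonneg (by linarith) (hδ N).le)
        rw [Finset.sum_range_succ, this, mul_zero, add_zero]
        exact ih
  -- The sum `g` may vanish on an initial interval; the linear term makes the maximum strictly
  -- increasing there.
  refine ⟨fun x => max (c * x) (g x), ⟨?_, ?_, ?_, ?_⟩, fun z hz => max_le (hlow z hz) (hgS z hz)⟩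
  · exact ContinuousOn.sup (by fun_prop : Continuous fun x : ℝ => c * x).continuousOn
      (hgcont.mono fun x hx => hx.2)
  · intro x hx y hy hxy
    have hcxy : c * x < c * y := mul_lt_mul_of_pos_left hxy hc
    refine max_lt (lt_max_of_lt_left hcxy) ?_
    rcases (hg0 x).eq_or_lt with h0 | h0
    · rw [← h0]
      exact lt_max_of_lt_left ((mul_nonneg hc.le hx.1).trans_lt hcxy)
    · exact lt_max_of_lt_right (hgstrict x y hxy hy.2 h0)
  · have hψ00 : ∀ n, ψ n 0 = 0 := fun n => max_eq_left
      (div_nonpos_of_nonpos_of_nonneg (by linarith [hδ1 n]) (hδ n).le)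
    have h0 : g 0 = 0 := by simp [g, hψ00]
    simp [h0]
  · simp [hg1, hc1]

end Slab

/-! ### Finite product measures: Harris' inequality, independence and counting of surgeries. -/

namespace Slab

section FiniteProbability

variable {ι : Type*}

open Classical in
/-- The weight of the set `ω` of open coordinates among the coordinates of `F`. -/
noncomputable def wt (F : Finset ι) (q : ι → ℝ) (ω : Set ι) : ℝ :=
  ∏ i ∈ F, if i ∈ ω then q i else 1 - q i

/-- Expectation when the coordinates of `F` are open independently with probabilities `q`. -/
noncomputable def Ex (F : Finset ι) (q : ι → ℝ) (f : Set ι → ℝ) : ℝ :=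
  ∑ ω ∈ F.powerset, wt F q ω * f ω

/-- Probability when the coordinates of `F` are open independently with probabilities `q`. -/
noncomputable def Pr (F : Finset ι) (q : ι → ℝ) (E : Set (Set ι)) : ℝ := Ex F q (E.indicator 1)

/-- The weights lie between `0` and `1`. -/
def IsWeight (q : ι → ℝ) : Prop := ∀ i, 0 ≤ q i ∧ q i ≤ 1

/-- `E` depends only on the coordinates in `S`. -/
def DependsOnly (S : Set ι) (E : Set (Set ι)) : Prop := ∀ ω ω', ω ∩ S = ω' ∩ S → ω ∈ E → ω' ∈ E

variable {F G : Finset ι} {q : ι → ℝ} {f g : Set ι → ℝ} {E E' : Set (Set ι)}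

theorem wt_nonneg (hq : IsWeight q) (ω : Set ι) : 0 ≤ wt F q ω :=
  Finset.prod_nonneg fun i _ => by split_ifs <;> linarith [(hq i).1, (hq i).2]

@[simp] theorem Ex_empty : Ex ∅ q f = f ∅ := by simp [Ex, wt]

/-- Conditioning on one coordinate. Harris' inequality, independence and the change of coordinates
all follow by induction on `F` from this formula. -/
theorem Ex_insert [DecidableEq ι] {a : ι} (ha : a ∉ F) :
    Ex (insert a F) q f = q a * Ex F q (fun ω => f (insert a ω)) + (1 - q a) * Ex F q f := by
  have h1 : ∀ ω ∈ F.powerset, wt (insert a F) q (ω : Set ι) = (1 - q a) * wt F q ω := by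
    intro ω hω
    have : a ∉ ω := fun h => ha (Finset.mem_powerset.1 hω h)
    simp [wt, Finset.prod_insert ha, this]
  have h2 : ∀ ω ∈ F.powerset, wt (insert a F) q (insert a ω : Set ι) = q a * wt F q ω := by
    intro ω hω
    rw [wt, Finset.prod_insert ha]
    congr 1
    · simp
    · refine Finset.prod_congr rfl fun i hi => ?_
      have : i ≠ a := fun h => ha (h ▸ hi)
      simp [this]
  unfold Ex
  rw [Finset.sum_powerset_insert ha, add_comm, Finset.mul_sum, Finset.mul_sum]
  congr 1
  · refine Finset.sum_congr rfl fun ω hω => ?_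
    rw [Finset.coe_insert, h2 ω hω, mul_assoc]
  · exact Finset.sum_congr rfl fun ω hω => by rw [h1 ω hω, mul_assoc]

theorem Ex_add : Ex F q (fun ω => f ω + g ω) = Ex F q f + Ex F q g := by
  simp [Ex, mul_add, Finset.sum_add_distrib]

theorem Ex_mul_left (c : ℝ) : Ex F q (fun ω => c * f ω) = c * Ex F q f := by
  simp only [Ex, Finset.mul_sum]
  exact Finset.sum_congr rfl fun _ _ => by ring

theorem Ex_sum {α : Type*} (s : Finset α) (h : α → Set ι → ℝ) :
    Ex F q (fun ω => ∑ a ∈ s, h a ω) = ∑ a ∈ s, Ex F q (h a) := by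
  simp only [Ex, Finset.mul_sum]
  exact Finset.sum_comm

theorem Ex_mono (hq : IsWeight q) (h : ∀ ω : Set ι, ω ⊆ F → f ω ≤ g ω) : Ex F q f ≤ Ex F q g :=
  Finset.sum_le_sum fun ω hω => mul_le_mul_of_nonneg_left
    (h ω (Finset.coe_subset.2 (Finset.mem_powerset.1 hω))) (wt_nonneg hq _)

theorem Ex_congr (h : ∀ ω : Set ι, ω ⊆ F → f ω = g ω) : Ex F q f = Ex F q g :=
  Finset.sum_congr rfl fun ω hω => by
    rw [h ω (Finset.coe_subset.2 (Finset.mem_powerset.1 hω))]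

theorem Ex_const (c : ℝ) : Ex F q (fun _ => c) = c := by
  classical
  induction F using Finset.induction_on with
  | empty => simp
  | insert a F ha ih => rw [Ex_insert ha, ih]; ring

theorem Ex_union [DecidableEq ι] (h : Disjoint F G) :
    Ex (F ∪ G) q f = Ex F q (fun ω => Ex G q (fun ξ => f (ω ∪ ξ))) := by
  induction F using Finset.induction_on generalizing f with
  | empty => simp
  | insert a F ha ih =>
    rw [Finset.disjoint_insert_left] at h
    rw [Finset.insert_union, Ex_insert (by simp [ha, h.1]), Ex_insert ha, ih h.2, ih h.2]
    simp only [Set.insert_union]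

/-- An expectation only involves the coordinates on which the function depends. -/
theorem Ex_filter {S : Set ι} [DecidablePred (· ∈ S)] (h : ∀ ω, f ω = f (ω ∩ S)) :
    Ex F q f = Ex (F.filter (· ∈ S)) q f := by
  classical
  induction F using Finset.induction_on generalizing f with
  | empty => simp
  | insert a F ha ih =>
    rw [Ex_insert ha, Finset.filter_insert]
    by_cases haS : a ∈ S
    · rw [if_pos haS, Ex_insert (by simp [ha]), ih h, ih]
      intro ω
      rw [h (insert a ω), h (insert a (ω ∩ S)), Set.insert_inter_of_mem haS,
        Set.insert_inter_of_mem haS, Set.inter_assoc, Set.inter_self]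
    · rw [if_neg haS, ← ih h]
      have : (fun ω => f (insert a ω)) = f := by
        funext ω
        rw [h (insert a ω), h ω, Set.insert_inter_of_notMem haS]
      rw [this]; ring

theorem Ex_congr_weight {q' : ι → ℝ} (h : ∀ i ∈ F, q i = q' i) : Ex F q f = Ex F q' f := by
  refine Finset.sum_congr rfl fun ω _ => ?_
  congr 1
  exact Finset.prod_congr rfl fun i hi => by rw [h i hi]

theorem Ex_map {κ : Type*} (e : ι ↪ κ) (q : κ → ℝ) (f : Set κ → ℝ) :
    Ex (F.map e) q f = Ex F (q ∘ e) (fun ω => f (e '' ω)) := by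
  classical
  induction F using Finset.induction_on generalizing f with
  | empty => simp
  | insert a F ha ih =>
    rw [Finset.map_insert, Ex_insert (by simpa using ha), Ex_insert ha, ih, ih]
    simp [Set.image_insert_eq]

/-- Harris' inequality. -/
theorem Ex_mul_Ex_le (hq : IsWeight q) (hf : Monotone f) (hg : Monotone g) :
    Ex F q f * Ex F q g ≤ Ex F q (fun ω => f ω * g ω) := by
  classical
  induction F using Finset.induction_on generalizing f g with
  | empty => simp
  | insert a F ha ih =>
    have hf' : Monotone fun ω => f (insert a ω) := fun x y h => hf (Set.insert_subset_insert h)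
    have hg' : Monotone fun ω => g (insert a ω) := fun x y h => hg (Set.insert_subset_insert h)
    have h1 := ih hf hg
    have h2 := ih hf' hg'
    have h3 : Ex F q f ≤ Ex F q (fun ω => f (insert a ω)) :=
      Ex_mono hq fun ω _ => hf (Set.subset_insert _ _)
    have h4 : Ex F q g ≤ Ex F q (fun ω => g (insert a ω)) :=
      Ex_mono hq fun ω _ => hg (Set.subset_insert _ _)
    rw [Ex_insert ha, Ex_insert ha, Ex_insert ha]
    obtain ⟨h5, h6⟩ := hq a
    have h5' : 0 ≤ 1 - q a := by linarith
    -- The gain over the product of expectations: the covariance of the two conditional expectations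
    -- given the coordinate `a`, both of which increase with it.
    have h7 := mul_nonneg (mul_nonneg h5 h5') (mul_nonneg (sub_nonneg.2 h3) (sub_nonneg.2 h4))
    have h8 := mul_le_mul_of_nonneg_left h1 h5'
    have h9 := mul_le_mul_of_nonneg_left h2 h5
    nlinarith

/-- Independence of functions of disjoint sets of coordinates. -/
theorem Ex_mul_of_disjoint {S S' : Set ι} (h : ∀ ω, f ω = f (ω ∩ S)) (h' : ∀ ω, g ω = g (ω ∩ S'))
    (hS : Disjoint S S') : Ex F q (fun ω => f ω * g ω) = Ex F q f * Ex F q g := by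
  classical
  induction F using Finset.induction_on generalizing f g with
  | empty => simp
  | insert a F ha ih =>
    have hins : ∀ (S : Set ι) (f : Set ι → ℝ), (∀ ω, f ω = f (ω ∩ S)) → a ∉ S →
        (fun ω => f (insert a ω)) = f := by
      intro S f h haS
      funext ω
      rw [h (insert a ω), h ω, Set.insert_inter_of_notMem haS]
    have hins' : ∀ (S : Set ι) (f : Set ι → ℝ), (∀ ω, f ω = f (ω ∩ S)) →
        ∀ ω, f (insert a ω) = f (insert a (ω ∩ S)) := by
      intro S f h ω
      rw [h (insert a ω), h (insert a (ω ∩ S))]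
      congr 1; ext x; by_cases hx : x = a <;> simp [hx]
    rw [Ex_insert ha, Ex_insert ha, Ex_insert ha, ih h h', ih (hins' S f h) (hins' S' g h')]
    by_cases haS : a ∈ S
    · rw [hins S' g h' (Set.disjoint_left.1 hS haS)]; ring
    · rw [hins S f h haS]; ring

theorem indicator_dep {S : Set ι} (h : DependsOnly S E) (ω : Set ι) :
    E.indicator (1 : Set ι → ℝ) ω = E.indicator 1 (ω ∩ S) := by
  classical
  have : ω ∈ E ↔ ω ∩ S ∈ E := ⟨h _ _ (by simp [Set.inter_assoc]), h _ _ (by simp [Set.inter_assoc])⟩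
  simp [Set.indicator_apply, this]

theorem indicator_mono_of_upper (h : IsUpperSet E) : Monotone (E.indicator (1 : Set ι → ℝ)) := by
  classical
  intro x y hxy
  by_cases hx : x ∈ E
  · simp [hx, h hxy hx]
  · simp only [Set.indicator_of_notMem hx]
    exact Set.indicator_nonneg (by simp) _

theorem Pr_nonneg (hq : IsWeight q) : 0 ≤ Pr F q E :=
  (Ex_const (F := F) (q := q) 0).symm.le.trans
    (Ex_mono hq fun ω _ => Set.indicator_nonneg (by simp) _)

theorem Pr_univ : Pr F q Set.univ = 1 := by
  rw [Pr, Set.indicator_univ]; exact Ex_const 1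

theorem Pr_mono (hq : IsWeight q) (h : ∀ ω, ω ⊆ (F : Set ι) → ω ∈ E → ω ∈ E') :
    Pr F q E ≤ Pr F q E' := by
  classical
  refine Ex_mono hq fun ω hω => ?_
  by_cases hE : ω ∈ E
  · simp [hE, h ω hω hE]
  · simp only [Set.indicator_of_notMem hE]
    exact Set.indicator_nonneg (by simp) _

theorem Pr_congr (h : ∀ ω, ω ⊆ (F : Set ι) → (ω ∈ E ↔ ω ∈ E')) : Pr F q E = Pr F q E' := by
  classical
  exact Ex_congr fun ω hω => by simp [Set.indicator_apply, h ω hω]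

theorem Pr_le_one (hq : IsWeight q) : Pr F q E ≤ 1 :=
  (Pr_mono hq fun _ _ _ => Set.mem_univ _).trans Pr_univ.le

theorem Pr_union_le (hq : IsWeight q) : Pr F q (E ∪ E') ≤ Pr F q E + Pr F q E' := by
  classical
  unfold Pr
  rw [← Ex_add]
  refine Ex_mono hq fun ω _ => ?_
  by_cases h : ω ∈ E <;> by_cases h' : ω ∈ E' <;> simp [h, h']

theorem Pr_compl : Pr F q Eᶜ = 1 - Pr F q E := by
  classical
  have : Pr F q Eᶜ + Pr F q E = 1 := by
    unfold Pr
    rw [← Ex_add, ← Ex_const (F := F) (q := q) 1]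
    refine Ex_congr fun ω _ => ?_
    by_cases h : ω ∈ E <;> simp [h]
  linarith

theorem Pr_iUnion_le {α : Type*} (hq : IsWeight q) (s : Finset α) (A : α → Set (Set ι)) :
    Pr F q (⋃ a ∈ s, A a) ≤ ∑ a ∈ s, Pr F q (A a) := by
  classical
  induction s using Finset.induction_on with
  | empty => simp [Pr, Ex]
  | insert a s ha ih =>
    rw [Finset.sum_insert ha, Finset.set_biUnion_insert]
    exact (Pr_union_le hq).trans (by linarith)

/-- Partition of a probability according to the value of a random variable. -/
theorem sum_Pr_fiber {α : Type*} (s : Finset α) (X : Set ι → α) (hX : ∀ ω ⊆ (F : Set ι), ω ∈ E → X ω ∈ s) :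
    Pr F q E = ∑ a ∈ s, Pr F q (E ∩ {ω | X ω = a}) := by
  classical
  unfold Pr
  rw [← Ex_sum]
  refine Ex_congr fun ω hω => ?_
  by_cases h : ω ∈ E
  · rw [Finset.sum_eq_single (X ω)]
    · simp [h]
    · intro b _ hb; simp [hb.symm]
    · intro h'; exact absurd (hX ω hω h) h'
  · simp [h]

theorem Pr_mul_le_Pr_inter (hq : IsWeight q) (hE : IsUpperSet E) (hE' : IsUpperSet E') :
    Pr F q E * Pr F q E' ≤ Pr F q (E ∩ E') := by
  refine (Ex_mul_Ex_le hq (indicator_mono_of_upper hE) (indicator_mono_of_upper hE')).trans_eq ?_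
  unfold Pr
  rw [Set.inter_indicator_one]; rfl

theorem Pr_inter_of_disjoint {S S' : Set ι} (h : DependsOnly S E) (h' : DependsOnly S' E')
    (hS : Disjoint S S') : Pr F q (E ∩ E') = Pr F q E * Pr F q E' := by
  unfold Pr
  rw [← Ex_mul_of_disjoint (indicator_dep h) (indicator_dep h') hS, Set.inter_indicator_one]; rfl

/-- The probability of a local event only involves the coordinates on which it depends. -/
theorem Pr_eq_of_dependsOnly {S : Set ι} (h : DependsOnly S E)
    (hFG : ∀ i ∈ S, i ∈ F ↔ i ∈ G) : Pr F q E = Pr G q E := by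
  classical
  unfold Pr
  rw [Ex_filter (indicator_dep h), Ex_filter (F := G) (indicator_dep h)]
  congr 1
  ext i
  simp only [Finset.mem_filter]
  exact ⟨fun hi => ⟨(hFG i hi.2).1 hi.1, hi.2⟩, fun hi => ⟨(hFG i hi.2).2 hi.1, hi.2⟩⟩

theorem Pr_map {κ : Type*} (e : ι ↪ κ) (q : κ → ℝ) (E : Set (Set κ)) :
    Pr (F.map e) q E = Pr F (q ∘ e) {ω | e '' ω ∈ E} := by
  unfold Pr; rw [Ex_map]; rfl

theorem Pr_union_eq [DecidableEq ι] (h : Disjoint F G) :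
    Pr (F ∪ G) q E = Ex F q (fun ω => Pr G q {ξ | ω ∪ ξ ∈ E}) := by
  unfold Pr; rw [Ex_union h]; rfl

/-- Square root trick. -/
theorem sqrt_trick (hq : IsWeight q) (hE : IsUpperSet E) (hE' : IsUpperSet E') :
    (1 - Pr F q E) * (1 - Pr F q E') ≤ 1 - Pr F q (E ∪ E') := by
  have h1 := Pr_mul_le_Pr_inter (F := F) hq hE hE'
  have h2 : Pr F q (E ∪ E') + Pr F q (E ∩ E') = Pr F q E + Pr F q E' := by
    classical
    unfold Pr
    rw [← Ex_add, ← Ex_add]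
    refine Ex_congr fun ω _ => ?_
    by_cases h : ω ∈ E <;> by_cases h' : ω ∈ E' <;> simp [h, h']
  nlinarith

/-- The configurations that agree with `ω'` off `M` weigh at most a constant times `ω'`. -/
theorem Pr_agree_off_le {M : Finset ι} {δ : ℝ} {C : ℕ} (hq : IsWeight q) (hδ : 0 < δ)
    (hδ1 : δ ≤ 1) (hM : ∀ i ∈ M, i ∈ F → δ ≤ q i ∧ q i ≤ 1 - δ) (hC : M.card ≤ C) {ω' : Set ι} (hω' : ω' ⊆ F) :
    δ ^ C * Pr F q {ω | ω \ M = ω' \ M} ≤ wt F q ω' := by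
  classical
  have hdep : DependsOnly (M : Set ι)ᶜ {ω : Set ι | ω \ M = ω' \ M} := by
    intro ω ω'' h h1
    have h1 : ω \ M = ω' \ M := h1
    change ω'' \ M = ω' \ M
    rw [← h1, Set.sdiff_eq, Set.sdiff_eq, h]
  -- The event fixes every coordinate off `M` and none in `M`, so its probability is the part of the
  -- weight of `ω'` that comes from off `M`. The missing factors are at least `δ` each.
  have h1 : Pr F q {ω | ω \ M = ω' \ M} = wt (F \ M) q ω' := by
    rw [Pr_eq_of_dependsOnly (G := F \ M) hdep (fun i hi => by
      have : i ∉ M := by simpa using hi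
      simp [this])]
    unfold Pr Ex
    rw [Finset.sum_eq_single ((F \ M).filter (· ∈ ω'))]
    · rw [Set.indicator_of_mem]
      · simp only [Pi.one_apply, mul_one]
        refine Finset.prod_congr rfl fun i hi => ?_
        simp at hi
        simp [hi]
      · ext i
        have := @hω' i
        simp only [Finset.coe_filter, Set.mem_sdiff, Set.mem_ofPred_eq, Finset.mem_sdiff,
          Finset.mem_coe] at *
        tauto
    · intro ω hω hne
      rw [Set.indicator_of_notMem, mul_zero]
      intro h
      have h : (ω : Set ι) \ M = ω' \ M := h
      apply hne
      ext i
      have h2 : i ∈ (ω : Set ι) \ M ↔ i ∈ ω' \ (M : Set ι) := by rw [h]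
      have h3 := Finset.mem_powerset.1 hω
      have h4 : i ∈ ω → i ∈ F \ M := fun h => h3 h
      simp only [Finset.mem_filter, Set.mem_sdiff, Finset.mem_sdiff, Finset.mem_coe] at *
      tauto
    · intro h; exact absurd (Finset.mem_powerset.2 (Finset.filter_subset _ _)) h
  have h2 : wt F q ω' = wt (F \ M) q ω' * wt (F ∩ M) q ω' := by
    unfold wt
    rw [← Finset.prod_union (Finset.disjoint_left.2 fun i h h' => by simp at h h'; tauto),
      Finset.sdiff_union_inter]
  rw [h1, h2, mul_comm]
  refine mul_le_mul_of_nonneg_left ?_ (wt_nonneg hq _)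
  calc δ ^ C ≤ δ ^ (F ∩ M).card := pow_le_pow_of_le_one hδ.le hδ1
        ((Finset.card_le_card Finset.inter_subset_right).trans hC)
    _ = ∏ i ∈ F ∩ M, δ := by simp
    _ ≤ wt (F ∩ M) q ω' := Finset.prod_le_prod (fun _ _ => hδ.le) fun i hi => by
        have := hM i (Finset.mem_inter.1 hi).2 (Finset.mem_inter.1 hi).1
        split_ifs <;> linarith

/-- Local surgery. In every configuration of `E` there are at least `N` possible surgeries, each
modifies at most `C` coordinates and leads to `E'`; the surgeries leading to a given configuration
have at most `L` labels. -/
theorem surgery_bound {α : Type*} {δ : ℝ} {C N L : ℕ} (hq : IsWeight q) (hδ : 0 < δ) (hδ1 : δ ≤ 1)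
    (A : Set ι → Finset α) (M : α → Finset ι) (φ : α → Set ι → Set ι)
    (hM : ∀ ω ∈ E, ω ⊆ F → ∀ a ∈ A ω, (M a).card ≤ C ∧ ∀ i ∈ M a, i ∈ F → δ ≤ q i ∧ q i ≤ 1 - δ)
    (hφ : ∀ ω ∈ E, ω ⊆ F → ∀ a ∈ A ω, φ a ω ⊆ F ∧ φ a ω \ M a = ω \ M a ∧ φ a ω ∈ E')
    (hN : ∀ ω ∈ E, ω ⊆ F → N ≤ (A ω).card)
    (hL : ∀ ω' : Set ι, ω' ⊆ F → ∃ B : Finset α, B.card ≤ L ∧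
      ∀ ω ∈ E, ω ⊆ F → ∀ a ∈ A ω, φ a ω = ω' → a ∈ B) :
    δ ^ C * (N * Pr F q E) ≤ L * Pr F q E' := by
  classical
  choose! B hBL hB using hL
  -- a double sum over configurations and labels
  have h1 : N * Pr F q E ≤ ∑ ω ∈ F.powerset, ∑ a ∈ A ω, wt F q ω * E.indicator 1 (ω : Set ι) := by
    unfold Pr Ex
    rw [Finset.mul_sum]
    refine Finset.sum_le_sum fun ω hω => ?_
    have hω' : (ω : Set ι) ⊆ F := Finset.coe_subset.2 (Finset.mem_powerset.1 hω)
    rw [Finset.sum_const, nsmul_eq_mul]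
    by_cases h : (ω : Set ι) ∈ E
    · have : (N : ℝ) ≤ (A ω).card := by exact_mod_cast hN ω h hω'
      refine mul_le_mul_of_nonneg_right this (mul_nonneg (wt_nonneg hq _) ?_)
      exact Set.indicator_nonneg (by simp) _
    · simp [h]
  have hex : ∀ ω : Finset ι, (ω : Set ι) ∈ E → (ω : Set ι) ⊆ F → ∀ a ∈ A ω,
      ∃ ω' ∈ F.powerset, (ω' : Set ι) = φ a ω := by
    intro ω h hω a ha
    refine ⟨F.filter (· ∈ φ a ω), Finset.mem_powerset.2 (Finset.filter_subset _ _), ?_⟩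
    ext i
    have := (hφ ω h hω a ha).1
    simp only [Finset.coe_filter, Set.mem_ofPred_eq]
    exact ⟨fun h => h.2, fun h => ⟨this h, h⟩⟩
  -- Pairs of a configuration and a surgery are sorted by result and label. Only labels in `B ω'`
  -- occur at the result `ω'`.
  have h2 : ∑ ω ∈ F.powerset, ∑ a ∈ A ω, wt F q ω * E.indicator 1 (ω : Set ι) ≤
      ∑ ω' ∈ F.powerset, ∑ a ∈ B ω', ∑ ω ∈ F.powerset,
        if (ω : Set ι) ∈ E ∧ a ∈ A ω ∧ φ a ω = (ω' : Set ι) then wt F q ω else 0 := by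
    have hcomm' : ∀ ω' : Finset ι, ω' ∈ F.powerset → ∑ a ∈ B ω', ∑ ω ∈ F.powerset,
        (if (ω : Set ι) ∈ E ∧ a ∈ A ω ∧ φ a ω = (ω' : Set ι) then wt F q ω else 0) =
      ∑ ω ∈ F.powerset, ∑ a ∈ B ω',
        if (ω : Set ι) ∈ E ∧ a ∈ A ω ∧ φ a ω = (ω' : Set ι) then wt F q ω else 0 :=
      fun ω' _ => Finset.sum_comm
    rw [Finset.sum_congr rfl hcomm', Finset.sum_comm]
    refine Finset.sum_le_sum fun ω hω => ?_
    have hω' : (ω : Set ι) ⊆ F := Finset.coe_subset.2 (Finset.mem_powerset.1 hω)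
    by_cases h : (ω : Set ι) ∈ E
    · simp only [Set.indicator_of_mem h, Pi.one_apply, mul_one, h, true_and]
      choose! g hg hg' using hex ω h hω'
      rw [Finset.sum_sigma']
      have hinj : Set.InjOn (fun a => (⟨g a, a⟩ : (_ : Finset ι) × α)) (A ω) := by
        intro a _ b _ hab
        simp only [Sigma.mk.injEq] at hab
        exact eq_of_heq hab.2
      calc ∑ a ∈ A ω, wt F q ω
          = ∑ x ∈ (A ω).image (fun a => (⟨g a, a⟩ : (_ : Finset ι) × α)),
            (if x.2 ∈ A ω ∧ φ x.2 ω = (x.1 : Set ι) then wt F q ω else 0) := by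
            rw [Finset.sum_image hinj]
            exact Finset.sum_congr rfl fun a ha => by rw [if_pos ⟨ha, (hg' a ha).symm⟩]
        _ ≤ _ := by
            refine Finset.sum_le_sum_of_subset_of_nonneg ?_ fun x _ _ => ?_
            · intro x hx
              obtain ⟨a, ha, rfl⟩ := Finset.mem_image.1 hx
              refine Finset.mem_sigma.2 ⟨hg a ha, ?_⟩
              exact hB _ (Finset.coe_subset.2 (Finset.mem_powerset.1 (hg a ha))) ω h hω' a ha
                (hg' a ha).symm
            · split_ifs
              exacts [wt_nonneg hq _, le_rfl]
    · simp [h]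
  -- For a fixed result and label all preimages agree with the result off `M a`, so that their total
  -- weight is controlled by that of the result; then there are at most `L` labels.
  have h3 : ∀ ω' ∈ F.powerset, δ ^ C * (∑ a ∈ B ω', ∑ ω ∈ F.powerset,
        if (ω : Set ι) ∈ E ∧ a ∈ A ω ∧ φ a ω = (ω' : Set ι) then wt F q ω else 0) ≤
      L * (wt F q ω' * E'.indicator 1 (ω' : Set ι)) := by
    intro ω' hω'
    have hω'' : (ω' : Set ι) ⊆ F := Finset.coe_subset.2 (Finset.mem_powerset.1 hω')
    have hnn : 0 ≤ wt F q ω' * E'.indicator 1 (ω' : Set ι) :=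
      mul_nonneg (wt_nonneg hq _) (Set.indicator_nonneg (by simp) _)
    rw [Finset.mul_sum]
    refine (Finset.sum_le_card_nsmul _ _ (wt F q ω' * E'.indicator 1 (ω' : Set ι)) ?_).trans ?_
    · intro a _
      by_cases hne : ∃ ω : Finset ι, ω ∈ F.powerset ∧ (ω : Set ι) ∈ E ∧ a ∈ A ω ∧
          φ a ω = (ω' : Set ι)
      · obtain ⟨ω₀, h0, h0E, h0A, h0φ⟩ := hne
        have hsub₀ : (ω₀ : Set ι) ⊆ F := Finset.coe_subset.2 (Finset.mem_powerset.1 h0)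
        have hE' : (ω' : Set ι) ∈ E' := h0φ ▸ (hφ _ h0E hsub₀ a h0A).2.2
        have hMa := hM _ h0E hsub₀ a h0A
        rw [Set.indicator_of_mem hE', Pi.one_apply, mul_one]
        refine le_trans (mul_le_mul_of_nonneg_left ?_ (by positivity))
          (Pr_agree_off_le hq hδ hδ1 hMa.2 hMa.1 hω'')
        unfold Pr Ex
        refine Finset.sum_le_sum fun ω hω => ?_
        have hsub : (ω : Set ι) ⊆ F := Finset.coe_subset.2 (Finset.mem_powerset.1 hω)
        split_ifs with hc
        · rw [Set.indicator_of_mem]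
          · simp
          · have := (hφ _ hc.1 hsub a hc.2.1).2.1
            rw [hc.2.2] at this
            exact this.symm
        · exact mul_nonneg (wt_nonneg hq _) (Set.indicator_nonneg (by simp) _)
      · rw [Finset.sum_eq_zero, mul_zero]
        · exact hnn
        · intro ω hω
          rw [if_neg]
          rintro ⟨h, h', h''⟩
          exact hne ⟨ω, hω, h, h', h''⟩
    · rw [nsmul_eq_mul]
      exact mul_le_mul_of_nonneg_right (by exact_mod_cast hBL _ hω'') hnn
  calc δ ^ C * (N * Pr F q E)
      ≤ δ ^ C * ∑ ω' ∈ F.powerset, ∑ a ∈ B ω', ∑ ω ∈ F.powerset,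
        (if (ω : Set ι) ∈ E ∧ a ∈ A ω ∧ φ a ω = (ω' : Set ι) then wt F q ω else 0) :=
        mul_le_mul_of_nonneg_left (h1.trans h2) (by positivity)
    _ ≤ L * Pr F q E' := by
        unfold Pr Ex
        rw [Finset.mul_sum, Finset.mul_sum]
        exact Finset.sum_le_sum h3

end FiniteProbability
end Slab

/-! ### Reachability inside a set. -/

namespace Slab

section Reachability

variable {V : Type*} {r r' : V → V → Prop} {D D' : Set V} {x y z : V}

/-- `y` can be reached from `x` by steps of the relation `r` inside `D`. -/
def Reach (r : V → V → Prop) (D : Set V) (x y : V) : Prop :=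
  x ∈ D ∧ Relation.ReflTransGen (fun a b => r a b ∧ b ∈ D) x y

theorem Reach.left_mem (h : Reach r D x y) : x ∈ D := h.1

theorem Reach.right_mem (h : Reach r D x y) : y ∈ D := by
  obtain ⟨hx, h⟩ := h
  induction h with
  | refl => exact hx
  | tail _ h _ => exact h.2

theorem Reach.refl (h : x ∈ D) : Reach r D x x := ⟨h, .refl⟩

theorem Reach.trans (h : Reach r D x y) (h' : Reach r D y z) : Reach r D x z :=
  ⟨h.1, h.2.trans h'.2⟩

theorem Reach.single (hx : x ∈ D) (hy : y ∈ D) (h : r x y) : Reach r D x y := ⟨hx, .single ⟨h, hy⟩⟩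

theorem Reach.tail (h : Reach r D x y) (h' : r y z) (hz : z ∈ D) : Reach r D x z :=
  h.trans (.single h.right_mem hz h')

theorem Reach.head (hx : x ∈ D) (h' : r x y) (h : Reach r D y z) : Reach r D x z :=
  (Reach.single hx h.1 h').trans h

theorem Reach.symm (hr : ∀ a b, r a b → r b a) (h : Reach r D x y) : Reach r D y x := by
  obtain ⟨hx, h⟩ := h
  induction h with
  | refl => exact .refl hx
  | tail h h' ih => exact (Reach.single h'.2 (Reach.right_mem ⟨hx, h⟩) (hr _ _ h'.1)).trans ih

theorem Reach.induction {P : V → Prop} (h : Reach r D x y) (hx : x ∈ D → P x)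
    (hs : ∀ a b, Reach r D x a → P a → r a b → b ∈ D → P b) : P y := by
  obtain ⟨hxD, h⟩ := h
  induction h with
  | refl => exact hx hxD
  | tail h h' ih => exact hs _ _ ⟨hxD, h⟩ ih h'.1 h'.2

theorem Reach.head_induction {P : V → Prop} (h : Reach r D x y) (hy : y ∈ D → P y)
    (hs : ∀ a b, a ∈ D → r a b → Reach r D b y → P b → P a) : P x := by
  have hyD := h.right_mem
  obtain ⟨hxD, h⟩ := h
  induction h using Relation.ReflTransGen.head_induction_on with
  | refl => exact hy hyD
  | head h1 h2 ih => exact hs _ _ hxD h1.1 ⟨h1.2, h2⟩ (ih h1.2)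

theorem Reach.mono (h : Reach r D x y) (hr : ∀ a b, a ∈ D → b ∈ D → r a b → r' a b) (hD : D ⊆ D') :
    Reach r' D' x y := by
  refine h.induction (P := fun y => Reach r' D' x y) (fun hx => .refl (hD hx)) fun a b ha ih hab hb => ?_
  exact ih.tail (hr a b ha.right_mem hb hab) (hD hb)

theorem Reach.mono_set (h : Reach r D x y) (hD : D ⊆ D') : Reach r D' x y :=
  h.mono (fun _ _ _ _ h => h) hD

/-- A reachable set of vertices, as a set in which all of the steps take place. -/
theorem Reach.closed (h : Reach r D x y) {P : V → Prop} (hx : P x)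
    (hs : ∀ a b, a ∈ D → b ∈ D → P a → r a b → P b) : P y :=
  h.induction (fun _ => hx) fun _ _ ha ih hab hb => hs _ _ ha.right_mem hb ih hab

/-- A path that enters a set has a first vertex in it. -/
theorem Reach.first_entry (h : Reach r D x y) (B : Set V) (hy : y ∈ B) :
    x ∈ B ∨ ∃ a b, Reach r (D \ B) x a ∧ r a b ∧ b ∈ B ∧ Reach r D b y := by
  classical
  by_cases hx : x ∈ B
  · exact Or.inl hx
  right
  revert hx
  refine h.head_induction (P := fun x => x ∉ B → ∃ a b, Reach r (D \ B) x a ∧ r a b ∧ b ∈ B ∧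
    Reach r D b y) (fun _ h => absurd hy h) fun a b ha hab hby ih haB => ?_
  by_cases hb : b ∈ B
  · exact ⟨a, b, .refl ⟨ha, haB⟩, hab, hb, hby⟩
  · obtain ⟨c, d, h1, h2, h3, h4⟩ := ih hb
    exact ⟨c, d, Reach.head ⟨ha, haB⟩ hab h1, h2, h3, h4⟩

/-- A path that leaves a vertex leaves it for good at some step. -/
theorem Reach.last_exit (h : Reach r D x y) (v : V) (hy : y ≠ v) :
    Reach r (D \ {v}) x y ∨ ∃ b, r v b ∧ Reach r (D \ {v}) b y := by
  refine h.head_induction (P := fun x => Reach r (D \ {v}) x y ∨ ∃ b, r v b ∧ Reach r (D \ {v}) b y)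
    (fun hD => Or.inl (.refl ⟨hD, hy⟩)) fun a b ha hab _ ih => ?_
  rcases ih with ih | ih
  · by_cases hav : a = v
    · exact Or.inr ⟨b, hav ▸ hab, ih⟩
    · exact Or.inl (Reach.head ⟨ha, hav⟩ hab ih)
  · exact Or.inr ih

end Reachability

/-! ### The slab graph, with configurations as sets of open edges. -/

section SlabGraph

variable {k : ℕ}

/-- The relation "joined by an open edge" when `o` is the set of open edges. -/
def Op (o : Set (Sym2 (Vertex k))) (x y : Vertex k) : Prop := (graph k).Adj x y ∧ s(x, y) ∈ o

theorem Op.symm {o : Set (Sym2 (Vertex k))} (x y : Vertex k) (h : Op o x y) : Op o y x :=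
  ⟨h.1.symm, by rw [Sym2.eq_swap]; exact h.2⟩

theorem Op.mono {o o' : Set (Sym2 (Vertex k))} (ho : o ⊆ o') {x y : Vertex k} (h : Op o x y) :
    Op o' x y := ⟨h.1, ho h.2⟩

/-- The set of open edges of a configuration. -/
def opens (ω : Config k) : Set (Sym2 (Vertex k)) := {e | ∃ h : e ∈ (graph k).edgeSet, ω ⟨e, h⟩ = true}

open Classical in
/-- The configuration with a given set of open edges. -/
noncomputable def cfg (o : Set (Sym2 (Vertex k))) : Config k := fun e => decide ((e : Sym2 (Vertex k)) ∈ o)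

@[simp] theorem cfg_opens (ω : Config k) : cfg (opens ω) = ω := by
  funext ⟨e, he⟩
  by_cases h : ω ⟨e, he⟩ = true
  · simp [cfg, opens, he, h]
  · simp [cfg, opens, he, Bool.eq_false_iff.2 h]

theorem openGraph_adj {ω : Config k} {x y : Vertex k} : (openGraph ω).Adj x y ↔ Op (opens ω) x y := by
  simp only [openGraph, SimpleGraph.fromEdgeSet_adj, Op, opens, Set.mem_ofPred_eq]
  constructor
  · rintro ⟨⟨h, h'⟩, -⟩; exact ⟨h, h, h'⟩
  · rintro ⟨h, h1, h2⟩; exact ⟨⟨h1, h2⟩, h.ne⟩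

theorem opens_cfg (o : Set (Sym2 (Vertex k))) : opens (cfg o) = o ∩ (graph k).edgeSet := by
  ext e; simp [opens, cfg, and_comm]

theorem op_opens_cfg {o : Set (Sym2 (Vertex k))} {x y : Vertex k} : Op (opens (cfg o)) x y ↔ Op o x y := by
  simp only [opens_cfg, Op, Set.mem_inter_iff, SimpleGraph.mem_edgeSet]; tauto

/-- `A` and `B` are joined by an open path inside `D`. -/
def Joined (o : Set (Sym2 (Vertex k))) (D A B : Set (Vertex k)) : Prop :=
  ∃ a ∈ A, ∃ b ∈ B, Reach (Op o) D a b

theorem Joined.mono {o o' : Set (Sym2 (Vertex k))} (ho : o ⊆ o') {D D' A A' B B' : Set (Vertex k)}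
    (hD : D ⊆ D') (hA : A ⊆ A') (hB : B ⊆ B') (h : Joined o D A B) : Joined o' D' A' B' := by
  obtain ⟨a, ha, b, hb, h⟩ := h
  exact ⟨a, hA ha, b, hB hb, h.mono (fun _ _ _ _ => Op.mono ho) hD⟩

theorem Joined.symm {o : Set (Sym2 (Vertex k))} {D A B : Set (Vertex k)} (h : Joined o D A B) :
    Joined o D B A := by
  obtain ⟨a, ha, b, hb, h⟩ := h
  exact ⟨b, hb, a, ha, h.symm Op.symm⟩

theorem isUpperSet_joined (D A B : Set (Vertex k)) :
    IsUpperSet {o : Set (Sym2 (Vertex k)) | Joined o D A B} :=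
  fun _ _ h h' => Joined.mono h subset_rfl subset_rfl subset_rfl h'

theorem reach_iff_walk {ω : Config k} {S : Set (Vertex k)} {a b : Vertex k} :
    Reach (Op (opens ω)) S a b ↔ ∃ w : (openGraph ω).Walk a b, ∀ x ∈ w.support, x ∈ S := by
  constructor
  · intro h
    refine h.head_induction (P := fun a => ∃ w : (openGraph ω).Walk a b, ∀ x ∈ w.support, x ∈ S)
      (fun h => ⟨.nil, by simpa using h⟩) ?_
    rintro a c ha hac - ⟨w, hw⟩
    exact ⟨.cons (openGraph_adj.2 hac) w, by simpa [ha] using hw⟩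
  · rintro ⟨w, hw⟩
    induction w with
    | nil => exact .refl (by simpa using hw)
    | cons h w ih =>
      simp only [SimpleGraph.Walk.support_cons, List.mem_cons, forall_eq_or_imp] at hw
      exact Reach.head hw.1 (openGraph_adj.1 h) (ih hw.2)

theorem connected_iff {ω : Config k} {A S B : Set (Vertex k)} :
    Connected ω A S B ↔ Joined (opens ω) S A B := by
  constructor
  · rintro ⟨a, ha, b, hb, h⟩
    exact ⟨a, ha.1, b, hb.1, reach_iff_walk.2 h⟩
  · rintro ⟨a, ha, b, hb, h⟩
    exact ⟨a, ⟨ha, h.left_mem⟩, b, ⟨hb, h.right_mem⟩, reach_iff_walk.1 h⟩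

/-- The edges of the slab with both endpoints in `D`. -/
def edgesIn (D : Set (Vertex k)) : Set (Sym2 (Vertex k)) := {e | e ∈ (graph k).edgeSet ∧ ∀ x ∈ e, x ∈ D}

theorem mem_edgesIn {D : Set (Vertex k)} {x y : Vertex k} :
    s(x, y) ∈ edgesIn D ↔ (graph k).Adj x y ∧ x ∈ D ∧ y ∈ D := by
  simp only [edgesIn, Set.mem_ofPred_eq, SimpleGraph.mem_edgeSet, Sym2.mem_iff, forall_eq_or_imp,
    forall_eq]

theorem Reach.congr_edges {o o' : Set (Sym2 (Vertex k))} {D : Set (Vertex k)} {x y : Vertex k}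
    (h : Reach (Op o) D x y) (ho : o ∩ edgesIn D ⊆ o') : Reach (Op o') D x y :=
  h.mono (fun _ _ ha hb hab => ⟨hab.1, ho ⟨hab.2, mem_edgesIn.2 ⟨hab.1, ha, hb⟩⟩⟩) subset_rfl

theorem dependsOnly_joined (D A B : Set (Vertex k)) :
    DependsOnly (edgesIn D) {o : Set (Sym2 (Vertex k)) | Joined o D A B} := by
  rintro o o' h ⟨a, ha, b, hb, hab⟩
  exact ⟨a, ha, b, hb, hab.congr_edges (h.le.trans Set.inter_subset_left)⟩

/-- The probability of an event that depends on finitely many edges. -/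
theorem perc_real_eq_Pr (p : unitInterval) (F : Finset (Sym2 (Vertex k)))
    (hF : ∀ e ∈ F, e ∈ (graph k).edgeSet) {E : Set (Set (Sym2 (Vertex k)))}
    (hE : DependsOnly (F : Set (Sym2 (Vertex k))) E) :
    (perc k p).real {ω | opens ω ∈ E} = Pr F (fun _ => (p : ℝ)) E := by
  classical
  have : IsProbabilityMeasure (perc k p) := by unfold perc; infer_instance
  set F' : Finset (graph k).edgeSet := F.subtype (· ∈ (graph k).edgeSet) with hF'
  -- The event is a finite disjoint union of cylinders, one for each admissible set of open edges of
  -- `F`, and the measure of each cylinder is its weight.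
  let cyl : Set (Sym2 (Vertex k)) → Set (Config k) := fun ξ =>
    Set.pi (F' : Set (graph k).edgeSet) fun e => {decide ((e : Sym2 (Vertex k)) ∈ ξ)}
  have hcyl : ∀ ξ : Set (Sym2 (Vertex k)), (perc k p).real (cyl ξ) = wt F (fun _ => (p : ℝ)) ξ := by
    intro ξ
    rw [measureReal_def, perc, Measure.infinitePi_pi _ (fun _ _ => MeasurableSet.singleton _),
      ENNReal.toReal_prod]
    unfold wt
    have h1 : ∀ e : (graph k).edgeSet,
        ((bernoulliMeasure true false p) {decide ((e : Sym2 (Vertex k)) ∈ ξ)}).toReal =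
          if (e : Sym2 (Vertex k)) ∈ ξ then (p : ℝ) else 1 - p := by
      intro e
      by_cases h : (e : Sym2 (Vertex k)) ∈ ξ
      · simp [h, bernoulliMeasure]
      · simp [h, bernoulliMeasure]
    rw [Finset.prod_congr rfl fun e _ => h1 e, hF',
      Finset.prod_subtype_of_mem (fun e => if e ∈ ξ then (p : ℝ) else 1 - p) hF]

  set X : Finset (Finset (Sym2 (Vertex k))) :=
    F.powerset.filter fun ξ : Finset (Sym2 (Vertex k)) => (ξ : Set (Sym2 (Vertex k))) ∈ E with hX
  have hcover : {ω | opens ω ∈ E} = ⋃ ξ ∈ X, cyl ξ := by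
    have key : ∀ (ω : Config k) (ξ : Finset (Sym2 (Vertex k))), ξ ⊆ F → ω ∈ cyl ξ →
        opens ω ∩ F = (ξ : Set (Sym2 (Vertex k))) ∩ F := by
      intro ω ξ hξ h
      ext e
      simp only [Set.mem_inter_iff, Finset.mem_coe, and_congr_left_iff]
      intro he
      have h1 := h ⟨e, hF e he⟩ (by simpa [hF'] using he)
      simp only [Set.mem_singleton_iff] at h1
      simp [opens, hF e he, h1]
    ext ω
    simp only [Set.mem_ofPred_eq, Set.mem_iUnion, hX, Finset.mem_filter, Finset.mem_powerset, exists_prop]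
    constructor
    · intro h
      have hc : ω ∈ cyl ((F.filter (· ∈ opens ω) : Finset (Sym2 (Vertex k))) : Set (Sym2 (Vertex k))) := by
        intro e he
        have he' : (e : Sym2 (Vertex k)) ∈ F := by simpa [hF'] using he
        obtain ⟨e, h'⟩ := e
        have he2 : e ∈ F := he'
        rw [Set.mem_singleton_iff, Finset.mem_coe, Finset.mem_filter]
        cases h2 : ω ⟨e, h'⟩ <;> simp [h2, h', he2, opens]
      refine ⟨_, ⟨Finset.filter_subset _ _, ?_⟩, hc⟩
      exact hE _ _ (key ω _ (Finset.filter_subset _ _) hc) h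
    · rintro ⟨ξ, ⟨hξ, hξE⟩, hc⟩
      exact hE _ _ (key ω ξ hξ hc).symm hξE
  rw [hcover, measureReal_biUnion_finset]
  · unfold Pr Ex
    rw [Finset.sum_filter]
    refine Finset.sum_congr rfl fun ξ _ => ?_
    by_cases h : (ξ : Set (Sym2 (Vertex k))) ∈ E <;> simp [h, hcyl]
  · intro ξ hξ ξ' hξ' hne
    refine Set.disjoint_left.2 fun ω h h' => hne ?_
    have h1 := Finset.mem_powerset.1 (Finset.mem_filter.1 hξ).1
    have h2 := Finset.mem_powerset.1 (Finset.mem_filter.1 hξ').1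
    ext e
    by_cases he : e ∈ F
    · have h3 := h ⟨e, hF e he⟩ (by simpa [hF'] using he)
      have h4 := h' ⟨e, hF e he⟩ (by simpa [hF'] using he)
      simp only [Set.mem_singleton_iff] at h3 h4
      rw [h3] at h4
      exact decide_eq_decide.1 h4
    · exact ⟨fun h => absurd (h1 h) he, fun h => absurd (h2 h) he⟩
  · intro ξ _
    exact MeasurableSet.pi (Finset.countable_toSet _) fun _ _ => MeasurableSet.singleton _

end SlabGraph
end Slab

/-! ### Selection rules for shapes, and greedy paths. -/

namespace Slab

section Greedy

variable {k : ℕ}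

/-- A set of vertices together with the edges that have to be open. -/
structure Shape (k : ℕ) where
  verts : Set (Vertex k)
  edges : Set (Sym2 (Vertex k))

/-- A rule that selects an open shape over the columns of `C` whenever there is one. -/
structure Family (k : ℕ) (C : Set (ℤ × ℤ)) where
  sel : Set (Sym2 (Vertex k)) → Option (Shape k)
  isOpen : ∀ {o S}, sel o = some S → S.edges ⊆ o
  cols : ∀ {o S}, sel o = some S → ∀ x ∈ S.verts, x.1 ∈ C
  edges_subset : ∀ {o S}, sel o = some S → S.edges ⊆ edgesIn S.verts
  isLocal : ∀ {o o'}, o ∩ edgesIn (lift k C) = o' ∩ edgesIn (lift k C) → sel o = sel o'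
  -- This and the next property are what remains of minimality in a fixed order. A selected shape is
  -- not kept fixed by a surgery that opens edges: it may be replaced by a smaller one, which must
  -- then use a new edge.
  antisymm : ∀ {o o' S S'}, sel o = some S → sel o' = some S' → S.edges ⊆ o' → S'.edges ⊆ o → S = S'
  exists_of_open : ∀ {o o' S}, sel o = some S → S.edges ⊆ o' → ∃ S', sel o' = some S'

/-- Number of a vertex in a fixed enumeration. -/
abbrev enc (x : Vertex k) : ℕ := Encodable.encode x

theorem enc_inj {x y : Vertex k} : enc x = enc y ↔ x = y := Encodable.encode_inj

variable (D A I : Set (Vertex k)) (o : Set (Sym2 (Vertex k))) (b : Set (Vertex k × Vertex k))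

/-- The first vertex of `A` that is joined to `I` inside `D`. -/
def IsStart (e : Vertex k) : Prop :=
  e ∈ A ∧ (∃ i ∈ I, Reach (Op o) D e i) ∧ ∀ a ∈ A, (∃ i ∈ I, Reach (Op o) D a i) → enc e ≤ enc a

/-- `y` is a possible continuation at `x` of the path with the vertices of `l`. -/
def Cand (l : List (Vertex k)) (x y : Vertex k) : Prop :=
  Op o x y ∧ ∃ i ∈ I, Reach (Op o) (D \ {v | v ∈ l}) y i

/-- Favoured neighbours come first, then the enumeration decides. -/
def Better (x y y' : Vertex k) : Prop :=
  ((x, y) ∈ b ∧ (x, y') ∉ b) ∨ (((x, y) ∈ b ↔ (x, y') ∈ b) ∧ enc y < enc y')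

/-- The best continuation. -/
def Best (l : List (Vertex k)) (x y : Vertex k) : Prop :=
  Cand D I o l x y ∧ ∀ y', Cand D I o l x y' → y' ≠ y → Better b x y y'

/-- The initial pieces of the greedy path from `A` to `I` inside `D`, last vertex first. -/
inductive Greedy : List (Vertex k) → Prop
  | start (e : Vertex k) : IsStart D A I o e → Greedy [e]
  | step (x : Vertex k) (l : List (Vertex k)) (y : Vertex k) : Greedy (x :: l) → x ∉ I →
      Best D I o b (x :: l) x y → Greedy (y :: x :: l)

/-- The greedy path from `A` to `I` inside `D`, last vertex first. -/
def FullGreedy (l : List (Vertex k)) : Prop := Greedy D A I o b l ∧ ∃ x l', l = x :: l' ∧ x ∈ I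

variable {D A I o b}

theorem IsStart.unique {e e' : Vertex k} (h : IsStart D A I o e) (h' : IsStart D A I o e') : e = e' :=
  enc_inj.1 (le_antisymm (h.2.2 _ h'.1 h'.2.1) (h'.2.2 _ h.1 h.2.1))

theorem exists_isStart (h : Joined o D A I) : ∃ e, IsStart D A I o e := by
  obtain ⟨a, ha, i, hi, hai⟩ := h
  have hne : {a | a ∈ A ∧ ∃ i ∈ I, Reach (Op o) D a i}.Nonempty := ⟨a, ha, i, hi, hai⟩
  obtain ⟨e, he, hmin⟩ := (InvImage.wf (enc (k := k)) Nat.lt_wfRel.wf).has_min _ hne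
  exact ⟨e, he.1, he.2, fun a ha h => not_lt.1 (hmin a ⟨ha, h⟩)⟩

theorem Better.asymm {x y y' : Vertex k} (h : Better b x y y') (h' : Better b x y' y) : False := by
  rcases h with ⟨h1, h2⟩ | ⟨h1, h2⟩ <;> rcases h' with ⟨h3, h4⟩ | ⟨h3, h4⟩
  · exact h2 h3
  · exact h2 (h3.2 h1)
  · exact h4 (h1.2 h3)
  · omega

theorem Best.unique {l : List (Vertex k)} {x y y' : Vertex k} (h : Best D I o b l x y)
    (h' : Best D I o b l x y') : y = y' := by
  by_contra hne
  exact (h.2 y' h'.1 (Ne.symm hne)).asymm (h'.2 y h.1 hne)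

theorem exists_best {l : List (Vertex k)} {x y : Vertex k} (h : Cand D I o l x y) :
    ∃ y, Best D I o b l x y := by
  classical
  let key : Vertex k → ℕ ×ₗ ℕ := fun y => toLex (if (x, y) ∈ b then 0 else 1, enc y)
  have hne : {y | Cand D I o l x y}.Nonempty := ⟨y, h⟩
  obtain ⟨e, he, hmin⟩ := (InvImage.wf key wellFounded_lt).has_min _ hne
  refine ⟨e, he, fun y' hy' hne => ?_⟩
  have h1 : ¬ key y' < key e := hmin y' hy'
  have h2 : enc y' ≠ enc e := fun h => hne (enc_inj.1 h)
  simp only [key, Prod.Lex.toLex_lt_toLex, not_or, not_and, not_lt] at h1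
  unfold Better
  by_cases h3 : (x, e) ∈ b <;> by_cases h4 : (x, y') ∈ b <;> simp [h3, h4] at h1 ⊢ <;> omega

theorem Greedy.unique {l l' : List (Vertex k)} (h : Greedy D A I o b l) (h' : Greedy D A I o b l')
    (hl : l.length = l'.length) : l = l' := by
  induction h generalizing l' with
  | start e he =>
    cases h' with
    | start e' he' => rw [he.unique he']
    | step x l y => simp at hl
  | step x l y _ _ hb ih =>
    cases h' with
    | start e' he' => simp at hl
    | step x' l'' y' h1' h2' hb' =>
      have := ih h1' (by simpa using hl)
      simp only [List.cons.injEq] at this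
      obtain ⟨rfl, rfl⟩ := this
      rw [hb.unique hb']

/-- The last vertex comes first in the list, so a suffix is an earlier stage of the construction.
The construction stops at the first visit to `I`, so earlier stages end outside `I`. -/
theorem Greedy.suffix {t s : List (Vertex k)} (h : Greedy D A I o b (t ++ s)) (hs : s ≠ []) :
    Greedy D A I o b s ∧ (t ≠ [] → ∀ x ∈ s.head?, x ∉ I) := by
  induction t with
  | nil => exact ⟨h, fun h => absurd rfl h⟩
  | cons u t ih =>
    obtain ⟨v, s, rfl⟩ := List.exists_cons_of_ne_nil hs
    cases t with
    | nil =>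
      cases h with
      | step _ _ _ h1 h2 h3 => exact ⟨h1, fun _ x hx => by simp at hx; exact hx ▸ h2⟩
    | cons u' t =>
      cases h with
      | step _ _ _ h1 h2 h3 => exact ⟨(ih h1).1, fun _ => (ih h1).2 (by simp)⟩

theorem FullGreedy.unique {l l' : List (Vertex k)} (h : FullGreedy D A I o b l)
    (h' : FullGreedy D A I o b l') : l = l' := by
  have key : ∀ l l' : List (Vertex k), FullGreedy D A I o b l → FullGreedy D A I o b l' →
      l.length ≤ l'.length → l = l' := by
    rintro l l' ⟨h, x, l₀, rfl, hx⟩ ⟨h', -⟩ hle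
    set s := l'.drop (l'.length - (x :: l₀).length) with hs
    have hlen : s.length = (x :: l₀).length := by rw [hs, List.length_drop]; omega
    have hsne : s ≠ [] := by intro h; rw [h] at hlen; simp at hlen
    have heq := List.take_append_drop (l'.length - (x :: l₀).length) l'
    rw [← heq] at h'
    have h1 := h'.suffix hsne
    have h2 : x :: l₀ = s := h.unique h1.1 hlen.symm
    by_cases ht : l'.take (l'.length - (x :: l₀).length) = []
    · rw [ht, List.nil_append, ← hs, ← h2] at heq; exact heq
    · exact absurd hx (h1.2 ht x (by rw [← hs, ← h2]; simp))
  rcases le_total l.length l'.length with hle | hle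
  · exact key _ _ h h' hle
  · exact (key _ _ h' h hle).symm

/-- The last clause is the invariant that keeps the construction alive: from its current end the
target can still be reached off the vertices already used. With the exclusion of used vertices in
`Cand` it also makes the path self-avoiding. -/
theorem Greedy.facts {l : List (Vertex k)} (h : Greedy D A I o b l) :
    l.Nodup ∧ (∀ x ∈ l, x ∈ D) ∧ (∀ e, IsStart D A I o e → ∀ x ∈ l, Reach (Op o) D e x) ∧
      ∀ x l', l = x :: l' → ∃ i ∈ I, Reach (Op o) (D \ {v | v ∈ l'}) x i := by
  induction h with
  | start e he =>
    obtain ⟨h1, ⟨i, hi, h2⟩, h3⟩ := id he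
    refine ⟨by simp, by simpa using h2.left_mem, ?_, ?_⟩
    · intro e' he' x hx
      rw [List.mem_singleton.1 hx, he'.unique he]
      exact .refl h2.left_mem
    · rintro x l' hl
      simp only [List.cons.injEq] at hl
      obtain ⟨rfl, rfl⟩ := hl
      exact ⟨i, hi, by simpa using h2⟩
  | step x l y hg hxI hb ih =>
    obtain ⟨ih1, ih2, ih3, ih4⟩ := ih
    obtain ⟨⟨hxy, i, hi, hyi⟩, -⟩ := hb
    have hy := hyi.left_mem
    refine ⟨List.nodup_cons.2 ⟨hy.2, ih1⟩, ?_, ?_, ?_⟩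
    · intro v hv
      rcases List.mem_cons.1 hv with rfl | hv
      exacts [hy.1, ih2 v hv]
    · intro e he v hv
      rcases List.mem_cons.1 hv with rfl | hv
      exacts [(ih3 e he x (by simp)).tail hxy hy.1, ih3 e he v hv]
    · rintro v l' hl
      simp only [List.cons.injEq] at hl
      obtain ⟨rfl, rfl⟩ := hl
      exact ⟨i, hi, hyi⟩

theorem Greedy.exists_isStart {l : List (Vertex k)} (h : Greedy D A I o b l) :
    ∃ e, IsStart D A I o e := by
  induction h with
  | start e he => exact ⟨e, he⟩
  | step _ _ _ _ _ _ ih => exact ih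

/-- An unfinished piece always has a continuation: take the last departure from its end along a
connection to `I`. A self-avoiding path in a finite set cannot be continued forever. -/
theorem exists_fullGreedy (hD : D.Finite) (h : Joined o D A I) : ∃ l, FullGreedy D A I o b l := by
  classical
  by_contra hcon
  have hstep : ∀ n : ℕ, ∃ l, Greedy D A I o b l ∧ l.length = n + 1 := by
    intro n
    induction n with
    | zero =>
      obtain ⟨e, he⟩ := exists_isStart h
      exact ⟨[e], .start e he, rfl⟩
    | succ n ih =>
      obtain ⟨l, hl, hn⟩ := ih
      obtain ⟨x, l, rfl⟩ := List.exists_cons_of_length_pos (l := l) (by omega)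
      have hxI : x ∉ I := fun hx => hcon ⟨_, hl, x, l, rfl, hx⟩
      obtain ⟨i, hi, hr⟩ := hl.facts.2.2.2 x l rfl
      have hcand : ∃ y, Cand D I o (x :: l) x y := by
        have hset : (D \ {v | v ∈ l}) \ {x} = D \ {v | v ∈ x :: l} := by
          ext v; simp; tauto
        rcases hr.last_exit x (fun h => hxI (h ▸ hi)) with h1 | ⟨y, hy, h1⟩
        · exact absurd rfl h1.left_mem.2
        · exact ⟨y, hy, i, hi, hset ▸ h1⟩
      obtain ⟨y, hy⟩ := hcand
      obtain ⟨y, hy⟩ := exists_best (b := b) hy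
      exact ⟨_, .step x l y hl hxI hy, by simp [hn]⟩
  obtain ⟨l, hl, hn⟩ := hstep hD.toFinset.card
  have h1 : l.toFinset ⊆ hD.toFinset := fun x hx => by
    simpa using hl.facts.2.1 x (by simpa using hx)
  have h2 := Finset.card_le_card h1
  rw [List.toFinset_card_of_nodup hl.facts.1] at h2
  omega

/-- Planar topology only sees the set of vertices of the path, as a set connected in the graph. -/
theorem FullGreedy.reach_adj {l : List (Vertex k)} (h : FullGreedy D A I o b l) :
    ∃ a ∈ A, ∃ i ∈ I, Reach (graph k).Adj {v | v ∈ l} a i := by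
  obtain ⟨h, x, l', rfl, hx⟩ := h
  have key : ∀ l, Greedy D A I o b l → ∀ x l', l = x :: l' → ∃ a ∈ A, Reach (graph k).Adj {v | v ∈ l} a x := by
    intro l hl
    induction hl with
    | start e he =>
      rintro x l' hl
      simp only [List.cons.injEq] at hl
      obtain ⟨rfl, -⟩ := hl
      exact ⟨e, he.1, .refl (by simp)⟩
    | step x l y _ _ hb ih =>
      rintro v l' hl
      simp only [List.cons.injEq] at hl
      obtain ⟨rfl, -⟩ := hl
      obtain ⟨a, ha, hr⟩ := ih x l rfl
      exact ⟨a, ha, (hr.mono_set fun v hv => List.mem_cons_of_mem _ hv).tail hb.1.1.1 List.mem_cons_self⟩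
  obtain ⟨a, ha, hr⟩ := key _ h x l' rfl
  exact ⟨a, ha, x, hx, hr⟩

/-- The greedy path is not changed by the opening of bridges that start at its vertices, whose
interiors are isolated and whose ends are not joined to vertices of `A` up to the starting point,
if at the starting points of the bridges the path is favoured. -/
theorem FullGreedy.transfer {o' B : Set (Sym2 (Vertex k))} {b' : Set (Vertex k × Vertex k)}
    {N W G : Set (Vertex k)} {l : List (Vertex k)} (h : FullGreedy D A I o b l)
    (h1 : o' ⊆ o ∪ B) (h2 : ∀ x y, Op o x y → x ∉ N → y ∉ N → Op o' x y)
    (h3 : ∀ x y, s(x, y) ∈ B → x ∈ N ∨ x ∈ W ∨ x ∈ G) (h4 : ∀ x y, Op o' x y → s(x, y) ∉ B → x ∉ N)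
    (h5 : ∀ w ∈ W, w ∈ l) (h6 : ∀ v ∈ l, v ∉ N)
    (h7 : ∀ g ∈ G, ∀ e, IsStart D A I o e → ∀ a ∈ A, enc a ≤ enc e → ¬ Reach (Op o) D a g)
    (h8 : ∀ a ∈ A, a ∉ N) (h9 : ∀ x, x ∉ W → ∀ y, (x, y) ∈ b' ↔ (x, y) ∈ b)
    (h10 : ∀ t y x l', l = t ++ y :: x :: l' → x ∈ W → ∀ y', (x, y') ∈ b' ↔ y' = y) :
    FullGreedy D A I o' b' l := by
  classical
  -- a path of `o'` either is a path of `o` or reaches a bridge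
  have hbr : ∀ (D' : Set (Vertex k)) x y, Reach (Op o') D' x y → Reach (Op o) D' x y ∨
      ∃ v, (v ∈ N ∧ v = x ∨ v ∈ W ∨ v ∈ G) ∧ Reach (Op o) D' x v := by
    intro D' x y hxy
    have h0 : ∀ a b, (Op o' a b ∧ s(a, b) ∉ B) → Op o a b := fun a b hab =>
      ⟨hab.1.1, (h1 hab.1.2).resolve_right hab.2⟩
    have := hxy.induction (P := fun y => Reach (fun a b => Op o' a b ∧ s(a, b) ∉ B) D' x y ∨
        ∃ v, (v ∈ N ∧ v = x ∨ v ∈ W ∨ v ∈ G) ∧ Reach (Op o) D' x v) (fun h => Or.inl (.refl h)) ?_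
    · rcases this with h | h
      · exact Or.inl (h.mono (fun a b _ _ => h0 a b) subset_rfl)
      · exact Or.inr h
    · rintro a c hxa ih hac hc
      rcases ih with ih | ih
      · by_cases hB : s(a, c) ∈ B
        · right
          have ha : Reach (Op o) D' x a := ih.mono (fun a b _ _ => h0 a b) subset_rfl
          refine ⟨a, ?_, ha⟩
          rcases h3 a c hB with h | h
          · refine Or.inl ⟨h, ?_⟩
            by_contra hne
            obtain ⟨hx, hr⟩ := ih
            rcases Relation.ReflTransGen.cases_tail hr with h' | ⟨u, -, hu, -⟩
            · exact hne h'
            · exact h4 a u (Op.symm _ _ hu.1) (by rw [Sym2.eq_swap]; exact hu.2) h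
          · exact Or.inr h
        · exact Or.inl (ih.tail ⟨hac, hB⟩ hc)
      · exact Or.inr ih
  obtain ⟨hg, x₀, l₀, hl₀, hx₀⟩ := h
  obtain ⟨hnd, hlD, hreach, -⟩ := id hg.facts
  -- the tail of the path leads to the target in `o'`
  have htail : ∀ t v s, l = t ++ v :: s → ∃ i ∈ I, Reach (Op o') (D \ {v | v ∈ s}) v i := by
    intro t
    induction t using List.reverseRecOn with
    | nil =>
      intro v s hl
      rw [List.nil_append, hl₀] at hl
      simp only [List.cons.injEq] at hl
      obtain ⟨rfl, rfl⟩ := hl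
      refine ⟨x₀, hx₀, .refl ⟨hlD _ (by simp [hl₀]), ?_⟩⟩
      rw [hl₀] at hnd
      exact (List.nodup_cons.1 hnd).1
    | append_singleton t u ih =>
      intro v s hl
      rw [List.append_assoc, List.singleton_append] at hl
      obtain ⟨i, hi, hr⟩ := ih u (v :: s) hl
      have h' := (Greedy.suffix (hl ▸ hg) (by simp)).1
      have hvu : Op o v u := by cases h' with | step _ _ _ _ _ hb => exact hb.1.1
      have hvs : v ∉ s := by
        rw [hl] at hnd
        have := (List.nodup_append.1 hnd).2.1
        exact (List.nodup_cons.1 (List.nodup_cons.1 this).2).1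
      refine ⟨i, hi, Reach.head ⟨hlD v (by simp [hl]), hvs⟩
        (h2 _ _ hvu (h6 v (by simp [hl])) (h6 u (by simp [hl]))) (hr.mono_set ?_)⟩
      intro w hw
      exact ⟨hw.1, fun h => hw.2 (List.mem_cons_of_mem _ h)⟩
  have htailo : ∀ t v s, l = t ++ v :: s → ∃ i ∈ I, Reach (Op o) (D \ {v | v ∈ s}) v i := by
    intro t v s hl
    exact (Greedy.suffix (hl ▸ hg) (by simp)).1.facts.2.2.2 v s rfl
  have hgood : ∀ s t, l = t ++ s → s ≠ [] → Greedy D A I o' b' s := by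
    intro s
    induction s with
    | nil => intro t _ h; exact absurd rfl h
    | cons y s ih =>
      intro t hl _
      have hgy := (Greedy.suffix (hl ▸ hg) (by simp)).1
      cases s with
      | nil =>
        cases hgy with
        | start _ he =>
          refine .start y ⟨he.1, ?_, ?_⟩
          · simpa using htail t y [] hl
          · rintro a ha ⟨i, hi, hr⟩
            by_contra hlt
            rw [not_le] at hlt
            -- An earlier starting point for the new configuration would be one for the old: its
            -- connection is either old, or leads by old edges to the foot of a bridge, from which
            -- the old path continues to `I`, or to the far end of a bridge, which is excluded by
            -- `h7`.
            rcases hbr D a i hr with h | ⟨v, hv | hv | hv, hav⟩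
            · exact absurd (he.2.2 a ha ⟨i, hi, h⟩) (not_le.2 hlt)
            · exact h8 a ha (hv.2 ▸ hv.1)
            · obtain ⟨t', s', hs'⟩ := List.append_of_mem (h5 v hv)
              obtain ⟨i', hi', hr'⟩ := htailo _ _ _ hs'
              exact absurd (he.2.2 a ha ⟨i', hi', hav.trans (hr'.mono_set Set.sdiff_subset)⟩)
                (not_le.2 hlt)
            · exact h7 v hv y he a ha hlt.le hav
      | cons x s =>
        cases hgy with
        | step _ _ _ hgx hxI hb =>
          refine .step x s y (ih (t ++ [y]) (by simp [hl]) (by simp)) hxI ?_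
          have hxl : x ∈ l := by simp [hl]
          have hyl : y ∈ l := by simp [hl]
          refine ⟨⟨h2 _ _ hb.1.1 (h6 x hxl) (h6 y hyl), htail t y (x :: s) hl⟩, ?_⟩
          rintro y' ⟨hxy', i, hi, hr⟩ hne
          -- At the foot of a bridge new continuations may have appeared, but there the old
          -- continuation is the only favoured one. Elsewhere the preferences are unchanged and no
          -- new candidate appears.
          by_cases hxW : x ∈ W
          · have := h10 t y x s hl hxW
            exact Or.inl ⟨(this y).2 rfl, fun h => hne ((this y').1 h)⟩
          · by_cases hxG : x ∈ G
            · obtain ⟨e, he⟩ := hg.exists_isStart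
              exact absurd (hreach e he x hxl) (h7 x hxG e he e he.1 le_rfl)
            have hB : s(x, y') ∉ B := fun h => by
              rcases h3 x y' h with h | h | h
              exacts [h6 x hxl h, hxW h, hxG h]
            have hoxy : Op o x y' := ⟨hxy'.1, (h1 hxy'.2).resolve_right hB⟩
            -- If the connection from `y'` uses a bridge, it first reaches by old edges an unused
            -- foot `v`. This lies on the later part of the path, and from there the path itself
            -- leads to `I` off the used vertices.
            have hcand : Cand D I o (x :: s) x y' := by
              refine ⟨hoxy, ?_⟩
              rcases hbr _ _ _ hr with h | ⟨v, hv | hv | hv, hav⟩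
              · exact ⟨i, hi, h⟩
              · exact absurd (hv.2 ▸ hv.1) (h4 y' x (Op.symm _ _ hxy') (by rw [Sym2.eq_swap]; exact hB))
              · have hvs : v ∉ x :: s := hav.right_mem.2
                have hvl := h5 v hv
                rw [hl] at hvl
                have hvt : v ∈ t ++ [y] := by
                  simp only [List.mem_append, List.mem_cons, List.not_mem_nil, or_false] at hvl hvs ⊢
                  tauto
                obtain ⟨t', s', hs'⟩ := List.append_of_mem hvt
                have hl' : l = t' ++ v :: (s' ++ x :: s) := by
                  rw [hl, ← List.cons_append, ← List.append_assoc, ← hs']; simp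
                obtain ⟨i', hi', hr'⟩ := htailo _ _ _ hl'
                refine ⟨i', hi', hav.trans (hr'.mono_set ?_)⟩
                intro u hu
                exact ⟨hu.1, fun h => hu.2 (by simp only [Set.mem_ofPred_eq, List.mem_append]; exact Or.inr h)⟩
              · exfalso
                obtain ⟨e, he⟩ := hg.exists_isStart
                refine h7 v hv e he e he.1 le_rfl ?_
                exact ((hreach e he x hxl).tail hoxy hav.left_mem.1).trans (hav.mono_set Set.sdiff_subset)
            have hbet := hb.2 y' hcand hne
            unfold Better at hbet ⊢
            rw [h9 x hxW, h9 x hxW]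
            exact hbet
  exact ⟨hgood l [] rfl (by simp [hl₀]), x₀, l₀, hl₀, hx₀⟩

end Greedy
end Slab

/-! ### Building vertical bridges, and recognising them afterwards. -/

namespace Slab

section Surgery

variable {k : ℕ}

/-- The vertical segment between two vertices of a column. -/
def seg (w g : Vertex k) : Set (Vertex k) := {v | v.1 = w.1 ∧ v.2 ∈ Set.uIcc w.2 g.2}

/-- The edges of the vertical segment between two vertices of a column. -/
def bridge (w g : Vertex k) : Set (Sym2 (Vertex k)) := edgesIn (seg w g)

/-- The interior of the vertical segment between two vertices of a column. -/
def inside (w g : Vertex k) : Set (Vertex k) := {v | v ∈ seg w g ∧ v ≠ w ∧ v ≠ g}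

theorem vertical_adj (z : ℤ × ℤ) (i j : Fin (k + 1)) (h : (i : ℕ) + 1 = j) :
    (graph k).Adj (z, i) (z, j) := by
  have : ((j : ℕ) : ℤ) = (i : ℕ) + 1 := by exact_mod_cast h.symm
  simp [graph, this]

theorem reach_seg {o : Set (Sym2 (Vertex k))} {w g : Vertex k} (hb : bridge w g ⊆ o) {v : Vertex k}
    (hv : v ∈ seg w g) : Reach (Op o) (seg w g) w v := by
  obtain ⟨z, i⟩ := w
  obtain ⟨z', j⟩ := v
  obtain ⟨rfl, hj⟩ := hv
  simp only at hj ⊢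
  have hop : ∀ a b : Fin (k + 1), (a : ℕ) + 1 = b → a ∈ Set.uIcc i g.2 → b ∈ Set.uIcc i g.2 →
      Op o (z', a) (z', b) := fun a b hab ha hb' =>
    ⟨vertical_adj _ _ _ hab, hb (mem_edgesIn.2 ⟨vertical_adj _ _ _ hab, ⟨rfl, ha⟩, ⟨rfl, hb'⟩⟩)⟩
  have hmem : ∀ a : Fin (k + 1), a ∈ Set.uIcc i g.2 ↔
      (min (i : ℕ) (g.2 : ℕ) ≤ a ∧ (a : ℕ) ≤ max (i : ℕ) g.2) := fun a => by
    rw [Set.uIcc, Set.mem_Icc, Fin.le_def, Fin.le_def]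
    rcases le_total i g.2 with h | h <;> simp [h, Fin.le_def.1 h]
  have up : ∀ n : ℕ, ∀ a b : Fin (k + 1), (a : ℕ) + n = b → a ∈ Set.uIcc i g.2 → b ∈ Set.uIcc i g.2 →
      Reach (Op o) (seg (z', i) g) (z', a) (z', b) := by
    intro n
    induction n with
    | zero =>
      intro a b hab ha hb
      have : a = b := Fin.ext (by simpa using hab)
      subst this
      exact .refl ⟨rfl, ha⟩
    | succ n ih =>
      intro a b hab ha hb
      have hc : (b : ℕ) - 1 < k + 1 := by have := b.2; omega
      have hcm : (⟨(b : ℕ) - 1, hc⟩ : Fin (k + 1)) ∈ Set.uIcc i g.2 := by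
        rw [hmem] at *; simp only; omega
      exact (ih a ⟨b - 1, hc⟩ (by simp only; omega) ha hcm).tail
        (hop _ _ (by simp only; omega) hcm hb) ⟨rfl, hb⟩
  rcases le_total (i : ℕ) j with h | h
  · exact up (j - i) i j (by omega) Set.left_mem_uIcc hj
  · exact (up (i - j) j i (by omega) hj Set.left_mem_uIcc).symm Op.symm

variable {σ : Type*} {C : σ → Set (ℤ × ℤ)} (fam : ∀ s, Family k (C s))
variable (D A I : Set (Vertex k)) (o : Set (Sym2 (Vertex k))) (b : Set (Vertex k × Vertex k))

/-- `S` is separate from the vertices of `A` up to the starting point of the greedy path. -/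
def IsFree (S : Shape k) : Prop := ∀ y ∈ S.verts, (y ∈ D → ∀ a ∈ A, a.1 ≠ y.1) ∧
  ∀ e, IsStart D A I o e → ∀ a ∈ A, enc a ≤ enc e → ¬ Reach (Op o) D a y

/-- The shape of index `s` exists and is free. -/
def IsGood (s : σ) : Prop := ∃ S, (fam s).sel o = some S ∧ IsFree D A I o S

/-- The shape of index `s` exists and is joined to the starting point of the greedy path. -/
def IsAttached (s : σ) : Prop := ∃ S, (fam s).sel o = some S ∧ ∃ y ∈ S.verts,
  ∀ e, IsStart D A I o e → Reach (Op o) D e y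

/-- Bridges that join the greedy path to free shapes. -/
structure IsSurgery (X : Finset σ) (w g : σ → Vertex k) (l : List (Vertex k)) : Prop where
  full : FullGreedy D A I o b l
  data : ∀ s ∈ X, ∃ S, (fam s).sel o = some S ∧ IsFree D A I o S ∧ w s ∈ l ∧ g s ∈ S.verts ∧
    (w s).1 = (g s).1 ∧ (∀ j, ((w s).1, j) ∈ D) ∧ ∀ v ∈ inside (w s) (g s), v ∉ l ∧ v ∉ S.verts

/-- The open edges after the construction of the bridges. -/
def surgOpen (X : Finset σ) (w g : σ → Vertex k) : Set (Sym2 (Vertex k)) :=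
  (o \ {e | ∃ s ∈ X, ∃ v ∈ inside (w s) (g s), v ∈ e}) ∪ {e | ∃ s ∈ X, e ∈ bridge (w s) (g s)}

/-- The favoured edges after the construction of the bridges. -/
def surgBits (X : Finset σ) (w : σ → Vertex k) (l : List (Vertex k)) : Set (Vertex k × Vertex k) :=
  {c | ((∃ s ∈ X, w s = c.1) ∧ ∃ t l', l = t ++ c.2 :: c.1 :: l') ∨ ((∀ s ∈ X, w s ≠ c.1) ∧ c ∈ b)}

variable {fam D A I o b}

namespace IsSurgery

variable {X : Finset σ} {w g : σ → Vertex k} {l : List (Vertex k)}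

theorem col_mem (h : IsSurgery fam D A I o b X w g l) {s : σ} (hs : s ∈ X) : (w s).1 ∈ C s := by
  obtain ⟨S, h1, -, -, h3, h4, -⟩ := h.data s hs
  rw [h4]; exact (fam s).cols h1 _ h3

theorem notMem_inside (h : IsSurgery fam D A I o b X w g l) {v : Vertex k} (hv : v ∈ l) :
    ∀ s ∈ X, v ∉ inside (w s) (g s) := fun s hs hin => by
  obtain ⟨S, -, -, -, -, -, -, h4⟩ := h.data s hs
  exact (h4 v hin).1 hv

/-- All edges at the interior of a bridge other than those of bridges are closed, so a bridge can
only be entered at its two ends. Its foot is on the path, and its far end is on a free shape, which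
no vertex of `A` up to the starting point reaches. -/
theorem transfer (h : IsSurgery fam D A I o b X w g l) :
    FullGreedy D A I (surgOpen o X w g) (surgBits b X w l) l := by
  have hnd := h.full.1.facts.1
  refine h.full.transfer (N := {v | ∃ s ∈ X, v ∈ inside (w s) (g s)})
    (B := {e | ∃ s ∈ X, e ∈ bridge (w s) (g s)}) (W := {v | ∃ s ∈ X, w s = v})
    (G := {v | ∃ s ∈ X, g s = v}) ?_ ?_ ?_ ?_ ?_ ?_ ?_ ?_ ?_ ?_
  · exact Set.union_subset_union_left _ Set.sdiff_subset
  · rintro x y ⟨h1, h2⟩ hx hy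
    refine ⟨h1, Or.inl ⟨h2, ?_⟩⟩
    rintro ⟨s, hs, v, hv, hve⟩
    rcases Sym2.mem_iff.1 hve with rfl | rfl
    exacts [hx ⟨s, hs, hv⟩, hy ⟨s, hs, hv⟩]
  · rintro x y ⟨s, hs, hb⟩
    by_cases h1 : x = w s
    · exact Or.inr (Or.inl ⟨s, hs, h1.symm⟩)
    · by_cases h2 : x = g s
      · exact Or.inr (Or.inr ⟨s, hs, h2.symm⟩)
      · exact Or.inl ⟨s, hs, (mem_edgesIn.1 hb).2.1, h1, h2⟩
  · rintro x y ⟨h1, h2⟩ hB ⟨s, hs, hx⟩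
    rcases h2 with h2 | h2
    · exact h2.2 ⟨s, hs, x, hx, Sym2.mem_mk_left _ _⟩
    · exact hB h2
  · rintro _ ⟨s, hs, rfl⟩
    obtain ⟨S, -, -, h1, -⟩ := h.data s hs
    exact h1
  · rintro v hv ⟨s, hs, hin⟩
    exact h.notMem_inside hv s hs hin
  · rintro _ ⟨s, hs, rfl⟩
    obtain ⟨S, -, h1, -, h2, -⟩ := h.data s hs
    exact (h1 _ h2).2
  · rintro a ha ⟨s, hs, hin⟩
    obtain ⟨S, -, h1, -, h2, h3, h4, -⟩ := h.data s hs
    exact (h1 _ h2).1 (by have := h4 (g s).2; rw [h3] at this; exact this) a ha (hin.1.1.trans h3)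
  · intro x hx y
    have hx' : ∀ s ∈ X, w s ≠ x := fun s hs h => hx ⟨s, hs, h⟩
    have hx'' : ¬ ∃ s ∈ X, w s = x := hx
    simp only [surgBits, Set.mem_ofPred_eq, hx'', false_and, false_or]
    exact ⟨fun h => h.2, fun h => ⟨hx', h⟩⟩
  · intro t y x l' hl hx y'
    simp only [surgBits, Set.mem_ofPred_eq]
    have hx' : ∃ s ∈ X, w s = x := hx
    constructor
    · rintro (⟨-, t', l'', hl'⟩ | ⟨h, -⟩)
      · rw [hl] at hl' hnd
        have hnd' := hl' ▸ hnd
        -- positions of `x` agree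
        have key : ∀ (t t' : List (Vertex k)) (y y' x : Vertex k) (l' l'' : List (Vertex k)),
            (t ++ y :: x :: l').Nodup → t ++ y :: x :: l' = t' ++ y' :: x :: l'' → y' = y := by
          intro t
          induction t with
          | nil =>
            intro t' y y' x l' l'' hnd heq
            cases t' with
            | nil => simp at heq; exact heq.1.symm
            | cons u t' =>
              simp only [List.nil_append, List.cons_append, List.cons.injEq] at heq
              obtain ⟨rfl, heq⟩ := heq
              cases t' with
              | nil =>
                simp only [List.nil_append, List.cons.injEq] at heq
                obtain ⟨rfl, heq⟩ := heq
                rw [heq] at hnd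
                simp at hnd
              | cons u' t' =>
                simp only [List.cons_append, List.cons.injEq] at heq
                obtain ⟨rfl, heq⟩ := heq
                rw [heq] at hnd
                simp at hnd
          | cons u t ih =>
            intro t' y y' x l' l'' hnd heq
            cases t' with
            | nil =>
              simp only [List.nil_append, List.cons_append, List.cons.injEq] at heq
              obtain ⟨rfl, heq⟩ := heq
              rw [List.cons_append, List.nodup_cons] at hnd
              cases t with
              | nil =>
                simp only [List.nil_append, List.cons.injEq] at heq
                obtain ⟨rfl, heq⟩ := heq
                simp at hnd
              | cons u' t =>
                simp only [List.cons_append, List.cons.injEq] at heq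
                obtain ⟨rfl, heq⟩ := heq
                simp at hnd
            | cons u' t' =>
              simp only [List.cons_append, List.cons.injEq] at heq
              rw [List.cons_append, List.nodup_cons] at hnd
              exact ih t' y y' x l' l'' hnd.2 heq.2
        exact key _ _ _ _ _ _ _ hnd hl'
      · obtain ⟨s, hs, hsx⟩ := hx'
        exact absurd hsx (h s hs)
    · rintro rfl
      exact Or.inl ⟨hx', t, l', hl⟩

variable (hC : ∀ s s', s ≠ s' → Disjoint (C s) (C s'))
include hC

/-- The surgery only modifies edges over the regions of the chosen shapes. -/
theorem mem_iff (h : IsSurgery fam D A I o b X w g l) {s : σ} {z : ℤ × ℤ} (hz : z ∈ C s)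
    (hsz : s ∈ X → (w s).1 ≠ z) {e : Sym2 (Vertex k)} (he : e ∈ edgesIn (lift k {z})) :
    e ∈ surgOpen o X w g ↔ e ∈ o := by
  induction e with | _ x y =>
  obtain ⟨-, hx, hy⟩ := mem_edgesIn.1 he
  have hx : x.1 = z := hx
  have hy : y.1 = z := hy
  have hcol : ∀ s' ∈ X, (w s').1 ≠ z := by
    intro s' hs' heq
    by_cases hss : s' = s
    · exact hsz (hss ▸ hs') (hss ▸ heq)
    · exact Set.disjoint_left.1 (hC _ _ hss) (h.col_mem hs') (heq ▸ hz)
  constructor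
  · rintro (h1 | ⟨s', hs', hb⟩)
    · exact h1.1
    · exact absurd ((mem_edgesIn.1 hb).2.1.1.symm.trans hx) (hcol s' hs')
  · intro ho
    refine Or.inl ⟨ho, ?_⟩
    rintro ⟨s', hs', v, hv, hve⟩
    rcases Sym2.mem_iff.1 hve with rfl | rfl
    exacts [hcol s' hs' (hv.1.1.symm.trans hx), hcol s' hs' (hv.1.1.symm.trans hy)]

theorem new_edge (h : IsSurgery fam D A I o b X w g l) {s : σ} {e : Sym2 (Vertex k)}
    (he : e ∈ edgesIn (lift k (C s))) (he' : e ∈ surgOpen o X w g) (heo : e ∉ o) :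
    s ∈ X ∧ e ∈ bridge (w s) (g s) := by
  rcases he' with h1 | ⟨s', hs', hb⟩
  · exact absurd h1.1 heo
  · induction e with | _ x y =>
    by_cases hss : s' = s
    · exact hss ▸ ⟨hs', hb⟩
    · have h1 : x.1 ∈ C s := (mem_edgesIn.1 he).2.1
      rw [(mem_edgesIn.1 hb).2.1.1] at h1
      exact absurd h1 (Set.disjoint_left.1 (hC _ _ hss) (h.col_mem hs'))

theorem sel_eq (h : IsSurgery fam D A I o b X w g l) {s : σ} (hs : s ∉ X) :
    (fam s).sel (surgOpen o X w g) = (fam s).sel o := by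
  refine (fam s).isLocal ?_
  ext e
  simp only [Set.mem_inter_iff, and_congr_left_iff]
  intro he
  constructor
  · intro he'
    by_contra heo
    exact hs (h.new_edge hC he he' heo).1
  · intro ho
    refine Or.inl ⟨ho, ?_⟩
    rintro ⟨s', hs', v, hv, hve⟩
    have h1 : v.1 ∈ C s := he.2 v hve
    rw [hv.1.1] at h1
    have hss : s' ≠ s := fun h => hs (h ▸ hs')
    exact Set.disjoint_left.1 (hC _ _ hss) (h.col_mem hs') h1

/-- An edge that is closed touches the interior of a bridge. The interior avoids the shape to which
the bridge leads, and the other bridges are over disjoint regions. -/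
theorem edges_subset (h : IsSurgery fam D A I o b X w g l) {s : σ} {S : Shape k}
    (hS : (fam s).sel o = some S) : S.edges ⊆ surgOpen o X w g := by
  intro e he
  refine Or.inl ⟨(fam s).isOpen hS he, ?_⟩
  rintro ⟨s', hs', v, hv, hve⟩
  have hvS := ((fam s).edges_subset hS he).2 v hve
  by_cases hss : s' = s
  · subst hss
    obtain ⟨S', h1, -, -, -, -, -, h2⟩ := h.data s' hs'
    rw [hS] at h1
    cases h1
    exact (h2 v hv).2 hvS
  · have h1 := (fam s).cols hS v hvS
    rw [hv.1.1] at h1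
    exact Set.disjoint_left.1 (hC _ _ hss) (h.col_mem hs') h1

/-- A bridge seen in the result over a column where this surgery built nothing was open before, and
then its points were joined to the start through the greedy path. -/
theorem reach_of_bridge (h : IsSurgery fam D A I o b X w g l) {s : σ} {w' g' : Vertex k}
    (hw : w' ∈ l) (hwC : w'.1 ∈ C s) (hD : ∀ j, (w'.1, j) ∈ D)
    (hsz : s ∈ X → (w s).1 ≠ w'.1) (hb : bridge w' g' ⊆ surgOpen o X w g) {e v : Vertex k}
    (he : IsStart D A I o e) (hv : v ∈ seg w' g') : Reach (Op o) D e v := by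
  have hb' : bridge w' g' ⊆ o := by
    intro c hc
    refine (h.mem_iff hC hwC hsz ?_).1 (hb hc)
    exact ⟨hc.1, fun x hx => (hc.2 x hx).1⟩
  refine (h.full.1.facts.2.2.1 e he w' hw).trans ((reach_seg hb' hv).mono_set ?_)
  rintro ⟨z, j⟩ ⟨hz, -⟩
  have hz : z = w'.1 := hz
  exact hz ▸ hD j

/-- The bridges can be read off from the result of the surgery, up to shapes that were attached. -/
theorem decode {o₂ : Set (Sym2 (Vertex k))} {b₂ : Set (Vertex k × Vertex k)} {X₂ : Finset σ}
    {w₂ g₂ : σ → Vertex k} {l₂ : List (Vertex k)}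
    (h : IsSurgery fam D A I o b X w g l) (h₂ : IsSurgery fam D A I o₂ b₂ X₂ w₂ g₂ l₂)
    (ho : surgOpen o X w g = surgOpen o₂ X₂ w₂ g₂) (hb : surgBits b X w l = surgBits b₂ X₂ w₂ l₂)
    {s : σ} (hs : s ∈ X₂) (hne : s ∈ X → (w s).1 ≠ (w₂ s).1) :
    s ∉ X ∧ IsAttached fam D A I o s := by
  -- Both paths are the greedy path of the common result.
  have hl : l = l₂ := by
    have h1 := h₂.transfer
    rw [← ho, ← hb] at h1
    exact h.transfer.unique h1
  subst hl
  obtain ⟨S₂, hS₂, hfree₂, hw₂, hg₂, hcol₂, hD₂, -⟩ := h₂.data s hs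
  have hbr₂ : bridge (w₂ s) (g₂ s) ⊆ surgOpen o X w g := by
    rw [ho]; exact fun c hc => Or.inr ⟨s, hs, hc⟩
  have hreach : ∀ v ∈ seg (w₂ s) (g₂ s), ∀ e, IsStart D A I o e → Reach (Op o) D e v :=
    fun v hv e he => h.reach_of_bridge hC hw₂ (h₂.col_mem hs) hD₂ hne hbr₂ he hv
  have hatt : IsAttached fam D A I o s := by
    have hS₂' : S₂.edges ⊆ surgOpen o X w g := ho ▸ h₂.edges_subset hC hS₂
    obtain ⟨S, hS⟩ : ∃ S, (fam s).sel o = some S := by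
      by_cases hsX : s ∈ X
      · obtain ⟨S, hS, -⟩ := h.data s hsX
        exact ⟨S, hS⟩
      · rw [← h.sel_eq hC hsX]
        exact (fam s).exists_of_open hS₂ hS₂'
    have hS' : S.edges ⊆ surgOpen o X w g := h.edges_subset hC hS
    refine ⟨S, hS, ?_⟩
    have hin : ∀ {o : Set (Sym2 (Vertex k))} {S : Shape k}, (fam s).sel o = some S →
        S.edges ⊆ edgesIn (lift k (C s)) := by
      intro o S hS e he
      have := (fam s).edges_subset hS he
      exact ⟨this.1, fun x hx => (fam s).cols hS x (this.2 x hx)⟩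
    -- Three cases. If each shape is open before the other surgery, then they coincide, and the
    -- second bridge leads to it. If `S` has an edge that was closed in `o₂`, this edge lies in the
    -- second bridge, which is already joined to the start in `o`. If `S₂` has an edge that was
    -- closed in `o`, this edge lies in the first bridge, which is joined to the start in `o₂`,
    -- although `S₂` is free there.
    by_cases h1 : S.edges ⊆ o₂
    · by_cases h2 : S₂.edges ⊆ o
      · have := (fam s).antisymm hS hS₂ h1 h2
        subst this
        refine ⟨g₂ s, hg₂, hreach _ ⟨hcol₂.symm, Set.right_mem_uIcc⟩⟩
      · obtain ⟨c, hc, hco⟩ := Set.not_subset.1 h2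
        obtain ⟨hsX, hcb⟩ := h.new_edge hC (hin hS₂ hc) (hS₂' hc) hco
        induction c with | _ x y =>
        have hx : x ∈ seg (w s) (g s) := (mem_edgesIn.1 hcb).2.1
        have hxS : x ∈ S₂.verts := (mem_edgesIn.1 ((fam s).edges_subset hS₂ hc)).2.1
        obtain ⟨e, he⟩ := h₂.full.1.exists_isStart
        obtain ⟨-, -, -, hw, -, -, hD, -⟩ := h.data s hsX
        refine absurd ?_ ((hfree₂ x hxS).2 e he e he.1 le_rfl)
        refine h₂.reach_of_bridge hC hw (h.col_mem hsX) hD (fun _ h' => hne hsX h'.symm) ?_ he hx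
        rw [← ho]; exact fun c hc => Or.inr ⟨s, hsX, hc⟩
    · obtain ⟨c, hc, hco⟩ := Set.not_subset.1 h1
      obtain ⟨-, hcb⟩ := h₂.new_edge hC (hin hS hc) (ho ▸ hS' hc) hco
      induction c with | _ x y =>
      exact ⟨x, (mem_edgesIn.1 ((fam s).edges_subset hS hc)).2.1, hreach x (mem_edgesIn.1 hcb).2.1⟩
  -- Chosen shapes are free, hence not attached.
  refine ⟨fun hsX => ?_, hatt⟩
  obtain ⟨S, hS, y, hy, hr⟩ := hatt
  obtain ⟨S', hS', hfree, -⟩ := h.data s hsX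
  rw [hS] at hS'
  cases hS'
  obtain ⟨e, he⟩ := h.full.1.exists_isStart
  exact (hfree y hy).2 e he e he.1 le_rfl (hr e he)

/-- After the surgery the start set is joined to the shapes of the chosen indices. -/
theorem image (h : IsSurgery fam D A I o b X w g l) {s : σ} (hs : s ∈ X) :
    ∃ S, (fam s).sel (surgOpen o X w g) = some S ∧ ∃ a ∈ A, ∃ y ∈ S.verts,
      (∃ i ∈ I, Reach (Op (surgOpen o X w g)) D a i) ∧ Reach (Op (surgOpen o X w g)) D a y := by
  obtain ⟨S, hS, hfree, hw, hg, hcol, hD, -⟩ := h.data s hs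
  obtain ⟨S', hS'⟩ := (fam s).exists_of_open hS (h.edges_subset hC hS)
  refine ⟨S', hS', ?_⟩
  obtain ⟨e, he⟩ := h.transfer.1.exists_isStart
  have hreach : ∀ v ∈ seg (w s) (g s), Reach (Op (surgOpen o X w g)) D e v := by
    intro v hv
    refine (h.transfer.1.facts.2.2.1 e he _ hw).trans
      ((reach_seg (fun c hc => Or.inr ⟨s, hs, hc⟩) hv).mono_set ?_)
    rintro ⟨z, j⟩ ⟨hz, -⟩
    have hz : z = (w s).1 := hz
    exact hz ▸ hD j
  -- The selection may have changed. If so, the newly selected shape uses an edge of the bridge,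
  -- which is joined to the start as well.
  by_cases h1 : S'.edges ⊆ o
  · have := (fam s).antisymm hS hS' (h.edges_subset hC hS) h1
    subst this
    exact ⟨e, he.1, g s, hg, he.2.1, hreach _ ⟨hcol.symm, Set.right_mem_uIcc⟩⟩
  · obtain ⟨c, hc, hco⟩ := Set.not_subset.1 h1
    have hcin : c ∈ edgesIn (lift k (C s)) := by
      have := (fam s).edges_subset hS' hc
      exact ⟨this.1, fun x hx => (fam s).cols hS' x (this.2 x hx)⟩
    obtain ⟨-, hcb⟩ := h.new_edge hC hcin ((fam s).isOpen hS' hc) hco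
    induction c with | _ x y =>
    exact ⟨e, he.1, x, (mem_edgesIn.1 ((fam s).edges_subset hS' hc)).2.1, he.2.1,
      hreach x (mem_edgesIn.1 hcb).2.1⟩

end IsSurgery

end Surgery
end Slab

/-! ### Many bridges at once. -/

namespace Slab

section MultiSurgery

variable {k : ℕ}

/-- The columns at distance at most `1` from a column. -/
def nbCols (z : ℤ × ℤ) : Finset (ℤ × ℤ) :=
  {z, (z.1 + 1, z.2), (z.1 - 1, z.2), (z.1, z.2 + 1), (z.1, z.2 - 1)}

theorem fst_eq_of_adj {x y : Vertex k} (h : (graph k).Adj x y) : y.1 ∈ nbCols x.1 := by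
  obtain ⟨⟨a, b⟩, i⟩ := x
  obtain ⟨⟨c, d⟩, j⟩ := y
  simp only [graph] at h
  simp only [nbCols, Finset.mem_insert, Prod.mk.injEq, Finset.mem_singleton]
  have h1 : (a - c) ^ 2 ≤ 1 := by nlinarith [sq_nonneg (b - d), sq_nonneg ((i.val : ℤ) - j.val)]
  have h2 : (b - d) ^ 2 ≤ 1 := by nlinarith [sq_nonneg (a - c), sq_nonneg ((i.val : ℤ) - j.val)]
  have h3 : (a - c) ^ 2 + (b - d) ^ 2 ≤ 1 := by nlinarith [sq_nonneg ((i.val : ℤ) - j.val)]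
  have h4 : a - c = 0 ∨ a - c = 1 ∨ a - c = -1 := by
    have : -1 ≤ a - c ∧ a - c ≤ 1 := ⟨by nlinarith, by nlinarith⟩
    omega
  have h5 : b - d = 0 ∨ b - d = 1 ∨ b - d = -1 := by
    have : -1 ≤ b - d ∧ b - d ≤ 1 := ⟨by nlinarith, by nlinarith⟩
    omega
  rcases h4 with h4 | h4 | h4 <;> rcases h5 with h5 | h5 | h5 <;> rw [h4, h5] at h3 <;>
    omega

/-- The edges that touch a column. -/
def colEdges (k : ℕ) (z : ℤ × ℤ) : Finset (Sym2 (Vertex k)) :=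
  (({z} ×ˢ Finset.univ) ×ˢ (nbCols z ×ˢ Finset.univ)).image fun c => s(c.1, c.2)

/-- The pairs of neighbours that start in a column. -/
def colPairs (k : ℕ) (z : ℤ × ℤ) : Finset (Vertex k × Vertex k) :=
  (({z} ×ˢ Finset.univ) ×ˢ (nbCols z ×ˢ Finset.univ))

theorem mem_colPairs {x y : Vertex k} (h : (graph k).Adj x y) : (x, y) ∈ colPairs k x.1 := by
  obtain ⟨z, i⟩ := x
  obtain ⟨z', j⟩ := y
  have := fst_eq_of_adj h
  simpa [colPairs] using this

theorem mem_colEdges {x y : Vertex k} (h : (graph k).Adj x y) : s(x, y) ∈ colEdges k x.1 :=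
  Finset.mem_image.2 ⟨(x, y), mem_colPairs h, rfl⟩

theorem card_colPairs_le (z : ℤ × ℤ) : (colPairs k z).card ≤ 5 * (k + 1) ^ 2 := by
  simp only [colPairs, Finset.card_product, Finset.card_singleton, Finset.card_univ, Fintype.card_fin]
  have : (nbCols z).card ≤ 5 := Finset.card_le_five
  nlinarith

theorem card_colEdges_le (z : ℤ × ℤ) : (colEdges k z).card ≤ 5 * (k + 1) ^ 2 :=
  Finset.card_image_le.trans (card_colPairs_le z)

variable {σ : Type*} {C : σ → Set (ℤ × ℤ)} {fam : ∀ s, Family k (C s)}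
variable {D A I : Set (Vertex k)}

/-- Lifting an event about edges to an event about edges and favoured pairs. -/
theorem Pr_disjSum {α β : Type*} (F : Finset α) (F' : Finset β) (q : α → ℝ) (q' : β → ℝ)
    (E : Set (Set α)) :
    Pr (F.disjSum F') (Sum.elim q q') {ζ | Sum.inl ⁻¹' ζ ∈ E} = Pr F q E := by
  have h : DependsOnly (Set.range Sum.inl) {ζ : Set (α ⊕ β) | Sum.inl ⁻¹' ζ ∈ E} := by
    intro ζ ζ' h hζ
    have : Sum.inl ⁻¹' ζ = Sum.inl ⁻¹' ζ' := by
      ext a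
      have h1 : Sum.inl a ∈ ζ ∩ Set.range Sum.inl ↔ Sum.inl a ∈ ζ' ∩ Set.range Sum.inl := by rw [h]
      simpa using h1
    change Sum.inl ⁻¹' ζ' ∈ E
    rw [← this]; exact hζ
  rw [Pr_eq_of_dependsOnly (G := F.map Function.Embedding.inl) h, Pr_map]
  · refine Pr_congr fun ω _ => ?_
    change Sum.inl ⁻¹' (Sum.inl '' ω) ∈ E ↔ _
    rw [Set.preimage_image_eq _ Sum.inl_injective]
  · rintro _ ⟨a, rfl⟩
    simp

/-- In a configuration with free shapes, bridges can be constructed. -/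
theorem exists_bridges {o : Set (Sym2 (Vertex k))} {b : Set (Vertex k × Vertex k)}
    {l : List (Vertex k)} (hl : FullGreedy D A I o b l)
    (hsep : ∀ s o S, (fam s).sel o = some S → ∀ Λ ⊆ D, (∃ a ∈ A, ∃ i ∈ I, Reach (graph k).Adj Λ a i) →
      ∃ x ∈ Λ, ∃ y ∈ S.verts, x.1 = y.1 ∧ ∀ j, (x.1, j) ∈ D) :
    ∃ w g : σ → Vertex k, ∀ X : Finset σ, (∀ s ∈ X, IsGood fam D A I o s) →
      IsSurgery fam D A I o b X w g l := by
  classical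
  have key : ∀ s, IsGood fam D A I o s → ∃ p : Vertex k × Vertex k,
      ∃ S, (fam s).sel o = some S ∧ IsFree D A I o S ∧ p.1 ∈ l ∧ p.2 ∈ S.verts ∧
      p.1.1 = p.2.1 ∧ (∀ j, (p.1.1, j) ∈ D) ∧ ∀ v ∈ inside p.1 p.2, v ∉ l ∧ v ∉ S.verts := by
    rintro s ⟨S, hS, hfree⟩
    obtain ⟨x, hx, y, hy, hxy, hD⟩ := hsep s o S hS {v | v ∈ l} (fun v hv => hl.1.facts.2.1 v hv)
      hl.reach_adj
    let T : Set (Vertex k × Vertex k) := {p | p.1 ∈ l ∧ p.2 ∈ S.verts ∧ p.1.1 = p.2.1 ∧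
      ∀ j, (p.1.1, j) ∈ D}
    let ht : Vertex k × Vertex k → ℕ := fun p => ((p.1.2 : ℕ) : ℤ) - (p.2.2 : ℕ) |>.natAbs
    -- A pair at minimal height difference, so that nothing of the path or of the shape lies
    -- strictly between its members.
    obtain ⟨p, hp, hmin⟩ := (InvImage.wf ht Nat.lt_wfRel.wf).has_min T ⟨(x, y), hx, hy, hxy, hD⟩
    refine ⟨p, S, hS, hfree, hp.1, hp.2.1, hp.2.2.1, hp.2.2.2, ?_⟩
    obtain ⟨⟨w, i⟩, ⟨g, j⟩⟩ := p
    obtain ⟨-, -, hpeq, hpD⟩ := id hp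
    simp only at hpeq hpD
    subst hpeq
    rintro ⟨z, h⟩ ⟨⟨hz, hh⟩, h1, h2⟩
    simp only at hz hh
    subst hz
    have hi : h ≠ i := fun h => h1 (by rw [h])
    have hj : h ≠ j := fun h => h2 (by rw [h])
    have hi' : (h : ℕ) ≠ i := fun h => hi (Fin.ext h)
    have hj' : (h : ℕ) ≠ j := fun h => hj (Fin.ext h)
    rw [Set.mem_uIcc, Fin.le_def, Fin.le_def, Fin.le_def, Fin.le_def] at hh
    constructor
    · intro hv
      refine hmin ((z, h), (z, j)) ⟨hv, hp.2.1, rfl, hpD⟩ ?_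
      change (((h : ℕ) : ℤ) - (j : ℕ)).natAbs < (((i : ℕ) : ℤ) - (j : ℕ)).natAbs
      omega
    · intro hv
      refine hmin ((z, i), (z, h)) ⟨hp.1, hv, rfl, hpD⟩ ?_
      change (((i : ℕ) : ℤ) - (h : ℕ)).natAbs < (((i : ℕ) : ℤ) - (j : ℕ)).natAbs
      omega
  obtain ⟨v₀, -⟩ : ∃ v₀ : Vertex k, True := ⟨((0, 0), 0), trivial⟩
  choose! p hp using key
  exact ⟨fun s => (p s).1, fun s => (p s).2, fun X hX => ⟨hl, fun s hs => hp s (hX s hs)⟩⟩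

theorem Greedy.adj {o : Set (Sym2 (Vertex k))} {b : Set (Vertex k × Vertex k)}
    {l t l' : List (Vertex k)} {x y : Vertex k} (h : Greedy D A I o b l) (hl : l = t ++ y :: x :: l') :
    (graph k).Adj x y := by
  cases (Greedy.suffix (hl ▸ h) (by simp)).1 with
  | step _ _ _ _ _ hb => exact hb.1.1.1

open Classical in
/-- Many simultaneous surgeries: if there are many free shapes and few attached ones, then the
start set can be joined to shapes in many ways that are easily told apart. -/
theorem multi_surgery [Fintype σ] {F : Finset (Sym2 (Vertex k))} {q : Sym2 (Vertex k) → ℝ} {δ : ℝ}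
    (hq : IsWeight q) (hδ : 0 < δ) (hδ' : δ ≤ 1 / 2) (hDfin : D.Finite)
    (hFe : ∀ e ∈ F, e ∈ (graph k).edgeSet) (hC : ∀ s s', s ≠ s' → Disjoint (C s) (C s'))
    (hsep : ∀ s o S, (fam s).sel o = some S → ∀ Λ ⊆ D, (∃ a ∈ A, ∃ i ∈ I, Reach (graph k).Adj Λ a i) →
      ∃ x ∈ Λ, ∃ y ∈ S.verts, x.1 = y.1 ∧ ∀ j, (x.1, j) ∈ D)
    (hF : ∀ s, ∀ x y : Vertex k, x.1 ∈ C s → x.1 = y.1 → (∀ j, (x.1, j) ∈ D) → (graph k).Adj x y →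
      s(x, y) ∈ F)
    (hqδ : ∀ s, ∀ x y : Vertex k, x.1 ∈ C s → (∀ j, (x.1, j) ∈ D) → (graph k).Adj x y → s(x, y) ∈ F →
      δ ≤ q s(x, y) ∧ q s(x, y) ≤ 1 - δ)
    (r g t : ℕ) (hr : 1 ≤ r) :
    δ ^ (r * (10 * (k + 1) ^ 2)) * ((g.choose r : ℕ) * Pr F q {o | Joined o D A I ∧
        g ≤ (Finset.univ.filter (IsGood fam D A I o)).card ∧
        (Finset.univ.filter (IsAttached fam D A I o)).card ≤ t}) ≤
      ((r + t).choose r : ℕ) * Pr F q {o | Joined o D A I ∧ ∃ s S, (fam s).sel o = some S ∧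
        Joined o D A S.verts} := by
  -- The auxiliary bits are additional independent coordinates of probability $1/2$, one for each
  -- ordered pair of neighbours in `D`; the events in question do not depend on them.
  let Fb : Finset (Vertex k × Vertex k) :=
    (hDfin.toFinset ×ˢ hDfin.toFinset).filter fun c => (graph k).Adj c.1 c.2
  let q' : Sym2 (Vertex k) ⊕ (Vertex k × Vertex k) → ℝ := Sum.elim q fun _ => 1 / 2
  have hq' : IsWeight q' := by
    rintro (e | c)
    · exact hq e
    · constructor <;> norm_num [q']
  rw [← Pr_disjSum F Fb q (fun _ => 1 / 2), ← Pr_disjSum F Fb q (fun _ => 1 / 2)]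
  -- the choice of the path and of the bridges
  have hchoice : ∀ ζ : Set (Sym2 (Vertex k) ⊕ (Vertex k × Vertex k)), ∃ c : List (Vertex k) × (σ → Vertex k) × (σ → Vertex k),
      Joined (Sum.inl ⁻¹' ζ) D A I → ∀ X : Finset σ, (∀ s ∈ X, IsGood fam D A I (Sum.inl ⁻¹' ζ) s) →
        IsSurgery fam D A I (Sum.inl ⁻¹' ζ) (Sum.inr ⁻¹' ζ) X c.2.1 c.2.2 c.1 := by
    intro ζ
    by_cases hj : Joined (Sum.inl ⁻¹' ζ) D A I
    · obtain ⟨l, hl⟩ := exists_fullGreedy (b := Sum.inr ⁻¹' ζ) hDfin hj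
      obtain ⟨w, g, h⟩ := exists_bridges hl hsep
      exact ⟨(l, w, g), fun _ => h⟩
    · exact ⟨([], fun _ => ((0, 0), 0), fun _ => ((0, 0), 0)), fun h => absurd h hj⟩
  choose c hc using hchoice
  -- A surgery is labelled by the chosen indices and the columns of their bridges. This determines
  -- the coordinates that may be modified, and the heights of the ends need not be remembered.
  let lab : Set (Sym2 (Vertex k) ⊕ (Vertex k × Vertex k)) → Finset σ → Finset (σ × (ℤ × ℤ)) := fun ζ X =>
    X.image fun s => (s, ((c ζ).2.1 s).1)
  have hlab : ∀ ζ X, (lab ζ X).image Prod.fst = X := by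
    intro ζ X
    simp only [lab, Finset.image_image, Function.comp_def]
    exact Finset.image_id
  let res : Finset (σ × (ℤ × ℤ)) → Set (Sym2 (Vertex k) ⊕ (Vertex k × Vertex k)) →
      Set (Sym2 (Vertex k) ⊕ (Vertex k × Vertex k)) := fun a ζ =>
    Sum.inl '' surgOpen (Sum.inl ⁻¹' ζ) (a.image Prod.fst) (c ζ).2.1 (c ζ).2.2 ∪
    Sum.inr '' surgBits (Sum.inr ⁻¹' ζ) (a.image Prod.fst) (c ζ).2.1 (c ζ).1
  have hresl : ∀ a ζ, Sum.inl ⁻¹' res a ζ =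
      surgOpen (Sum.inl ⁻¹' ζ) (a.image Prod.fst) (c ζ).2.1 (c ζ).2.2 := by
    intro a ζ; ext e; simp [res]
  have hresr : ∀ a ζ, Sum.inr ⁻¹' res a ζ =
      surgBits (Sum.inr ⁻¹' ζ) (a.image Prod.fst) (c ζ).2.1 (c ζ).1 := by
    intro a ζ; ext e; simp [res]
  let good : Set (Sym2 (Vertex k) ⊕ (Vertex k × Vertex k)) → Finset σ := fun ζ =>
    Finset.univ.filter (IsGood fam D A I (Sum.inl ⁻¹' ζ))
  have hsurg : ∀ ζ, Joined (Sum.inl ⁻¹' ζ) D A I → ∀ X ∈ (good ζ).powersetCard r,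
      IsSurgery fam D A I (Sum.inl ⁻¹' ζ) (Sum.inr ⁻¹' ζ) X (c ζ).2.1 (c ζ).2.2 (c ζ).1 := by
    intro ζ hj X hX
    refine hc ζ hj X fun s hs => ?_
    have := (Finset.mem_powersetCard.1 hX).1 hs
    exact (Finset.mem_filter.1 this).2
  let M : Finset (σ × (ℤ × ℤ)) → Finset (Sym2 (Vertex k) ⊕ (Vertex k × Vertex k)) := fun a =>
    a.biUnion fun p => (colEdges k p.2).disjSum (colPairs k p.2)
  refine surgery_bound (F := F.disjSum Fb) hq' hδ (by linarith)
    (fun ζ => ((good ζ).powersetCard r).image (lab ζ)) M res ?_ ?_ ?_ ?_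
  · rintro ζ ⟨hj, -, -⟩ - a ha
    obtain ⟨X, hX, rfl⟩ := Finset.mem_image.1 ha
    have hS := hsurg ζ hj X hX
    have hXr := (Finset.mem_powersetCard.1 hX).2
    constructor
    · refine Finset.card_biUnion_le.trans ?_
      -- Each column accounts for at most $5(k+1)^2$ edges and as many bits.
      refine (Finset.sum_le_card_nsmul _ _ (10 * (k + 1) ^ 2) fun p _ => ?_).trans ?_
      · rw [Finset.card_disjSum]
        have h1 := card_colEdges_le (k := k) p.2
        have h2 := card_colPairs_le (k := k) p.2
        omega
      · rw [smul_eq_mul]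
        exact Nat.mul_le_mul_right _ (Finset.card_image_le.trans hXr.le)
    · intro i hi hiF
      obtain ⟨p, hp, hpi⟩ := Finset.mem_biUnion.1 hi
      obtain ⟨s, hs, rfl⟩ := Finset.mem_image.1 hp
      rcases i with e | c'
      · have he : e ∈ colEdges k ((c ζ).2.1 s).1 := by simpa using hpi
        obtain ⟨⟨x, y⟩, hxy, rfl⟩ := Finset.mem_image.1 he
        have hx : x.1 = ((c ζ).2.1 s).1 := by
          simp only [Finset.mem_product, Finset.mem_singleton] at hxy; exact hxy.1.1
        obtain ⟨S, -, -, -, -, -, hD, -⟩ := hS.data s hs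
        have heF : s(x, y) ∈ F := Finset.inl_mem_disjSum.1 hiF
        exact hqδ s x y (hx ▸ hS.col_mem hs) (hx ▸ hD) (hFe _ heF) heF
      · simp only [Sum.elim_inr]; constructor <;> linarith
  · rintro ζ ⟨hj, -, -⟩ hζF a ha
    obtain ⟨X, hX, rfl⟩ := Finset.mem_image.1 ha
    have hS := hsurg ζ hj X hX
    have hXr := (Finset.mem_powersetCard.1 hX).2
    refine ⟨?_, ?_, ?_⟩
    · rintro i (⟨e, he, rfl⟩ | ⟨⟨x, y⟩, he, rfl⟩)
      · rw [hlab] at he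
        rcases he with he | ⟨s, hs, he⟩
        · exact hζF he.1
        · induction e with | _ x y =>
          obtain ⟨hadj, hx, hy⟩ := mem_edgesIn.1 he
          obtain ⟨S, -, -, -, -, -, hD, -⟩ := hS.data s hs
          simp only [Finset.mem_coe, Finset.inl_mem_disjSum]
          refine hF s x y (hx.1 ▸ hS.col_mem hs) (hx.1.trans hy.1.symm) (hx.1 ▸ hD) hadj
      · rcases he with ⟨-, t', l', hl'⟩ | ⟨-, he⟩
        · have hD := hS.full.1.facts.2.1
          rw [hl'] at hD
          simp only [Finset.mem_coe, Finset.inr_mem_disjSum, Fb, Finset.mem_filter, Finset.mem_product,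
            Set.Finite.mem_toFinset]
          exact ⟨⟨hD x (by simp), hD y (by simp)⟩, hS.full.1.adj hl'⟩
        · exact hζF he
    · ext i
      simp only [Set.mem_sdiff, and_congr_left_iff, Finset.mem_coe]
      intro hi
      have hnotM : ∀ s ∈ X, i ∉ (colEdges k ((c ζ).2.1 s).1).disjSum (colPairs k ((c ζ).2.1 s).1) :=
        fun s hs h => hi (Finset.mem_biUnion.2 ⟨_, Finset.mem_image.2 ⟨s, hs, rfl⟩, h⟩)
      rcases i with e | ⟨x, y⟩
      · change e ∈ Sum.inl ⁻¹' res _ ζ ↔ _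
        rw [hresl, hlab]
        constructor
        · rintro (he | ⟨s, hs, hb⟩)
          · exact he.1
          · induction e with | _ x y =>
            obtain ⟨hadj, hx, -⟩ := mem_edgesIn.1 hb
            exact absurd (Finset.inl_mem_disjSum.2 (hx.1 ▸ mem_colEdges hadj)) (hnotM s hs)
        · intro he
          refine Or.inl ⟨he, ?_⟩
          rintro ⟨s, hs, v, hv, hve⟩
          have hadj := hFe e (Finset.inl_mem_disjSum.1 (hζF he))
          obtain ⟨y, rfl⟩ := hve
          exact hnotM s hs (Finset.inl_mem_disjSum.2 (hv.1.1 ▸ mem_colEdges hadj))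
      · change (x, y) ∈ Sum.inr ⁻¹' res _ ζ ↔ _
        rw [hresr, hlab]
        have hw : (graph k).Adj x y → ∀ s ∈ X, (c ζ).2.1 s ≠ x := fun hadj s hs h =>
          hnotM s hs (Finset.inr_mem_disjSum.2 (by rw [h]; exact mem_colPairs hadj))
        constructor
        · rintro (⟨⟨s, hs, hx⟩, t', l', hl'⟩ | ⟨-, he⟩)
          · exact absurd hx (hw (hS.full.1.adj hl') s hs)
          · exact he
        · intro he
          have h1 := Finset.inr_mem_disjSum.1 (hζF he)
          exact Or.inr ⟨hw (Finset.mem_filter.1 h1).2, he⟩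
    · change Joined (Sum.inl ⁻¹' res _ ζ) D A I ∧ _
      have hne : X.Nonempty := Finset.card_pos.1 (by omega)
      obtain ⟨s, hs⟩ := hne
      obtain ⟨S, hS1, a, ha, y, hy, ⟨i, hi, h1⟩, h2⟩ := hS.image hC hs
      simp only [hresl, hlab]
      exact ⟨⟨a, ha, i, hi, h1⟩, s, S, hS1, a, ha, y, hy, h2⟩
  · rintro ζ ⟨hj, hg, -⟩ -
    rw [Finset.card_image_of_injOn, Finset.card_powersetCard]
    · exact Nat.choose_le_choose _ hg
    · intro X _ Y _ hXY
      have := congrArg (Finset.image Prod.fst) hXY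
      rwa [hlab, hlab] at this
  · intro ζ' _
    by_cases hex : ∃ ζ X, ζ ∈ {ζ | Sum.inl ⁻¹' ζ ∈ {o | Joined o D A I ∧
        g ≤ (Finset.univ.filter (IsGood fam D A I o)).card ∧
        (Finset.univ.filter (IsAttached fam D A I o)).card ≤ t}} ∧ X ∈ (good ζ).powersetCard r ∧
        res (lab ζ X) ζ = ζ'
    · obtain ⟨ζ₁, X₁, ⟨hj₁, -, ht₁⟩, hX₁, hres₁⟩ := hex
      have hS₁ := hsurg ζ₁ hj₁ X₁ hX₁
      set P : Set (Finset (σ × (ℤ × ℤ))) := {a | ∃ ζ X, Joined (Sum.inl ⁻¹' ζ) D A I ∧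
        X ∈ (good ζ).powersetCard r ∧ a = lab ζ X ∧ res a ζ = ζ'} with hP
      have heqs : ∀ ζ X ζ'' Y, res (lab ζ X) ζ = ζ' → res (lab ζ'' Y) ζ'' = ζ' →
          surgOpen (Sum.inl ⁻¹' ζ) X (c ζ).2.1 (c ζ).2.2 =
            surgOpen (Sum.inl ⁻¹' ζ'') Y (c ζ'').2.1 (c ζ'').2.2 ∧
          surgBits (Sum.inr ⁻¹' ζ) X (c ζ).2.1 (c ζ).1 =
            surgBits (Sum.inr ⁻¹' ζ'') Y (c ζ'').2.1 (c ζ'').1 := by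
        intro ζ X ζ'' Y h1 h2
        have h3 := hresl (lab ζ X) ζ
        have h4 := hresl (lab ζ'' Y) ζ''
        have h5 := hresr (lab ζ X) ζ
        have h6 := hresr (lab ζ'' Y) ζ''
        rw [h1, hlab] at h3 h5
        rw [h2, hlab] at h4 h6
        exact ⟨h3.symm.trans h4, h5.symm.trans h6⟩
      -- Relative to one preimage, every other one uses only indices of that preimage or indices
      -- attached in it: at most $r+t$ in all.
      set U := X₁ ∪ Finset.univ.filter (IsAttached fam D A I (Sum.inl ⁻¹' ζ₁)) with hU
      have hmaps : Set.MapsTo (fun a : Finset (σ × (ℤ × ℤ)) => a.image Prod.fst) P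
          (U.powersetCard r : Finset (Finset σ)) := by
        rintro a ⟨ζ, X, hj, hX, rfl, hres⟩
        simp only [hlab, Finset.mem_coe, Finset.mem_powersetCard]
        refine ⟨fun s hs => ?_, (Finset.mem_powersetCard.1 hX).2⟩
        rw [hU, Finset.mem_union]
        by_cases hsX : s ∈ X₁
        · exact Or.inl hsX
        · obtain ⟨h1, h2⟩ := heqs _ _ _ _ hres₁ hres
          refine Or.inr (Finset.mem_filter.2 ⟨Finset.mem_univ _, ?_⟩)
          exact (hS₁.decode hC (hsurg ζ hj X hX) h1 h2 hs fun h => absurd h hsX).2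
      -- By `decode`, two preimages with the same set of indices have their bridges in the same
      -- columns, so that the set of indices determines the label.
      have hinj : Set.InjOn (fun a : Finset (σ × (ℤ × ℤ)) => a.image Prod.fst) P := by
        rintro a ⟨ζ, X, hj, hX, rfl, hres⟩ a' ⟨ζ'', Y, hj', hY, rfl, hres'⟩ heq
        simp only [hlab] at heq
        subst heq
        obtain ⟨h1, h2⟩ := heqs _ _ _ _ hres hres'
        refine Finset.image_congr fun s hs => ?_
        simp only [Prod.mk.injEq, true_and]
        by_contra hne
        exact ((hsurg ζ hj X hX).decode hC (hsurg ζ'' hj' X hY) h1 h2 hs fun _ => hne).1 hs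
      have hfin : P.Finite := Set.Finite.of_injOn hmaps hinj (Finset.finite_toSet _)
      refine ⟨hfin.toFinset, ?_, ?_⟩
      · refine (Finset.card_le_card_of_injOn (fun a : Finset (σ × (ℤ × ℤ)) => a.image Prod.fst)
          (t := U.powersetCard r) (by simpa using hmaps) (by simpa using hinj)).trans ?_
        rw [Finset.card_powersetCard]
        refine Nat.choose_le_choose _ ((Finset.card_union_le _ _).trans ?_)
        exact Nat.add_le_add (Finset.mem_powersetCard.1 hX₁).2.le ht₁
      · rintro ζ ⟨hj, -, -⟩ - a ha hres
        obtain ⟨X, hX, rfl⟩ := Finset.mem_image.1 ha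
        simp only [Set.Finite.mem_toFinset]
        exact ⟨ζ, X, hj, hX, rfl, hres⟩
    · refine ⟨∅, by simp, ?_⟩
      intro ζ hζ _ a ha hres
      obtain ⟨X, hX, rfl⟩ := Finset.mem_image.1 ha
      exact absurd ⟨ζ, X, hζ, hX, hres⟩ hex

end MultiSurgery
end Slab

/-! ### Planar topology: signed passages through a ray. -/

namespace Slab

section Planar

/-- Lattice points that are equal or adjacent. -/
def PAdj (z z' : ℤ × ℤ) : Prop := z' ∈ nbCols z

theorem pAdj_iff {z z' : ℤ × ℤ} : PAdj z z' ↔ z' = z ∨ z' = (z.1 + 1, z.2) ∨ z' = (z.1 - 1, z.2) ∨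
    z' = (z.1, z.2 + 1) ∨ z' = (z.1, z.2 - 1) := by
  simp [PAdj, nbCols]

theorem pAdj_iff' {z z' : ℤ × ℤ} : PAdj z z' ↔ (z'.1 = z.1 ∧ z'.2 = z.2) ∨ (z'.1 = z.1 + 1 ∧ z'.2 = z.2) ∨
    (z'.1 = z.1 - 1 ∧ z'.2 = z.2) ∨ (z'.1 = z.1 ∧ z'.2 = z.2 + 1) ∨ (z'.1 = z.1 ∧ z'.2 = z.2 - 1) := by
  simp only [pAdj_iff, Prod.ext_iff]

theorem PAdj.symm (z z' : ℤ × ℤ) (h : PAdj z z') : PAdj z' z := by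
  rw [pAdj_iff'] at *; omega

/-- Signed number of passages of the step from `u` to `v` through the ray that starts half a unit
below `z` and runs to the left. -/
def cross (z u v : ℤ × ℤ) : ℤ :=
  if u.1 = v.1 ∧ u.1 < z.1 then
    (if u.2 = z.2 ∧ v.2 = z.2 - 1 then 1 else if u.2 = z.2 - 1 ∧ v.2 = z.2 then -1 else 0) else 0

/-- Indicator of the half line to the left of `z`. -/
def leftOf (z u : ℤ × ℤ) : ℤ := if u.2 = z.2 ∧ u.1 < z.1 then 1 else 0

/-- Indicator of the half plane of the points not below `z`. -/
def above (z u : ℤ × ℤ) : ℤ := if z.2 ≤ u.2 then 1 else 0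

/-- Moving the base point one step to the right lengthens the ray by the single step between `(x,
y)` and the point below it, which is not taken because `(x, y)` is avoided. -/
theorem cross_right {x y : ℤ} {u v : ℤ × ℤ} (h : PAdj u v) (hu : u ≠ (x, y)) (hv : v ≠ (x, y)) :
    cross (x + 1, y) u v = cross (x, y) u v := by
  rw [pAdj_iff'] at h
  obtain ⟨a, b⟩ := u; obtain ⟨c, d⟩ := v
  simp only [ne_eq, Prod.mk.injEq, cross] at *
  split_ifs <;> omega

/-- A balance for the half row to the left of `(x, y)`: it is entered and left through its top,
through its bottom, or at `(x, y)`, and the last is excluded. -/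
theorem cross_up {x y : ℤ} {u v : ℤ × ℤ} (h : PAdj u v) (hu : u ≠ (x, y)) (hv : v ≠ (x, y)) :
    cross (x, y + 1) u v - cross (x, y) u v = leftOf (x, y) v - leftOf (x, y) u := by
  rw [pAdj_iff'] at h
  obtain ⟨a, b⟩ := u; obtain ⟨c, d⟩ := v
  simp only [ne_eq, Prod.mk.injEq, cross, leftOf] at *
  split_ifs <;> omega

theorem cross_eq_zero {z u v : ℤ × ℤ} (hu : z.1 ≤ u.1) : cross z u v = 0 := by
  rw [cross, if_neg]; omega

theorem cross_of_lt {z u v : ℤ × ℤ} (h : PAdj u v) (hu : u.1 < z.1) :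
    cross z u v = above z u - above z v := by
  rw [pAdj_iff'] at h
  simp only [cross, above]
  split_ifs <;> omega

/-- A list of steps in a planar set from one point to another. -/
inductive Steps (Q : Set (ℤ × ℤ)) : ℤ × ℤ → ℤ × ℤ → List ((ℤ × ℤ) × (ℤ × ℤ)) → Prop
  | nil (s) : s ∈ Q → Steps Q s s []
  | cons (s s' t L) : s ∈ Q → PAdj s s' → Steps Q s' t L → Steps Q s t ((s, s') :: L)

theorem Steps.left_mem {Q : Set (ℤ × ℤ)} {s t : ℤ × ℤ} {L} (h : Steps Q s t L) : s ∈ Q := by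
  cases h <;> assumption

theorem exists_steps {Q : Set (ℤ × ℤ)} {s t : ℤ × ℤ} (h : Reach PAdj Q s t) : ∃ L, Steps Q s t L :=
  h.head_induction (P := fun s => ∃ L, Steps Q s t L) (fun h => ⟨_, .nil _ h⟩)
    fun _ _ ha hab _ ⟨L, hL⟩ => ⟨_, .cons _ _ _ L ha hab hL⟩

/-- Signed number of passages of a list of steps through the ray to the left below `z`. -/
def crossSum (z : ℤ × ℤ) (L : List ((ℤ × ℤ) × (ℤ × ℤ))) : ℤ := (L.map fun d => cross z d.1 d.2).sum

variable {Q : Set (ℤ × ℤ)} {s t : ℤ × ℤ} {L : List ((ℤ × ℤ) × (ℤ × ℤ))}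

theorem Steps.crossSum_right (h : Steps Q s t L) {x y : ℤ} (hz : (x, y) ∉ Q) :
    crossSum (x + 1, y) L = crossSum (x, y) L := by
  induction h with
  | nil => rfl
  | cons s s' t L hs hss hL ih =>
    simp only [crossSum, List.map_cons, List.sum_cons] at ih ⊢
    rw [ih, cross_right hss (fun h => hz (h ▸ hs)) (fun h => hz (h ▸ hL.left_mem))]

theorem Steps.crossSum_up (h : Steps Q s t L) {x y : ℤ} (hz : (x, y) ∉ Q) :
    crossSum (x, y + 1) L - crossSum (x, y) L = leftOf (x, y) t - leftOf (x, y) s := by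
  induction h with
  | nil => simp [crossSum]
  | cons s s' t L hs hss hL ih =>
    have := cross_up hss (fun h => hz (h ▸ hs)) (fun h => hz (h ▸ hL.left_mem))
    simp only [crossSum, List.map_cons, List.sum_cons] at ih ⊢
    linarith

theorem Steps.crossSum_eq_zero (h : Steps Q s t L) {z : ℤ × ℤ} (hz : ∀ u ∈ Q, z.1 ≤ u.1) :
    crossSum z L = 0 := by
  induction h with
  | nil => rfl
  | cons s s' t L hs hss hL ih =>
    simp only [crossSum, List.map_cons, List.sum_cons] at ih ⊢
    rw [ih, cross_eq_zero (hz s hs), add_zero]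

theorem Steps.crossSum_of_lt (h : Steps Q s t L) {z : ℤ × ℤ} (hz : ∀ u ∈ Q, u.1 < z.1) :
    crossSum z L = above z s - above z t := by
  induction h with
  | nil => simp [crossSum]
  | cons s s' t L hs hss hL ih =>
    simp only [crossSum, List.map_cons, List.sum_cons] at ih ⊢
    rw [ih, cross_of_lt hss (hz s hs)]; ring

/-- The count does not change along paths that avoid the steps and the rows of the end points. -/
theorem Steps.crossSum_const (h : Steps Q s t L) {P : Set (ℤ × ℤ)} (hPQ : ∀ z ∈ P, z ∉ Q)
    (hst : ∀ z ∈ P, (z.1, z.2 + 1) ∈ P → leftOf z t = leftOf z s) {x y : ℤ × ℤ} (hxy : Reach PAdj P x y) :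
    crossSum y L = crossSum x L := by
  refine hxy.induction (P := fun y => crossSum y L = crossSum x L) (fun _ => rfl) ?_
  rintro ⟨a, b⟩ v ha ih hab hv
  have haP := ha.right_mem
  rw [← ih]
  rcases pAdj_iff.1 hab with rfl | rfl | rfl | rfl | rfl
  · rfl
  · exact h.crossSum_right (hPQ _ haP)
  · have := h.crossSum_right (hPQ _ hv)
    simp only [sub_add_cancel] at this
    exact this.symm
  · have := h.crossSum_up (hPQ _ haP)
    have h2 := hst _ haP hv
    simp only at this h2 ⊢; omega
  · have := h.crossSum_up (hPQ _ hv)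
    have h2 := hst _ hv (by simpa using haP)
    simp only [sub_add_cancel] at this h2 ⊢; omega

/-- A path between the vertical sides and a path between the horizontal sides of a rectangle
share a point. -/
theorem crossing_inter {a₀ a₁ b₀ b₁ : ℤ} {P Q : Set (ℤ × ℤ)}
    (hP : ∀ z ∈ P, a₀ ≤ z.1 ∧ z.1 ≤ a₁ ∧ b₀ ≤ z.2 ∧ z.2 ≤ b₁)
    (hQ : ∀ z ∈ Q, a₀ ≤ z.1 ∧ z.1 ≤ a₁ ∧ b₀ ≤ z.2 ∧ z.2 ≤ b₁) {x x' y y' : ℤ × ℤ}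
    (hx : Reach PAdj P x x') (hxa : x.1 = a₀) (hxa' : x'.1 = a₁)
    (hy : Reach PAdj Q y y') (hyb : y.2 = b₀) (hyb' : y'.2 = b₁) : ∃ z ∈ P, z ∈ Q := by
  by_contra! hPQ
  -- With an initial step from below the rectangle, both ends of the path lie outside the rows in
  -- which the base point moves, so the balance of `cross_up` has no boundary terms.
  set s : ℤ × ℤ := (y.1, y.2 - 1)
  have hs : Reach PAdj (insert s Q) s y' := by
    refine Reach.head (Set.mem_insert _ _) ?_ (hy.mono_set (Set.subset_insert _ _))
    rw [pAdj_iff']; simp [s]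
  obtain ⟨L, hL⟩ := exists_steps hs
  have hsP : ∀ z ∈ P, z ≠ s := fun z hz h => by
    have := (hP z hz).2.2.1
    rw [h] at this; simp only [s] at this; omega
  have hPQ' : ∀ z ∈ P, z ∉ insert s Q := fun z hz h => by
    rcases h with h | h
    exacts [hsP z hz h, hPQ z hz h]
  have hsQ := hQ y hy.left_mem
  have h1 := hL.crossSum_const hPQ' (fun z hz hz' => by
    have h1 := (hP z hz).2.2.1
    have h2 := (hP _ hz').2.2.2
    simp only at h2
    simp only [leftOf, s]
    rw [if_neg (by omega), if_neg (by omega)]) hx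
  have h2 : crossSum x L = 0 := hL.crossSum_eq_zero fun u hu => by
    rcases hu with rfl | hu
    · simp only [s]; omega
    · have := hQ u hu; omega
  -- One step past the right side the whole path is to the left of the base point, and the count
  -- reduces to a difference of heights of its end points.
  have h3 : crossSum (x'.1 + 1, x'.2) L = crossSum x' L := hL.crossSum_right (hPQ' _ hx.right_mem)
  have h4 := hL.crossSum_of_lt (z := (x'.1 + 1, x'.2)) fun u hu => by
    rcases hu with rfl | hu
    · simp only [s]; omega
    · have := hQ u hu; simp only; omega
  have h5 := hP x' hx.right_mem
  simp only [above, s] at h4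
  rw [if_neg (by omega), if_pos (by omega)] at h4
  omega

/-- A rectangle is connected. -/
theorem reach_rectangle {a₀ a₁ b₀ b₁ : ℤ} {x y : ℤ × ℤ} (hx : x ∈ Set.Icc a₀ a₁ ×ˢ Set.Icc b₀ b₁)
    (hy : y ∈ Set.Icc a₀ a₁ ×ˢ Set.Icc b₀ b₁) :
    Reach PAdj (Set.Icc a₀ a₁ ×ˢ Set.Icc b₀ b₁) x y := by
  have hor : ∀ n : ℕ, ∀ a b : ℤ, (a, b) ∈ Set.Icc a₀ a₁ ×ˢ Set.Icc b₀ b₁ → a + n ≤ a₁ →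
      Reach PAdj (Set.Icc a₀ a₁ ×ˢ Set.Icc b₀ b₁) (a, b) (a + n, b) := by
    intro n
    induction n with
    | zero => intro a b h _; simpa using Reach.refl h
    | succ n ih =>
      intro a b h ha
      refine (ih a b h (by push_cast at ha; omega)).tail ?_ ?_
      · exact pAdj_iff'.2 (Or.inr (Or.inl ⟨by push_cast; ring, rfl⟩))
      · simp only [Set.mem_prod, Set.mem_Icc] at h ⊢; push_cast at ha ⊢; omega
  have ver : ∀ n : ℕ, ∀ a b : ℤ, (a, b) ∈ Set.Icc a₀ a₁ ×ˢ Set.Icc b₀ b₁ → b + n ≤ b₁ →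
      Reach PAdj (Set.Icc a₀ a₁ ×ˢ Set.Icc b₀ b₁) (a, b) (a, b + n) := by
    intro n
    induction n with
    | zero => intro a b h _; simpa using Reach.refl h
    | succ n ih =>
      intro a b h ha
      refine (ih a b h (by push_cast at ha; omega)).tail ?_ ?_
      · exact pAdj_iff'.2 (Or.inr (Or.inr (Or.inr (Or.inl ⟨rfl, by push_cast; ring⟩))))
      · simp only [Set.mem_prod, Set.mem_Icc] at h ⊢; push_cast at ha ⊢; omega
  -- both points reach the corner
  have key : ∀ z ∈ Set.Icc a₀ a₁ ×ˢ Set.Icc b₀ b₁,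
      Reach PAdj (Set.Icc a₀ a₁ ×ˢ Set.Icc b₀ b₁) z (a₁, b₁) := by
    rintro ⟨a, b⟩ h
    have h' := h
    simp only [Set.mem_prod, Set.mem_Icc] at h'
    have h1 := hor (a₁ - a).toNat a b h (by omega)
    have e1 : a + ((a₁ - a).toNat : ℤ) = a₁ := by omega
    rw [e1] at h1
    have h2 := ver (b₁ - b).toNat a₁ b h1.right_mem (by omega)
    have e2 : b + ((b₁ - b).toNat : ℤ) = b₁ := by omega
    rw [e2] at h2
    exact h1.trans h2
  exact (key x hx).trans ((key y hy).symm PAdj.symm)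

end Planar

/-! ### Winding numbers of circuits, and the separation property. -/

section Winding

theorem toComplex_sub (u c : ℤ × ℤ) : toComplex u - toComplex c = ⟨((u.1 - c.1 : ℤ) : ℝ), ((u.2 - c.2 : ℤ) : ℝ)⟩ := by
  apply Complex.ext <;> simp [toComplex]

open Complex in
/-- The angle of a lattice step is the difference of the arguments, up to a full turn when the step
passes through the negative real axis. -/
theorem arg_step {c u v : ℤ × ℤ} (h : PAdj u v) (hu : u ≠ c) (hv : v ≠ c) :
    arg ((toComplex v - toComplex c) / (toComplex u - toComplex c)) =
      arg (toComplex v - toComplex c) - arg (toComplex u - toComplex c) + 2 * Real.pi * cross c u v := by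
  set A := toComplex u - toComplex c with hA
  set B := toComplex v - toComplex c with hB
  have hA' := toComplex_sub u c
  have hB' := toComplex_sub v c
  rw [← hA] at hA'
  rw [← hB] at hB'
  have hAre : A.re = ((u.1 - c.1 : ℤ) : ℝ) := by rw [hA']
  have hAim : A.im = ((u.2 - c.2 : ℤ) : ℝ) := by rw [hA']
  have hBre : B.re = ((v.1 - c.1 : ℤ) : ℝ) := by rw [hB']
  have hBim : B.im = ((v.2 - c.2 : ℤ) : ℝ) := by rw [hB']
  have hu' : ¬ (u.1 - c.1 = 0 ∧ u.2 - c.2 = 0) := fun h => hu (Prod.ext (by omega) (by omega))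
  have hv' : ¬ (v.1 - c.1 = 0 ∧ v.2 - c.2 = 0) := fun h => hv (Prod.ext (by omega) (by omega))
  have hA0 : A ≠ 0 := fun h => hu' (by
    have h1 := hAre; have h2 := hAim
    rw [h] at h1 h2
    simp only [Complex.zero_re, Complex.zero_im] at h1 h2
    exact ⟨by exact_mod_cast h1.symm, by exact_mod_cast h2.symm⟩)
  have hB0 : B ≠ 0 := fun h => hv' (by
    have h1 := hBre; have h2 := hBim
    rw [h] at h1 h2
    simp only [Complex.zero_re, Complex.zero_im] at h1 h2
    exact ⟨by exact_mod_cast h1.symm, by exact_mod_cast h2.symm⟩)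
  have hangle : (arg (B / A) : Real.Angle) =
      ((arg B - arg A + 2 * Real.pi * cross c u v : ℝ) : Real.Angle) := by
    rw [arg_div_coe_angle hB0 hA0, Real.Angle.coe_add, Real.Angle.coe_sub,
      mul_comm (2 * Real.pi) _, ← zsmul_eq_mul, Real.Angle.coe_zsmul]
    simp
  -- The identity holds modulo $2\pi$; both sides lie in $(-\pi,\pi]$, so it holds exactly. The term
  -- with `cross` compensates the jump of the argument at the negative real axis.
  have hrange : arg B - arg A + 2 * Real.pi * cross c u v ∈ Set.Ioc (-Real.pi) Real.pi := by
    have hpi := Real.pi_pos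
    have a1 := arg_mem_Ioc A
    have b1 := arg_mem_Ioc B
    rw [pAdj_iff'] at h
    have a2 := arg_nonneg_iff (z := A)
    have b2 := arg_nonneg_iff (z := B)
    have a3 := arg_eq_pi_iff (z := A)
    have b3 := arg_eq_pi_iff (z := B)
    have a4 := arg_eq_zero_iff (z := A)
    have b4 := arg_eq_zero_iff (z := B)
    rw [hAim] at a2
    rw [hBim] at b2
    rw [hAre, hAim] at a3 a4
    rw [hBre, hBim] at b3 b4
    norm_cast at a2 a3 a4 b2 b3 b4
    rw [Set.mem_Ioc] at a1 b1 ⊢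
    by_cases hA1 : 0 ≤ u.2 - c.2 <;> by_cases hB1 : 0 ≤ v.2 - c.2
    · have hcr : cross c u v = 0 := by simp only [cross]; split_ifs <;> omega
      have h1 := a2.2 hA1
      have h2 := b2.2 hB1
      rw [hcr]
      refine ⟨?_, by push_cast; linarith⟩
      by_contra hcon
      push_cast at hcon
      have h3 : A.arg = Real.pi := by linarith
      have h4 : B.arg = 0 := by linarith
      have h5 := a3.1 h3
      have h6 := b4.1 h4
      omega
    · have h2 : B.arg < 0 := lt_of_not_ge fun h => hB1 (b2.1 h)
      rcases lt_trichotomy (u.1 - c.1) 0 with h3 | h3 | h3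
      · have hcr : cross c u v = 1 := by
          simp only [cross]; rw [if_pos (by omega), if_pos (by omega)]
        have h4 : A.arg = Real.pi := a3.2 ⟨h3, by omega⟩
        rw [hcr, h4]; push_cast; constructor <;> linarith
      · omega
      · have hcr : cross c u v = 0 := by simp only [cross]; split_ifs <;> omega
        have h4 : A.arg = 0 := a4.2 ⟨by omega, by omega⟩
        rw [hcr, h4]; push_cast; constructor <;> linarith
    · have h2 : A.arg < 0 := lt_of_not_ge fun h => hA1 (a2.1 h)
      rcases lt_trichotomy (v.1 - c.1) 0 with h3 | h3 | h3
      · have hcr : cross c u v = -1 := by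
          simp only [cross]; rw [if_pos (by omega), if_neg (by omega), if_pos (by omega)]
        have h4 : B.arg = Real.pi := b3.2 ⟨h3, by omega⟩
        rw [hcr, h4]; push_cast; constructor <;> linarith
      · omega
      · have hcr : cross c u v = 0 := by simp only [cross]; split_ifs <;> omega
        have h4 : B.arg = 0 := b4.2 ⟨by omega, by omega⟩
        rw [hcr, h4]; push_cast; constructor <;> linarith
    · have hcr : cross c u v = 0 := by simp only [cross]; split_ifs <;> omega
      have h1 : A.arg < 0 := lt_of_not_ge fun h => hA1 (a2.1 h)
      have h2 : B.arg < 0 := lt_of_not_ge fun h => hB1 (b2.1 h)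
      rw [hcr]; push_cast; constructor <;> linarith
  rw [← (arg_mem_Ioc (B / A)).elim fun h1 h2 => Real.Angle.toReal_coe_eq_self_iff.2 ⟨h1, h2⟩, hangle,
    Real.Angle.toReal_coe_eq_self_iff.2 hrange]

variable {k : ℕ}

theorem pAdj_of_adj {x y : Vertex k} (h : (graph k).Adj x y) : PAdj x.1 y.1 := fst_eq_of_adj h

theorem reach_fst {Λ : Set (Vertex k)} {x y : Vertex k} (h : Reach (graph k).Adj Λ x y) :
    Reach PAdj (Prod.fst '' Λ) x.1 y.1 := by
  refine h.induction (P := fun y => Reach PAdj (Prod.fst '' Λ) x.1 y.1) ?_ ?_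
  · intro hx
    exact Reach.refl (Set.mem_image_of_mem Prod.fst hx)
  · intro a b _ ih hab hb
    exact Reach.tail ih (pAdj_of_adj hab) (Set.mem_image_of_mem Prod.fst hb)

theorem steps_of_walk {x y : Vertex k} (w : (graph k).Walk x y) {Q : Set (ℤ × ℤ)}
    (hQ : ∀ v ∈ w.support, v.1 ∈ Q) : Steps Q x.1 y.1 (w.darts.map fun d => (d.fst.1, d.snd.1)) := by
  induction w with
  | nil => exact .nil _ (hQ _ (by simp))
  | cons h w ih =>
    simp only [SimpleGraph.Walk.support_cons, List.mem_cons, forall_eq_or_imp] at hQ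
    exact .cons _ _ _ _ hQ.1 (pAdj_of_adj h) (ih hQ.2)

/-- The winding number counts the passages through a ray. -/
theorem windingNumber_eq (γ : Circuit k) {c : ℤ × ℤ} (hc : ∀ v ∈ γ.verts, v.1 ≠ c) :
    γ.windingNumber c = crossSum c (γ.walk.darts.map fun d => (d.fst.1, d.snd.1)) := by
  have key : ∀ {x y : Vertex k} (w : (graph k).Walk x y), (∀ v ∈ w.support, v.1 ≠ c) →
      (w.darts.map fun d => Complex.arg ((toComplex d.snd.1 - toComplex c) /
        (toComplex d.fst.1 - toComplex c))).sum =
      Complex.arg (toComplex y.1 - toComplex c) - Complex.arg (toComplex x.1 - toComplex c) +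
        2 * Real.pi * crossSum c (w.darts.map fun d => (d.fst.1, d.snd.1)) := by
    intro x y w
    induction w with
    | nil => intro _; simp [crossSum]
    | cons h w ih =>
      intro hw
      simp only [SimpleGraph.Walk.support_cons, List.mem_cons, forall_eq_or_imp] at hw
      have h1 := ih hw.2
      simp only [SimpleGraph.Walk.darts_cons, List.map_cons, List.sum_cons, crossSum] at h1 ⊢
      rw [h1, arg_step (pAdj_of_adj h) hw.1 (hw.2 _ (SimpleGraph.Walk.start_mem_support _))]
      push_cast
      ring
  unfold Circuit.windingNumber
  rw [key γ.walk hc]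
  field_simp
  ring

theorem mem_box {m : ℕ} {c z : ℤ × ℤ} : z ∈ box m c ↔
    (c.1 - m ≤ z.1 ∧ z.1 ≤ c.1 + m) ∧ (c.2 - m ≤ z.2 ∧ z.2 ≤ c.2 + m) := by
  have h1 : z ∈ box m c ↔ |z.1 - c.1| ≤ (m : ℤ) ∧ |z.2 - c.2| ≤ (m : ℤ) := Iff.rfl
  rw [h1, abs_le, abs_le]; omega

theorem mem_annulus {m n : ℕ} {c z : ℤ × ℤ} : z ∈ annulus m n c ↔ z ∈ box n c ∧ z ∉ box m c := Iff.rfl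

theorem mem_lift {T : Set (ℤ × ℤ)} {x : Vertex k} : x ∈ lift k T ↔ x.1 ∈ T := Iff.rfl

/-- A circuit that surrounds a box meets every path from the box that leaves the annulus on the
left or on the right. -/
theorem Circuit.meets (γ : Circuit k) {m n : ℕ} {c : ℤ × ℤ} (hγ : γ.verts ⊆ lift k (annulus m n c))
    (hw : γ.windingNumber c ≠ 0) {P : Set (ℤ × ℤ)} {x y : ℤ × ℤ} (hP : Reach PAdj P x y)
    (hx : x ∈ box m c) (hy : y.1 < c.1 - n ∨ c.1 + n < y.1) : ∃ v ∈ γ.verts, v.1 ∈ P := by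
  by_contra! hcon
  have hann : ∀ v ∈ γ.verts, v.1 ∈ box n c ∧ v.1 ∉ box m c := fun v hv =>
    mem_annulus.1 (mem_lift.1 (hγ hv))
  have hbox : ∀ z, z ∈ box m c ↔ z ∈ Set.Icc (c.1 - m) (c.1 + m) ×ˢ Set.Icc (c.2 - m) (c.2 + m) := by
    intro z
    rw [mem_box, Set.mem_prod, Set.mem_Icc, Set.mem_Icc]
  have hc : c ∈ box m c := mem_box.2 (by omega)
  obtain ⟨Q, hQdef⟩ : ∃ Q : Set (ℤ × ℤ), Q = Prod.fst '' γ.verts := ⟨_, rfl⟩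
  have hmem : ∀ u ∈ Q, ∃ v ∈ γ.verts, v.1 = u := fun u hu => by rw [hQdef] at hu; exact hu
  have hL := steps_of_walk (Q := Q) γ.walk fun v hv => by
    rw [hQdef]; exact Set.mem_image_of_mem _ hv
  have h1 := reach_rectangle ((hbox c).1 hc) ((hbox x).1 hx)
  -- The number of passages is constant on the inner box, and constant along `P` if `P` avoids the
  -- circuit. It vanishes outside the vertical strip, so the winding number around the centre would
  -- be zero. For a closed path no condition on the rows of its end points is needed.
  have h2 := hL.crossSum_const (P := Set.Icc (c.1 - m) (c.1 + m) ×ˢ Set.Icc (c.2 - m) (c.2 + m))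
    (by rintro z hz hzQ; obtain ⟨v, hv, rfl⟩ := hmem z hzQ; exact (hann v hv).2 ((hbox _).2 hz)) (fun _ _ _ => rfl) h1
  have h3 := hL.crossSum_const (P := P) (by rintro z hz hzQ; obtain ⟨v, hv, rfl⟩ := hmem z hzQ; exact hcon v hv hz)
    (fun _ _ _ => rfl) hP
  have hQ : ∀ u ∈ Q, c.1 - n ≤ u.1 ∧ u.1 ≤ c.1 + n := by
    intro u hu
    obtain ⟨v, hv, rfl⟩ := hmem u hu
    exact (mem_box.1 (hann v hv).1).1
  have h4 : crossSum y (γ.walk.darts.map fun d => (d.fst.1, d.snd.1)) = 0 := by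
    rcases hy with hy | hy
    · exact hL.crossSum_eq_zero fun u hu => by have := hQ u hu; omega
    · rw [hL.crossSum_of_lt fun u hu => by have := hQ u hu; omega]; ring
  apply hw
  rw [windingNumber_eq γ fun v hv h => (hann v hv).2 (h ▸ hc), ← h2, ← h3, h4]
  simp

end Winding
end Slab

/-! ### Selection of least open shapes, and gluing of one path to one shape. -/

namespace Slab

section Families

variable {k : ℕ} {C : Set (ℤ × ℤ)}

/-- The least open shape of a class in a fixed well-order. -/
noncomputable def leastShape (𝔽 : Set (Shape k)) (o : Set (Sym2 (Vertex k))) : Option (Shape k) := by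
  classical
  exact if h : {S | S ∈ 𝔽 ∧ S.edges ⊆ o}.Nonempty then
    some ((IsWellFounded.wf (r := WellOrderingRel (α := Shape k))).min _ h) else none

theorem leastShape_mem {𝔽 : Set (Shape k)} {o : Set (Sym2 (Vertex k))} {S : Shape k}
    (h : leastShape 𝔽 o = some S) :
    (S ∈ 𝔽 ∧ S.edges ⊆ o) ∧ ∀ S' ∈ 𝔽, S'.edges ⊆ o → ¬ WellOrderingRel S' S := by
  unfold leastShape at h
  split_ifs at h with hne
  cases h
  exact ⟨WellFounded.min_mem _ _ hne, fun S' h1 h2 =>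
    (IsWellFounded.wf (r := WellOrderingRel (α := Shape k))).not_lt_min {S | S ∈ 𝔽 ∧ S.edges ⊆ o} (show S' ∈ {S | S ∈ 𝔽 ∧ S.edges ⊆ o} from ⟨h1, h2⟩)⟩

theorem exists_leastShape {𝔽 : Set (Shape k)} {o : Set (Sym2 (Vertex k))} {S : Shape k}
    (h : S ∈ 𝔽) (ho : S.edges ⊆ o) : ∃ S', leastShape 𝔽 o = some S' := by
  have hne : {S | S ∈ 𝔽 ∧ S.edges ⊆ o}.Nonempty := ⟨S, h, ho⟩
  unfold leastShape
  rw [dif_pos hne]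
  exact ⟨_, rfl⟩

theorem edgesIn_mono {D D' : Set (Vertex k)} (h : D ⊆ D') : edgesIn D ⊆ edgesIn D' :=
  fun _ he => ⟨he.1, fun x hx => h (he.2 x hx)⟩

/-- The family of the least open shapes of a class. -/
noncomputable def Family.ofShapes (C : Set (ℤ × ℤ)) (𝔽 : Set (Shape k))
    (h1 : ∀ S ∈ 𝔽, ∀ x ∈ S.verts, x.1 ∈ C) (h2 : ∀ S ∈ 𝔽, S.edges ⊆ edgesIn S.verts) : Family k C where
  sel := leastShape 𝔽
  isOpen h := (leastShape_mem h).1.2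
  cols h := h1 _ (leastShape_mem h).1.1
  edges_subset h := h2 _ (leastShape_mem h).1.1
  isLocal {o o'} h := by
    have key : {S | S ∈ 𝔽 ∧ S.edges ⊆ o} = {S | S ∈ 𝔽 ∧ S.edges ⊆ o'} := by
      have aux : ∀ o : Set (Sym2 (Vertex k)), {S | S ∈ 𝔽 ∧ S.edges ⊆ o} =
          {S | S ∈ 𝔽 ∧ S.edges ⊆ o ∩ edgesIn (lift k C)} := by
        intro o
        ext S
        simp only [Set.mem_ofPred_eq, Set.subset_inter_iff]
        refine ⟨fun h => ⟨h.1, h.2, (h2 S h.1).trans (edgesIn_mono (h1 S h.1))⟩, fun h => ⟨h.1, h.2.1⟩⟩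
      rw [aux, aux o', h]
    unfold leastShape
    rw [key]
  antisymm {o o' S S'} h h' hS hS' := by
    obtain ⟨⟨a1, a2⟩, a3⟩ := leastShape_mem h
    obtain ⟨⟨b1, b2⟩, b3⟩ := leastShape_mem h'
    exact Std.Trichotomous.trichotomous (r := WellOrderingRel) _ _ (b3 _ a1 hS) (a3 _ b1 hS')
  exists_of_open h ho := exists_leastShape (leastShape_mem h).1.1 ho

/-- Connected shapes inside `D` that contain vertices of `A` and of `B`. -/
def pathShapes (D A B : Set (Vertex k)) : Set (Shape k) :=
  {S | S.verts ⊆ D ∧ S.edges ⊆ edgesIn S.verts ∧ (∃ a ∈ A, a ∈ S.verts) ∧ (∃ b ∈ B, b ∈ S.verts) ∧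
    ∀ x ∈ S.verts, ∀ y ∈ S.verts, Reach (Op S.edges) S.verts x y}

/-- The family of open paths from `A` to `B` inside `D`. -/
noncomputable def pathFamily (C : Set (ℤ × ℤ)) (D A B : Set (Vertex k)) (h : D ⊆ lift k C) : Family k C :=
  Family.ofShapes C (pathShapes D A B) (fun _ hS _ hx => h (hS.1 hx)) (fun _ hS => hS.2.1)

theorem pathFamily_mem {D A B : Set (Vertex k)} {h : D ⊆ lift k C} {o : Set (Sym2 (Vertex k))}
    {S : Shape k} (hS : (pathFamily C D A B h).sel o = some S) : S ∈ pathShapes D A B :=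
  (leastShape_mem hS).1.1

/-- The shape formed by the vertices that can be reached from a given one. -/
def clusterShape (o : Set (Sym2 (Vertex k))) (D : Set (Vertex k)) (a : Vertex k) : Shape k where
  verts := {x | Reach (Op o) D a x}
  edges := o ∩ edgesIn {x | Reach (Op o) D a x}

theorem reach_cluster {o : Set (Sym2 (Vertex k))} {D : Set (Vertex k)} {a x : Vertex k}
    (h : Reach (Op o) D a x) : Reach (Op (clusterShape o D a).edges) (clusterShape o D a).verts a x := by
  refine h.induction (P := fun x => Reach (Op (clusterShape o D a).edges) (clusterShape o D a).verts a x)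
    (fun ha => .refl (Reach.refl ha)) fun x y hx ih hxy hy => ?_
  exact ih.tail ⟨hxy.1, hxy.2, mem_edgesIn.2 ⟨hxy.1, hx, hx.tail hxy hy⟩⟩ (hx.tail hxy hy)

theorem clusterShape_mem {o : Set (Sym2 (Vertex k))} {D A B : Set (Vertex k)} {a b : Vertex k}
    (ha : a ∈ A) (hb : b ∈ B) (h : Reach (Op o) D a b) : clusterShape o D a ∈ pathShapes D A B :=
  ⟨fun _ hx => Reach.right_mem hx, Set.inter_subset_right, ⟨a, ha, .refl h.left_mem⟩, ⟨b, hb, h⟩,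
    fun _ hx _ hy => ((reach_cluster hx).symm Op.symm).trans (reach_cluster hy)⟩

/-- The cluster of a vertex of `A` is itself an admissible shape, so no simple path has to be
extracted. -/
theorem pathFamily_isSome {D A B : Set (Vertex k)} {h : D ⊆ lift k C} {o : Set (Sym2 (Vertex k))} :
    (∃ S, (pathFamily C D A B h).sel o = some S) ↔ Joined o D A B := by
  constructor
  · rintro ⟨S, hS⟩
    obtain ⟨h1, h2, ⟨a, ha, ha'⟩, ⟨b, hb, hb'⟩, h3⟩ := pathFamily_mem hS
    exact ⟨a, ha, b, hb, (h3 a ha' b hb').mono (fun _ _ _ _ => Op.mono ((pathFamily C D A B h).isOpen hS)) h1⟩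
  · rintro ⟨a, ha, b, hb, hab⟩
    exact exists_leastShape (clusterShape_mem ha hb hab) Set.inter_subset_left

/-- A set that is joined to a path is joined to both of its ends. -/
theorem Joined.of_path {D D' A A' B' : Set (Vertex k)} {h : D' ⊆ lift k C} {o : Set (Sym2 (Vertex k))}
    {S : Shape k} (hS : (pathFamily C D' A' B' h).sel o = some S) (hj : Joined o D A S.verts) :
    Joined o (D ∪ D') A A' ∧ Joined o (D ∪ D') A B' := by
  obtain ⟨h1, h2, ⟨a', ha, ha'⟩, ⟨b', hb, hb'⟩, h3⟩ := pathFamily_mem hS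
  obtain ⟨a, haA, x, hx, hax⟩ := hj
  have h4 : ∀ y ∈ S.verts, Reach (Op o) (D ∪ D') a y := fun y hy =>
    (hax.mono_set Set.subset_union_left).trans ((h3 x hx y hy).mono
      (fun _ _ _ _ => Op.mono ((pathFamily C D' A' B' h).isOpen hS)) (h1.trans Set.subset_union_right))
  exact ⟨⟨a, haA, a', ha, h4 a' ha'⟩, ⟨a, haA, b', hb, h4 b' hb'⟩⟩

open Classical in
/-- Gluing a path to a shape. -/
theorem glue (fam : Family k C) {D A I : Set (Vertex k)} {F : Finset (Sym2 (Vertex k))}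
    {q : Sym2 (Vertex k) → ℝ} {δ : ℝ}
    (hq : IsWeight q) (hδ : 0 < δ) (hδ' : δ ≤ 1 / 2) (hDfin : D.Finite)
    (hFe : ∀ e ∈ F, e ∈ (graph k).edgeSet) (hA : ∀ a ∈ A, a.1 ∈ C → ∀ v : Vertex k, v.1 = a.1 → v ∈ A)
    (hsep : ∀ o S, fam.sel o = some S → ∀ Λ ⊆ D, (∃ a ∈ A, ∃ i ∈ I, Reach (graph k).Adj Λ a i) →
      ∃ x ∈ Λ, ∃ y ∈ S.verts, x.1 = y.1 ∧ ∀ j, (x.1, j) ∈ D)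
    (hF : ∀ x y : Vertex k, x.1 ∈ C → x.1 = y.1 → (∀ j, (x.1, j) ∈ D) → (graph k).Adj x y → s(x, y) ∈ F)
    (hqδ : ∀ x y : Vertex k, x.1 ∈ C → (∀ j, (x.1, j) ∈ D) → (graph k).Adj x y → s(x, y) ∈ F →
      δ ≤ q s(x, y) ∧ q s(x, y) ≤ 1 - δ) :
    δ ^ (10 * (k + 1) ^ 2) * Pr F q {o | Joined o D A I ∧ ∃ S, fam.sel o = some S} ≤
      2 * Pr F q {o | ∃ S, fam.sel o = some S ∧ Joined o D A S.verts} := by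
  -- A single shape, a single bridge and no attached shape: the result has exactly one possible
  -- label.
  have key := multi_surgery (σ := Unit) (C := fun _ => C) (fam := fun _ => fam) (A := A) (I := I) hq hδ hδ' hDfin hFe
    (fun s s' h => absurd (Subsingleton.elim s s') h) (fun _ => hsep) (fun _ => hF) (fun _ => hqδ) 1 1 0 le_rfl
  simp only [one_mul, Nat.choose_self, Nat.cast_one, Nat.add_zero] at key
  have hle1 : δ ^ (10 * (k + 1) ^ 2) ≤ 1 := pow_le_one₀ hδ.le (by linarith)
  set E : Set (Set (Sym2 (Vertex k))) := {o | ∃ S, fam.sel o = some S ∧ Joined o D A S.verts} with hE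
  have hE0 : 0 ≤ Pr F q E := Pr_nonneg hq
  -- A shape that exists and is not yet joined to `A` is free and not attached. Where it is already
  -- joined to `A` there is nothing to prove, which accounts for the factor $2$ in the conclusion.
  have h1 : Pr F q {o | Joined o D A I ∧ ∃ S, fam.sel o = some S} ≤
      Pr F q {o | Joined o D A I ∧ 1 ≤ (Finset.univ.filter (IsGood (fun _ : Unit => fam) D A I o)).card ∧
        (Finset.univ.filter (IsAttached (fun _ : Unit => fam) D A I o)).card ≤ 0} + Pr F q E := by
    refine (Pr_mono hq ?_).trans (Pr_union_le hq)
    rintro o - ⟨hj, S, hS⟩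
    by_cases hj' : Joined o D A S.verts
    · exact Or.inr ⟨S, hS, hj'⟩
    · refine Or.inl ⟨hj, ?_, ?_⟩
      · rw [Nat.one_le_iff_ne_zero, ← Nat.pos_iff_ne_zero, Finset.card_pos]
        refine ⟨(), Finset.mem_filter.2 ⟨Finset.mem_univ _, S, hS, fun y hy => ⟨fun hyD a ha hay => ?_, fun e he a ha _ hr => ?_⟩⟩⟩
        · exact hj' ⟨y, hA a ha (hay ▸ fam.cols hS y hy) y hay.symm, y, hy, .refl hyD⟩
        · exact hj' ⟨a, ha, y, hy, hr⟩
      · rw [Nat.le_zero, Finset.card_eq_zero, Finset.filter_eq_empty_iff]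
        rintro _ _ ⟨S', hS', y, hy, hye⟩
        obtain ⟨e, he⟩ := exists_isStart hj
        have hSS : S = S' := Option.some.inj (hS.symm.trans hS')
        exact hj' ⟨e, he.1, y, hSS ▸ hy, hye e he⟩
  have h2 : Pr F q {o | Joined o D A I ∧ ∃ s : Unit, ∃ S, fam.sel o = some S ∧ Joined o D A S.verts} ≤ Pr F q E :=
    Pr_mono hq fun o _ ⟨_, _, S, h, h'⟩ => ⟨S, h, h'⟩
  have h3 := mul_le_mul_of_nonneg_left h1 (pow_nonneg hδ.le (10 * (k + 1) ^ 2))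
  have h4 : δ ^ (10 * (k + 1) ^ 2) * Pr F q E ≤ Pr F q E := mul_le_of_le_one_left hE0 hle1
  rw [mul_add] at h3
  linarith

end Families

/-! ### Minimal circuits as a selection rule. -/

section Circuits

variable {k : ℕ}

/-- The key of a vertex in the order by which circuits are compared. -/
def precKey (x : Vertex k) : ℤ ×ₗ (ℤ ×ₗ (ℤ ×ₗ Fin (k + 1))) :=
  toLex (normSq x, toLex (x.1.1, toLex (x.1.2, x.2)))

theorem prec_iff {x y : Vertex k} : Prec x y ↔ precKey x < precKey y := by
  simp only [Prec, precKey, Prod.Lex.toLex_lt_toLex]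

theorem precKey_injective : Function.Injective (precKey (k := k)) := by
  rintro ⟨⟨a, b⟩, c⟩ ⟨⟨a', b'⟩, c'⟩ h
  simp only [precKey, toLex_inj, Prod.mk.injEq] at h
  simp [h.2]

/-- An injective key with values in a linear order turns the comparison of circuits into the order
of lists, where minima and asymmetry are available. -/
theorem lex_prec_iff {l l' : List (Vertex k)} :
    List.Lex Prec l l' ↔ l.map precKey < l'.map precKey := by
  induction l generalizing l' with
  | nil =>
    cases l' with
    | nil => simp
    | cons a l' => simp
  | cons a l ih =>
    cases l' with
    | nil => simp
    | cons a' l' =>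
      rw [List.map_cons, List.map_cons, List.cons_lt_cons_iff, ← prec_iff, ← ih]
      constructor
      · rintro (_ | h | h)
        · exact Or.inl h
        · exact Or.inr ⟨rfl, h⟩
      · rintro (h | ⟨h, h'⟩)
        · exact .rel h
        · rw [precKey_injective h]; exact .cons h'

theorem Circuit.ext_support {γ γ' : Circuit k} (h : γ.walk.support = γ'.walk.support) : γ = γ' := by
  obtain ⟨b, w, h1, h2, h3⟩ := γ
  obtain ⟨b', w', h1', h2', h3'⟩ := γ'
  have hb : b = b' := by
    have := congrArg List.head? h
    rw [← SimpleGraph.Walk.cons_tail_support w, ← SimpleGraph.Walk.cons_tail_support w'] at this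
    exact Option.some.inj this
  subst hb
  have hw : w = w' := SimpleGraph.Walk.ext_support h
  subst hw
  rfl

/-- A circuit is determined by its list of vertices, and this list has no repetition apart from its
ends, so its length is bounded by the size of `D`. -/
theorem finite_circuits {D : Set (Vertex k)} (hD : D.Finite) : {γ : Circuit k | γ.verts ⊆ D}.Finite := by
  have : Finite D := hD
  have hf := List.finite_length_le D (hD.toFinset.card + 1)
  refine Set.Finite.of_finite_image (f := fun γ : Circuit k => γ.walk.support)
    ((hf.image (List.map Subtype.val)).subset ?_) fun γ _ γ' _ h => Circuit.ext_support h
  rintro _ ⟨γ, hγ, rfl⟩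
  refine ⟨γ.walk.support.pmap Subtype.mk fun x hx => hγ hx, ?_, by simp [List.map_pmap]⟩
  rw [Set.mem_ofPred_eq, List.length_pmap]
  have h1 : γ.walk.support.tail.length ≤ hD.toFinset.card := by
    rw [← List.toFinset_card_of_nodup γ.isCycle.support_nodup]
    refine Finset.card_le_card fun x hx => ?_
    rw [hD.mem_toFinset]
    exact hγ (List.mem_of_mem_tail (List.mem_toFinset.1 hx))
  rw [List.length_tail] at h1
  omega

theorem finite_lift_box (M : ℕ) (c : ℤ × ℤ) : (lift k (box M c)).Finite := by
  have : lift k (box M c) ⊆ (Set.Icc (c.1 - M) (c.1 + M) ×ˢ Set.Icc (c.2 - M) (c.2 + M)) ×ˢ Set.univ := by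
    intro x hx
    rw [mem_lift, mem_box] at hx
    exact ⟨⟨hx.1, hx.2⟩, Set.mem_univ _⟩
  exact (((Set.finite_Icc _ _).prod (Set.finite_Icc _ _)).prod Set.finite_univ).subset this

theorem annulus_subset (m n : ℕ) (c : ℤ × ℤ) : annulus m n c ⊆ box n c := fun _ h => (mem_annulus.1 h).1

theorem exists_isMinimalCircuit {ω : Config k} {m n : ℕ} {c : ℤ × ℤ} {γ : Circuit k}
    (h : IsOpenSurrounding ω m n c γ) : ∃ γ', IsMinimalCircuit ω m n c γ' := by
  have hfin : {γ | IsOpenSurrounding ω m n c γ}.Finite :=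
    (finite_circuits (((finite_lift_box n c).subset fun x hx => annulus_subset m n c hx))).subset fun γ hγ => hγ.2.1
  obtain ⟨γ₀, h0, hmin⟩ := Set.exists_min_image _ (fun γ : Circuit k => γ.walk.support.map precKey) hfin ⟨γ, h⟩
  refine ⟨γ₀, h0, fun γ' h' => ?_⟩
  rcases (hmin γ' h').lt_or_eq with h1 | h1
  · exact Or.inr (lex_prec_iff.2 h1)
  · exact Or.inl (Circuit.ext_support (List.map_injective_iff.2 precKey_injective h1.symm))

theorem Circuit.Lt.asymm {γ γ' : Circuit k} (h : γ.Lt γ') (h' : γ'.Lt γ) : False :=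
  lt_asymm (lex_prec_iff.1 h) (lex_prec_iff.1 h')

theorem IsMinimalCircuit.unique {ω : Config k} {m n : ℕ} {c : ℤ × ℤ} {γ γ' : Circuit k}
    (h : IsMinimalCircuit ω m n c γ) (h' : IsMinimalCircuit ω m n c γ') : γ = γ' := by
  rcases h.2 γ' h'.1 with h1 | h1
  · exact h1.symm
  · rcases h'.2 γ h.1 with h2 | h2
    · exact h2
    · exact (h1.asymm h2).elim

/-- The shape of a circuit. -/
def Circuit.shape (γ : Circuit k) : Shape k := ⟨γ.verts, {e | e ∈ γ.walk.edges}⟩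

theorem Circuit.shape_edges_subset (γ : Circuit k) : γ.shape.edges ⊆ edgesIn γ.verts := by
  intro e he
  exact ⟨γ.walk.edges_subset_edgeSet he, fun x hx => γ.walk.mem_support_of_mem_edges he hx⟩

theorem Circuit.isOpen_cfg {γ : Circuit k} {o : Set (Sym2 (Vertex k))} :
    γ.IsOpen (cfg o) ↔ γ.shape.edges ⊆ o := by
  have key : ∀ e ∈ γ.walk.edges, (e ∈ (openGraph (cfg o)).edgeSet ↔ e ∈ o) := by
    intro e he
    have h1 := γ.walk.edges_subset_edgeSet he
    induction e using Sym2.ind with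
    | _ x y =>
      rw [SimpleGraph.mem_edgeSet, openGraph_adj, op_opens_cfg]
      exact ⟨fun h => h.2, fun h => ⟨h1, h⟩⟩
  exact ⟨fun h e he => (key e he).1 (h e he), fun h e he => (key e he).2 (h he)⟩

open Classical in
/-- The shape of the minimal circuit. -/
noncomputable def circuitSel (m n : ℕ) (c : ℤ × ℤ) (o : Set (Sym2 (Vertex k))) : Option (Shape k) :=
  if h : ∃ γ, IsMinimalCircuit (cfg o) m n c γ then some h.choose.shape else none

theorem circuitSel_eq_some {m n : ℕ} {c : ℤ × ℤ} {o : Set (Sym2 (Vertex k))} {S : Shape k} :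
    circuitSel m n c o = some S ↔ ∃ γ, IsMinimalCircuit (cfg o) m n c γ ∧ S = γ.shape := by
  unfold circuitSel
  split_ifs with h
  · constructor
    · intro hS
      cases hS
      exact ⟨_, h.choose_spec, rfl⟩
    · rintro ⟨γ, hγ, rfl⟩
      rw [hγ.unique h.choose_spec]
  · simp only [false_iff, not_exists, not_and]
    exact fun γ hγ => absurd ⟨γ, hγ⟩ h

theorem isOpenSurrounding_iff {m n : ℕ} {c : ℤ × ℤ} {o : Set (Sym2 (Vertex k))} {γ : Circuit k} :
    IsOpenSurrounding (cfg o) m n c γ ↔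
      γ.shape.edges ⊆ o ∧ γ.verts ⊆ lift k (annulus m n c) ∧ γ.windingNumber c ≠ 0 := by
  unfold IsOpenSurrounding
  rw [Circuit.isOpen_cfg]

/-- The family of minimal circuits. -/
noncomputable def circuitFamily (k m n : ℕ) (c : ℤ × ℤ) : Family k (annulus m n c) where
  sel := circuitSel m n c
  isOpen h := by
    obtain ⟨γ, hγ, rfl⟩ := circuitSel_eq_some.1 h
    exact (isOpenSurrounding_iff.1 hγ.1).1
  cols h := by
    obtain ⟨γ, hγ, rfl⟩ := circuitSel_eq_some.1 h
    exact fun x hx => mem_lift.1 ((isOpenSurrounding_iff.1 hγ.1).2.1 hx)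
  edges_subset h := by
    obtain ⟨γ, hγ, rfl⟩ := circuitSel_eq_some.1 h
    exact γ.shape_edges_subset
  isLocal {o o'} h := by
    have key : ∀ γ : Circuit k, IsOpenSurrounding (cfg o) m n c γ ↔ IsOpenSurrounding (cfg o') m n c γ := by
      have aux : ∀ (o : Set (Sym2 (Vertex k))) (γ : Circuit k), IsOpenSurrounding (cfg o) m n c γ ↔
          γ.shape.edges ⊆ o ∩ edgesIn (lift k (annulus m n c)) ∧ γ.verts ⊆ lift k (annulus m n c) ∧
            γ.windingNumber c ≠ 0 := by
        intro o γ
        rw [isOpenSurrounding_iff, Set.subset_inter_iff]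
        exact ⟨fun h => ⟨⟨h.1, γ.shape_edges_subset.trans (edgesIn_mono h.2.1)⟩, h.2⟩,
          fun h => ⟨h.1.1, h.2⟩⟩
      intro γ
      rw [aux, aux, h]
    have h2 : ∀ γ : Circuit k, IsMinimalCircuit (cfg o) m n c γ ↔ IsMinimalCircuit (cfg o') m n c γ := by
      intro γ
      unfold IsMinimalCircuit
      simp only [key]
    refine Option.ext fun S => ?_
    rw [circuitSel_eq_some, circuitSel_eq_some]
    simp only [h2]
  antisymm {o o' S S'} h h' hS hS' := by
    obtain ⟨γ, hγ, rfl⟩ := circuitSel_eq_some.1 h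
    obtain ⟨γ', hγ', rfl⟩ := circuitSel_eq_some.1 h'
    have h1 := isOpenSurrounding_iff.1 hγ.1
    have h2 := isOpenSurrounding_iff.1 hγ'.1
    rcases hγ.2 γ' (isOpenSurrounding_iff.2 ⟨hS', h2.2⟩) with h3 | h3
    · rw [h3]
    rcases hγ'.2 γ (isOpenSurrounding_iff.2 ⟨hS, h1.2⟩) with h4 | h4
    · rw [h4]
    · exact (h3.asymm h4).elim
  exists_of_open {o o' S} h ho := by
    obtain ⟨γ, hγ, rfl⟩ := circuitSel_eq_some.1 h
    have h1 := isOpenSurrounding_iff.1 hγ.1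
    obtain ⟨γ', hγ'⟩ := exists_isMinimalCircuit (isOpenSurrounding_iff.2 ⟨ho, h1.2⟩)
    exact ⟨γ'.shape, circuitSel_eq_some.2 ⟨γ', hγ', rfl⟩⟩

theorem circuitFamily_sel {m n : ℕ} {c : ℤ × ℤ} {o : Set (Sym2 (Vertex k))} {S : Shape k} :
    (circuitFamily k m n c).sel o = some S ↔ ∃ γ, IsMinimalCircuit (cfg o) m n c γ ∧ S = γ.shape :=
  circuitSel_eq_some

theorem circuitFamily_isSome {m n : ℕ} {c : ℤ × ℤ} {o : Set (Sym2 (Vertex k))} :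
    (∃ S, (circuitFamily k m n c).sel o = some S) ↔ ∃ γ : Circuit k, γ.shape.edges ⊆ o ∧
      γ.verts ⊆ lift k (annulus m n c) ∧ γ.windingNumber c ≠ 0 := by
  constructor
  · rintro ⟨S, hS⟩
    obtain ⟨γ, hγ, -⟩ := circuitFamily_sel.1 hS
    exact ⟨γ, isOpenSurrounding_iff.1 hγ.1⟩
  · rintro ⟨γ, hγ⟩
    obtain ⟨γ', hγ'⟩ := exists_isMinimalCircuit (isOpenSurrounding_iff.2 hγ)
    exact ⟨_, circuitFamily_sel.2 ⟨γ', hγ', rfl⟩⟩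

theorem mem_minCircuit_cfg {m n : ℕ} {c : ℤ × ℤ} {o : Set (Sym2 (Vertex k))} {x : Vertex k} :
    x ∈ minCircuit (cfg o) m n c ↔ ∃ S, (circuitFamily k m n c).sel o = some S ∧ x ∈ S.verts := by
  constructor
  · rintro ⟨γ, hγ, hx⟩
    exact ⟨γ.shape, circuitFamily_sel.2 ⟨γ, hγ, rfl⟩, hx⟩
  · rintro ⟨S, hS, hx⟩
    obtain ⟨γ, hγ, rfl⟩ := circuitFamily_sel.1 hS
    exact ⟨γ, hγ, hx⟩

theorem minCircuit_cfg_of_sel {m n : ℕ} {c : ℤ × ℤ} {o : Set (Sym2 (Vertex k))} {S : Shape k}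
    (h : (circuitFamily k m n c).sel o = some S) : minCircuit (cfg o) m n c = S.verts := by
  ext x
  rw [mem_minCircuit_cfg]
  exact ⟨fun ⟨S', hS', hx⟩ => by rw [h] at hS'; cases hS'; exact hx, fun hx => ⟨S, h, hx⟩⟩

theorem minCircuit_cfg_nonempty {m n : ℕ} {c : ℤ × ℤ} {o : Set (Sym2 (Vertex k))} :
    (minCircuit (cfg o) m n c).Nonempty ↔ ∃ S, (circuitFamily k m n c).sel o = some S := by
  constructor
  · rintro ⟨x, hx⟩
    obtain ⟨S, hS, -⟩ := mem_minCircuit_cfg.1 hx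
    exact ⟨S, hS⟩
  · rintro ⟨S, hS⟩
    rw [minCircuit_cfg_of_sel hS]
    obtain ⟨γ, hγ, rfl⟩ := circuitFamily_sel.1 hS
    exact ⟨γ.base, γ.walk.start_mem_support⟩

theorem circuitFamily_meets {m n : ℕ} {c : ℤ × ℤ} {o : Set (Sym2 (Vertex k))} {S : Shape k}
    (hS : (circuitFamily k m n c).sel o = some S) {P : Set (ℤ × ℤ)} {x y : ℤ × ℤ} (hP : Reach PAdj P x y)
    (hx : x ∈ box m c) (hy : y.1 < c.1 - n ∨ c.1 + n < y.1) : ∃ v ∈ S.verts, v.1 ∈ P := by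
  obtain ⟨γ, hγ, rfl⟩ := circuitFamily_sel.1 hS
  have h1 := isOpenSurrounding_iff.1 hγ.1
  exact γ.meets h1.2.1 h1.2.2 hP hx hy

end Circuits
end Slab

/-! ### Transport of events under planar isometries. -/

namespace Slab

section Transport

variable {k : ℕ}

/-- The number of passages of a walk through a ray. -/
def crossWalk (c : ℤ × ℤ) {x y : Vertex k} (w : (graph k).Walk x y) : ℤ :=
  crossSum c (w.darts.map fun d => (d.fst.1, d.snd.1))

theorem cross_swap (z u v : ℤ × ℤ) : cross z v u = - cross z u v := by
  unfold cross; split_ifs <;> omega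

theorem crossWalk_rotate (c : ℤ × ℤ) {x y : Vertex k} (w : (graph k).Walk x x) (h : y ∈ w.support) :
    crossWalk c (w.rotate y h) = crossWalk c w :=
  (((w.rotate_darts y h).perm.map _).map _).sum_eq

theorem crossWalk_reverse (c : ℤ × ℤ) {x y : Vertex k} (w : (graph k).Walk x y) :
    crossWalk c w.reverse = - crossWalk c w := by
  unfold crossWalk crossSum
  rw [SimpleGraph.Walk.darts_reverse, List.map_reverse, List.map_reverse, List.sum_reverse]
  induction w.darts with
  | nil => simp
  | cons d l ih =>
    simp only [List.map_cons, List.sum_cons] at ih ⊢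
    rw [ih, neg_add]
    congr 1
    exact cross_swap _ _ _

theorem prec_total {x y : Vertex k} (h : x ≠ y) : Prec x y ∨ Prec y x := by
  rw [prec_iff, prec_iff]
  exact lt_or_gt_of_ne fun h' => h (precKey_injective h')

/-- Every cycle gives rise to a circuit. -/
theorem exists_circuit {c : ℤ × ℤ} {x : Vertex k} (w : (graph k).Walk x x) (hw : w.IsCycle)
    (hc : ∀ v ∈ w.support, v.1 ≠ c) (h0 : crossWalk c w ≠ 0) :
    ∃ γ : Circuit k, (∀ v, v ∈ γ.verts ↔ v ∈ w.support) ∧ (∀ e, e ∈ γ.shape.edges ↔ e ∈ w.edges) ∧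
      γ.windingNumber c ≠ 0 := by
  classical
  -- The cycle is rotated to its least vertex and, if necessary, reversed; this changes the count of
  -- passages at most by a sign.
  obtain ⟨y, hy, hmin⟩ := Finset.exists_min_image w.support.toFinset precKey
    ⟨x, List.mem_toFinset.2 w.start_mem_support⟩
  rw [List.mem_toFinset] at hy
  have key : ∀ w' : (graph k).Walk y y, w'.IsCycle → (∀ v, v ∈ w'.support ↔ v ∈ w.support) →
      (∀ e, e ∈ w'.edges ↔ e ∈ w.edges) → crossWalk c w' ≠ 0 → Prec w'.snd w'.penultimate →
      ∃ γ : Circuit k, (∀ v, v ∈ γ.verts ↔ v ∈ w.support) ∧ (∀ e, e ∈ γ.shape.edges ↔ e ∈ w.edges) ∧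
        γ.windingNumber c ≠ 0 := by
    intro w' h1 h2 h3 h4 h5
    have h6 : ∀ v ∈ w'.support, v ≠ y → Prec y v := fun v hv hvy => by
      rw [prec_iff]
      exact lt_of_le_of_ne (hmin v (List.mem_toFinset.2 ((h2 v).1 hv))) fun h => hvy (precKey_injective h).symm
    refine ⟨⟨y, w', h1, h6, h5⟩, h2, h3, ?_⟩
    rw [windingNumber_eq ⟨y, w', h1, h6, h5⟩ fun v hv => hc v ((h2 v).1 hv)]
    exact_mod_cast h4
  have h1 : (w.rotate y hy).IsCycle := hw.rotate hy
  have h2 : ∀ v, v ∈ (w.rotate y hy).support ↔ v ∈ w.support := fun v => w.mem_support_rotate_iff y hy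
  have h3 : ∀ e, e ∈ (w.rotate y hy).edges ↔ e ∈ w.edges := fun e => (w.rotate_edges y hy).mem_iff
  have h4 : crossWalk c (w.rotate y hy) ≠ 0 := by rwa [crossWalk_rotate]
  rcases prec_total h1.snd_ne_penultimate with h5 | h5
  · exact key _ h1 h2 h3 h4 h5
  · refine key (w.rotate y hy).reverse h1.reverse (fun v => ?_) (fun e => ?_) ?_ ?_
    · rw [SimpleGraph.Walk.support_reverse, List.mem_reverse, h2]
    · rw [SimpleGraph.Walk.edges_reverse, List.mem_reverse, h3]
    · rw [crossWalk_reverse]; exact neg_ne_zero.2 h4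
    · rwa [SimpleGraph.Walk.snd_reverse, SimpleGraph.Walk.penultimate_reverse]

/-- Planar isometries. -/
def IsPlanarIsometry (σ : (ℤ × ℤ) ≃ (ℤ × ℤ)) : Prop := ∀ z w : ℤ × ℤ,
  ((σ z).1 - (σ w).1) ^ 2 + ((σ z).2 - (σ w).2) ^ 2 = (z.1 - w.1) ^ 2 + (z.2 - w.2) ^ 2

/-- The action of a planar map on vertices. -/
def vmap (k : ℕ) (σ : (ℤ × ℤ) ≃ (ℤ × ℤ)) : Vertex k ≃ Vertex k := σ.prodCongr (Equiv.refl _)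

/-- The action of a planar map on edges. -/
def emap (k : ℕ) (σ : (ℤ × ℤ) ≃ (ℤ × ℤ)) : Sym2 (Vertex k) ↪ Sym2 (Vertex k) := (vmap k σ).toEmbedding.sym2Map

variable {σ : (ℤ × ℤ) ≃ (ℤ × ℤ)}

@[simp] theorem emap_mk (x y : Vertex k) : emap k σ s(x, y) = s(vmap k σ x, vmap k σ y) := rfl

@[simp] theorem vmap_fst (x : Vertex k) : (vmap k σ x).1 = σ x.1 := rfl

@[simp] theorem vmap_snd (x : Vertex k) : (vmap k σ x).2 = x.2 := rfl

theorem adj_vmap (hσ : IsPlanarIsometry σ) {x y : Vertex k} :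
    (graph k).Adj (vmap k σ x) (vmap k σ y) ↔ (graph k).Adj x y := by
  simp only [graph, vmap_fst, vmap_snd, hσ x.1 y.1]

theorem vmap_image_lift (T : Set (ℤ × ℤ)) : vmap k σ '' lift k T = lift k (σ '' T) := by
  ext x
  constructor
  · rintro ⟨y, hy, rfl⟩
    exact ⟨y.1, hy, rfl⟩
  · rintro ⟨z, hz, hzx⟩
    exact ⟨(z, x.2), hz, Prod.ext hzx rfl⟩

theorem mem_edgesIn_image (hσ : IsPlanarIsometry σ) {D : Set (Vertex k)} {e : Sym2 (Vertex k)} :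
    e ∈ edgesIn (vmap k σ '' D) ↔ ∃ e' ∈ edgesIn D, emap k σ e' = e := by
  induction e using Sym2.ind with
  | _ x y =>
    rw [mem_edgesIn]
    constructor
    · rintro ⟨h, ⟨x', hx, rfl⟩, ⟨y', hy, rfl⟩⟩
      exact ⟨s(x', y'), mem_edgesIn.2 ⟨(adj_vmap hσ).1 h, hx, hy⟩, rfl⟩
    · rintro ⟨e', he', h⟩
      induction e' using Sym2.ind with
      | _ x' y' =>
        rw [mem_edgesIn] at he'
        rw [emap_mk, Sym2.eq_iff] at h
        rcases h with ⟨rfl, rfl⟩ | ⟨rfl, rfl⟩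
        · exact ⟨(adj_vmap hσ).2 he'.1, ⟨_, he'.2.1, rfl⟩, ⟨_, he'.2.2, rfl⟩⟩
        · exact ⟨((adj_vmap hσ).2 he'.1).symm, ⟨_, he'.2.2, rfl⟩, ⟨_, he'.2.1, rfl⟩⟩

theorem op_vmap (hσ : IsPlanarIsometry σ) {o : Set (Sym2 (Vertex k))} {x y : Vertex k} :
    Op o (vmap k σ x) (vmap k σ y) ↔ Op (emap k σ ⁻¹' o) x y := by
  unfold Op; rw [adj_vmap hσ]; rfl

theorem reach_vmap (hσ : IsPlanarIsometry σ) {o : Set (Sym2 (Vertex k))} {D : Set (Vertex k)}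
    {x y : Vertex k} : Reach (Op (emap k σ ⁻¹' o)) D x y ↔
      Reach (Op o) (vmap k σ '' D) (vmap k σ x) (vmap k σ y) := by
  constructor
  · intro h
    refine h.induction (P := fun y => Reach (Op o) (vmap k σ '' D) (vmap k σ x) (vmap k σ y))
      (fun hx => .refl ⟨_, hx, rfl⟩) fun a b _ ih hab hb => ih.tail ((op_vmap hσ).2 hab) ⟨_, hb, rfl⟩
  · intro h
    have key := h.induction (P := fun y => Reach (Op (emap k σ ⁻¹' o)) D x ((vmap k σ).symm y)) ?_ ?_
    · simpa using key
    · rintro ⟨x', hx', h'⟩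
      rw [(vmap k σ).injective h'] at hx'
      simpa using Reach.refl hx'
    · rintro a b - ih hab ⟨b', hb', rfl⟩
      have h1 : Op (emap k σ ⁻¹' o) ((vmap k σ).symm a) b' := by
        rw [← op_vmap hσ, Equiv.apply_symm_apply]; exact hab
      simpa using ih.tail h1 hb'

theorem joined_vmap (hσ : IsPlanarIsometry σ) {o : Set (Sym2 (Vertex k))} {D A B : Set (Vertex k)} :
    Joined (emap k σ ⁻¹' o) D A B ↔ Joined o (vmap k σ '' D) (vmap k σ '' A) (vmap k σ '' B) := by
  constructor
  · rintro ⟨a, ha, b, hb, h⟩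
    exact ⟨_, ⟨a, ha, rfl⟩, _, ⟨b, hb, rfl⟩, (reach_vmap hσ).1 h⟩
  · rintro ⟨_, ⟨a, ha, rfl⟩, _, ⟨b, hb, rfl⟩, h⟩
    exact ⟨a, ha, b, hb, (reach_vmap hσ).2 h⟩

theorem DependsOnly.mono {ι : Type*} {S S' : Set ι} {E : Set (Set ι)} (h : DependsOnly S E) (hS : S ⊆ S') :
    DependsOnly S' E := by
  intro ω ω' h' hω
  refine h ω ω' ?_ hω
  rw [← Set.inter_eq_self_of_subset_right hS, ← Set.inter_assoc, h', Set.inter_assoc]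

theorem DependsOnly.compl {ι : Type*} {S : Set ι} {E : Set (Set ι)} (h : DependsOnly S E) :
    DependsOnly S Eᶜ := fun ω ω' hS hω hω' => hω (h ω' ω hS.symm hω')

/-- The homogeneous measure is invariant under planar isometries. -/
theorem Pr_vmap (hσ : IsPlanarIsometry σ) {p : ℝ} {F G : Finset (Sym2 (Vertex k))} {D : Set (Vertex k)}
    {E : Set (Set (Sym2 (Vertex k)))} (hE : DependsOnly (edgesIn D) E) (hF : edgesIn D ⊆ F)
    (hG : edgesIn (vmap k σ '' D) ⊆ G) :
    Pr G (fun _ => p) {o | emap k σ ⁻¹' o ∈ E} = Pr F (fun _ => p) E := by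
  have hdep : DependsOnly (edgesIn (vmap k σ '' D)) {o | emap k σ ⁻¹' o ∈ E} := by
    intro o o' h ho
    refine hE _ _ ?_ ho
    ext e
    simp only [Set.mem_inter_iff, Set.mem_preimage, and_congr_left_iff]
    intro he
    have h1 : emap k σ e ∈ edgesIn (vmap k σ '' D) := (mem_edgesIn_image hσ).2 ⟨e, he, rfl⟩
    have h2 : emap k σ e ∈ o ∩ edgesIn (vmap k σ '' D) ↔ emap k σ e ∈ o' ∩ edgesIn (vmap k σ '' D) := by rw [h]
    simpa [h1] using h2
  rw [Pr_eq_of_dependsOnly (G := F.map (emap k σ)) hdep, Pr_map]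
  · refine Pr_congr fun ω _ => ?_
    rw [Set.mem_ofPred_eq, Set.mem_ofPred_eq, Set.preimage_image_eq _ (emap k σ).injective]
  · intro e he
    refine iff_of_true (hG he) ?_
    obtain ⟨e', he', rfl⟩ := (mem_edgesIn_image hσ).1 he
    exact Finset.mem_map_of_mem _ (hF he')

theorem Pr_joined_vmap (hσ : IsPlanarIsometry σ) {p : ℝ} {F G : Finset (Sym2 (Vertex k))}
    {D A B : Set (Vertex k)} (hF : edgesIn D ⊆ F) (hG : edgesIn (vmap k σ '' D) ⊆ G) :
    Pr G (fun _ => p) {o | Joined o (vmap k σ '' D) (vmap k σ '' A) (vmap k σ '' B)} =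
      Pr F (fun _ => p) {o | Joined o D A B} := by
  rw [← Pr_vmap hσ (dependsOnly_joined D A B) hF hG]
  exact Pr_congr fun o _ => (joined_vmap hσ).symm

/-- The edges of a box. -/
noncomputable def boxEdges (k M : ℕ) : Finset (Sym2 (Vertex k)) := by
  classical
  exact (((finite_lift_box (k := k) M (0, 0)).toFinset.sym2).filter fun e => e ∈ (graph k).edgeSet)

theorem coe_boxEdges (k M : ℕ) : (boxEdges k M : Set (Sym2 (Vertex k))) = edgesIn (lift k (box M (0, 0))) := by
  ext e
  simp [boxEdges, edgesIn, and_comm]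

theorem edgesIn_subset_boxEdges {M : ℕ} {D : Set (Vertex k)} (h : D ⊆ lift k (box M (0, 0))) :
    edgesIn D ⊆ boxEdges k M := by
  rw [coe_boxEdges]; exact edgesIn_mono h

theorem boxEdges_subset {M : ℕ} : ∀ e ∈ boxEdges k M, e ∈ (graph k).edgeSet := by
  intro e he
  have : e ∈ (boxEdges k M : Set (Sym2 (Vertex k))) := he
  rw [coe_boxEdges] at this
  exact this.1

/-- Translations of the plane. -/
def shift (a : ℤ × ℤ) : (ℤ × ℤ) ≃ (ℤ × ℤ) := Equiv.addRight a

theorem shift_apply (a z : ℤ × ℤ) : shift a z = (z.1 + a.1, z.2 + a.2) := rfl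

theorem isPlanarIsometry_shift (a : ℤ × ℤ) : IsPlanarIsometry (shift a) := by
  intro z w
  simp only [shift_apply]
  ring

theorem shift_box (a c : ℤ × ℤ) (n : ℕ) : shift a '' box n c = box n (shift a c) := by
  ext z
  constructor
  · rintro ⟨w, hw, rfl⟩
    rw [mem_box, shift_apply, shift_apply] at *
    dsimp only; omega
  · intro hz
    refine ⟨(z.1 - a.1, z.2 - a.2), ?_, Prod.ext (by simp [shift_apply]) (by simp [shift_apply])⟩
    rw [mem_box, shift_apply] at *
    dsimp only at *; omega

theorem shift_annulus (a c : ℤ × ℤ) (m n : ℕ) : shift a '' annulus m n c = annulus m n (shift a c) := by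
  unfold annulus
  rw [Set.image_sdiff (shift a).injective, shift_box, shift_box]

theorem dependsOnly_circuit (m n : ℕ) (c : ℤ × ℤ) :
    DependsOnly (edgesIn (lift k (annulus m n c))) {o | ∃ S, (circuitFamily k m n c).sel o = some S} := by
  rintro o o' h ⟨S, hS⟩
  exact ⟨S, ((circuitFamily k m n c).isLocal h.symm).trans hS⟩

theorem isUpperSet_circuit (m n : ℕ) (c : ℤ × ℤ) :
    IsUpperSet {o | ∃ S, (circuitFamily k m n c).sel o = some S} :=
  fun _ _ h ⟨_, hS⟩ => (circuitFamily k m n c).exists_of_open hS (((circuitFamily k m n c).isOpen hS).trans h)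

theorem not_annulus_center {m n : ℕ} {c : ℤ × ℤ} : c ∉ annulus m n c := fun h =>
  (mem_annulus.1 h).2 (mem_box.2 (by omega))

/-- The order on circuits refers to the norm and is not invariant under translations, so minimal
circuits are not mapped to minimal ones. Only existence is transported, and the image has to be
normalised anew. -/
theorem exists_circuit_shift {m n : ℕ} {a : ℤ × ℤ} {o : Set (Sym2 (Vertex k))} {c : ℤ × ℤ}
    (h : ∃ S, (circuitFamily k m n c).sel (emap k (shift a) ⁻¹' o) = some S) :
    ∃ S, (circuitFamily k m n (shift a c)).sel o = some S := by
  obtain ⟨γ, h1, h2, h3⟩ := circuitFamily_isSome.1 h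
  have hσ := isPlanarIsometry_shift a
  let f : graph k →g graph k := ⟨vmap k (shift a), fun h => (adj_vmap hσ).2 h⟩
  have hf : Function.Injective f := (vmap k (shift a)).injective
  have hann : ∀ v ∈ (γ.walk.map f).support, v.1 ∈ annulus m n (shift a c) := by
    intro v hv
    rw [SimpleGraph.Walk.support_map, List.mem_map] at hv
    obtain ⟨u, hu, rfl⟩ := hv
    rw [← shift_annulus]
    exact ⟨u.1, mem_lift.1 (h2 hu), rfl⟩
  have hcr : crossWalk (shift a c) (γ.walk.map f) = crossWalk c γ.walk := by
    unfold crossWalk crossSum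
    rw [SimpleGraph.Walk.darts_map, List.map_map, List.map_map, List.map_map]
    congr 1
    refine List.map_congr_left fun d _ => ?_
    change cross (shift a c) (shift a d.fst.1) (shift a d.snd.1) = cross c d.fst.1 d.snd.1
    simp only [cross, shift_apply]
    split_ifs <;> omega
  rw [windingNumber_eq γ fun v hv h => not_annulus_center (h ▸ mem_lift.1 (h2 hv))] at h3
  obtain ⟨γ', h4, h5, h6⟩ := exists_circuit (c := shift a c) (γ.walk.map f)
    ((SimpleGraph.Walk.isCycle_map_iff_of_injective hf).2 γ.isCycle)
    (fun v hv h => not_annulus_center (h ▸ hann v hv)) (by rw [hcr]; exact_mod_cast h3)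
  refine circuitFamily_isSome.2 ⟨γ', fun e he => ?_, fun v hv => hann v ((h4 v).1 hv), h6⟩
  rw [h5, SimpleGraph.Walk.edges_map, List.mem_map] at he
  obtain ⟨e', he', rfl⟩ := he
  exact h1 he'

end Transport

/-! ### Conditioning on finitely many coordinates. -/

section Freezing

variable {ι : Type*}

open Classical in
/-- Weights for which the coordinates in `G` are those of `ξ`. -/
noncomputable def freeze (q : ι → ℝ) (G : Finset ι) (ξ : Set ι) : ι → ℝ := fun i =>
  if i ∈ G then (if i ∈ ξ then 1 else 0) else q i

theorem isWeight_freeze {q : ι → ℝ} (hq : IsWeight q) (G : Finset ι) (ξ : Set ι) : IsWeight (freeze q G ξ) := by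
  intro i
  unfold freeze
  split_ifs
  · norm_num
  · norm_num
  · exact hq i

theorem freeze_of_notMem {q : ι → ℝ} {G : Finset ι} {ξ : Set ι} {i : ι} (h : i ∉ G) : freeze q G ξ i = q i := by
  simp [freeze, h]

theorem wt_freeze_eq_zero {q : ι → ℝ} {F G : Finset ι} (hG : G ⊆ F) {ξ ω : Set ι}
    (h : ω ∩ G ≠ ξ ∩ G) : wt F (freeze q G ξ) ω = 0 := by
  classical
  obtain ⟨i, hi, hi'⟩ : ∃ i ∈ G, ¬ (i ∈ ω ↔ i ∈ ξ) := by
    by_contra! hcon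
    exact h (by ext i; simp only [Set.mem_inter_iff, Finset.mem_coe, and_congr_left_iff]; exact hcon i)
  refine Finset.prod_eq_zero (hG hi) ?_
  by_cases h1 : i ∈ ω <;> by_cases h2 : i ∈ ξ <;> simp_all [freeze]

/-- Only the configurations with the frozen values matter. -/
theorem Pr_freeze_mono {q : ι → ℝ} (hq : IsWeight q) {F G : Finset ι} (hG : G ⊆ F) {ξ : Set ι}
    {E E' : Set (Set ι)} (h : ∀ ω, ω ⊆ (F : Set ι) → ω ∩ G = ξ ∩ G → ω ∈ E → ω ∈ E') :
    Pr F (freeze q G ξ) E ≤ Pr F (freeze q G ξ) E' := by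
  classical
  refine Finset.sum_le_sum fun ω hω => ?_
  by_cases h1 : (ω : Set ι) ∩ G = ξ ∩ G
  · refine mul_le_mul_of_nonneg_left ?_ (wt_nonneg (isWeight_freeze hq G ξ) _)
    by_cases h2 : (ω : Set ι) ∈ E
    · simp [h2, h _ (Finset.coe_subset.2 (Finset.mem_powerset.1 hω)) h1 h2]
    · rw [Set.indicator_of_notMem h2]
      exact Set.indicator_nonneg (by simp) _
  · rw [wt_freeze_eq_zero hG h1, zero_mul, zero_mul]

theorem Pr_freeze_congr {q : ι → ℝ} (hq : IsWeight q) {F G : Finset ι} (hG : G ⊆ F) {ξ : Set ι}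
    {E E' : Set (Set ι)} (h : ∀ ω, ω ⊆ (F : Set ι) → ω ∩ G = ξ ∩ G → (ω ∈ E ↔ ω ∈ E')) :
    Pr F (freeze q G ξ) E = Pr F (freeze q G ξ) E' :=
  le_antisymm (Pr_freeze_mono hq hG fun ω h1 h2 => (h ω h1 h2).1)
    (Pr_freeze_mono hq hG fun ω h1 h2 => (h ω h1 h2).2)

/-- Conditioning on the coordinates in `G`. -/
theorem Pr_eq_Ex_freeze {q : ι → ℝ} {F G : Finset ι} (hG : G ⊆ F) (E : Set (Set ι)) :
    Pr F q E = Ex G q fun ξ => Pr F (freeze q G ξ) E := by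
  classical
  have hF : F = G ∪ F \ G := (Finset.union_sdiff_of_subset hG).symm
  have hd : Disjoint G (F \ G) := Finset.disjoint_sdiff
  have h0 : ∀ q' : ι → ℝ, Pr F q' E = Ex G q' fun ω => Pr (F \ G) q' {ζ | ω ∪ ζ ∈ E} := by
    intro q'
    conv_lhs => rw [hF]
    exact Pr_union_eq hd
  rw [h0 q]
  refine Ex_congr fun ξ hξ => ?_
  rw [h0 (freeze q G ξ)]
  obtain ⟨ξ, rfl⟩ : ∃ ξ' : Finset ι, (ξ' : Set ι) = ξ := ⟨(G.finite_toSet.subset hξ).toFinset, by simp⟩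
  unfold Ex
  rw [Finset.sum_eq_single ξ]
  · have h1 : wt G (freeze q G ξ) (ξ : Set ι) = 1 := by
      refine Finset.prod_eq_one fun i hi => ?_
      by_cases h : i ∈ ξ <;> simp [freeze, h, hi]
    rw [h1, one_mul]
    refine Ex_congr_weight fun i hi => ?_
    rw [freeze_of_notMem (Finset.mem_sdiff.1 hi).2]
  · intro ω hω hne
    rw [wt_freeze_eq_zero subset_rfl, zero_mul]
    intro h
    rw [Set.inter_eq_left.2 (Finset.coe_subset.2 (Finset.mem_powerset.1 hω)), Set.inter_eq_left.2 hξ] at h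
    exact hne (Finset.coe_injective h)
  · intro h
    exact absurd (Finset.mem_powerset.2 (Finset.coe_subset.1 hξ)) h

/-- A linear inequality between probabilities may be proved conditionally. A surgery can then be
carried out with all edges over one annulus kept fixed, together with the circuit selected there. -/
theorem Pr_le_of_freeze {q : ι → ℝ} (hq : IsWeight q) {F G : Finset ι} (hG : G ⊆ F) {E E' : Set (Set ι)} {a b : ℝ}
    (h : ∀ ξ, ξ ⊆ (G : Set ι) → a * Pr F (freeze q G ξ) E ≤ b * Pr F (freeze q G ξ) E') :
    a * Pr F q E ≤ b * Pr F q E' := by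
  rw [Pr_eq_Ex_freeze hG E, Pr_eq_Ex_freeze hG E', ← Ex_mul_left, ← Ex_mul_left]
  exact Ex_mono hq h

end Freezing
end Slab

/-! ### The linear lower bound. -/

namespace Slab

section LowerBound

variable {k : ℕ}

/-- Every shape of the family separates the box of radius `m` from the outside of the vertical
strip of half width `n`. -/
def Family.Surrounds {C : Set (ℤ × ℤ)} (fam : Family k C) (m n : ℕ) (c : ℤ × ℤ) : Prop :=
  ∀ o S, fam.sel o = some S → ∀ (P : Set (ℤ × ℤ)) (x y : ℤ × ℤ), Reach PAdj P x y → x ∈ box m c →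
    (y.1 < c.1 - n ∨ c.1 + n < y.1) → ∃ v ∈ S.verts, v.1 ∈ P

theorem circuitFamily_surrounds (m n : ℕ) (c : ℤ × ℤ) : (circuitFamily k m n c).Surrounds m n c :=
  fun _ _ hS _ _ _ hP hx hy => circuitFamily_meets hS hP hx hy

theorem Reach.fst_inter {Λ : Set (Vertex k)} {x y : Vertex k} (h : Reach (graph k).Adj Λ x y) :
    Reach PAdj (Prod.fst '' Λ) x.1 y.1 := reach_fst h

/-- Gluing a path to a surrounding shape. -/
theorem glue_surrounding {m n M : ℕ} {c : ℤ × ℤ} {fam : Family k (annulus m n c)} (hfam : fam.Surrounds m n c)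
    {T : Set (ℤ × ℤ)} (hT : T ⊆ box M (0, 0)) {A I : Set (Vertex k)} {q : Sym2 (Vertex k) → ℝ} {δ : ℝ}
    (hq : IsWeight q) (hδ : 0 < δ) (hδ' : δ ≤ 1 / 2)
    (hA : ∀ a ∈ A, a.1.1 < c.1 - n ∨ c.1 + n < a.1.1) (hI : ∀ i ∈ I, i.1 ∈ T → i.1 ∈ box m c)
    (hqδ : ∀ x y : Vertex k, x.1 ∈ annulus m n c → δ ≤ q s(x, y) ∧ q s(x, y) ≤ 1 - δ) :
    δ ^ (10 * (k + 1) ^ 2) * Pr (boxEdges k M) q {o | Joined o (lift k T) A I ∧ ∃ S, fam.sel o = some S} ≤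
      2 * Pr (boxEdges k M) q {o | ∃ S, fam.sel o = some S ∧ Joined o (lift k T) A S.verts} := by
  refine glue fam hq hδ hδ' ((finite_lift_box M (0, 0)).subset fun x hx => hT hx) boxEdges_subset ?_ ?_ ?_ ?_
  · intro a ha haC
    have h1 := (mem_box.1 (mem_annulus.1 haC).1).1
    have h2 := hA a ha
    omega
  · rintro o S hS Λ hΛ ⟨a, ha, i, hi, h⟩
    have h1 := (h.symm fun _ _ h => h.symm).fst_inter
    obtain ⟨v, hv, x, hx, hxv⟩ := hfam o S hS _ _ _ h1 (hI i hi (hΛ h.right_mem)) (hA a ha)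
    exact ⟨x, hx, v, hv, hxv, fun j => (hΛ hx : x.1 ∈ T)⟩
  · intro x y _ hxy hx hadj
    have h1 : s(x, y) ∈ (boxEdges k M : Set (Sym2 (Vertex k))) := by
      rw [coe_boxEdges, mem_edgesIn]
      exact ⟨hadj, hT (hx x.2), mem_lift.2 (hxy ▸ hT (hx x.2))⟩
    exact h1
  · exact fun x y hx _ _ _ => hqδ x y hx

/-- The rectangle in which the two circuits are to be connected. -/
def mainRect (m n : ℕ) : Set (ℤ × ℤ) := Set.Icc 0 (3 * (n : ℤ)) ×ˢ Set.Icc (-(m : ℤ)) (m : ℤ)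

theorem mainRect_subset {m n : ℕ} (h : m ≤ n) : mainRect m n ⊆ box (4 * n) (0, 0) := by
  rintro z ⟨⟨h1, h2⟩, h3, h4⟩
  rw [mem_box]
  push_cast
  omega

/-- The left side of the rectangle. -/
def mainLeft (k m : ℕ) : Set (Vertex k) := lift k ({0} ×ˢ Set.Icc (-(m : ℤ)) (m : ℤ))

/-- The right side of the rectangle. -/
def mainRight (k m n : ℕ) : Set (Vertex k) := lift k ({3 * (n : ℤ)} ×ˢ Set.Icc (-(m : ℤ)) (m : ℤ))

theorem annulus_subset_left {m n : ℕ} : annulus m n (0, 0) ⊆ box (4 * n) (0, 0) := by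
  intro z hz
  have := mem_box.1 (annulus_subset _ _ _ hz)
  rw [mem_box]
  push_cast
  dsimp only at *
  omega

theorem annulus_subset_right {m n : ℕ} : annulus m n (3 * (n : ℤ), 0) ⊆ box (4 * n) (0, 0) := by
  intro z hz
  have := mem_box.1 (annulus_subset _ _ _ hz)
  rw [mem_box]
  push_cast
  dsimp only at *
  omega

theorem crossProb_eq (p : unitInterval) {m n : ℕ} (h : m ≤ n) :
    crossProb k p (3 * n) (2 * m) = Pr (boxEdges k (4 * n)) (fun _ => (p : ℝ))
      {o | Joined o (lift k (mainRect m n)) (mainLeft k m) (mainRight k m n)} := by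
  set T : Set (ℤ × ℤ) := Set.Icc 0 ((3 * n : ℕ) : ℤ) ×ˢ Set.Icc 0 ((2 * m : ℕ) : ℤ) with hT
  have hTbox : T ⊆ box (4 * n) (0, 0) := by
    rintro z ⟨⟨h1, h2⟩, h3, h4⟩
    rw [mem_box]
    push_cast at *
    omega
  have himg : ∀ X : Set ℤ, shift (0, -(m : ℤ)) '' (X ×ˢ Set.Icc 0 ((2 * m : ℕ) : ℤ)) = X ×ˢ Set.Icc (-(m : ℤ)) (m : ℤ) := by
    intro X
    ext z
    constructor
    · rintro ⟨w, ⟨h1, h2, h3⟩, rfl⟩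
      rw [shift_apply]
      refine ⟨by simpa using h1, ?_, ?_⟩ <;> push_cast at * <;> omega
    · rintro ⟨h1, h2, h3⟩
      refine ⟨(z.1, z.2 + m), ⟨h1, ?_, ?_⟩, Prod.ext (by simp [shift_apply]) (by simp [shift_apply])⟩ <;>
        push_cast at * <;> omega
  have h1 : crossProb k p (3 * n) (2 * m) = Pr (boxEdges k (4 * n)) (fun _ => (p : ℝ))
      {o | Joined o (lift k T) (lift k ({0} ×ˢ Set.Icc 0 ((2 * m : ℕ) : ℤ)))
        (lift k ({((3 * n : ℕ) : ℤ)} ×ˢ Set.Icc 0 ((2 * m : ℕ) : ℤ)))} := by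
    rw [← perc_real_eq_Pr p _ boxEdges_subset]
    · unfold crossProb
      simp only [connected_iff]
      rfl
    · exact (dependsOnly_joined _ _ _).mono (edgesIn_subset_boxEdges fun x hx => hTbox hx)
  rw [h1, ← Pr_joined_vmap (D := lift k T) (G := boxEdges k (4 * n)) (isPlanarIsometry_shift (0, -(m : ℤ)))
    (edgesIn_subset_boxEdges fun x hx => hTbox hx)]
  · rw [vmap_image_lift, vmap_image_lift, vmap_image_lift, hT, himg, himg, himg]
    push_cast
    rfl
  · rw [vmap_image_lift, hT, himg]
    refine edgesIn_subset_boxEdges fun x hx => mainRect_subset h ?_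
    have := mem_lift.1 hx
    unfold mainRect
    push_cast at this
    exact this

theorem circuitProb_eq (p : unitInterval) {m n : ℕ} :
    circuitProb k p m n = Pr (boxEdges k (4 * n)) (fun _ => (p : ℝ))
      {o | ∃ S, (circuitFamily k m n (0, 0)).sel o = some S} := by
  rw [← perc_real_eq_Pr p _ boxEdges_subset]
  · unfold circuitProb
    congr 1
    ext ω
    rw [Set.mem_ofPred_eq, Set.mem_ofPred_eq, Set.mem_ofPred_eq, ← minCircuit_cfg_nonempty, cfg_opens]
  · exact (dependsOnly_circuit m n (0, 0)).mono (edgesIn_subset_boxEdges fun x hx => annulus_subset_left hx)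

theorem circuitProb_le (p : unitInterval) {m n : ℕ} :
    circuitProb k p m n ≤ Pr (boxEdges k (4 * n)) (fun _ => (p : ℝ))
      {o | ∃ S, (circuitFamily k m n (3 * (n : ℤ), 0)).sel o = some S} := by
  have hp : IsWeight fun _ : Sym2 (Vertex k) => (p : ℝ) := fun _ => ⟨p.2.1, p.2.2⟩
  rw [circuitProb_eq, ← Pr_vmap (G := boxEdges k (4 * n)) (isPlanarIsometry_shift (3 * (n : ℤ), 0)) (dependsOnly_circuit m n (0, 0))
    (edgesIn_subset_boxEdges fun x hx => annulus_subset_left hx)]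
  · refine Pr_mono hp fun o _ h => ?_
    have := exists_circuit_shift h
    rwa [shift_apply, zero_add, zero_add] at this
  · rw [vmap_image_lift, shift_annulus, shift_apply, zero_add, zero_add]
    exact edgesIn_subset_boxEdges fun x hx => annulus_subset_right hx

/-- The probability that the two minimal circuits are connected inside the rectangle. -/
noncomputable def connectionProb (k : ℕ) (p : unitInterval) (m n : ℕ) : ℝ :=
  (perc k p).real {ω | Connected ω
    (minCircuit ω m n (0, 0))
    (lift k (Set.Icc 0 (3 * (n : ℤ)) ×ˢ Set.Icc (-(m : ℤ)) (m : ℤ)))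
    (minCircuit ω m n (3 * (n : ℤ), 0))}

theorem connectionProb_eq (p : unitInterval) {m n : ℕ} (h : m ≤ n) :
    connectionProb k p m n = Pr (boxEdges k (4 * n)) (fun _ => (p : ℝ))
      {o | ∃ S₁ S₂, (circuitFamily k m n (0, 0)).sel o = some S₁ ∧
        (circuitFamily k m n (3 * (n : ℤ), 0)).sel o = some S₂ ∧
        Joined o (lift k (mainRect m n)) S₁.verts S₂.verts} := by
  rw [← perc_real_eq_Pr p _ boxEdges_subset]
  · unfold connectionProb
    congr 1
    ext ω
    rw [Set.mem_ofPred_eq, Set.mem_ofPred_eq, Set.mem_ofPred_eq, connected_iff]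
    constructor
    · rintro ⟨a, ha, b, hb, hab⟩
      rw [← cfg_opens ω, mem_minCircuit_cfg] at ha hb
      obtain ⟨S₁, h1, ha⟩ := ha
      obtain ⟨S₂, h2, hb⟩ := hb
      exact ⟨S₁, S₂, h1, h2, a, ha, b, hb, hab⟩
    · rintro ⟨S₁, S₂, h1, h2, hj⟩
      rw [← minCircuit_cfg_of_sel h1, ← minCircuit_cfg_of_sel h2, cfg_opens] at hj
      exact hj
  · rintro o o' hoo ⟨S₁, S₂, h1, h2, hj⟩
    have aux : ∀ D : Set (Vertex k), D ⊆ lift k (box (4 * n) (0, 0)) → o ∩ edgesIn D = o' ∩ edgesIn D := by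
      intro D hD
      rw [← Set.inter_eq_self_of_subset_right (edgesIn_subset_boxEdges hD), ← Set.inter_assoc, hoo, Set.inter_assoc]
    refine ⟨S₁, S₂, ?_, ?_, dependsOnly_joined _ _ _ o o' (aux _ fun x hx => mainRect_subset h hx) hj⟩
    · rw [← (circuitFamily k m n (0, 0)).isLocal (aux _ fun x hx => annulus_subset_left hx)]; exact h1
    · rw [← (circuitFamily k m n (3 * (n : ℤ), 0)).isLocal (aux _ fun x hx => annulus_subset_right hx)]; exact h2

theorem finite_lift_annulus (m n : ℕ) (c : ℤ × ℤ) : (lift k (annulus m n c)).Finite :=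
  (finite_lift_box (k := k) n c).subset fun _ hx => annulus_subset m n c hx

/-- The edges over an annulus. -/
noncomputable def annulusEdges (k m n : ℕ) (c : ℤ × ℤ) : Finset (Sym2 (Vertex k)) := by
  classical
  exact ((finite_lift_annulus m n c).toFinset.sym2).filter fun e => e ∈ (graph k).edgeSet

theorem coe_annulusEdges (k m n : ℕ) (c : ℤ × ℤ) :
    (annulusEdges k m n c : Set (Sym2 (Vertex k))) = edgesIn (lift k (annulus m n c)) := by
  ext e
  simp [annulusEdges, edgesIn, and_comm]

theorem annulusEdges_subset {m n M : ℕ} {c : ℤ × ℤ} (h : annulus m n c ⊆ box M (0, 0)) :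
    annulusEdges k m n c ⊆ boxEdges k M := by
  rw [← Finset.coe_subset, coe_annulusEdges, coe_boxEdges]
  exact edgesIn_mono fun x hx => h hx

theorem sel_eq_of_freeze {m n : ℕ} {c : ℤ × ℤ} (fam : Family k (annulus m n c)) {o ξ : Set (Sym2 (Vertex k))}
    (h : o ∩ annulusEdges k m n c = ξ ∩ annulusEdges k m n c) : fam.sel o = fam.sel ξ := by
  rw [coe_annulusEdges] at h
  exact fam.isLocal h

theorem notMem_annulusEdges {m n : ℕ} {c : ℤ × ℤ} {x y : Vertex k} (h : x.1 ∉ annulus m n c) :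
    s(x, y) ∉ annulusEdges k m n c := by
  intro h'
  have h1 : s(x, y) ∈ (annulusEdges k m n c : Set (Sym2 (Vertex k))) := h'
  rw [coe_annulusEdges, mem_edgesIn] at h1
  exact h h1.2.1

theorem annulus_disjoint {m n : ℕ} (hn : 1 ≤ n) {z : ℤ × ℤ} (h : z ∈ annulus m n (0, 0)) :
    z ∉ annulus m n (3 * (n : ℤ), 0) := by
  intro h'
  have h1 := mem_box.1 (annulus_subset _ _ _ h)
  have h2 := mem_box.1 (annulus_subset _ _ _ h')
  dsimp only at *
  omega

/-- The lower bound in the regime of small probabilities. -/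
theorem exists_mul_le_connectionProb (ε : ℝ) (hε : 0 < ε) (k : ℕ) :
    ∃ c : ℝ, 0 < c ∧ c ≤ 1 ∧ ∀ p : unitInterval, ε ≤ (p : ℝ) → (p : ℝ) ≤ 1 - ε →
      ∀ m n : ℕ, 3 ≤ m → m ≤ n →
        c * (crossProb k p (3 * n) (2 * m) * circuitProb k p m n ^ 2) ≤
          connectionProb k p m n := by
  obtain ⟨δ, hδ, hδε, hδ2⟩ : ∃ δ : ℝ, 0 < δ ∧ δ ≤ ε ∧ δ ≤ 1 / 2 :=
    ⟨min ε (1 / 2), lt_min hε (by norm_num), min_le_left _ _, min_le_right _ _⟩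
  have hκ : 0 < δ ^ (10 * (k + 1) ^ 2) := pow_pos hδ _
  have hκ1 : δ ^ (10 * (k + 1) ^ 2) ≤ 1 := pow_le_one₀ hδ.le (by linarith)
  set κ := δ ^ (10 * (k + 1) ^ 2) with hκdef
  refine ⟨(κ / 2) ^ 2, by positivity, by nlinarith, fun p hp hp' m n hm hn => ?_⟩
  have hw : IsWeight fun _ : Sym2 (Vertex k) => (p : ℝ) := fun _ => ⟨p.2.1, p.2.2⟩
  set F := boxEdges k (4 * n) with hF
  set f₁ := circuitFamily k m n (0, 0) with hf₁
  set f₂ := circuitFamily k m n (3 * (n : ℤ), 0) with hf₂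
  set D := lift k (mainRect m n) with hD
  have hbd : ∀ (G : Finset (Sym2 (Vertex k))) (ξ : Set (Sym2 (Vertex k))) (e : Sym2 (Vertex k)), e ∉ G →
      δ ≤ freeze (fun _ => (p : ℝ)) G ξ e ∧ freeze (fun _ => (p : ℝ)) G ξ e ≤ 1 - δ := by
    intro G ξ e he
    rw [freeze_of_notMem he]
    exact ⟨hδε.trans hp, by linarith⟩
  have hharris : crossProb k p (3 * n) (2 * m) * circuitProb k p m n ^ 2 ≤
      Pr F (fun _ => (p : ℝ)) {o | (Joined o D (mainLeft k m) (mainRight k m n) ∧ ∃ S, f₂.sel o = some S) ∧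
        ∃ S, f₁.sel o = some S} := by
    have h1 := Pr_mul_le_Pr_inter (F := F) hw (isUpperSet_joined D (mainLeft k m) (mainRight k m n))
      (isUpperSet_circuit m n (3 * (n : ℤ), 0))
    have h2 := Pr_mul_le_Pr_inter (F := F) hw ((isUpperSet_joined D (mainLeft k m) (mainRight k m n)).inter
      (isUpperSet_circuit m n (3 * (n : ℤ), 0))) (isUpperSet_circuit (k := k) m n (0, 0))
    refine le_trans ?_ h2
    rw [crossProb_eq p hn, pow_two, ← mul_assoc]
    have h3 : 0 ≤ circuitProb k p m n := measureReal_nonneg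
    refine mul_le_mul ?_ (circuitProb_eq p).le h3 (Pr_nonneg hw)
    refine le_trans ?_ h1
    exact mul_le_mul_of_nonneg_left (circuitProb_le p) (Pr_nonneg hw)
  -- First gluing: the crossing of $R$ is attached to $\Gamma_2$, with the edges over the left
  -- annulus frozen so that the existence of $\Gamma_1$ is not disturbed.
  have hA : κ * Pr F (fun _ => (p : ℝ)) {o | (Joined o D (mainLeft k m) (mainRight k m n) ∧ ∃ S, f₂.sel o = some S) ∧
        ∃ S, f₁.sel o = some S} ≤ 2 * Pr F (fun _ => (p : ℝ)) {o | (∃ S, f₂.sel o = some S ∧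
          Joined o D (mainLeft k m) S.verts) ∧ ∃ S, f₁.sel o = some S} := by
    refine Pr_le_of_freeze (G := annulusEdges k m n (0, 0)) hw (annulusEdges_subset annulus_subset_left) fun ξ _ => ?_
    by_cases hξ : ∃ S, f₁.sel ξ = some S
    · have hone : ∀ E : Set (Set (Sym2 (Vertex k))),
          Pr F (freeze (fun _ => (p : ℝ)) (annulusEdges k m n (0, 0)) ξ) {o | o ∈ E ∧ ∃ S, f₁.sel o = some S} =
          Pr F (freeze (fun _ => (p : ℝ)) (annulusEdges k m n (0, 0)) ξ) E := fun E =>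
        Pr_freeze_congr hw (annulusEdges_subset annulus_subset_left) fun o _ ho => by
          rw [Set.mem_ofPred_eq, sel_eq_of_freeze f₁ ho]; simp [hξ]
      refine le_of_eq_of_le (congrArg (κ * ·) (hone {o | Joined o D (mainLeft k m) (mainRight k m n) ∧ ∃ S, f₂.sel o = some S}))
        (le_of_le_of_eq ?_ (congrArg (2 * ·) (hone {o | ∃ S, f₂.sel o = some S ∧ Joined o D (mainLeft k m) S.verts}).symm))
      refine glue_surrounding (circuitFamily_surrounds m n _) (mainRect_subset hn) (isWeight_freeze hw _ _) hδ hδ2 ?_ ?_ ?_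
      · rintro a ⟨ha, -⟩
        rw [Set.mem_singleton_iff] at ha
        dsimp only; omega
      · rintro i ⟨hi, h1, h2⟩ -
        rw [Set.mem_singleton_iff] at hi
        rw [mem_box]; dsimp only; omega
      · intro x y hx
        exact hbd _ _ _ (notMem_annulusEdges fun h => annulus_disjoint (by omega) h hx)
    · have hzero : Pr F (freeze (fun _ => (p : ℝ)) (annulusEdges k m n (0, 0)) ξ)
          {o | (Joined o D (mainLeft k m) (mainRight k m n) ∧ ∃ S, f₂.sel o = some S) ∧ ∃ S, f₁.sel o = some S} ≤
          Pr F (freeze (fun _ => (p : ℝ)) (annulusEdges k m n (0, 0)) ξ)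
          {o | (∃ S, f₂.sel o = some S ∧ Joined o D (mainLeft k m) S.verts) ∧ ∃ S, f₁.sel o = some S} :=
        Pr_freeze_mono hw (annulusEdges_subset annulus_subset_left) fun o _ ho h => by
          have h3 := h.2
          rw [sel_eq_of_freeze f₁ ho] at h3
          exact absurd h3 hξ
      have h0 := Pr_nonneg (F := F) (E := {o | (Joined o D (mainLeft k m) (mainRight k m n) ∧ ∃ S, f₂.sel o = some S) ∧
        ∃ S, f₁.sel o = some S}) (isWeight_freeze hw (annulusEdges k m n (0, 0)) ξ)
      nlinarith
  -- Second gluing: with the edges over the right annulus frozen, $\Gamma_2$ is a fixed set, which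
  -- serves as the start of paths to the left side; these have to cross $\Gamma_1$.
  have hB : κ * Pr F (fun _ => (p : ℝ)) {o | (∃ S, f₂.sel o = some S ∧
          Joined o D (mainLeft k m) S.verts) ∧ ∃ S, f₁.sel o = some S} ≤
      2 * Pr F (fun _ => (p : ℝ)) {o | ∃ S₁ S₂, f₁.sel o = some S₁ ∧ f₂.sel o = some S₂ ∧ Joined o D S₁.verts S₂.verts} := by
    refine Pr_le_of_freeze (G := annulusEdges k m n (3 * (n : ℤ), 0)) hw (annulusEdges_subset annulus_subset_right) fun ξ _ => ?_
    have hwξ := isWeight_freeze hw (annulusEdges k m n (3 * (n : ℤ), 0)) ξ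
    by_cases hξ : ∃ S, f₂.sel ξ = some S
    · obtain ⟨S, hS⟩ := hξ
      have h1 := glue_surrounding (A := S.verts) (I := mainLeft k m) (circuitFamily_surrounds m n (0, 0)) (mainRect_subset hn) hwξ hδ hδ2 ?_ ?_ ?_
      · refine le_trans (mul_le_mul_of_nonneg_left ?_ hκ.le) (h1.trans (mul_le_mul_of_nonneg_left ?_ zero_le_two))
        · refine Pr_freeze_mono hw (annulusEdges_subset annulus_subset_right) fun o _ ho => ?_
          rintro ⟨⟨S', hS', hj⟩, h2⟩
          rw [sel_eq_of_freeze f₂ ho, hS] at hS'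
          cases hS'
          exact ⟨hj.symm, h2⟩
        · refine Pr_freeze_mono hw (annulusEdges_subset annulus_subset_right) fun o _ ho => ?_
          rintro ⟨S', hS', hj⟩
          exact ⟨S', S, hS', (sel_eq_of_freeze f₂ ho).trans hS, hj.symm⟩
      · intro a ha
        have h2 := mem_box.1 (annulus_subset _ _ _ (f₂.cols hS a ha))
        dsimp only at *; omega
      · rintro i ⟨hi, h1, h2⟩ -
        rw [Set.mem_singleton_iff] at hi
        rw [mem_box]; dsimp only; omega
      · intro x y hx
        exact hbd _ _ _ (notMem_annulusEdges (annulus_disjoint (by omega) hx))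
    · have hzero : Pr F (freeze (fun _ => (p : ℝ)) (annulusEdges k m n (3 * (n : ℤ), 0)) ξ)
          {o | (∃ S, f₂.sel o = some S ∧ Joined o D (mainLeft k m) S.verts) ∧ ∃ S, f₁.sel o = some S} ≤
          Pr F (freeze (fun _ => (p : ℝ)) (annulusEdges k m n (3 * (n : ℤ), 0)) ξ)
          {o | ∃ S₁ S₂, f₁.sel o = some S₁ ∧ f₂.sel o = some S₂ ∧ Joined o D S₁.verts S₂.verts} :=
        Pr_freeze_mono hw (annulusEdges_subset annulus_subset_right) fun o _ ho h => by
          obtain ⟨⟨S, hS, -⟩, -⟩ := h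
          rw [sel_eq_of_freeze f₂ ho] at hS
          exact absurd ⟨S, hS⟩ hξ
      have h0 := Pr_nonneg (F := F) (E := {o | (∃ S, f₂.sel o = some S ∧
        Joined o D (mainLeft k m) S.verts) ∧ ∃ S, f₁.sel o = some S}) hwξ
      nlinarith
  rw [connectionProb_eq p hn]
  have h1 : (κ / 2) ^ 2 * (crossProb k p (3 * n) (2 * m) * circuitProb k p m n ^ 2) ≤
      (κ / 2) ^ 2 * Pr F (fun _ => (p : ℝ)) {o | (Joined o D (mainLeft k m) (mainRight k m n) ∧ ∃ S, f₂.sel o = some S) ∧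
        ∃ S, f₁.sel o = some S} := mul_le_mul_of_nonneg_left hharris (by positivity)
  nlinarith

end LowerBound
end Slab

/-! ### Pieces of paths between levels, and planar crossing lemmas. -/

open Filter Topology

namespace Slab

section Paths

variable {V : Type*} {r : V → V → Prop} {D : Set V} {x y : V}

/-- A path either stays in a given set or leaves it at some vertex. -/
theorem Reach.stays_or (h : Reach r D x y) (G : Set V) :
    Reach r (D ∩ G) x y ∨ ∃ v ∈ D, v ∉ G ∧ Reach r D x v ∧ Reach r D v y := by
  refine h.head_induction (P := fun x => Reach r (D ∩ G) x y ∨ ∃ v ∈ D, v ∉ G ∧ Reach r D x v ∧ Reach r D v y)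
    (fun hy => ?_) fun a b ha hab hby ih => ?_
  · by_cases hG : y ∈ G
    · exact Or.inl (.refl ⟨hy, hG⟩)
    · exact Or.inr ⟨y, hy, hG, .refl hy, .refl hy⟩
  · by_cases hG : a ∈ G
    · rcases ih with ih | ⟨v, h1, h2, h3, h4⟩
      · exact Or.inl (Reach.head ⟨ha, hG⟩ hab ih)
      · exact Or.inr ⟨v, h1, h2, Reach.head ha hab h3, h4⟩
    · exact Or.inr ⟨a, ha, hG, .refl ha, Reach.head ha hab hby⟩

/-- A path along which a function changes by at most one per step, up to the first time at which
the function takes a given value. -/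
theorem Reach.until {f : V → ℤ} (hf : ∀ a b, r a b → f b ≤ f a + 1) (h : Reach r D x y) {c : ℤ}
    (hx : f x ≤ c) (hy : c ≤ f y) : ∃ v, f v = c ∧ Reach r (D ∩ {z | f z ≤ c}) x v ∧ Reach r D v y := by
  by_cases hxc : f x = c
  · exact ⟨x, hxc, .refl ⟨h.left_mem, hx⟩, h⟩
  rcases h.first_entry {z | c ≤ f z} hy with h1 | ⟨a, b, h1, h2, h3, h4⟩
  · have : c ≤ f x := h1
    omega
  · have ha : ¬ c ≤ f a := h1.right_mem.2
    have hb : c ≤ f b := h3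
    have hab := hf a b h2
    refine ⟨b, by omega, ?_, h4⟩
    refine Reach.tail (h1.mono_set fun z hz => ⟨hz.1, ?_⟩) h2 ⟨h4.left_mem, ?_⟩
    · have : ¬ c ≤ f z := hz.2
      change f z ≤ c
      omega
    · change f b ≤ c; omega

/-- The part of a path between the last visit to a level before the first visit to another. -/
theorem Reach.between (hr : ∀ a b, r a b → r b a) {f : V → ℤ} (hf : ∀ a b, r a b → f b ≤ f a + 1)
    (h : Reach r D x y) {a b : ℤ} (hx : f x ≤ a) (hab : a ≤ b) (hy : b ≤ f y) :
    ∃ v w, f v = a ∧ f w = b ∧ Reach r (D ∩ {z | a ≤ f z ∧ f z ≤ b}) v w ∧ Reach r D x v ∧ Reach r D w y := by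
  obtain ⟨w, hw, h1, h2⟩ := h.until hf (hx.trans hab) hy
  have hf' : ∀ u v, r u v → -f v ≤ -f u + 1 := fun u v huv => by
    have := hf v u (hr u v huv); omega
  obtain ⟨v, hv, h3, h4⟩ := (h1.symm hr).until (f := fun z => - f z) hf' (c := -a)
    (by omega) (by omega)
  refine ⟨v, w, by omega, hw, ((h3.mono_set ?_).symm hr), (h4.mono_set Set.inter_subset_left).symm hr, h2⟩
  rintro z ⟨⟨hz, hzb⟩, hza⟩
  have h5 : f z ≤ b := hzb
  have h6 : -f z ≤ -a := hza
  exact ⟨hz, by omega, h5⟩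

end Paths

section PlanarSets

/-- The rectangle `[a₀, a₁] × [b₀, b₁]`. -/
def rect (a₀ a₁ b₀ b₁ : ℤ) : Set (ℤ × ℤ) := {z | (a₀ ≤ z.1 ∧ z.1 ≤ a₁) ∧ b₀ ≤ z.2 ∧ z.2 ≤ b₁}

/-- The vertical segment `{x} × [c, d]`. -/
def vseg (x c d : ℤ) : Set (ℤ × ℤ) := {z | z.1 = x ∧ c ≤ z.2 ∧ z.2 ≤ d}

/-- The vertical line at abscissa `x`. -/
def vline (x : ℤ) : Set (ℤ × ℤ) := {z | z.1 = x}

/-- The horizontal line at ordinate `y`. -/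
def hline (y : ℤ) : Set (ℤ × ℤ) := {z | z.2 = y}

theorem mem_rect {a₀ a₁ b₀ b₁ : ℤ} {z : ℤ × ℤ} :
    z ∈ rect a₀ a₁ b₀ b₁ ↔ (a₀ ≤ z.1 ∧ z.1 ≤ a₁) ∧ b₀ ≤ z.2 ∧ z.2 ≤ b₁ := Iff.rfl

theorem mem_vseg {x c d : ℤ} {z : ℤ × ℤ} : z ∈ vseg x c d ↔ z.1 = x ∧ c ≤ z.2 ∧ z.2 ≤ d := Iff.rfl

theorem mem_vline {x : ℤ} {z : ℤ × ℤ} : z ∈ vline x ↔ z.1 = x := Iff.rfl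

theorem PAdj.fst_le (a b : ℤ × ℤ) (h : PAdj a b) : b.1 ≤ a.1 + 1 := by
  rw [pAdj_iff'] at h; omega

theorem PAdj.snd_le (a b : ℤ × ℤ) (h : PAdj a b) : b.2 ≤ a.2 + 1 := by
  rw [pAdj_iff'] at h; omega

/-- A vertical segment is connected. -/
theorem reach_vseg {x c d y y' : ℤ} (hy : c ≤ y ∧ y ≤ d) (hy' : c ≤ y' ∧ y' ≤ d) :
    Reach PAdj (vseg x c d) (x, y) (x, y') := by
  have := reach_rectangle (a₀ := x) (a₁ := x) (b₀ := c) (b₁ := d) (x := (x, y)) (y := (x, y'))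
    ⟨⟨le_rfl, le_rfl⟩, hy⟩ ⟨⟨le_rfl, le_rfl⟩, hy'⟩
  refine this.mono_set fun z hz => ?_
  obtain ⟨⟨h1, h2⟩, h3, h4⟩ := hz
  exact ⟨le_antisymm h2 h1, h3, h4⟩

/-- A horizontal segment is connected. -/
theorem reach_hseg {y c d x x' : ℤ} (hx : c ≤ x ∧ x ≤ d) (hx' : c ≤ x' ∧ x' ≤ d) :
    Reach PAdj (rect c d y y) (x, y) (x', y) := by
  have := reach_rectangle (a₀ := c) (a₁ := d) (b₀ := y) (b₁ := y) (x := (x, y)) (y := (x', y))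
    ⟨hx, ⟨le_rfl, le_rfl⟩⟩ ⟨hx', ⟨le_rfl, le_rfl⟩⟩
  exact this.mono_set fun z hz => ⟨hz.1, hz.2⟩

/-- Concatenation of two paths whose end and starting points are close. -/
theorem Reach.append {P Q : Set (ℤ × ℤ)} {x y x' y' : ℤ × ℤ} (h : Reach PAdj P x y) (h' : Reach PAdj Q x' y')
    (hyx : PAdj y x') : Reach PAdj (P ∪ Q) x y' :=
  (h.mono_set Set.subset_union_left).trans
    ((Reach.single (D := P ∪ Q) (Or.inl h.right_mem) (Or.inr h'.left_mem) hyx).trans (h'.mono_set Set.subset_union_right))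

/-- A path from the lower part of the left side of a rectangle to its upper side meets every path from
the upper part of the left side to the right side. -/
theorem corner_inter {a₀ a₁ b₀ b₁ s s' : ℤ} {P Q : Set (ℤ × ℤ)} (hP : P ⊆ rect a₀ a₁ b₀ b₁)
    (hQ : Q ⊆ rect a₀ a₁ b₀ b₁) {x y : ℤ × ℤ} (hp : Reach PAdj P (a₀, s) x) (hx : x.2 = b₁)
    (hq : Reach PAdj Q (a₀, s') y) (hy : y.1 = a₁) (hs : s ≤ s') : ∃ z ∈ P, z ∈ Q := by
  rcases hs.eq_or_lt with rfl | hs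
  · exact ⟨_, hp.left_mem, hq.left_mem⟩
  have h1 := (mem_rect.1 (hP hp.left_mem)).2
  have h2 := (mem_rect.1 (hQ hq.left_mem)).2
  dsimp only at h1 h2
  -- Both paths are prolonged into one additional column on the left, the upper one by a single
  -- point and the lower one down to the bottom. The prolongations are disjoint because `s < s'`.
  have hq' : Reach PAdj ({(a₀ - 1, s')} ∪ Q) (a₀ - 1, s') y := by
    refine (Reach.refl (Set.mem_singleton _)).append hq ?_
    rw [pAdj_iff']; dsimp only; omega
  have hp' : Reach PAdj (vseg (a₀ - 1) b₀ s ∪ P) (a₀ - 1, b₀) x := by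
    refine (reach_vseg (x := a₀ - 1) (c := b₀) (d := s) (y := b₀) (y' := s) (by omega) (by omega)).append hp ?_
    rw [pAdj_iff']; dsimp only; omega
  have key := crossing_inter (a₀ := a₀ - 1) (a₁ := a₁) (b₀ := b₀) (b₁ := b₁)
    (P := {(a₀ - 1, s')} ∪ Q) (Q := vseg (a₀ - 1) b₀ s ∪ P) ?_ ?_ hq' rfl hy hp' rfl hx
  · obtain ⟨z, hz, hz'⟩ := key
    rcases hz with hz | hz <;> rcases hz' with hz' | hz'
    · rw [Set.mem_singleton_iff] at hz
      rw [hz, mem_vseg] at hz'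
      dsimp only at hz'; omega
    · rw [Set.mem_singleton_iff] at hz
      have := mem_rect.1 (hP hz')
      rw [hz] at this; dsimp only at this; omega
    · have := mem_rect.1 (hQ hz)
      rw [mem_vseg] at hz'; omega
    · exact ⟨z, hz', hz⟩
  · rintro z (hz | hz)
    · rw [Set.mem_singleton_iff] at hz
      have := (mem_rect.1 (hP hp.left_mem)).1
      rw [hz]; dsimp only at *; omega
    · have := mem_rect.1 (hQ hz); omega
  · rintro z (hz | hz)
    · have := (mem_rect.1 (hP hp.left_mem)).1
      rw [mem_vseg] at hz; dsimp only at *; omega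
    · have := mem_rect.1 (hP hz); omega

/-- Two paths in a half plane with interlacing endpoints on its boundary line meet. -/
theorem arch_inter {a₁ b₀ b₁ s₀ s₁ e₀ e₁ : ℤ} {P Q : Set (ℤ × ℤ)} (hP : P ⊆ rect 0 a₁ b₀ b₁)
    (hQ : Q ⊆ rect 0 a₁ b₀ b₁) (hp : Reach PAdj P (0, s₀) (0, e₀)) (hq : Reach PAdj Q (0, s₁) (0, e₁))
    (h1 : s₀ ≤ s₁) (h2 : s₁ ≤ e₀) (h3 : e₀ ≤ e₁) : ∃ z ∈ P, z ∈ Q := by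
  rcases h1.eq_or_lt with rfl | h1
  · exact ⟨_, hp.left_mem, hq.left_mem⟩
  rcases h2.eq_or_lt with rfl | h2
  · exact ⟨_, hp.right_mem, hq.left_mem⟩
  rcases h3.eq_or_lt with rfl | h3
  · exact ⟨_, hp.right_mem, hq.right_mem⟩
  have g1 := mem_rect.1 (hP hp.left_mem)
  have g2 := mem_rect.1 (hQ hq.right_mem)
  have g3 := mem_rect.1 (hP hp.right_mem)
  have g4 := mem_rect.1 (hQ hq.left_mem)
  dsimp only at g1 g2 g3 g4
  -- the first path is extended to the right side below the rectangle and to the left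
  have hp' : Reach PAdj (rect (-1) a₁ (b₀ - 1) (b₀ - 1) ∪ (vseg (-1) (b₀ - 1) s₀ ∪ (P ∪ rect (-3) (-1) e₀ e₀)))
      (a₁, b₀ - 1) (-3, e₀) := by
    refine (reach_hseg (y := b₀ - 1) (c := -1) (d := a₁) (x := a₁) (x' := -1) (by omega) (by omega)).append
      ((reach_vseg (x := -1) (c := b₀ - 1) (d := s₀) (y := b₀ - 1) (y' := s₀) (by omega) (by omega)).append
      (hp.append (reach_hseg (y := e₀) (c := -3) (d := -1) (x := -1) (x' := -3) (by omega) (by omega)) ?_) ?_) ?_ <;>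
    · rw [pAdj_iff']; dsimp only; omega
  have hq' : Reach PAdj (vseg (-2) (b₀ - 1) s₁ ∪ ({(-1, s₁)} ∪ (Q ∪ vseg (-1) e₁ b₁))) (-2, b₀ - 1) (-1, b₁) := by
    refine (reach_vseg (x := -2) (c := b₀ - 1) (d := s₁) (y := b₀ - 1) (y' := s₁) (by omega) (by omega)).append
      ((Reach.refl (Set.mem_singleton _)).append
      (hq.append (reach_vseg (x := -1) (c := e₁) (d := b₁) (y := e₁) (y' := b₁) (by omega) (by omega)) ?_) ?_) ?_ <;>
    · rw [pAdj_iff']; dsimp only; omega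
  have key := crossing_inter (a₀ := -3) (a₁ := a₁) (b₀ := b₀ - 1) (b₁ := b₁) ?_ ?_
    (hp'.symm PAdj.symm) rfl rfl hq' rfl rfl
  · obtain ⟨z, hz, hz'⟩ := key
    rcases hz with hz | hz | hz | hz <;> rcases hz' with hz' | hz' | hz' | hz'
    all_goals first
      | exact ⟨z, hz, hz'⟩
      | exfalso
        try have i1 := mem_rect.1 (hP hz)
        try have i2 := mem_rect.1 (hQ hz')
        try rw [mem_rect] at hz
        try rw [mem_vseg] at hz
        try rw [mem_vseg] at hz'
        try rw [Set.mem_singleton_iff, Prod.ext_iff] at hz'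
        try dsimp only at *
        omega
  · rintro z (hz | hz | hz | hz)
    · rw [mem_rect] at hz; omega
    · rw [mem_vseg] at hz; omega
    · have := mem_rect.1 (hP hz); omega
    · rw [mem_rect] at hz; omega
  · rintro z (hz | hz | hz | hz)
    · rw [mem_vseg] at hz; omega
    · rw [Set.mem_singleton_iff, Prod.ext_iff] at hz; dsimp only at hz; omega
    · have := mem_rect.1 (hQ hz); omega
    · rw [mem_vseg] at hz; omega

end PlanarSets

/-! ### Open connections over planar sets. -/

section Planar

variable {k : ℕ}

/-- Open connection over planar sets. -/
def PJ (o : Set (Sym2 (Vertex k))) (T A B : Set (ℤ × ℤ)) : Prop := Joined o (lift k T) (lift k A) (lift k B)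

theorem PJ.mono {o : Set (Sym2 (Vertex k))} {T A B T' A' B' : Set (ℤ × ℤ)} (h : PJ o T A B) (hT : T ⊆ T')
    (hA : ∀ z ∈ T, z ∈ A → z ∈ A') (hB : ∀ z ∈ T, z ∈ B → z ∈ B') : PJ o T' A' B' := by
  obtain ⟨a, ha, b, hb, hab⟩ := h
  exact ⟨a, hA _ hab.left_mem ha, b, hB _ hab.right_mem hb, hab.mono_set fun x hx => hT hx⟩

theorem PJ.symm {o : Set (Sym2 (Vertex k))} {T A B : Set (ℤ × ℤ)} (h : PJ o T A B) : PJ o T B A :=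
  Joined.symm h

theorem isUpperSet_pj (T A B : Set (ℤ × ℤ)) : IsUpperSet {o : Set (Sym2 (Vertex k)) | PJ o T A B} :=
  isUpperSet_joined _ _ _

theorem Op.fst_le {o : Set (Sym2 (Vertex k))} (a b : Vertex k) (h : Op o a b) : b.1.1 ≤ a.1.1 + 1 :=
  PAdj.fst_le _ _ (pAdj_of_adj h.1)

theorem Op.snd_le {o : Set (Sym2 (Vertex k))} (a b : Vertex k) (h : Op o a b) : b.1.2 ≤ a.1.2 + 1 :=
  PAdj.snd_le _ _ (pAdj_of_adj h.1)

/-- A path between two vertical lines contains a path inside the strip between them. -/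
theorem PJ.between_fst {o : Set (Sym2 (Vertex k))} {T A B : Set (ℤ × ℤ)} (h : PJ o T A B) {a b : ℤ} (hab : a ≤ b)
    (hA : ∀ z ∈ T, z ∈ A → z.1 ≤ a) (hB : ∀ z ∈ T, z ∈ B → b ≤ z.1) :
    PJ o (T ∩ {z | a ≤ z.1 ∧ z.1 ≤ b}) (vline a) (vline b) := by
  obtain ⟨x, hx, y, hy, hxy⟩ := h
  obtain ⟨v, w, hv, hw, h1, -⟩ := hxy.between Op.symm (f := fun v : Vertex k => v.1.1) Op.fst_le
    (hA _ hxy.left_mem hx) hab (hB _ hxy.right_mem hy)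
  exact ⟨v, hv, w, hw, h1⟩

theorem PJ.between_snd {o : Set (Sym2 (Vertex k))} {T A B : Set (ℤ × ℤ)} (h : PJ o T A B) {a b : ℤ} (hab : a ≤ b)
    (hA : ∀ z ∈ T, z ∈ A → z.2 ≤ a) (hB : ∀ z ∈ T, z ∈ B → b ≤ z.2) :
    PJ o (T ∩ {z | a ≤ z.2 ∧ z.2 ≤ b}) (hline a) (hline b) := by
  obtain ⟨x, hx, y, hy, hxy⟩ := h
  obtain ⟨v, w, hv, hw, h1, -⟩ := hxy.between Op.symm (f := fun v : Vertex k => v.1.2) Op.snd_le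
    (hA _ hxy.left_mem hx) hab (hB _ hxy.right_mem hy)
  exact ⟨v, hv, w, hw, h1⟩

theorem lift_box_subset {M : ℕ} {T : Set (ℤ × ℤ)} (h : T ⊆ box M (0, 0)) :
    edgesIn (lift k T) ⊆ boxEdges k M := edgesIn_subset_boxEdges fun _ hx => h hx

theorem dependsOnly_pj (T A B : Set (ℤ × ℤ)) :
    DependsOnly (edgesIn (lift k T)) {o : Set (Sym2 (Vertex k)) | PJ o T A B} := dependsOnly_joined _ _ _

/-- Invariance under planar isometries. -/
theorem Pr_pj {σ : (ℤ × ℤ) ≃ (ℤ × ℤ)} (hσ : IsPlanarIsometry σ) {p : ℝ} {M : ℕ} {T A B T' A' B' : Set (ℤ × ℤ)}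
    (hT : T ⊆ box M (0, 0)) (hT' : T' ⊆ box M (0, 0)) (h1 : ∀ z, σ z ∈ T' ↔ z ∈ T)
    (h2 : ∀ z ∈ T, σ z ∈ A' ↔ z ∈ A) (h3 : ∀ z ∈ T, σ z ∈ B' ↔ z ∈ B) :
    Pr (boxEdges k M) (fun _ => p) {o | PJ o T' A' B'} = Pr (boxEdges k M) (fun _ => p) {o | PJ o T A B} := by
  have himg : σ '' T = T' := by
    ext z
    constructor
    · rintro ⟨w, hw, rfl⟩; exact (h1 w).2 hw
    · intro hz
      refine ⟨σ.symm z, (h1 _).1 ?_, ?_⟩ <;> simp [hz]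
  have h := Pr_joined_vmap (k := k) (p := p) hσ (F := boxEdges k M) (G := boxEdges k M) (D := lift k T) (A := lift k A) (B := lift k B)
    (lift_box_subset hT) (by rw [vmap_image_lift, himg]; exact lift_box_subset hT')
  rw [vmap_image_lift, vmap_image_lift, vmap_image_lift, himg] at h
  rw [show {o : Set (Sym2 (Vertex k)) | PJ o T A B} = {o | Joined o (lift k T) (lift k A) (lift k B)} from rfl, ← h]
  refine Pr_congr fun o _ => ⟨fun h => h.mono subset_rfl ?_ ?_, fun h => PJ.mono h subset_rfl ?_ ?_⟩
  · intro z hz hA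
    obtain ⟨w, rfl⟩ := σ.surjective z
    exact ⟨w, (h2 w ((h1 w).1 hz)).1 hA, rfl⟩
  · intro z hz hB
    obtain ⟨w, rfl⟩ := σ.surjective z
    exact ⟨w, (h3 w ((h1 w).1 hz)).1 hB, rfl⟩
  · rintro _ hz ⟨w, hw, rfl⟩
    exact (h2 w ((h1 w).1 hz)).2 hw
  · rintro _ hz ⟨w, hw, rfl⟩
    exact (h3 w ((h1 w).1 hz)).2 hw

/-- The reflection of the plane that reverses the first coordinate. -/
def flipFst (a : ℤ) : (ℤ × ℤ) ≃ (ℤ × ℤ) := (Equiv.subLeft a).prodCongr (Equiv.refl _)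

/-- The reflection of the plane that reverses the second coordinate. -/
def flipSnd (a : ℤ) : (ℤ × ℤ) ≃ (ℤ × ℤ) := (Equiv.refl _).prodCongr (Equiv.subLeft a)

theorem flipFst_apply (a : ℤ) (z : ℤ × ℤ) : flipFst a z = (a - z.1, z.2) := rfl

theorem flipSnd_apply (a : ℤ) (z : ℤ × ℤ) : flipSnd a z = (z.1, a - z.2) := rfl

theorem swap_apply (z : ℤ × ℤ) : Equiv.prodComm ℤ ℤ z = (z.2, z.1) := rfl

theorem isPlanarIsometry_flipFst (a : ℤ) : IsPlanarIsometry (flipFst a) := by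
  intro z w; simp only [flipFst_apply]; ring

theorem isPlanarIsometry_flipSnd (a : ℤ) : IsPlanarIsometry (flipSnd a) := by
  intro z w; simp only [flipSnd_apply]; ring

theorem isPlanarIsometry_swap : IsPlanarIsometry (Equiv.prodComm ℤ ℤ) := by
  intro z w; simp only [swap_apply]; ring

/-- Gluing two paths whose projections have to meet. -/
theorem glue_planar {p δ : ℝ} (hδ : 0 < δ) (hδ' : δ ≤ 1 / 2) (hp : δ ≤ p ∧ p ≤ 1 - δ) {M : ℕ}
    {T A I T' A' B' : Set (ℤ × ℤ)} (hT : T ⊆ box M (0, 0))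
    (hx : ∀ P Q : Set (ℤ × ℤ), P ⊆ T → Q ⊆ T' → ∀ a ∈ A, ∀ i ∈ I, Reach PAdj P a i →
      ∀ a' ∈ A', ∀ b' ∈ B', Reach PAdj Q a' b' → ∃ z ∈ P, z ∈ Q) :
    δ ^ (10 * (k + 1) ^ 2) * (Pr (boxEdges k M) (fun _ => p) {o | PJ o T A I} *
      Pr (boxEdges k M) (fun _ => p) {o | PJ o T' A' B'}) ≤
      2 * Pr (boxEdges k M) (fun _ => p) {o | PJ o (T ∪ T') A A'} := by
  have hq : IsWeight fun _ : Sym2 (Vertex k) => p := fun _ => ⟨by linarith, by linarith⟩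
  have hC : lift k T' ⊆ lift k T' := subset_rfl
  have h1 := glue (pathFamily T' (lift k T') (lift k A') (lift k B') hC) (D := lift k T) (A := lift k A)
    (I := lift k I) (F := boxEdges k M) hq hδ hδ' ((finite_lift_box M (0, 0)).subset fun x hx => hT hx)
    boxEdges_subset (fun a ha _ v hv => by rw [mem_lift, hv]; exact ha) ?_ ?_ (fun _ _ _ _ _ _ => hp)
  · refine le_trans (mul_le_mul_of_nonneg_left ?_ (by positivity)) (h1.trans (mul_le_mul_of_nonneg_left ?_ zero_le_two))
    · refine (Pr_mul_le_Pr_inter hq (isUpperSet_pj T A I) (isUpperSet_pj T' A' B')).trans (Pr_mono hq ?_)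
      rintro o - ⟨h2, h3⟩
      exact ⟨h2, pathFamily_isSome.2 h3⟩
    · refine Pr_mono hq ?_
      rintro o - ⟨S, hS, hj⟩
      exact (Joined.of_path hS hj).1
  · rintro o S hS Λ hΛ ⟨a, ha, i, hi, hai⟩
    obtain ⟨g1, g2, ⟨a', ha', haS⟩, ⟨b', hb', hbS⟩, g3⟩ := pathFamily_mem hS
    have h4 := ((g3 a' haS b' hbS).mono (fun _ _ _ _ h => h.1) subset_rfl).fst_inter
    obtain ⟨z, ⟨x, hx, hxz⟩, ⟨y, hy, hyz⟩⟩ := hx (Prod.fst '' Λ) (Prod.fst '' S.verts)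
      (by rintro _ ⟨x, hx, rfl⟩; exact hΛ hx) (by rintro _ ⟨x, hx, rfl⟩; exact g1 hx)
      _ ha _ hi hai.fst_inter _ ha' _ hb' h4
    exact ⟨x, hx, y, hy, hxz.trans hyz.symm, fun j => (hΛ hx : x.1 ∈ T)⟩
  · intro x y _ hxy hx hadj
    have h1 : s(x, y) ∈ (boxEdges k M : Set (Sym2 (Vertex k))) := by
      rw [coe_boxEdges, mem_edgesIn]
      exact ⟨hadj, hT (hx x.2), mem_lift.2 (hxy ▸ hT (hx x.2))⟩
    exact h1

end Planar

/-! ### Events of high or positive probability along an ultrafilter. -/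

section Limits

variable {ι : Type*} (𝒰 : Ultrafilter ℕ) (F : ℕ → Finset ι) (q : ℕ → ι → ℝ)

/-- The probability of the event tends to one along the ultrafilter. -/
def Whp (E : ℕ → Set (Set ι)) : Prop := Tendsto (fun i => Pr (F i) (q i) (E i)) 𝒰 (𝓝 1)

/-- The probability of the event is at least `c` along the ultrafilter. -/
def Pos (c : ℝ) (E : ℕ → Set (Set ι)) : Prop := ∀ᶠ i in 𝒰, c ≤ Pr (F i) (q i) (E i)

variable {𝒰 F q} {E E' : ℕ → Set (Set ι)}

theorem whp_iff (hq : ∀ i, IsWeight (q i)) :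
    Whp 𝒰 F q E ↔ ∀ η > (0 : ℝ), ∀ᶠ i in 𝒰, 1 - η ≤ Pr (F i) (q i) (E i) := by
  constructor
  · intro h η hη
    exact (h.eventually (lt_mem_nhds (show 1 - η < 1 by linarith))).mono fun i hi => hi.le
  · intro h
    rw [Whp, Metric.tendsto_nhds]
    intro η hη
    filter_upwards [h (η / 2) (by linarith)] with i hi
    have := Pr_le_one (F := F i) (E := E i) (hq i)
    rw [Real.dist_eq, abs_lt]
    constructor <;> linarith

theorem Whp.of_le {F' : ℕ → Finset ι} {q' : ℕ → ι → ℝ} (h : Whp 𝒰 F q E) (hq : ∀ i, IsWeight (q i))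
    (hq' : ∀ i, IsWeight (q' i)) (hE : ∀ᶠ i in 𝒰, Pr (F i) (q i) (E i) ≤ Pr (F' i) (q' i) (E' i)) : Whp 𝒰 F' q' E' := by
  rw [whp_iff hq] at h
  rw [whp_iff hq']
  intro η hη
  filter_upwards [h η hη, hE] with i h1 h2 using h1.trans h2

theorem Whp.mono' (hq : ∀ i, IsWeight (q i)) (h : Whp 𝒰 F q E)
    (hE : ∀ᶠ i in 𝒰, Pr (F i) (q i) (E i) ≤ Pr (F i) (q i) (E' i)) : Whp 𝒰 F q E' := h.of_le hq hq hE

theorem Whp.mono (hq : ∀ i, IsWeight (q i)) (h : Whp 𝒰 F q E) (hE : ∀ᶠ i in 𝒰, ∀ ω ∈ E i, ω ∈ E' i) :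
    Whp 𝒰 F q E' :=
  h.mono' hq (hE.mono fun i hi => Pr_mono (hq i) fun ω _ => hi ω)

theorem Whp.inter (hq : ∀ i, IsWeight (q i)) (h : Whp 𝒰 F q E) (h' : Whp 𝒰 F q E') :
    Whp 𝒰 F q fun i => E i ∩ E' i := by
  rw [whp_iff hq] at h h' ⊢
  intro η hη
  filter_upwards [h (η / 2) (by linarith), h' (η / 2) (by linarith)] with i h1 h2
  have h3 := Pr_union_le (F := F i) (E := (E i)ᶜ) (E' := (E' i)ᶜ) (hq i)
  rw [← Set.compl_inter, Pr_compl, Pr_compl, Pr_compl] at h3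
  linarith

theorem Whp.pos (hq : ∀ i, IsWeight (q i)) (h : Whp 𝒰 F q E) {c : ℝ} (hc : c < 1) : Pos 𝒰 F q c E := by
  have := (whp_iff hq).1 h (1 - c) (by linarith)
  simpa [Pos] using this

/-- Square root trick. -/
theorem Whp.or (hq : ∀ i, IsWeight (q i)) (hE : ∀ i, IsUpperSet (E i)) (hE' : ∀ i, IsUpperSet (E' i))
    (h : Whp 𝒰 F q fun i => E i ∪ E' i) : Whp 𝒰 F q E ∨ Whp 𝒰 F q E' := by
  by_contra! hcon
  obtain ⟨h1, h2⟩ := hcon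
  rw [whp_iff hq] at h h1 h2
  -- Along an ultrafilter what does not hold eventually fails eventually, so both failures and the
  -- hypothesis hold at a common index.
  push Not at h1 h2
  obtain ⟨η, hη, h1⟩ := h1
  obtain ⟨η', hη', h2⟩ := h2
  obtain ⟨i, g1, g2, g3⟩ := (h1.and (h2.and (h (η * η' / 2) (by positivity)))).exists
  have g4 := sqrt_trick (F := F i) (hq i) (hE i) (hE' i)
  nlinarith

theorem Whp.exists_fin (hq : ∀ i, IsWeight (q i)) (N : ℕ) {A : ℕ → ℕ → Set (Set ι)}
    (hA : ∀ j i, IsUpperSet (A j i)) (h : Whp 𝒰 F q fun i => ⋃ j ∈ Finset.range N, A j i) :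
    ∃ j < N, Whp 𝒰 F q (A j) := by
  induction N with
  | zero =>
    simp only [Finset.range_zero, Finset.notMem_empty, Set.iUnion_of_empty, Set.iUnion_empty] at h
    have h0 : ∀ i, Pr (F i) (q i) (∅ : Set (Set ι)) = 0 := fun i => by simp [Pr, Ex]
    simp only [Whp, h0] at h
    exact absurd (tendsto_nhds_unique h tendsto_const_nhds) one_ne_zero
  | succ N ih =>
    have h1 : Whp 𝒰 F q fun i => A N i ∪ ⋃ j ∈ Finset.range N, A j i := by
      simpa only [Finset.range_add_one, Finset.set_biUnion_insert] using h
    rcases h1.or hq (hA N) (fun i => isUpperSet_iUnion₂ fun j _ => hA j i) with h2 | h2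
    · exact ⟨N, Nat.lt_succ_self N, h2⟩
    · obtain ⟨j, hj, h3⟩ := ih h2
      exact ⟨j, hj.trans (Nat.lt_succ_self N), h3⟩

theorem Pos.mono' {c c' : ℝ} (h : Pos 𝒰 F q c E) (hc : c' ≤ c)
    (hE : ∀ᶠ i in 𝒰, Pr (F i) (q i) (E i) ≤ Pr (F i) (q i) (E' i)) : Pos 𝒰 F q c' E' := by
  filter_upwards [h, hE] with i h1 h2 using hc.trans (h1.trans h2)

theorem Pos.or (hq : ∀ i, IsWeight (q i)) {c : ℝ} (h : Pos 𝒰 F q c fun i => E i ∪ E' i) :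
    Pos 𝒰 F q (c / 2) E ∨ Pos 𝒰 F q (c / 2) E' := by
  by_contra! hcon
  obtain ⟨h1, h2⟩ := hcon
  unfold Pos at h1 h2
  rw [← Ultrafilter.eventually_not] at h1 h2
  obtain ⟨i, g1, g2, g3⟩ := (h1.and (h2.and h)).exists
  have := Pr_union_le (F := F i) (E := E i) (E' := E' i) (hq i)
  push Not at g1 g2
  linarith

theorem Pos.exists_fin (hq : ∀ i, IsWeight (q i)) {c : ℝ} (hc : 0 < c) {N : ℕ} {A : ℕ → ℕ → Set (Set ι)}
    (h : Pos 𝒰 F q c fun i => ⋃ j ∈ Finset.range N, A j i) : ∃ j < N, Pos 𝒰 F q (c / N) (A j) := by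
  by_contra! hcon
  have h1 : ∀ j ∈ Finset.range N, ∀ᶠ i in 𝒰, Pr (F i) (q i) (A j i) < c / N := by
    intro j hj
    have h2 := hcon j (Finset.mem_range.1 hj)
    unfold Pos at h2
    rw [← Ultrafilter.eventually_not] at h2
    exact h2.mono fun i hi => not_le.1 hi
  obtain ⟨i, g1, g2⟩ := (h.and ((Filter.eventually_all_finset _).2 h1)).exists
  have g3 := Pr_iUnion_le (F := F i) (hq i) (Finset.range N) fun j => A j i
  rcases Nat.eq_zero_or_pos N with rfl | hN
  · have g4 : Pr (F i) (q i) (⋃ j ∈ Finset.range 0, A j i) ≤ 0 := g3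
    have g5 : c ≤ Pr (F i) (q i) (⋃ j ∈ Finset.range 0, A j i) := g1
    linarith
  · have g4 : ∑ j ∈ Finset.range N, Pr (F i) (q i) (A j i) < ∑ j ∈ Finset.range N, c / N :=
      Finset.sum_lt_sum_of_nonempty ⟨0, Finset.mem_range.2 hN⟩ g2
    rw [Finset.sum_const, Finset.card_range, nsmul_eq_mul, mul_div_cancel₀ _ (by positivity)] at g4
    linarith

end Limits
end Slab

/-! ### Crossing probabilities, and pairs of paths with neighbouring projections. -/

namespace Slab

section Crossings

variable {k : ℕ}

/-- The probability of a crossing from left to right of a rectangle. -/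
noncomputable def cr (k : ℕ) (p : ℝ) (M : ℕ) (a b : ℤ) : ℝ :=
  Pr (boxEdges k M) (fun _ => p) {o | PJ o (rect 0 a 0 b) (vline 0) (vline a)}

theorem rect_subset_box {M : ℕ} {a₀ a₁ b₀ b₁ : ℤ} (h1 : -(M : ℤ) ≤ a₀) (h2 : a₁ ≤ M) (h3 : -(M : ℤ) ≤ b₀)
    (h4 : b₁ ≤ M) : rect a₀ a₁ b₀ b₁ ⊆ box M (0, 0) := by
  intro z hz
  rw [mem_rect] at hz
  rw [mem_box]
  dsimp only
  omega

theorem Pr_hcross_eq {p : ℝ} {M : ℕ} {a₀ a₁ b₀ b₁ : ℤ} (h1 : -(M : ℤ) ≤ a₀) (h2 : a₁ ≤ M) (h3 : -(M : ℤ) ≤ b₀)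
    (h4 : b₁ ≤ M) (h5 : a₁ - a₀ ≤ M) (h6 : b₁ - b₀ ≤ M) :
    Pr (boxEdges k M) (fun _ => p) {o | PJ o (rect a₀ a₁ b₀ b₁) (vline a₀) (vline a₁)} =
      cr k p M (a₁ - a₀) (b₁ - b₀) := by
  refine Pr_pj (isPlanarIsometry_shift (a₀, b₀)) (rect_subset_box (by omega) (by omega) (by omega) (by omega))
    (rect_subset_box h1 h2 h3 h4) ?_ ?_ ?_
  all_goals
    intro z
    simp only [shift_apply, mem_rect, mem_vline]
    omega

theorem Pr_vcross_eq {p : ℝ} {M : ℕ} {a₀ a₁ b₀ b₁ : ℤ} (h1 : -(M : ℤ) ≤ a₀) (h2 : a₁ ≤ M) (h3 : -(M : ℤ) ≤ b₀)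
    (h4 : b₁ ≤ M) (h5 : a₁ - a₀ ≤ M) (h6 : b₁ - b₀ ≤ M) :
    Pr (boxEdges k M) (fun _ => p) {o | PJ o (rect a₀ a₁ b₀ b₁) (hline b₀) (hline b₁)} =
      cr k p M (b₁ - b₀) (a₁ - a₀) := by
  rw [← Pr_hcross_eq (k := k) (p := p) (M := M) (a₀ := b₀) (a₁ := b₁) (b₀ := a₀) (b₁ := a₁) h3 h4 h1 h2 h6 h5]
  refine Pr_pj isPlanarIsometry_swap (rect_subset_box (by omega) (by omega) (by omega) (by omega))
    (rect_subset_box h1 h2 h3 h4) ?_ ?_ ?_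
  · intro z
    simp only [swap_apply, mem_rect]
    omega
  · exact fun z _ => Iff.rfl
  · exact fun z _ => Iff.rfl

theorem cr_mono {p : ℝ} (hp : 0 ≤ p ∧ p ≤ 1) {M : ℕ} {a b a' b' : ℤ} (ha' : 0 ≤ a') (ha : a' ≤ a) (hb : b ≤ b') :
    cr k p M a b ≤ cr k p M a' b' := by
  refine Pr_mono (fun _ => hp) fun o _ h => ?_
  refine (PJ.between_fst h ha' (fun z _ h => le_of_eq h) (fun z _ (h : z.1 = a) => ?_)).mono ?_ (fun _ _ h => h) (fun _ _ h => h)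
  · omega
  · rintro z ⟨hz, h1⟩
    have h1 : 0 ≤ z.1 ∧ z.1 ≤ a' := h1
    rw [mem_rect] at hz ⊢
    omega

/-- Two open paths whose end points have close projections. -/
def Broken (o : Set (Sym2 (Vertex k))) (T T' A B : Set (ℤ × ℤ)) : Prop :=
  ∃ x y : Vertex k, (∃ a ∈ lift k A, Reach (Op o) (lift k T) a x) ∧
    (∃ b ∈ lift k B, Reach (Op o) (lift k T') b y) ∧ PAdj x.1 y.1

/-- The vertices that are joined to `A` inside `D`. -/
def clusterOf (o : Set (Sym2 (Vertex k))) (D A : Set (Vertex k)) : Set (Vertex k) :=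
  {x | ∃ a ∈ A, Reach (Op o) D a x}

theorem clusterOf_subset (o : Set (Sym2 (Vertex k))) (D A : Set (Vertex k)) : clusterOf o D A ⊆ D := by
  rintro x ⟨a, -, h⟩; exact h.right_mem

theorem reach_clusterOf {o : Set (Sym2 (Vertex k))} {D A : Set (Vertex k)} {x y : Vertex k}
    (hx : x ∈ clusterOf o D A) (h : Reach (Op o) D x y) : Reach (Op o) (clusterOf o D A) x y := by
  obtain ⟨a, ha, hax⟩ := hx
  refine h.induction (P := fun y => Reach (Op o) (clusterOf o D A) x y) (fun _ => .refl ⟨a, ha, hax⟩) ?_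
  intro b c hb ih hbc hc
  exact ih.tail hbc ⟨a, ha, (hax.trans hb).tail hbc hc⟩

/-- The exploration of a cluster only queries edges that touch the cluster. -/
theorem clusterOf_congr {o o' : Set (Sym2 (Vertex k))} {D A : Set (Vertex k)}
    (h : ∀ x ∈ clusterOf o D A, ∀ y ∈ D, s(x, y) ∈ o ↔ s(x, y) ∈ o') : clusterOf o' D A = clusterOf o D A := by
  refine Set.Subset.antisymm ?_ ?_
  · rintro x ⟨a, ha, hax⟩
    refine hax.induction (P := fun x => x ∈ clusterOf o D A) (fun haD => ⟨a, ha, .refl haD⟩) ?_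
    rintro b c - hb hbc hc
    obtain ⟨a', ha', h1⟩ := hb
    exact ⟨a', ha', h1.tail ⟨hbc.1, (h b ⟨a', ha', h1⟩ c hc).2 hbc.2⟩ hc⟩
  · rintro x ⟨a, ha, hax⟩
    have h1 : a ∈ clusterOf o D A := ⟨a, ha, .refl hax.left_mem⟩
    have h2 := reach_clusterOf h1 hax
    exact ⟨a, ha, h2.mono (fun b c hb hc hbc => ⟨hbc.1, (h b hb c (clusterOf_subset _ _ _ hc)).1 hbc.2⟩)
      (clusterOf_subset _ _ _)⟩

/-- Given the cluster, everything over the columns that it does not visit is still independent of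
it. -/
theorem dependsOnly_clusterOf (D A K : Set (Vertex k)) :
    DependsOnly {e | ∃ x ∈ K, x ∈ e} {o : Set (Sym2 (Vertex k)) | clusterOf o D A = K} := by
  intro o o' h ho
  have ho : clusterOf o D A = K := ho
  change clusterOf o' D A = K
  rw [← ho]
  refine clusterOf_congr fun x hx y _ => ?_
  have h1 : s(x, y) ∈ o ∩ {e | ∃ x ∈ K, x ∈ e} ↔ s(x, y) ∈ o' ∩ {e | ∃ x ∈ K, x ∈ e} := by rw [h]
  have h2 : s(x, y) ∈ {e : Sym2 (Vertex k) | ∃ x ∈ K, x ∈ e} := ⟨x, ho ▸ hx, Sym2.mem_mk_left x y⟩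
  simpa only [Set.mem_inter_iff, h2, and_true] using h1

theorem Pr_empty {ι : Type*} {F : Finset ι} {q : ι → ℝ} : Pr F q ∅ = 0 := by simp [Pr, Ex]

/-- The lowest cluster from the left to the right of a rectangle is likely to be approached by
a path from above. -/
theorem broken_prob {p : ℝ} (hp : 0 ≤ p ∧ p ≤ 1) {M : ℕ} {a b₀ b₁ h c d : ℤ} {s : ℝ} (ha : 0 ≤ a)
    (haM : 2 * a ≤ M) (hb₀ : -(M : ℤ) ≤ b₀) (hh : h ≤ M) (hbh : b₁ < h) (hs : 0 ≤ s)
    (hTB : 1 - Pr (boxEdges k M) (fun _ => p) {o | PJ o (rect 0 (2 * a) b₀ h) (hline b₀) (hline h)} ≤ s ^ 2) :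
    Pr (boxEdges k M) (fun _ => p) {o | PJ o (rect 0 a b₀ b₁) (vseg 0 c d) (vline a)} * (1 - s) ≤
      Pr (boxEdges k M) (fun _ => p) {o | Broken o (rect 0 a b₀ b₁) (rect 0 (2 * a) b₀ h) (vseg 0 c d) (hline h)} := by
  have hq : IsWeight fun _ : Sym2 (Vertex k) => p := fun _ => hp
  set D := lift k (rect 0 a b₀ b₁) with hD
  set A := lift k (vseg 0 c d) with hA
  have hDfin : D.Finite := (finite_lift_box M (0, 0)).subset fun x hx =>
    rect_subset_box (by omega) (by omega) hb₀ (by omega) hx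
  -- The probabilities are decomposed according to the cluster of the segment, as in the exploration
  -- of a lowest crossing.
  have hX : ∀ E : Set (Set (Sym2 (Vertex k))), Pr (boxEdges k M) (fun _ => p) E =
      ∑ K ∈ hDfin.finite_subsets.toFinset, Pr (boxEdges k M) (fun _ => p) (E ∩ {o | clusterOf o D A = K}) := fun E =>
    sum_Pr_fiber _ (fun o => clusterOf o D A) fun o _ _ => by
      rw [Set.Finite.mem_toFinset]; exact clusterOf_subset o D A
  rw [hX {o | PJ o (rect 0 a b₀ b₁) (vseg 0 c d) (vline a)},
    hX {o | Broken o (rect 0 a b₀ b₁) (rect 0 (2 * a) b₀ h) (vseg 0 c d) (hline h)}, Finset.sum_mul]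
  refine Finset.sum_le_sum fun K _ => ?_
  by_cases hK : ∃ o, PJ o (rect 0 a b₀ b₁) (vseg 0 c d) (vline a) ∧ clusterOf o D A = K
  swap
  · have : {o : Set (Sym2 (Vertex k)) | PJ o (rect 0 a b₀ b₁) (vseg 0 c d) (vline a)} ∩ {o | clusterOf o D A = K} = ∅ :=
      Set.eq_empty_iff_forall_notMem.2 fun o ho => hK ⟨o, ho⟩
    rw [this, Pr_empty, zero_mul]
    exact Pr_nonneg hq
  obtain ⟨o₀, ⟨x₀, hx₀, y₀, hy₀, h₀⟩, hK₀⟩ := hK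
  obtain ⟨P, hPdef⟩ : ∃ P : Set (ℤ × ℤ), P = Prod.fst '' K := ⟨_, rfl⟩
  have hKD : K ⊆ D := hK₀ ▸ clusterOf_subset o₀ D A
  have hPrect : P ⊆ rect 0 a b₀ b₁ := by
    rw [hPdef]; rintro _ ⟨v, hv, rfl⟩; exact hKD hv
  have hPx : Reach PAdj P x₀.1 y₀.1 := by
    rw [hPdef, ← hK₀]
    exact ((reach_clusterOf ⟨x₀, hx₀, .refl h₀.left_mem⟩ h₀).mono (fun _ _ _ _ h => h.1) subset_rfl).fst_inter
  -- The projection of the cluster joins the left side to the line at abscissa `a`. Together with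
  -- its mirror image in this line it crosses the rectangle of double width from left to right.
  set ρ := flipFst (2 * a) with hρ
  have hρρ : ∀ z, ρ (ρ z) = z := fun z => Prod.ext (by simp [hρ, flipFst_apply]) rfl
  have hPx' : Reach PAdj (ρ ⁻¹' P) (ρ x₀.1) (ρ y₀.1) := by
    refine hPx.induction (P := fun y => Reach PAdj (ρ ⁻¹' P) (ρ x₀.1) (ρ y)) (fun h => .refl ?_) ?_
    · rw [Set.mem_preimage, hρρ]; exact h
    · intro u v _ ih huv hv
      refine ih.tail ?_ (by rw [Set.mem_preimage, hρρ]; exact hv)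
      rw [pAdj_iff'] at huv ⊢
      simp only [hρ, flipFst_apply]; omega
  have hy₀ρ : ρ y₀.1 = y₀.1 := Prod.ext (by
    have : y₀.1.1 = a := hy₀
    simp only [hρ, flipFst_apply]; omega) rfl
  have hW : Reach PAdj (P ∪ ρ ⁻¹' P) x₀.1 (ρ x₀.1) := by
    refine hPx.append (hPx'.symm PAdj.symm) ?_
    rw [hy₀ρ, pAdj_iff']; exact Or.inl ⟨rfl, rfl⟩
  have hWrect : ∀ z ∈ P ∪ ρ ⁻¹' P, 0 ≤ z.1 ∧ z.1 ≤ 2 * a ∧ b₀ ≤ z.2 ∧ z.2 ≤ b₁ := by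
    rintro z (hz | hz)
    · have := mem_rect.1 (hPrect hz); omega
    · have := mem_rect.1 (hPrect hz)
      simp only [hρ, flipFst_apply] at this; omega
  -- The part of the wide rectangle off the columns of the cluster and of their mirror images.
  -- Excluding both makes it symmetric.
  set off := rect 0 (2 * a) b₀ h \ (P ∪ ρ ⁻¹' P) with hoff
  have hoffbox : off ⊆ box M (0, 0) :=
    Set.sdiff_subset.trans (rect_subset_box (by omega) (by omega) (by omega) (by omega))
  set V : Set (Set (Sym2 (Vertex k))) := {o | PJ o off (hline h) {z | ∃ z' ∈ P, PAdj z z'}} with hV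
  set V' : Set (Set (Sym2 (Vertex k))) := {o | PJ o off (hline h) {z | ∃ z' ∈ ρ ⁻¹' P, PAdj z z'}} with hV'
  have hadjρ : ∀ z w : ℤ × ℤ, PAdj (ρ z) (ρ w) ↔ PAdj z w := by
    intro z w
    rw [pAdj_iff', pAdj_iff']; simp only [hρ, flipFst_apply]; omega
  have hVV' : Pr (boxEdges k M) (fun _ => p) V' = Pr (boxEdges k M) (fun _ => p) V := by
    refine Pr_pj (isPlanarIsometry_flipFst (2 * a)) hoffbox hoffbox ?_ ?_ ?_
    · intro z
      simp only [hoff, Set.mem_sdiff, Set.mem_union, Set.mem_preimage, ← hρ, hρρ, mem_rect]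
      have h1 : (ρ z).1 = 2 * a - z.1 := rfl
      have h2 : (ρ z).2 = z.2 := rfl
      rw [h1, h2]
      have h3 : (0 ≤ 2 * a - z.1 ∧ 2 * a - z.1 ≤ 2 * a) ↔ (0 ≤ z.1 ∧ z.1 ≤ 2 * a) := by omega
      rw [h3, or_comm]
    · intro z _; exact Iff.rfl
    · intro z _
      constructor
      · rintro ⟨z', hz', hadj⟩
        refine ⟨ρ z', hz', ?_⟩
        rw [← hadjρ, hρρ]; exact hadj
      · rintro ⟨z', hz', hadj⟩
        refine ⟨ρ z', by rw [Set.mem_preimage, hρρ]; exact hz', ?_⟩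
        rw [← hρ, hadjρ]; exact hadj
  -- A crossing between top and bottom, followed from the top, comes next to the cluster or to its
  -- mirror image before it touches one of their columns. By symmetry and the square root trick it
  -- is the cluster with probability at least $1-s$.
  have hTBV : Pr (boxEdges k M) (fun _ => p) {o | PJ o (rect 0 (2 * a) b₀ h) (hline b₀) (hline h)} ≤
      Pr (boxEdges k M) (fun _ => p) (V ∪ V') := by
    refine Pr_mono hq ?_
    rintro o - ⟨x, hx, y, hy, hxy⟩
    have hxW : ∃ u w, Reach (Op o) (lift k off) y u ∧ Op o u w ∧ w.1 ∈ P ∪ ρ ⁻¹' P := by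
      rcases (hxy.symm Op.symm).stays_or {v | v.1 ∉ P ∪ ρ ⁻¹' P} with h1 | ⟨v, hv, hvW, h1, -⟩
      · exfalso
        have h2 : Reach PAdj off y.1 x.1 :=
          ((h1.mono (fun _ _ _ _ h => h.1) subset_rfl).fst_inter).mono_set (by
            rintro _ ⟨v, ⟨hv1, hv2⟩, rfl⟩; exact ⟨hv1, hv2⟩)
        have h3 : x₀.1.1 = 0 := hx₀.1
        obtain ⟨z, hz, hz'⟩ := crossing_inter (a₀ := 0) (a₁ := 2 * a) (b₀ := b₀) (b₁ := h)
          (fun z hz => by have := hWrect z hz; omega)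
          (fun z (hz : z ∈ off) => by have := mem_rect.1 hz.1; omega) hW h3
          (show 2 * a - x₀.1.1 = 2 * a by omega) (h2.symm PAdj.symm) hx hy
        exact hz'.2 hz
      · have hvW : v.1 ∈ P ∪ ρ ⁻¹' P := not_not.1 hvW
        rcases h1.first_entry {v | v.1 ∈ P ∪ ρ ⁻¹' P} hvW with h2 | ⟨u, w, h2, h3, h4, -⟩
        · exfalso
          have h3 : y.1.2 = h := hy
          have := hWrect _ h2
          omega
        · exact ⟨u, w, h2, h3, h4⟩
    obtain ⟨u, w, h1, h2, h3⟩ := hxW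
    rcases h3 with h3 | h3
    · exact Or.inl ⟨y, hy, u, ⟨w.1, h3, pAdj_of_adj h2.1⟩, h1⟩
    · exact Or.inr ⟨y, hy, u, ⟨w.1, h3, pAdj_of_adj h2.1⟩, h1⟩
  have hVs : 1 - s ≤ Pr (boxEdges k M) (fun _ => p) V := by
    have h1 := sqrt_trick (F := boxEdges k M) hq (isUpperSet_pj (k := k) off (hline h) {z | ∃ z' ∈ P, PAdj z z'})
      (isUpperSet_pj (k := k) off (hline h) {z | ∃ z' ∈ ρ ⁻¹' P, PAdj z z'})
    change (1 - Pr (boxEdges k M) (fun _ => p) V) * (1 - Pr (boxEdges k M) (fun _ => p) V') ≤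
      1 - Pr (boxEdges k M) (fun _ => p) (V ∪ V') at h1
    rw [hVV'] at h1
    by_contra! hcon
    nlinarith
  -- The value of the cluster is decided by edges that touch it; the approach from above uses only
  -- edges over other columns.
  have hind : Pr (boxEdges k M) (fun _ => p) ({o | clusterOf o D A = K} ∩ V) =
      Pr (boxEdges k M) (fun _ => p) {o | clusterOf o D A = K} * Pr (boxEdges k M) (fun _ => p) V := by
    refine Pr_inter_of_disjoint (dependsOnly_clusterOf D A K) (dependsOnly_pj off _ _) ?_
    rw [Set.disjoint_left]
    rintro e ⟨x, hx, hxe⟩ ⟨-, he⟩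
    exact (he x hxe).2 (Or.inl (by rw [hPdef]; exact Set.mem_image_of_mem _ hx))
  have hK0 : 0 ≤ Pr (boxEdges k M) (fun _ => p) {o | clusterOf o D A = K} := Pr_nonneg hq
  have hle : Pr (boxEdges k M) (fun _ => p) ({o | clusterOf o D A = K} ∩ V) ≤ Pr (boxEdges k M) (fun _ => p)
      ({o | Broken o (rect 0 a b₀ b₁) (rect 0 (2 * a) b₀ h) (vseg 0 c d) (hline h)} ∩ {o | clusterOf o D A = K}) := by
    refine Pr_mono hq ?_
    rintro o - ⟨h1, ⟨y, hy, u, ⟨z, hz, huz⟩, hyu⟩⟩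
    refine ⟨?_, h1⟩
    rw [hPdef] at hz
    obtain ⟨w, hw, rfl⟩ := hz
    have hw' : w ∈ clusterOf o D A := by rw [show clusterOf o D A = K from h1]; exact hw
    obtain ⟨a', ha', haw⟩ := hw'
    exact ⟨w, u, ⟨a', ha', haw⟩, ⟨y, hy, hyu.mono_set fun v hv => hv.1⟩, PAdj.symm _ _ huz⟩
  refine le_trans ?_ hle
  rw [hind]
  have h1 : Pr (boxEdges k M) (fun _ => p) ({o | PJ o (rect 0 a b₀ b₁) (vseg 0 c d) (vline a)} ∩ {o | clusterOf o D A = K}) ≤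
      Pr (boxEdges k M) (fun _ => p) {o | clusterOf o D A = K} := Pr_mono hq fun o _ h => h.2
  by_cases hs1 : s ≤ 1
  · exact mul_le_mul h1 hVs (by linarith) hK0
  · refine le_trans ?_ (mul_nonneg hK0 (Pr_nonneg hq))
    have := Pr_nonneg (F := boxEdges k M) (E := {o | PJ o (rect 0 a b₀ b₁) (vseg 0 c d) (vline a)} ∩ {o | clusterOf o D A = K}) hq
    push Not at hs1
    nlinarith

/-- Shapes made of two connected pieces with close projections. -/
def brokenShapes (k : ℕ) (T T' A B : Set (ℤ × ℤ)) : Set (Shape k) :=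
  {S | S.edges ⊆ edgesIn S.verts ∧ ∃ V V' : Set (Vertex k), S.verts = V ∪ V' ∧ V ⊆ lift k T ∧ V' ⊆ lift k T' ∧
    (∀ x ∈ V, ∀ y ∈ V, Reach (Op S.edges) V x y) ∧ (∀ x ∈ V', ∀ y ∈ V', Reach (Op S.edges) V' x y) ∧
    (∃ a ∈ lift k A, a ∈ V) ∧ (∃ b ∈ lift k B, b ∈ V') ∧ ∃ x ∈ V, ∃ y ∈ V', PAdj x.1 y.1}

theorem brokenShapes_of_broken {o : Set (Sym2 (Vertex k))} {T T' A B : Set (ℤ × ℤ)} (h : Broken o T T' A B) :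
    ∃ S ∈ brokenShapes k T T' A B, S.edges ⊆ o := by
  obtain ⟨x, y, ⟨a, ha, hax⟩, ⟨b, hb, hby⟩, hxy⟩ := h
  set V := {x | Reach (Op o) (lift k T) a x}
  set V' := {x | Reach (Op o) (lift k T') b x}
  have key : ∀ (D : Set (Vertex k)) (W : Set (Vertex k)) (c x : Vertex k), {x | Reach (Op o) D c x} ⊆ W →
      Reach (Op o) D c x → Reach (Op (o ∩ edgesIn W)) {x | Reach (Op o) D c x} c x := by
    intro D W c x hW hx
    refine hx.induction (P := fun x => Reach (Op (o ∩ edgesIn W)) {x | Reach (Op o) D c x} c x)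
      (fun hc => .refl (Reach.refl hc)) fun u v hu ih huv hv => ?_
    exact ih.tail ⟨huv.1, huv.2, mem_edgesIn.2 ⟨huv.1, hW hu, hW (hu.tail huv hv)⟩⟩ (hu.tail huv hv)
  refine ⟨⟨V ∪ V', o ∩ edgesIn (V ∪ V')⟩, ⟨Set.inter_subset_right, V, V', rfl, fun _ h => Reach.right_mem h,
    fun _ h => Reach.right_mem h, fun u hu v hv => ?_, fun u hu v hv => ?_, ⟨a, ha, .refl hax.left_mem⟩,
    ⟨b, hb, .refl hby.left_mem⟩, x, hax, y, hby, hxy⟩, Set.inter_subset_left⟩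
  · exact ((key _ _ _ _ Set.subset_union_left hu).symm Op.symm).trans (key _ _ _ _ Set.subset_union_left hv)
  · exact ((key _ _ _ _ Set.subset_union_right hu).symm Op.symm).trans (key _ _ _ _ Set.subset_union_right hv)

/-- The family of the broken paths. -/
noncomputable def brokenFamily (k : ℕ) (T T' A B : Set (ℤ × ℤ)) : Family k (T ∪ T') :=
  Family.ofShapes (T ∪ T') (brokenShapes k T T' A B) (by
    rintro S ⟨-, V, V', hS, hV, hV', -⟩ x hx
    rw [hS] at hx
    exact hx.imp (fun h => hV h) (fun h => hV' h)) fun S hS => hS.1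

/-- Gluing a path to a broken path. -/
theorem glue_broken {p δ : ℝ} (hδ : 0 < δ) (hδ' : δ ≤ 1 / 2) (hp : δ ≤ p ∧ p ≤ 1 - δ) {M : ℕ}
    {D A I T T' A' B' : Set (ℤ × ℤ)} (hD : D ⊆ box M (0, 0)) (hT : T ∪ T' ⊆ D)
    (hx : ∀ P Q : Set (ℤ × ℤ), P ⊆ D → Q ⊆ D → ∀ a ∈ A, ∀ i ∈ I, Reach PAdj P a i →
      ∀ a' ∈ A', ∀ b' ∈ B', Reach PAdj Q a' b' → ∃ z ∈ P, z ∈ Q) :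
    δ ^ (10 * (k + 1) ^ 2) * Pr (boxEdges k M) (fun _ => p) ({o | PJ o D A I} ∩ {o | Broken o T T' A' B'}) ≤
      2 * Pr (boxEdges k M) (fun _ => p) ({o | PJ o D A A'} ∪ {o | PJ o D A B'}) := by
  have hq : IsWeight fun _ : Sym2 (Vertex k) => p := fun _ => ⟨by linarith, by linarith⟩
  have h1 := glue (brokenFamily k T T' A' B') (D := lift k D) (A := lift k A)
    (I := lift k I) (F := boxEdges k M) hq hδ hδ' ((finite_lift_box M (0, 0)).subset fun x hx => hD hx)
    boxEdges_subset (fun a ha _ v hv => by rw [mem_lift, hv]; exact ha) ?_ ?_ (fun _ _ _ _ _ _ => hp)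
  · refine le_trans (mul_le_mul_of_nonneg_left ?_ (by positivity)) (h1.trans (mul_le_mul_of_nonneg_left ?_ zero_le_two))
    · refine Pr_mono hq ?_
      rintro o - ⟨h2, h3⟩
      obtain ⟨S, hS, hSo⟩ := brokenShapes_of_broken h3
      exact ⟨h2, exists_leastShape hS hSo⟩
    · refine Pr_mono hq ?_
      rintro o - ⟨S, hS, a, ha, x, hx, hax⟩
      obtain ⟨⟨g1, V, V', g2, g3, g4, g5, g6, ⟨a', ha', haV⟩, ⟨b', hb', hbV⟩, -⟩, hSo⟩ := (leastShape_mem hS).1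
      rw [g2] at hx
      rcases hx with hx | hx
      · exact Or.inl ⟨a, ha, a', ha', hax.trans ((g5 x hx a' haV).mono (fun _ _ _ _ => Op.mono hSo)
          fun v hv => hT (Or.inl (g3 hv)))⟩
      · exact Or.inr ⟨a, ha, b', hb', hax.trans ((g6 x hx b' hbV).mono (fun _ _ _ _ => Op.mono hSo)
          fun v hv => hT (Or.inr (g4 hv)))⟩
  · rintro o S hS Λ hΛ ⟨a, ha, i, hi, hai⟩
    obtain ⟨⟨g1, V, V', g2, g3, g4, g5, g6, ⟨a', ha', haV⟩, ⟨b', hb', hbV⟩, x, hxV, y, hyV, hxy⟩, hSo⟩ := (leastShape_mem hS).1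
    have h4 := (((g5 a' haV x hxV).mono (fun _ _ _ _ h => h.1) subset_rfl).fst_inter).append
      (((g6 y hyV b' hbV).mono (fun _ _ _ _ h => h.1) subset_rfl).fst_inter) hxy
    obtain ⟨z, ⟨v, hv, hvz⟩, hz⟩ := hx (Prod.fst '' Λ) (Prod.fst '' V ∪ Prod.fst '' V')
      (by rintro _ ⟨x, hx, rfl⟩; exact hΛ hx)
      (by rintro _ (⟨x, hx, rfl⟩ | ⟨x, hx, rfl⟩)
          · exact hT (Or.inl (g3 hx))
          · exact hT (Or.inr (g4 hx)))
      _ ha _ hi hai.fst_inter _ ha' _ hb' h4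
    have hz' : ∃ w ∈ S.verts, w.1 = z := by
      rw [g2]
      rcases hz with ⟨w, hw, rfl⟩ | ⟨w, hw, rfl⟩
      · exact ⟨w, Or.inl hw, rfl⟩
      · exact ⟨w, Or.inr hw, rfl⟩
    obtain ⟨w, hw, hwz⟩ := hz'
    exact ⟨v, hv, w, hw, hvz.trans hwz.symm, fun j => (hΛ hv : v.1 ∈ D)⟩
  · intro x y _ hxy hx hadj
    have h1 : s(x, y) ∈ (boxEdges k M : Set (Sym2 (Vertex k))) := by
      rw [coe_boxEdges, mem_edgesIn]
      exact ⟨hadj, hD (hx x.2), mem_lift.2 (hxy ▸ hD (hx x.2))⟩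
    exact h1

end Crossings
end Slab

/-! ### Crossings at a given length scale: almost squares, chords and broken paths. -/

namespace Slab

/-- A sequence of homogeneous percolation models in boxes, with a length scale. -/
structure Scale (δ : ℝ) where
  p : ℕ → ℝ
  M : ℕ → ℕ
  u : ℕ → ℕ
  pos : 0 < δ
  le_half : δ ≤ 1 / 2
  hp : ∀ i, δ ≤ p i ∧ p i ≤ 1 - δ
  hu : ∀ i, 1 ≤ u i
  hM : ∀ i, 1000 * u i ≤ M i

namespace Scale

variable {k : ℕ} {δ : ℝ} (X : Scale δ) (𝒰 : Ultrafilter ℕ)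

/-- The event has high probability at the given scale. -/
def W (E : ℤ → Set (Set (Sym2 (Vertex k)))) : Prop :=
  Whp 𝒰 (fun i => boxEdges k (X.M i)) (fun i _ => X.p i) fun i => E (X.u i)

/-- The event has probability at least `c` at the given scale. -/
def Q (c : ℝ) (E : ℤ → Set (Set (Sym2 (Vertex k)))) : Prop :=
  Pos 𝒰 (fun i => boxEdges k (X.M i)) (fun i _ => X.p i) c fun i => E (X.u i)

/-- The second event is more likely at all scales. -/
def Dom (E E' : ℤ → Set (Set (Sym2 (Vertex k)))) : Prop :=
  ∀ (p : ℝ) (M : ℕ) (U : ℤ), 0 ≤ p ∧ p ≤ 1 → 1 ≤ U → 1000 * U ≤ M →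
    Pr (boxEdges k M) (fun _ => p) (E U) ≤ Pr (boxEdges k M) (fun _ => p) (E' U)

variable {X 𝒰} {E E' : ℤ → Set (Set (Sym2 (Vertex k)))}

theorem unit (X : Scale δ) (i : ℕ) : 0 ≤ X.p i ∧ X.p i ≤ 1 :=
  ⟨X.pos.le.trans (X.hp i).1, (X.hp i).2.trans (by linarith [X.pos])⟩

theorem isWeight (X : Scale δ) : ∀ i, IsWeight (fun _ : Sym2 (Vertex k) => X.p i) := fun i _ => X.unit i

theorem one_le (X : Scale δ) (i : ℕ) : (1 : ℤ) ≤ X.u i := by exact_mod_cast X.hu i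

theorem le_M (X : Scale δ) (i : ℕ) : 1000 * (X.u i : ℤ) ≤ X.M i := by exact_mod_cast X.hM i

theorem dom_of_subset (h : ∀ U, 1 ≤ U → E U ⊆ E' U) : Dom E E' :=
  fun _ _ U hp hU _ => Pr_mono (fun _ => hp) fun _ _ ho => h U hU ho

theorem W.dom (h : X.W 𝒰 E) (hE : Dom E E') : X.W 𝒰 E' :=
  Whp.mono' X.isWeight h (Eventually.of_forall fun i => hE _ _ _ (X.unit i) (X.one_le i) (X.le_M i))

theorem Q.dom {c : ℝ} (h : X.Q 𝒰 c E) (hE : Dom E E') : X.Q 𝒰 c E' :=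
  Pos.mono' h le_rfl (Eventually.of_forall fun i => hE _ _ _ (X.unit i) (X.one_le i) (X.le_M i))

theorem Q.le {c c' : ℝ} (h : X.Q 𝒰 c E) (hc : c' ≤ c) : X.Q 𝒰 c' E :=
  Pos.mono' h hc (Eventually.of_forall fun _ => le_rfl)

theorem W.or (hE : ∀ U, IsUpperSet (E U)) (hE' : ∀ U, IsUpperSet (E' U)) (h : X.W 𝒰 fun U => E U ∪ E' U) :
    X.W 𝒰 E ∨ X.W 𝒰 E' :=
  Whp.or X.isWeight (fun _ => hE _) (fun _ => hE' _) h

theorem W.inter (h : X.W 𝒰 E) (h' : X.W 𝒰 E') : X.W 𝒰 fun U => E U ∩ E' U :=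
  Whp.inter X.isWeight h h'

theorem W.exists_fin {N : ℕ} {A : ℕ → ℤ → Set (Set (Sym2 (Vertex k)))} (hA : ∀ j U, IsUpperSet (A j U))
    (h : X.W 𝒰 fun U => ⋃ j ∈ Finset.range N, A j U) : ∃ j < N, X.W 𝒰 (A j) :=
  Whp.exists_fin (A := fun j i => A j (X.u i)) X.isWeight N (fun j _ => hA j _) h

theorem Q.exists_fin {N : ℕ} {c : ℝ} (hc : 0 < c) {A : ℕ → ℤ → Set (Set (Sym2 (Vertex k)))}
    (h : X.Q 𝒰 c fun U => ⋃ j ∈ Finset.range N, A j U) : ∃ j < N, X.Q 𝒰 (c / N) (A j) :=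
  Pos.exists_fin (A := fun j i => A j (X.u i)) X.isWeight hc h

theorem Q.or {c : ℝ} (h : X.Q 𝒰 c fun U => E U ∪ E' U) : X.Q 𝒰 (c / 2) E ∨ X.Q 𝒰 (c / 2) E' :=
  Pos.or X.isWeight h

theorem W.q (h : X.W 𝒰 E) : X.Q 𝒰 (1 / 2) E := Whp.pos X.isWeight h (by norm_num)

/-- The left-right crossing of `[0, a] × [0, b]`. -/
def hEvent (k : ℕ) (a b : ℤ → ℤ) (U : ℤ) : Set (Set (Sym2 (Vertex k))) :=
  {o | PJ o (rect 0 (a U) 0 (b U)) (vline 0) (vline (a U))}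

theorem dom_h {a b x₀ x₁ y₀ y₁ : ℤ → ℤ} (h : ∀ U, 1 ≤ U → (x₀ U ≤ x₁ U ∧ x₁ U - x₀ U ≤ a U ∧ b U ≤ y₁ U - y₀ U) ∧
    -(500 * U) ≤ x₀ U ∧ x₁ U ≤ 500 * U ∧ -(500 * U) ≤ y₀ U ∧ y₁ U ≤ 500 * U) :
    Dom (hEvent k a b) fun U => {o | PJ o (rect (x₀ U) (x₁ U) (y₀ U) (y₁ U)) (vline (x₀ U)) (vline (x₁ U))} := by
  intro p M U hp hU hM
  have h1 := h U hU
  rw [Pr_hcross_eq (by omega) (by omega) (by omega) (by omega) (by omega) (by omega)]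
  exact cr_mono hp (by omega) (by omega) (by omega)

theorem dom_v {a b x₀ x₁ y₀ y₁ : ℤ → ℤ} (h : ∀ U, 1 ≤ U → (y₀ U ≤ y₁ U ∧ y₁ U - y₀ U ≤ a U ∧ b U ≤ x₁ U - x₀ U) ∧
    -(500 * U) ≤ x₀ U ∧ x₁ U ≤ 500 * U ∧ -(500 * U) ≤ y₀ U ∧ y₁ U ≤ 500 * U) :
    Dom (hEvent k a b) fun U => {o | PJ o (rect (x₀ U) (x₁ U) (y₀ U) (y₁ U)) (hline (y₀ U)) (hline (y₁ U))} := by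
  intro p M U hp hU hM
  have h1 := h U hU
  rw [Pr_vcross_eq (by omega) (by omega) (by omega) (by omega) (by omega) (by omega)]
  exact cr_mono hp (by omega) (by omega) (by omega)

theorem dom_of_v {a b x₀ x₁ y₀ y₁ : ℤ → ℤ} (h : ∀ U, 1 ≤ U → (0 ≤ a U ∧ a U ≤ y₁ U - y₀ U ∧ x₁ U - x₀ U ≤ b U) ∧
    -(500 * U) ≤ x₀ U ∧ x₁ U ≤ 500 * U ∧ -(500 * U) ≤ y₀ U ∧ y₁ U ≤ 500 * U) :
    Dom (fun U => {o | PJ o (rect (x₀ U) (x₁ U) (y₀ U) (y₁ U)) (hline (y₀ U)) (hline (y₁ U))}) (hEvent k a b) := by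
  intro p M U hp hU hM
  have h1 := h U hU
  rw [Pr_vcross_eq (by omega) (by omega) (by omega) (by omega) (by omega) (by omega)]
  exact cr_mono hp (by omega) (by omega) (by omega)

theorem dom_of_h {a b x₀ x₁ y₀ y₁ : ℤ → ℤ} (h : ∀ U, 1 ≤ U → (0 ≤ a U ∧ a U ≤ x₁ U - x₀ U ∧ y₁ U - y₀ U ≤ b U) ∧
    -(500 * U) ≤ x₀ U ∧ x₁ U ≤ 500 * U ∧ -(500 * U) ≤ y₀ U ∧ y₁ U ≤ 500 * U) :
    Dom (fun U => {o | PJ o (rect (x₀ U) (x₁ U) (y₀ U) (y₁ U)) (vline (x₀ U)) (vline (x₁ U))}) (hEvent k a b) := by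
  intro p M U hp hU hM
  have h1 := h U hU
  rw [Pr_hcross_eq (by omega) (by omega) (by omega) (by omega) (by omega) (by omega)]
  exact cr_mono hp (by omega) (by omega) (by omega)

/-- A wide rectangle that is likely to be crossed contains a narrower one with the same property. -/
theorem hEvent_step {a b : ℤ → ℤ} (h : ∀ U, 1 ≤ U → 0 ≤ a U ∧ a U + 2 * U ≤ b U ∧ b U ≤ 500 * U)
    (hW : X.W 𝒰 (hEvent k a b)) :
    X.W 𝒰 (hEvent k a fun U => b U - U) ∨ X.W 𝒰 (hEvent k (fun U => b U - 2 * U) a) := by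
  set E₁ : ℤ → Set (Set (Sym2 (Vertex k))) := fun U => {o | PJ o (rect 0 (a U) 0 (b U - U)) (vline 0) (vline (a U))}
  set E₂ : ℤ → Set (Set (Sym2 (Vertex k))) := fun U => {o | PJ o (rect 0 (a U) U (b U)) (vline 0) (vline (a U))}
  set E₃ : ℤ → Set (Set (Sym2 (Vertex k))) := fun U =>
    {o | PJ o (rect 0 (a U) U (b U - U)) (hline U) (hline (b U - U))}
  -- A crossing avoids the top layer of thickness $U$, or avoids the bottom one, or visits both and
  -- thereby crosses vertically the strip between them. The square root trick makes one of these
  -- likely.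
  have key : X.W 𝒰 fun U => E₁ U ∪ (E₂ U ∪ E₃ U) := by
    refine hW.dom (dom_of_subset fun U hU => ?_)
    have hU' := h U hU
    rintro o ⟨x, hx, y, hy, hxy⟩
    rcases hxy.stays_or {v | v.1.2 ≤ b U - U} with h1 | ⟨v, hv, hvb, h1, -⟩
    · refine Or.inl ⟨x, hx, y, hy, h1.mono_set ?_⟩
      rintro z ⟨hz, hz'⟩
      exact ⟨hz.1, hz.2.1, hz'⟩
    rcases hxy.stays_or {v | U ≤ v.1.2} with h2 | ⟨w, hw, hwb, h2, -⟩
    · refine Or.inr (Or.inl ⟨x, hx, y, hy, h2.mono_set ?_⟩)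
      rintro z ⟨hz, hz'⟩
      exact ⟨hz.1, hz', hz.2.2⟩
    refine Or.inr (Or.inr ?_)
    have hv' : ¬ v.1.2 ≤ b U - U := hvb
    have hw' : ¬ U ≤ w.1.2 := hwb
    have h3 : PJ o (rect 0 (a U) 0 (b U)) {w.1} {v.1} := ⟨w, rfl, v, rfl, (h2.symm Op.symm).trans h1⟩
    refine (h3.between_snd (a := U) (b := b U - U) (by omega) ?_ ?_).mono ?_ (fun _ _ h => h) (fun _ _ h => h)
    · rintro z - hz; rw [Set.mem_singleton_iff] at hz; rw [hz]; omega
    · rintro z - hz; rw [Set.mem_singleton_iff] at hz; rw [hz]; omega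
    · rintro z ⟨hz, hz'⟩
      exact ⟨hz.1, hz'⟩
  rcases key.or (fun U => isUpperSet_pj _ _ _) (fun U => (isUpperSet_pj _ _ _).union (isUpperSet_pj _ _ _)) with h1 | h1
  · exact Or.inl h1
  rcases h1.or (fun U => isUpperSet_pj _ _ _) (fun U => isUpperSet_pj _ _ _) with h1 | h1
  · refine Or.inl (h1.dom (dom_of_h (x₀ := fun _ => 0) (x₁ := a) (y₀ := fun U => U) (y₁ := b) fun U hU => ?_))
    have := h U hU
    omega
  · refine Or.inr (h1.dom (dom_of_v (x₀ := fun _ => 0) (x₁ := a) (y₀ := fun U => U) (y₁ := fun U => b U - U) fun U hU => ?_))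
    have := h U hU
    omega

theorem hEvent_mono {a b a' b' : ℤ → ℤ} (h : ∀ U, 1 ≤ U → 0 ≤ a' U ∧ a' U ≤ a U ∧ b U ≤ b' U ∧ a U ≤ 500 * U ∧ b' U ≤ 500 * U)
    (hW : X.W 𝒰 (hEvent k a b)) : X.W 𝒰 (hEvent k a' b') := by
  refine hW.dom (dom_h (x₀ := fun _ => 0) (x₁ := a') (y₀ := fun _ => 0) (y₁ := b') fun U hU => ?_)
  have := h U hU
  omega

/-- Crossings of rectangles that are almost squares. -/
theorem hEvent_narrow {w : ℕ} (hw : w ≤ 200) (b : ℕ) (hb : w + 1 ≤ b) (hb' : b ≤ 500)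
    (hW : X.W 𝒰 (hEvent k (fun U => w * U) fun U => b * U)) :
    X.W 𝒰 (hEvent k (fun U => w * U) fun U => (w + 1) * U) := by
  induction b, hb using Nat.le_induction with
  | base => simpa using hW
  | succ b hb ih =>
    have hcast : (w : ℤ) + 1 ≤ b := by exact_mod_cast hb
    have hcast' : (b : ℤ) + 1 ≤ 500 := by exact_mod_cast hb'
    have hw' : (w : ℤ) ≤ 200 := by exact_mod_cast hw
    have hw0 : (0 : ℤ) ≤ w := by positivity
    -- In the second alternative the vertical crossing has length $(b+1)U-2U\ge wU$ within width
    -- $wU$, which is already better than required.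
    rcases hEvent_step (fun U hU => ⟨by positivity, by push_cast; nlinarith, by push_cast; nlinarith⟩) hW with h1 | h1
    · refine ih (by omega) (hEvent_mono (fun U hU => ⟨by positivity, le_rfl, ?_, by nlinarith, by nlinarith⟩) h1)
      push_cast; nlinarith
    · refine hEvent_mono (fun U hU => ⟨by positivity, ?_, ?_, ?_, ?_⟩) h1
      · push_cast; nlinarith
      · nlinarith
      · push_cast; nlinarith
      · nlinarith

/-- Chords from a unit bin of the left side to the right side. -/
theorem chord (hW : X.W 𝒰 (hEvent k (fun U => 40 * U) fun U => 41 * U)) :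
    X.W 𝒰 fun U => {o : Set (Sym2 (Vertex k)) | PJ o (rect 0 (40 * U) (-37 * U) (24 * U)) (vseg 0 (3 * U) (4 * U)) (vline (40 * U))} := by
  -- The left side has $41$ bins of length $U$; the upper end point is counted in the last bin.
  have h1 : X.W 𝒰 fun U => ⋃ j ∈ Finset.range 41, {o : Set (Sym2 (Vertex k)) |
      PJ o (rect 0 (40 * U) 0 (41 * U)) (vseg 0 (j * U) ((j + 1) * U)) (vline (40 * U))} := by
    refine hW.dom (dom_of_subset fun U hU => ?_)
    rintro o ⟨x, hx, y, hy, hxy⟩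
    have h2 : 0 ≤ x.1.2 ∧ x.1.2 ≤ 41 * U := (mem_rect.1 hxy.left_mem).2
    have hx0 : x.1.1 = 0 := hx
    have h3 : x.1.2 / U * U ≤ x.1.2 := Int.ediv_mul_le _ (by omega)
    have h4 : x.1.2 < (x.1.2 / U + 1) * U := Int.lt_ediv_add_one_mul_self _ (by omega)
    have h5 : 0 ≤ x.1.2 / U := Int.ediv_nonneg h2.1 (by omega)
    have h6 : x.1.2 / U ≤ 41 := by
      by_contra! hcon
      nlinarith
    obtain ⟨j, hj⟩ := Int.eq_ofNat_of_zero_le h5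
    rw [hj] at h3 h4 h6
    by_cases hj41 : j = 41
    · simp only [Set.mem_iUnion]
      refine ⟨40, by simp, x, ⟨hx0, ?_, ?_⟩, y, hy, hxy⟩
      · rw [hj41] at h3; push_cast at *; omega
      · push_cast; omega
    · simp only [Set.mem_iUnion]
      exact ⟨j, Finset.mem_range.2 (by omega), x, ⟨hx0, h3, h4.le⟩, y, hy, hxy⟩
  obtain ⟨j, hj, h2⟩ := h1.exists_fin fun j U => isUpperSet_pj _ _ _
  have hj' : (j : ℤ) ≤ 40 := by omega
  refine h2.dom ?_
  intro p M U hp hU hM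
  have hjU : (j : ℤ) * U ≤ 40 * U := by nlinarith
  have hjU0 : 0 ≤ (j : ℤ) * U := by positivity
  -- The bin is moved to $[3U,4U]$ by a translation if it is in the upper half and by a reflection
  -- otherwise. In both cases the rectangle stays below height $24U$, hence below the level $28U$
  -- reached by the broken path.
  rcases le_or_gt (20 : ℤ) j with h3 | h3
  · have h3U : 20 * U ≤ j * U := by nlinarith
    refine le_trans (Pr_pj (T' := rect 0 (40 * U) ((3 - j) * U) ((44 - j) * U)) (A' := vseg 0 (3 * U) (4 * U))
      (B' := vline (40 * U)) (isPlanarIsometry_shift (0, (3 - j) * U))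
      (rect_subset_box (by omega) (by omega) (by omega) (by omega))
      (rect_subset_box (by omega) (by omega) ?_ ?_) ?_ ?_ ?_).symm.le (Pr_mono (fun _ => hp) fun o _ h => h.mono ?_ (fun _ _ h => h) (fun _ _ h => h))
    · rw [sub_mul]; omega
    · rw [sub_mul]; omega
    · intro z; simp only [shift_apply, mem_rect, sub_mul]; omega
    · intro z _; simp only [shift_apply, mem_vseg, sub_mul, add_mul]; omega
    · intro z _; simp only [shift_apply, mem_vline]; omega
    · intro z hz; simp only [mem_rect, sub_mul] at *; omega
  · have h3U : j * U ≤ 19 * U := by nlinarith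
    refine le_trans (Pr_pj (T' := rect 0 (40 * U) ((j - 37) * U) ((4 + j) * U)) (A' := vseg 0 (3 * U) (4 * U))
      (B' := vline (40 * U)) (isPlanarIsometry_flipSnd ((4 + j) * U))
      (rect_subset_box (by omega) (by omega) (by omega) (by omega))
      (rect_subset_box (by omega) (by omega) ?_ ?_) ?_ ?_ ?_).symm.le (Pr_mono (fun _ => hp) fun o _ h => h.mono ?_ (fun _ _ h => h) (fun _ _ h => h))
    · rw [sub_mul]; omega
    · rw [add_mul]; omega
    · intro z; simp only [flipSnd_apply, mem_rect, sub_mul, add_mul]; omega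
    · intro z _; simp only [flipSnd_apply, mem_vseg, add_mul]; omega
    · intro z _; simp only [flipSnd_apply, mem_vline]
    · intro z hz; simp only [mem_rect, sub_mul, add_mul] at *; omega

/-- A broken path from the lower part of the left side to the top. -/
theorem broken (h20 : X.W 𝒰 (hEvent k (fun U => 20 * U) fun U => 21 * U))
    (h39 : X.W 𝒰 (hEvent k (fun U => 39 * U) fun U => 40 * U)) :
    X.W 𝒰 fun U => {o : Set (Sym2 (Vertex k)) | Broken o (rect 0 (20 * U) (-11 * U) (11 * U)) (rect 0 (2 * (20 * U)) (-11 * U) (28 * U))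
      (vseg 0 (-11 * U) 0) (hline (28 * U))} := by
  -- The rectangle is symmetric under a reflection that exchanges the halves of its left side, so
  -- each half is very likely to be the origin of a crossing.
  have h1 : X.W 𝒰 fun U => {o : Set (Sym2 (Vertex k)) | PJ o (rect 0 (20 * U) (-11 * U) (11 * U)) (vseg 0 (-11 * U) 0) (vline (20 * U))} := by
    have h2 : X.W 𝒰 fun U => {o : Set (Sym2 (Vertex k)) | PJ o (rect 0 (20 * U) (-11 * U) (11 * U)) (vseg 0 (-11 * U) 0) (vline (20 * U))} ∪
        {o : Set (Sym2 (Vertex k)) | PJ o (rect 0 (20 * U) (-11 * U) (11 * U)) (vseg 0 0 (11 * U)) (vline (20 * U))} := by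
      have h3 : X.W 𝒰 fun U => {o : Set (Sym2 (Vertex k)) | PJ o (rect 0 (20 * U) (-11 * U) (11 * U)) (vline 0) (vline (20 * U))} :=
        h20.dom (dom_h (x₀ := fun _ => 0) (x₁ := fun U => 20 * U) (y₀ := fun U => -11 * U) (y₁ := fun U => 11 * U)
          fun U hU => by omega)
      refine h3.dom (dom_of_subset fun U hU => ?_)
      rintro o ⟨x, hx, y, hy, hxy⟩
      have h2 := (mem_rect.1 hxy.left_mem).2
      rcases le_total x.1.2 0 with h4 | h4
      · exact Or.inl ⟨x, ⟨hx, h2.1, h4⟩, y, hy, hxy⟩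
      · exact Or.inr ⟨x, ⟨hx, h4, h2.2⟩, y, hy, hxy⟩
    rcases h2.or (fun U => isUpperSet_pj _ _ _) (fun U => isUpperSet_pj _ _ _) with h3 | h3
    · exact h3
    · refine h3.dom fun p M U hp hU hM => le_of_eq (Pr_pj (isPlanarIsometry_flipSnd 0)
        (rect_subset_box (by omega) (by omega) (by omega) (by omega))
        (rect_subset_box (by omega) (by omega) (by omega) (by omega)) ?_ ?_ ?_).symm
      · intro z; simp only [flipSnd_apply, mem_rect]; omega
      · intro z _; simp only [flipSnd_apply, mem_vseg]; omega
      · intro z _; simp only [flipSnd_apply, mem_vline]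
  have h2 : X.W 𝒰 fun U => {o : Set (Sym2 (Vertex k)) | PJ o (rect 0 (2 * (20 * U)) (-11 * U) (28 * U)) (hline (-11 * U)) (hline (28 * U))} :=
    h39.dom (dom_v (x₀ := fun _ => 0) (x₁ := fun U => 2 * (20 * U)) (y₀ := fun U => -11 * U) (y₁ := fun U => 28 * U)
      fun U hU => by omega)
  unfold W at h1 h2 ⊢
  rw [whp_iff X.isWeight] at h1 h2 ⊢
  intro η hη
  filter_upwards [h1 (η / 2) (by linarith), h2 ((η / 2) ^ 2) (by positivity)] with i g1 g2
  have hU := X.one_le i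
  have hM := X.le_M i
  have g3 := broken_prob (k := k) (X.unit i) (M := X.M i) (a := 20 * (X.u i : ℤ)) (b₀ := -11 * (X.u i : ℤ)) (b₁ := 11 * (X.u i : ℤ))
    (h := 28 * (X.u i : ℤ)) (c := -11 * (X.u i : ℤ)) (d := 0) (s := η / 2) (by omega) (by omega) (by omega) (by omega) (by omega)
    (by linarith) (by linarith)
  refine le_trans ?_ g3
  have g4 := Pr_le_one (F := boxEdges k (X.M i)) (E := {o | PJ o (rect 0 (20 * (X.u i : ℤ)) (-11 * X.u i) (11 * X.u i)) (vseg 0 (-11 * X.u i) 0) (vline (20 * X.u i))}) (X.isWeight i)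
  rcases le_total (η / 2) 1 with h5 | h5
  · nlinarith
  · have g6 := Pr_nonneg (F := boxEdges k (X.M i)) (E := {o | PJ o (rect 0 (20 * (X.u i : ℤ)) (-11 * X.u i) (11 * X.u i)) (vseg 0 (-11 * X.u i) 0) (vline (20 * X.u i))}) (X.isWeight i)
    nlinarith

end Scale
end Slab

/-! ### From chords to arches, and to crossings in the long direction. -/

namespace Slab
namespace Scale

variable {k : ℕ} {δ : ℝ} {X : Scale δ} {𝒰 : Ultrafilter ℕ}

theorem rect_mono {a₀ a₁ b₀ b₁ a₀' a₁' b₀' b₁' : ℤ} (h : a₀' ≤ a₀ ∧ a₁ ≤ a₁' ∧ b₀' ≤ b₀ ∧ b₁ ≤ b₁') :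
    rect a₀ a₁ b₀ b₁ ⊆ rect a₀' a₁' b₀' b₁' :=
  fun _ hz => ⟨⟨h.1.trans hz.1.1, hz.1.2.trans h.2.1⟩, h.2.2.1.trans hz.2.1, hz.2.2.trans h.2.2.2⟩

theorem Q.glue {c c' : ℝ} (hc : 0 ≤ c) (hc' : 0 ≤ c') {T A I T' A' B' : ℤ → Set (ℤ × ℤ)}
    (h : X.Q 𝒰 c fun U => {o : Set (Sym2 (Vertex k)) | PJ o (T U) (A U) (I U)})
    (h' : X.Q 𝒰 c' fun U => {o : Set (Sym2 (Vertex k)) | PJ o (T' U) (A' U) (B' U)})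
    (hT : ∀ U, 1 ≤ U → T U ⊆ rect (-(1000 * U)) (1000 * U) (-(1000 * U)) (1000 * U))
    (hx : ∀ U, 1 ≤ U → ∀ P Q : Set (ℤ × ℤ), P ⊆ T U → Q ⊆ T' U → ∀ a ∈ A U, ∀ i ∈ I U, Reach PAdj P a i →
      ∀ a' ∈ A' U, ∀ b' ∈ B' U, Reach PAdj Q a' b' → ∃ z ∈ P, z ∈ Q) :
    X.Q 𝒰 (δ ^ (10 * (k + 1) ^ 2) * (c * c') / 2)
      fun U => {o : Set (Sym2 (Vertex k)) | PJ o (T U ∪ T' U) (A U) (A' U)} := by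
  unfold Q Pos at *
  filter_upwards [h, h'] with i h1 h2
  have hM := X.le_M i
  have hpos := X.pos
  have h3 := glue_planar (k := k) X.pos X.le_half (X.hp i) (M := X.M i)
    (fun z hz => rect_subset_box (by omega) (by omega) (by omega) (by omega) (hT _ (X.one_le i) hz)) (hx _ (X.one_le i))
  have h4 : δ ^ (10 * (k + 1) ^ 2) * (c * c') ≤ δ ^ (10 * (k + 1) ^ 2) *
      (Pr (boxEdges k (X.M i)) (fun _ => X.p i) {o | PJ o (T (X.u i)) (A (X.u i)) (I (X.u i))} *
      Pr (boxEdges k (X.M i)) (fun _ => X.p i) {o | PJ o (T' (X.u i)) (A' (X.u i)) (B' (X.u i))}) :=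
    mul_le_mul_of_nonneg_left (mul_le_mul h1 h2 hc' (hc.trans h1)) (by positivity)
  linarith

/-- An arch between two unit bins of the left side. -/
def archEvent (k : ℕ) (d : ℕ) (U : ℤ) : Set (Set (Sym2 (Vertex k))) :=
  {o | PJ o (rect 0 (40 * U) (-50 * U) ((40 + d) * U)) (vseg 0 0 U) (vseg 0 (d * U) ((d + 1) * U))}

theorem shift_dom {T A B : ℤ → Set (ℤ × ℤ)} {s : ℤ → ℤ} {b₀ b₁ b₀' b₁' c₀ c₁ d₀ d₁ c₀' c₁' d₀' d₁' : ℤ → ℤ}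
    (h : ∀ U, 1 ≤ U → (b₀' U = b₀ U + s U ∧ b₁' U = b₁ U + s U ∧ c₀' U = c₀ U + s U ∧ c₁' U = c₁ U + s U ∧
      d₀' U = d₀ U + s U ∧ d₁' U = d₁ U + s U) ∧ -(1000 * U) ≤ b₀ U ∧ b₁ U ≤ 1000 * U ∧ -(1000 * U) ≤ b₀' U ∧ b₁' U ≤ 1000 * U)
    (hT : ∀ U, 1 ≤ U → rect 0 (40 * U) (b₀' U) (b₁' U) ⊆ T U)
    (hA : ∀ U, 1 ≤ U → vseg 0 (c₀' U) (c₁' U) ⊆ A U) (hB : ∀ U, 1 ≤ U → vseg 0 (d₀' U) (d₁' U) ⊆ B U) :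
    Dom (fun U => {o : Set (Sym2 (Vertex k)) | PJ o (rect 0 (40 * U) (b₀ U) (b₁ U)) (vseg 0 (c₀ U) (c₁ U)) (vseg 0 (d₀ U) (d₁ U))})
      fun U => {o : Set (Sym2 (Vertex k)) | PJ o (T U) (A U) (B U)} := by
  intro p M U hp hU hM
  have h1 := h U hU
  refine le_trans (Pr_pj (T' := rect 0 (40 * U) (b₀' U) (b₁' U)) (A' := vseg 0 (c₀' U) (c₁' U))
    (B' := vseg 0 (d₀' U) (d₁' U)) (isPlanarIsometry_shift (0, s U))
    (rect_subset_box (by omega) (by omega) (by omega) (by omega))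
    (rect_subset_box (by omega) (by omega) (by omega) (by omega)) ?_ ?_ ?_).symm.le
    (Pr_mono (fun _ => hp) fun o _ h => h.mono (hT U hU) (fun _ _ h => hA U hU h) (fun _ _ h => hB U hU h))
  · intro z; simp only [shift_apply, mem_rect]; omega
  · intro z _; simp only [shift_apply, mem_vseg]; omega
  · intro z _; simp only [shift_apply, mem_vseg]; omega

/-- The chord starts above the lower part of the left side and runs to the right side, below the
top, so its projection meets that of the broken path. Gluing joins the bin of the chord to one of
the two halves of the broken path, hence to the lower part of the left side or to the top. The
constant is $\delta^{10(k+1)^2}\cdot\frac12\cdot\frac12\cdot\frac12$: the probability of chord and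
broken path, the loss in gluing, and the choice of the half. -/
theorem chord_or (h20 : X.W 𝒰 (hEvent k (fun U => 20 * U) fun U => 21 * U))
    (h39 : X.W 𝒰 (hEvent k (fun U => 39 * U) fun U => 40 * U))
    (h40 : X.W 𝒰 (hEvent k (fun U => 40 * U) fun U => 41 * U)) :
    X.Q 𝒰 (δ ^ (10 * (k + 1) ^ 2) / 8) (fun U => {o : Set (Sym2 (Vertex k)) | PJ o (rect 0 (40 * U) (-40 * U) (28 * U)) (vseg 0 (3 * U) (4 * U)) (vseg 0 (-11 * U) 0)}) ∨
    X.Q 𝒰 (δ ^ (10 * (k + 1) ^ 2) / 8) fun U => {o : Set (Sym2 (Vertex k)) | PJ o (rect 0 (40 * U) (-40 * U) (28 * U)) (vseg 0 (3 * U) (4 * U)) (hline (28 * U))} := by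
  have hpos := X.pos
  have hκ0 : 0 < δ ^ (10 * (k + 1) ^ 2) := by positivity
  have h1 := ((chord h40).inter (broken h20 h39)).q
  rw [show δ ^ (10 * (k + 1) ^ 2) / 8 = δ ^ (10 * (k + 1) ^ 2) / 4 / 2 by ring]
  apply Q.or
  unfold Q Pos at h1 ⊢
  filter_upwards [h1] with i h1
  have hM := X.le_M i
  have hU := X.one_le i
  have h3 := glue_broken (k := k) X.pos X.le_half (X.hp i) (M := X.M i) (D := rect 0 (40 * (X.u i : ℤ)) (-40 * X.u i) (28 * X.u i))
    (A := vseg 0 (3 * (X.u i : ℤ)) (4 * X.u i)) (I := vline (40 * (X.u i : ℤ))) (T := rect 0 (20 * (X.u i : ℤ)) (-11 * X.u i) (11 * X.u i))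
    (T' := rect 0 (2 * (20 * (X.u i : ℤ))) (-11 * X.u i) (28 * X.u i)) (A' := vseg 0 (-11 * (X.u i : ℤ)) 0) (B' := hline (28 * (X.u i : ℤ)))
    (rect_subset_box (by omega) (by omega) (by omega) (by omega))
    (Set.union_subset (rect_mono (by omega)) (rect_mono (by omega))) ?_
  · have h4 : Pr (boxEdges k (X.M i)) (fun _ => X.p i) ({o : Set (Sym2 (Vertex k)) | PJ o (rect 0 (40 * (X.u i : ℤ)) (-37 * X.u i) (24 * X.u i)) (vseg 0 (3 * X.u i) (4 * X.u i)) (vline (40 * X.u i))} ∩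
        {o : Set (Sym2 (Vertex k)) | Broken o (rect 0 (20 * (X.u i : ℤ)) (-11 * X.u i) (11 * X.u i)) (rect 0 (2 * (20 * X.u i)) (-11 * X.u i) (28 * X.u i)) (vseg 0 (-11 * X.u i) 0) (hline (28 * X.u i))}) ≤
        Pr (boxEdges k (X.M i)) (fun _ => X.p i) ({o : Set (Sym2 (Vertex k)) | PJ o (rect 0 (40 * (X.u i : ℤ)) (-40 * X.u i) (28 * X.u i)) (vseg 0 (3 * X.u i) (4 * X.u i)) (vline (40 * X.u i))} ∩
        {o : Set (Sym2 (Vertex k)) | Broken o (rect 0 (20 * (X.u i : ℤ)) (-11 * X.u i) (11 * X.u i)) (rect 0 (2 * (20 * X.u i)) (-11 * X.u i) (28 * X.u i)) (vseg 0 (-11 * X.u i) 0) (hline (28 * X.u i))}) := by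
      refine Pr_mono (X.isWeight i) ?_
      rintro o - ⟨g1, g2⟩
      exact ⟨g1.mono (rect_mono (by omega)) (fun _ _ h => h) (fun _ _ h => h), g2⟩
    have h5 := h1.trans h4
    have h6 := mul_le_mul_of_nonneg_left h5 hκ0.le
    linarith
  · rintro P Q hP hQ ⟨a, s'⟩ ha y hy hay ⟨a', s⟩ ha' x hx hax
    obtain ⟨rfl, ha1, ha2⟩ := mem_vseg.1 ha
    obtain ⟨rfl, hb1, hb2⟩ := mem_vseg.1 ha'
    obtain ⟨z, hz, hz'⟩ := corner_inter hQ hP hax hx hay hy (by dsimp only at *; omega)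
    exact ⟨z, hz', hz⟩

/-- The lower part of the left side consists of $11$ bins; a connection from $[3U,4U]$ to the $j$-th
of them is, after a translation, an arch of span $j+4$. -/
theorem arch_of_low {c : ℝ} (hc : 0 < c) (h : X.Q 𝒰 c fun U => {o : Set (Sym2 (Vertex k)) |
    PJ o (rect 0 (40 * U) (-40 * U) (28 * U)) (vseg 0 (3 * U) (4 * U)) (vseg 0 (-11 * U) 0)}) :
    ∃ d, 4 ≤ d ∧ d ≤ 14 ∧ X.Q 𝒰 (c / 11) (archEvent k d) := by
  have h4 : X.Q 𝒰 c fun U => ⋃ j ∈ Finset.range 11, {o : Set (Sym2 (Vertex k)) |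
      PJ o (rect 0 (40 * U) (-40 * U) (28 * U)) (vseg 0 ((-j - 1) * U) (-j * U)) (vseg 0 (3 * U) (4 * U))} := by
    refine h.dom (dom_of_subset fun U hU => ?_)
    rintro o ⟨x, hx, y, hy, hxy⟩
    have h2 : -11 * U ≤ y.1.2 ∧ y.1.2 ≤ 0 := hy.2
    have h3 : -y.1.2 / U * U ≤ -y.1.2 := Int.ediv_mul_le _ (by omega)
    have h4 : -y.1.2 < (-y.1.2 / U + 1) * U := Int.lt_ediv_add_one_mul_self _ (by omega)
    have h5 : 0 ≤ -y.1.2 / U := Int.ediv_nonneg (by omega) (by omega)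
    have h6 : -y.1.2 / U ≤ 11 := by
      by_contra! hcon
      nlinarith
    obtain ⟨j, hj⟩ := Int.eq_ofNat_of_zero_le h5
    rw [hj] at h3 h4 h6
    simp only [Set.mem_iUnion]
    by_cases hj11 : j = 11
    · refine ⟨10, by simp, y, ⟨hy.1, ?_, ?_⟩, x, hx, hxy.symm Op.symm⟩
      · push_cast; omega
      · rw [hj11] at h3; push_cast at *; omega
    · refine ⟨j, Finset.mem_range.2 (by omega), y, ⟨hy.1, ?_, ?_⟩, x, hx, hxy.symm Op.symm⟩
      · linarith
      · linarith
  obtain ⟨j, hj, h5⟩ := h4.exists_fin hc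
  have hj' : (j : ℤ) ≤ 10 := by omega
  refine ⟨j + 4, by omega, by omega, ?_⟩
  have h6 := h5.dom (shift_dom (s := fun U => (j + 1) * U) (b₀ := fun U => -40 * U) (b₁ := fun U => 28 * U)
    (b₀' := fun U => (j - 39) * U) (b₁' := fun U => (j + 29) * U) (c₀ := fun U => (-j - 1) * U) (c₁ := fun U => -j * U)
    (d₀ := fun U => 3 * U) (d₁ := fun U => 4 * U) (c₀' := fun U => 0) (c₁' := fun U => U) (d₀' := fun U => (j + 4) * U)
    (d₁' := fun U => (j + 5) * U) (T := fun U => rect 0 (40 * U) (-50 * U) ((40 + ((j + 4 : ℕ) : ℤ)) * U))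
    (A := fun U => vseg 0 0 U) (B := fun U => vseg 0 (((j + 4 : ℕ) : ℤ) * U) ((((j + 4 : ℕ) : ℤ) + 1) * U))
    (fun U hU => ?_) (fun U hU => ?_) (fun U hU => subset_rfl) (fun U hU => ?_))
  · have h7 : c / ((11 : ℕ) : ℝ) = c / 11 := by norm_num
    rw [← h7]
    exact h6
  · refine ⟨⟨by ring, by ring, by ring, by ring, by ring, by ring⟩, by omega, by omega, ?_, ?_⟩ <;> nlinarith
  · have : 0 ≤ (j : ℤ) * U := by positivity
    refine rect_mono ⟨le_rfl, le_rfl, by nlinarith, ?_⟩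
    push_cast; nlinarith
  · push_cast; rw [show ((j : ℤ) + 4 + 1) = j + 5 by ring]

/-- A chord from the bin $[7U,8U]$ separates the bin $[3U,4U]$ from the top. A path from the lower
bin to the top can therefore be glued to the chord, which joins the two bins. -/
theorem arch_of_high {c : ℝ} (hc : 0 < c) (hW : X.W 𝒰 (hEvent k (fun U => 40 * U) fun U => 41 * U))
    (h : X.Q 𝒰 c fun U => {o : Set (Sym2 (Vertex k)) |
      PJ o (rect 0 (40 * U) (-40 * U) (28 * U)) (vseg 0 (3 * U) (4 * U)) (hline (28 * U))}) :
    X.Q 𝒰 (δ ^ (10 * (k + 1) ^ 2) * (1 / 2 * c) / 2) (archEvent k 4) := by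
  have hch : X.Q 𝒰 (1 / 2) fun U => {o : Set (Sym2 (Vertex k)) | PJ o (rect 0 (40 * U) (-33 * U) (28 * U)) (vseg 0 (7 * U) (8 * U)) (vline (40 * U))} := by
    refine (chord hW).q.dom fun p M U hp hU hM => le_of_eq (Pr_pj (isPlanarIsometry_shift (0, 4 * U))
      (rect_subset_box (by omega) (by omega) (by omega) (by omega))
      (rect_subset_box (by omega) (by omega) (by omega) (by omega)) ?_ ?_ ?_).symm
    · intro z; simp only [shift_apply, mem_rect]; omega
    · intro z _; simp only [shift_apply, mem_vseg]; omega
    · intro z _; simp only [shift_apply, mem_vline]; omega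
  have h4 := hch.glue (by norm_num) hc.le h (fun U hU => rect_mono (by omega)) ?_
  · have h5 : X.Q 𝒰 (δ ^ (10 * (k + 1) ^ 2) * (1 / 2 * c) / 2) fun U => {o : Set (Sym2 (Vertex k)) |
        PJ o (rect 0 (40 * U) (-40 * U) (28 * U)) (vseg 0 (3 * U) (4 * U)) (vseg 0 (7 * U) (8 * U))} :=
      h4.dom (dom_of_subset fun U hU o ho => (PJ.symm ho).mono
        (Set.union_subset (rect_mono (by omega)) (rect_mono (by omega))) (fun _ _ h => h) (fun _ _ h => h))
    have h6 := h5.dom (shift_dom (s := fun U => -3 * U) (b₀ := fun U => -40 * U) (b₁ := fun U => 28 * U)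
      (b₀' := fun U => -43 * U) (b₁' := fun U => 25 * U) (c₀ := fun U => 3 * U) (c₁ := fun U => 4 * U)
      (d₀ := fun U => 7 * U) (d₁ := fun U => 8 * U) (c₀' := fun U => 0) (c₁' := fun U => U) (d₀' := fun U => 4 * U)
      (d₁' := fun U => 5 * U) (T := fun U => rect 0 (40 * U) (-50 * U) ((40 + ((4 : ℕ) : ℤ)) * U))
      (A := fun U => vseg 0 0 U) (B := fun U => vseg 0 (((4 : ℕ) : ℤ) * U) ((((4 : ℕ) : ℤ) + 1) * U))
      (fun U hU => ?_) (fun U hU => ?_) (fun U hU => subset_rfl) (fun U hU => ?_))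
    · exact h6
    · omega
    · refine rect_mono ⟨le_rfl, le_rfl, by omega, ?_⟩
      push_cast; nlinarith
    · push_cast; exact subset_rfl
  · rintro U hU P Q hP hQ ⟨a, s'⟩ ha y hy hay ⟨a', s⟩ ha' x hx hax
    obtain ⟨rfl, ha1, ha2⟩ := mem_vseg.1 ha
    obtain ⟨rfl, hb1, hb2⟩ := mem_vseg.1 ha'
    obtain ⟨z, hz, hz'⟩ := corner_inter (P := Q) (Q := P) hQ (hP.trans (rect_mono (by omega))) hax hx hay hy
      (by dsimp only at *; omega)
    exact ⟨z, hz', hz⟩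

/-- An arch and its translate are glued to a longer arch. -/
theorem arch_succ {c : ℝ} (hc : 0 < c) {d : ℕ} (hd : 4 ≤ d) (hd' : d ≤ 200) (h : X.Q 𝒰 c (archEvent k d)) :
    X.Q 𝒰 (δ ^ (10 * (k + 1) ^ 2) * (c * c) / 2) (archEvent k (d + 1)) := by
  have h4d : (4 : ℤ) ≤ d := by exact_mod_cast hd
  have hd2 : (d : ℤ) ≤ 200 := by exact_mod_cast hd'
  have h1 : X.Q 𝒰 c fun U => {o : Set (Sym2 (Vertex k)) | PJ o (rect 0 (40 * U) (-49 * U) ((41 + d) * U))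
      (vseg 0 ((d + 1) * U) ((d + 2) * U)) (vseg 0 U (2 * U))} := by
    have h2 := h.dom (shift_dom (s := fun U => U) (b₀ := fun U => -50 * U) (b₁ := fun U => (40 + d) * U)
      (b₀' := fun U => -49 * U) (b₁' := fun U => (41 + d) * U) (c₀ := fun U => 0) (c₁ := fun U => U)
      (d₀ := fun U => d * U) (d₁ := fun U => (d + 1) * U) (c₀' := fun U => U) (c₁' := fun U => 2 * U)
      (d₀' := fun U => (d + 1) * U) (d₁' := fun U => (d + 2) * U) (T := fun U => rect 0 (40 * U) (-49 * U) ((41 + d) * U))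
      (A := fun U => vseg 0 U (2 * U)) (B := fun U => vseg 0 ((d + 1) * U) ((d + 2) * U))
      (fun U hU => ?_) (fun U hU => subset_rfl) (fun U hU => subset_rfl) (fun U hU => subset_rfl))
    · exact h2.dom (dom_of_subset fun U hU o ho => PJ.symm ho)
    · refine ⟨⟨by ring, by ring, by ring, by ring, by ring, by ring⟩, by omega, ?_, by omega, ?_⟩ <;> nlinarith
  have h2 := h1.glue hc.le hc.le h (fun U hU => rect_mono ⟨by omega, by omega, by omega, by nlinarith⟩) ?_
  · refine h2.dom (dom_of_subset fun U hU o ho => (PJ.symm ho).mono ?_ (fun _ _ h => h) (fun z _ hz => ?_))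
    · refine Set.union_subset (rect_mono ⟨by omega, by omega, by omega, ?_⟩) (rect_mono ⟨by omega, by omega, by omega, ?_⟩) <;>
      · push_cast; nlinarith
    · push_cast; rw [show ((d : ℤ) + 1 + 1) = d + 2 by ring]; exact hz
  · rintro U hU P Q hP hQ ⟨a, s₁⟩ ha ⟨b, s₂⟩ hy hay ⟨a', s₃⟩ ha' ⟨b', s₄⟩ hx hax
    obtain ⟨rfl, ha1, ha2⟩ := mem_vseg.1 ha
    obtain ⟨rfl, hb1, hb2⟩ := mem_vseg.1 ha'
    obtain ⟨rfl, hc1, hc2⟩ := mem_vseg.1 hy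
    obtain ⟨rfl, hd1, hd2⟩ := mem_vseg.1 hx
    dsimp only at *
    -- The feet lie in the order $[0,U]$, $[U,2U]$, $[dU,(d+1)U]$, $[(d+1)U,(d+2)U]$, so that the
    -- arch and its translate interlace.
    have h4U : 4 * U ≤ d * U := by nlinarith
    obtain ⟨z, hz, hz'⟩ := arch_inter (P := Q) (Q := P) (b₀ := -50 * U) (b₁ := (41 + d) * U) (a₁ := 40 * U)
      (hQ.trans (rect_mono ⟨by omega, by omega, by omega, by nlinarith⟩))
      (hP.trans (rect_mono ⟨by omega, by omega, by omega, by nlinarith⟩)) hax (hay.symm PAdj.symm) (by omega) (by omega)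
      (by linarith)
    exact ⟨z, hz', hz⟩

theorem exists_arch_of_arch (hδ : 0 < δ) (k : ℕ) {d : ℕ} (hd : 4 ≤ d) {c : ℝ} (hc : 0 < c) (D : ℕ) (hD : d ≤ D) (hD' : D ≤ 200) :
    ∃ c' > 0, ∀ (X : Scale δ) (𝒰 : Ultrafilter ℕ), X.Q 𝒰 c (archEvent k d) → X.Q 𝒰 c' (archEvent k D) := by
  induction D, hD using Nat.le_induction with
  | base => exact ⟨c, hc, fun X 𝒰 h => h⟩
  | succ D hD ih =>
    obtain ⟨c', hc', h⟩ := ih (by omega)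
    exact ⟨δ ^ (10 * (k + 1) ^ 2) * (c' * c') / 2, by positivity, fun X 𝒰 hX =>
      arch_succ hc' (by omega) (by omega) (h X 𝒰 hX)⟩

/-- Arches of span up to $14$ are prolonged by one unit at a time to span $121$ without leaving the
strip of width $40U$. Such an arch contains a vertical crossing of height $120U$: one loses at most
the length of the bin at its lower foot. -/
theorem exists_hard (hδ : 0 < δ) (k : ℕ) : ∃ c > 0, ∀ (X : Scale δ) (𝒰 : Ultrafilter ℕ),
    X.W 𝒰 (hEvent k (fun U => 20 * U) fun U => 21 * U) → X.W 𝒰 (hEvent k (fun U => 39 * U) fun U => 40 * U) →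
    X.W 𝒰 (hEvent k (fun U => 40 * U) fun U => 41 * U) → X.Q 𝒰 c (hEvent k (fun U => 120 * U) fun U => 40 * U) := by
  set κ := δ ^ (10 * (k + 1) ^ 2) with hκ
  have hκ0 : 0 < κ := by positivity
  set c₀ := min (κ / 8 / 11) (κ * (1 / 2 * (κ / 8)) / 2) with hc₀
  have hc0 : 0 < c₀ := by positivity
  have hex : ∀ d, ∃ c' > 0, 4 ≤ d → d ≤ 121 → ∀ (X : Scale δ) (𝒰 : Ultrafilter ℕ), X.Q 𝒰 c₀ (archEvent k d) → X.Q 𝒰 c' (archEvent k 121) := by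
    intro d
    by_cases hd : 4 ≤ d ∧ d ≤ 121
    · obtain ⟨c', hc', h⟩ := exists_arch_of_arch hδ k hd.1 hc0 121 hd.2 (by norm_num)
      exact ⟨c', hc', fun _ _ => h⟩
    · exact ⟨1, one_pos, fun h1 h2 => absurd ⟨h1, h2⟩ hd⟩
  choose c hc hcQ using hex
  have hne : (Finset.range 15).Nonempty := ⟨0, by simp⟩
  -- The span of the first arch depends on the sequence, but it takes finitely many values, so the
  -- least of the constants serves for all of them.
  refine ⟨(Finset.range 15).inf' hne c, (Finset.lt_inf'_iff _).2 fun d _ => hc d, fun X 𝒰 h20 h39 h40 => ?_⟩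
  have h1 : ∃ d, 4 ≤ d ∧ d ≤ 14 ∧ X.Q 𝒰 c₀ (archEvent k d) := by
    rcases chord_or h20 h39 h40 with h | h
    · obtain ⟨d, h1, h2, h3⟩ := arch_of_low (by positivity) h
      exact ⟨d, h1, h2, h3.le (min_le_left _ _)⟩
    · exact ⟨4, by omega, by omega, (arch_of_high (by positivity) h40 h).le (min_le_right _ _)⟩
  obtain ⟨d, hd, hd', h2⟩ := h1
  have h3 := (hcQ d hd (by omega) X 𝒰 h2).le (Finset.inf'_le c (Finset.mem_range.2 (show d < 15 by omega)))
  have h4 : X.Q 𝒰 ((Finset.range 15).inf' hne c) fun U => {o : Set (Sym2 (Vertex k)) | PJ o (rect 0 (40 * U) U (121 * U)) (hline U) (hline (121 * U))} := by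
    refine h3.dom (dom_of_subset fun U hU o ho => ?_)
    refine (PJ.between_snd ho (a := U) (b := 121 * U) (by omega) (fun z _ hz => hz.2.2) (fun z _ hz => ?_)).mono ?_ (fun _ _ h => h) (fun _ _ h => h)
    · have := hz.2.1
      push_cast at this
      exact this
    · rintro z ⟨hz, hz'⟩
      exact ⟨hz.1, hz'⟩
  exact h4.dom (dom_of_v (x₀ := fun _ => 0) (x₁ := fun U => 40 * U) (y₀ := fun U => U) (y₁ := fun U => 121 * U) fun U hU => by omega)

/-- The half annulus of inner radius `20 U` and outer radius `60 U`. -/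
def halfAnnulus (U : ℤ) : Set (ℤ × ℤ) := {z | (0 ≤ z.1 ∧ z.1 ≤ 60 * U ∧ -(60 * U) ≤ z.2 ∧ z.2 ≤ 60 * U) ∧
  (20 * U ≤ z.1 ∨ 20 * U ≤ z.2 ∨ z.2 ≤ -(20 * U))}

theorem crossing_rect {a₀ a₁ b₀ b₁ : ℤ} {P Q : Set (ℤ × ℤ)} (hP : P ⊆ rect a₀ a₁ b₀ b₁)
    (hQ : Q ⊆ rect a₀ a₁ b₀ b₁) {x x' y y' : ℤ × ℤ}
    (hx : Reach PAdj P x x') (hxa : x.1 = a₀) (hxa' : x'.1 = a₁)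
    (hy : Reach PAdj Q y y') (hyb : y.2 = b₀) (hyb' : y'.2 = b₁) : ∃ z ∈ P, z ∈ Q :=
  crossing_inter (fun _ h => ⟨(hP h).1.1, (hP h).1.2, (hP h).2⟩) (fun _ h => ⟨(hQ h).1.1, (hQ h).1.2, (hQ h).2⟩)
    hx hxa hxa' hy hyb hyb'

/-- Half-annuli contain arches with positive probability. -/
theorem exists_halfAnnulus (hδ : 0 < δ) (k : ℕ) : ∃ c > 0, ∀ (X : Scale δ) (𝒰 : Ultrafilter ℕ),
    X.W 𝒰 (hEvent k (fun U => 20 * U) fun U => 21 * U) → X.W 𝒰 (hEvent k (fun U => 39 * U) fun U => 40 * U) →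
    X.W 𝒰 (hEvent k (fun U => 40 * U) fun U => 41 * U) →
    X.Q 𝒰 c fun U => {o : Set (Sym2 (Vertex k)) | PJ o (halfAnnulus U) (vseg 0 (20 * U) (60 * U)) (vseg 0 (-(60 * U)) (-(20 * U)))} := by
  obtain ⟨c, hc, hQ⟩ := exists_hard hδ k
  refine ⟨δ ^ (10 * (k + 1) ^ 2) * (c * (δ ^ (10 * (k + 1) ^ 2) * (c * c) / 2)) / 2, by positivity, fun X 𝒰 h20 h39 h40 => ?_⟩
  have h1 := hQ X 𝒰 h20 h39 h40
  have hR : X.Q 𝒰 c fun U => {o : Set (Sym2 (Vertex k)) | PJ o (rect (20 * U) (60 * U) (-(60 * U)) (60 * U)) (hline (60 * U)) (hline (-(60 * U)))} :=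
    (h1.dom (dom_v (x₀ := fun U => 20 * U) (x₁ := fun U => 60 * U) (y₀ := fun U => -(60 * U)) (y₁ := fun U => 60 * U) fun U hU => by omega)).dom
      (dom_of_subset fun U hU o ho => PJ.symm ho)
  have hB : X.Q 𝒰 c fun U => {o : Set (Sym2 (Vertex k)) | PJ o (rect 0 (60 * U) (-(60 * U)) (-(20 * U))) (vseg 0 (-(60 * U)) (-(20 * U))) (vline (60 * U))} :=
    (h1.dom (dom_h (x₀ := fun U => 0) (x₁ := fun U => 60 * U) (y₀ := fun U => -(60 * U)) (y₁ := fun U => -(20 * U)) fun U hU => by omega)).dom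
      (dom_of_subset fun U hU o ho => PJ.mono ho subset_rfl (fun z hz hz' => ⟨hz', hz.2⟩) (fun _ _ h => h))
  have hT : X.Q 𝒰 c fun U => {o : Set (Sym2 (Vertex k)) | PJ o (rect 0 (60 * U) (20 * U) (60 * U)) (vseg 0 (20 * U) (60 * U)) (vline (60 * U))} :=
    (h1.dom (dom_h (x₀ := fun U => 0) (x₁ := fun U => 60 * U) (y₀ := fun U => 20 * U) (y₁ := fun U => 60 * U) fun U hU => by omega)).dom
      (dom_of_subset fun U hU o ho => PJ.mono ho subset_rfl (fun z hz hz' => ⟨hz', hz.2⟩) (fun _ _ h => h))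
  have h2 := hB.glue hc.le hc.le hR (fun U hU => rect_mono (by omega)) ?_
  · have h3 := hT.glue hc.le (by have := X.pos; positivity) h2 (fun U hU => rect_mono (by omega)) ?_
    · refine h3.dom (dom_of_subset fun U hU o ho => PJ.mono ho ?_ (fun _ _ h => h) (fun _ _ h => h))
      rintro z (hz | hz | hz) <;>
      · rw [mem_rect] at hz
        change _ ∧ _
        omega
    · rintro U hU P Q hP hQ ⟨a, s'⟩ ha y hy hay ⟨a', s⟩ ha' x hx hax
      obtain ⟨rfl, ha1, ha2⟩ := mem_vseg.1 ha
      obtain ⟨rfl, hb1, hb2⟩ := mem_vseg.1 ha'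
      obtain ⟨z, hz, hz'⟩ := corner_inter (P := Q) (Q := P) (b₀ := -(60 * U))
        (hQ.trans (Set.union_subset (rect_mono (by omega)) (rect_mono (by omega)))) (hP.trans (rect_mono (by omega))) hax hx hay hy
        (by dsimp only at *; omega)
      exact ⟨z, hz', hz⟩
  · rintro U hU P Q hP hQ a ha y hy hay a' ha' x hx hax
    exact crossing_rect (hP.trans (rect_mono (a₀' := 0) (a₁' := 60 * U) (b₀' := -(60 * U)) (b₁' := 60 * U) (by omega)))
      (hQ.trans (rect_mono (by omega))) hay ha.1 hy (hax.symm PAdj.symm) hx ha'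

end Scale
end Slab

/-! ### Two-sided surgery: connections that have to cross many shapes are joined to many of them. -/

namespace Slab

section TwoSided

variable {k : ℕ} {σ : Type*} {C : σ → Set (ℤ × ℤ)}

/-- The shape of index `s` exists and is joined to `x`. -/
def MeetsShape (fam : ∀ s, Family k (C s)) (D : Set (Vertex k)) (o : Set (Sym2 (Vertex k))) (x : Vertex k) (s : σ) : Prop :=
  ∃ S, (fam s).sel o = some S ∧ ∃ y ∈ S.verts, Reach (Op o) D x y

/-- The shape of index `s` exists. -/
def HasShape (fam : ∀ s, Family k (C s)) (o : Set (Sym2 (Vertex k))) (s : σ) : Prop :=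
  ∃ S, (fam s).sel o = some S

variable {fam : ∀ s, Family k (C s)} {D A I : Set (Vertex k)} {o : Set (Sym2 (Vertex k))}

/-- A shape that exists is free, attached, or joined to a vertex of `A` that is not joined to `I`. -/
theorem good_or_attached (hA : ∀ s, ∀ a ∈ A, a.1 ∉ C s) {s : σ} (hs : HasShape fam o s) :
    IsGood fam D A I o s ∨ IsAttached fam D A I o s ∨
      ∃ a ∈ A, MeetsShape fam D o a s ∧ ¬ ∃ i ∈ I, Reach (Op o) D a i := by
  obtain ⟨S, hS⟩ := hs
  by_cases hf : IsFree D A I o S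
  · exact Or.inl ⟨S, hS, hf⟩
  right
  simp only [IsFree, not_forall] at hf
  obtain ⟨y, hy, hf⟩ := hf
  rw [not_and_or] at hf
  rcases hf with hf | hf
  · push Not at hf
    obtain ⟨-, a, ha, hay⟩ := hf
    exact absurd (hay ▸ (fam s).cols hS y hy) (hA s a ha)
  · push Not at hf
    obtain ⟨e, he, a, ha, hae, hr⟩ := hf
    by_cases hI : ∃ i ∈ I, Reach (Op o) D a i
    · left
      have h1 : a = e := enc_inj.1 (le_antisymm hae (he.2.2 a ha hI))
      subst h1
      exact ⟨S, hS, y, hy, fun e' he' => he.unique he' ▸ hr⟩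
    · exact Or.inr ⟨a, ha, ⟨S, hS, y, hy, hr⟩, hI⟩

open Classical in
/-- Paths between two sets are joined to many shapes, if there are many shapes. -/
theorem two_sided_surgery [Fintype σ] {F : Finset (Sym2 (Vertex k))} {q : Sym2 (Vertex k) → ℝ} {δ : ℝ}
    (hq : IsWeight q) (hδ : 0 < δ) (hδ' : δ ≤ 1 / 2) (hDfin : D.Finite)
    (hFe : ∀ e ∈ F, e ∈ (graph k).edgeSet) (hC : ∀ s s', s ≠ s' → Disjoint (C s) (C s'))
    (hA : ∀ s, ∀ a ∈ A, a.1 ∉ C s) (hI : ∀ s, ∀ a ∈ I, a.1 ∉ C s)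
    (hconn : ∀ s o S, (fam s).sel o = some S → ∀ x ∈ S.verts, ∀ y ∈ S.verts, Reach (Op o) D x y)
    (hsep : ∀ s o S, (fam s).sel o = some S → ∀ Λ ⊆ D, (∃ a ∈ A, ∃ i ∈ I, Reach (graph k).Adj Λ a i) →
      ∃ x ∈ Λ, ∃ y ∈ S.verts, x.1 = y.1 ∧ ∀ j, (x.1, j) ∈ D)
    (hF : ∀ s, ∀ x y : Vertex k, x.1 ∈ C s → x.1 = y.1 → (∀ j, (x.1, j) ∈ D) → (graph k).Adj x y →
      s(x, y) ∈ F)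
    (hqδ : ∀ s, ∀ x y : Vertex k, x.1 ∈ C s → (∀ j, (x.1, j) ∈ D) → (graph k).Adj x y → s(x, y) ∈ F →
      δ ≤ q s(x, y) ∧ q s(x, y) ≤ 1 - δ)
    (r g t : ℕ) (hr : 1 ≤ r) :
    δ ^ (r * (10 * (k + 1) ^ 2)) * ((g.choose r : ℕ) * Pr F q {o | Joined o D A I ∧
        2 * (g + t) ≤ (Finset.univ.filter (HasShape fam o)).card ∧
        ∀ a ∈ A, (∃ i ∈ I, Reach (Op o) D a i) → (Finset.univ.filter (MeetsShape fam D o a)).card ≤ t}) ≤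
      2 * ((r + t).choose r : ℕ) := by
  have hsep' : ∀ s o S, (fam s).sel o = some S → ∀ Λ ⊆ D, (∃ a ∈ I, ∃ i ∈ A, Reach (graph k).Adj Λ a i) →
      ∃ x ∈ Λ, ∃ y ∈ S.verts, x.1 = y.1 ∧ ∀ j, (x.1, j) ∈ D := fun s o S hS Λ hΛ ⟨a, ha, i, hi, h⟩ =>
    hsep s o S hS Λ hΛ ⟨i, hi, a, ha, h.symm fun _ _ h => h.symm⟩
  have k1 := multi_surgery (fam := fam) (A := A) (I := I) hq hδ hδ' hDfin hFe hC hsep hF hqδ r g t hr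
  have k2 := multi_surgery (fam := fam) (A := I) (I := A) hq hδ hδ' hDfin hFe hC hsep' hF hqδ r g t hr
  set E₁ : Set (Set (Sym2 (Vertex k))) := {o | Joined o D A I ∧
        g ≤ (Finset.univ.filter (IsGood fam D A I o)).card ∧
        (Finset.univ.filter (IsAttached fam D A I o)).card ≤ t} with hE₁
  set E₂ : Set (Set (Sym2 (Vertex k))) := {o | Joined o D I A ∧
        g ≤ (Finset.univ.filter (IsGood fam D I A o)).card ∧
        (Finset.univ.filter (IsAttached fam D I A o)).card ≤ t} with hE₂
  have hle : Pr F q {o | Joined o D A I ∧ 2 * (g + t) ≤ (Finset.univ.filter (HasShape fam o)).card ∧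
        ∀ a ∈ A, (∃ i ∈ I, Reach (Op o) D a i) → (Finset.univ.filter (MeetsShape fam D o a)).card ≤ t} ≤
      Pr F q E₁ + Pr F q E₂ := by
    refine (Pr_mono hq ?_).trans (Pr_union_le hq)
    rintro o - ⟨hj, hcard, ht⟩
    have hj' : Joined o D I A := hj.symm
    have a1 : (Finset.univ.filter (IsAttached fam D A I o)).card ≤ t := by
      obtain ⟨e, he⟩ := exists_isStart hj
      refine le_trans (Finset.card_le_card fun s hs => ?_) (ht e he.1 he.2.1)
      obtain ⟨-, S, hS, y, hy, h⟩ := Finset.mem_filter.1 hs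
      exact Finset.mem_filter.2 ⟨Finset.mem_univ _, S, hS, y, hy, h e he⟩
    have a2 : (Finset.univ.filter (IsAttached fam D I A o)).card ≤ t := by
      obtain ⟨e, he⟩ := exists_isStart hj'
      obtain ⟨a, ha, hea⟩ := he.2.1
      refine le_trans (Finset.card_le_card fun s hs => ?_) (ht a ha ⟨e, he.1, hea.symm Op.symm⟩)
      obtain ⟨-, S, hS, y, hy, h⟩ := Finset.mem_filter.1 hs
      exact Finset.mem_filter.2 ⟨Finset.mem_univ _, S, hS, y, hy, (hea.symm Op.symm).trans (h e he)⟩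
    -- A shape that is neither free nor attached from the side of `A` is joined to a vertex of `A`
    -- that is not joined to `I`, and likewise with the roles exchanged. No shape is of both kinds,
    -- as it would join the two vertices. So one kind comprises at most half of the $2(g+t)$ or more
    -- shapes, and from that side at least $g$ of them are free.
    by_contra hcon
    simp only [hE₁, hE₂, Set.mem_union, Set.mem_ofPred_eq, hj, hj', a1, a2, true_and, and_true, not_or, not_le] at hcon
    set PA := Finset.univ.filter fun s => ∃ a ∈ A, MeetsShape fam D o a s ∧ ¬ ∃ i ∈ I, Reach (Op o) D a i
    set PI := Finset.univ.filter fun s => ∃ a ∈ I, MeetsShape fam D o a s ∧ ¬ ∃ i ∈ A, Reach (Op o) D a i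
    have hd : Disjoint PA PI := by
      rw [Finset.disjoint_left]
      intro s h1 h2
      obtain ⟨-, a, ha, ⟨S, hS, y, hy, hay⟩, hn⟩ := Finset.mem_filter.1 h1
      obtain ⟨-, i, hi, ⟨S', hS', y', hy', hiy⟩, -⟩ := Finset.mem_filter.1 h2
      rw [hS] at hS'
      cases hS'
      exact hn ⟨i, hi, (hay.trans (hconn s o S hS y hy y' hy')).trans (hiy.symm Op.symm)⟩
    have hsub : PA ∪ PI ⊆ Finset.univ.filter (HasShape fam o) := by
      intro s hs
      rcases Finset.mem_union.1 hs with h | h <;>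
      · obtain ⟨-, a, -, ⟨S, hS, -⟩, -⟩ := Finset.mem_filter.1 h
        exact Finset.mem_filter.2 ⟨Finset.mem_univ _, S, hS⟩
    have c1 := Finset.card_le_card hsub
    rw [Finset.card_union_of_disjoint hd] at c1
    have c2 : Finset.univ.filter (HasShape fam o) ⊆ Finset.univ.filter (IsGood fam D A I o) ∪
        (Finset.univ.filter (IsAttached fam D A I o) ∪ PA) := by
      intro s hs
      simp only [PA, Finset.mem_union, Finset.mem_filter, Finset.mem_univ, true_and]
      exact good_or_attached hA (Finset.mem_filter.1 hs).2
    have c3 : Finset.univ.filter (HasShape fam o) ⊆ Finset.univ.filter (IsGood fam D I A o) ∪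
        (Finset.univ.filter (IsAttached fam D I A o) ∪ PI) := by
      intro s hs
      simp only [PI, Finset.mem_union, Finset.mem_filter, Finset.mem_univ, true_and]
      exact good_or_attached hI (Finset.mem_filter.1 hs).2
    have d2 := (Finset.card_le_card c2).trans ((Finset.card_union_le _ _).trans (Nat.add_le_add_left (Finset.card_union_le _ _) _))
    have d3 := (Finset.card_le_card c3).trans ((Finset.card_union_le _ _).trans (Nat.add_le_add_left (Finset.card_union_le _ _) _))
    omega
  have hb : ∀ E : Set (Set (Sym2 (Vertex k))), (((r + t).choose r : ℕ) : ℝ) * Pr F q E ≤ ((r + t).choose r : ℕ) := fun E =>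
    mul_le_of_le_one_right (by positivity) (Pr_le_one hq)
  have l1 := k1.trans (hb _)
  have l2 := k2.trans (hb _)
  calc _ ≤ δ ^ (r * (10 * (k + 1) ^ 2)) * ((g.choose r : ℕ) * (Pr F q E₁ + Pr F q E₂)) := by gcongr
    _ = δ ^ (r * (10 * (k + 1) ^ 2)) * ((g.choose r : ℕ) * Pr F q E₁) + δ ^ (r * (10 * (k + 1) ^ 2)) * ((g.choose r : ℕ) * Pr F q E₂) := by ring
    _ ≤ _ := by linarith

end TwoSided
end Slab

/-! ### Opening a column of the circuit next to the cluster of `T`. -/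

namespace Slab

variable {k m n : ℕ} {σ : Type*} {C : σ → Set (ℤ × ℤ)}

/-- Families of shapes in the left part of the rectangle that separate `I` from the right part. -/
structure Screen (m n : ℕ) (I : Set (Vertex k)) (arc : ∀ s, Family k (C s)) : Prop where
  disj : ∀ s s', s ≠ s' → Disjoint (C s) (C s')
  sub : ∀ s, ∀ z ∈ C s, z ∈ mainRect m n ∧ z.1 < m
  avoid : ∀ s, ∀ i ∈ I, i.1 ∉ C s
  left : ∀ i ∈ I, i.1.1 ≤ m
  conn : ∀ s o S, (arc s).sel o = some S → ∀ x ∈ S.verts, ∀ y ∈ S.verts, Reach (Op o) S.verts x y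
  sep : ∀ s o S, (arc s).sel o = some S → ∀ Λ ⊆ lift k (mainRect m n), ∀ a ∈ Λ, ∀ i ∈ I, m < a.1.1 →
    Reach (graph k).Adj Λ a i → ∃ x ∈ Λ, ∃ y ∈ S.verts, x.1 = y.1

/-- The vertices of the rectangle whose column contains no vertex of the shape. -/
def offCols (k m n : ℕ) (S : Shape k) : Set (Vertex k) := {x | x.1 ∈ mainRect m n ∧ ∀ v ∈ S.verts, v.1 ≠ x.1}

/-- The vertices that are joined to `T` off the columns of the shape. -/
def offCluster (m n : ℕ) (T : Set (Vertex k)) (S : Shape k) (o : Set (Sym2 (Vertex k))) : Set (Vertex k) :=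
  {x | ∃ t ∈ T, Reach (Op o) (offCols k m n S) t x}

/-- The rest of the rectangle. -/
def rest (m n : ℕ) (T : Set (Vertex k)) (S : Shape k) (o : Set (Sym2 (Vertex k))) : Set (Vertex k) :=
  lift k (mainRect m n) \ offCluster m n T S o

/-- A vertex in a column of the shape that is next to the cluster of `T`. -/
def Entry (m n : ℕ) (T : Set (Vertex k)) (S : Shape k) (o : Set (Sym2 (Vertex k))) (a b : Vertex k) : Prop :=
  (a ∈ offCluster m n T S o ∧ (graph k).Adj a b) ∧ b.1 ∈ mainRect m n ∧ ∃ v ∈ S.verts, v.1 = b.1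

open Classical in
/-- The shapes of the screen that are joined to a vertex in the rest of the rectangle. -/
noncomputable def strength [Fintype σ] (arc : ∀ s, Family k (C s)) (m n : ℕ) (T : Set (Vertex k)) (S : Shape k)
    (o : Set (Sym2 (Vertex k))) (b : Vertex k) : Finset σ :=
  Finset.univ.filter (MeetsShape arc (rest m n T S o) o b)

theorem mem_strength [Fintype σ] {arc : ∀ s, Family k (C s)} {T : Set (Vertex k)} {S : Shape k}
    {o : Set (Sym2 (Vertex k))} {b : Vertex k} {s : σ} :
    s ∈ strength arc m n T S o b ↔ MeetsShape arc (rest m n T S o) o b s := by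
  simp [strength]

/-- A vertex that is joined to many shapes of the screen and to an entry with an open edge. -/
def Active [Fintype σ] (arc : ∀ s, Family k (C s)) (m n : ℕ) (T : Set (Vertex k)) (S : Shape k) (t : ℕ)
    (o : Set (Sym2 (Vertex k))) (b : Vertex k) : Prop :=
  t < (strength arc m n T S o b).card ∧ ∃ a' b', Entry m n T S o a' b' ∧ Op o a' b' ∧ Reach (Op o) (rest m n T S o) b b'

variable {T : Set (Vertex k)} {S S' : Shape k} {o o' : Set (Sym2 (Vertex k))}

theorem offCluster_subset : offCluster m n T S o ⊆ offCols k m n S := by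
  rintro x ⟨t, -, h⟩
  exact h.right_mem

theorem offCluster_mono (h : ∀ x ∈ offCluster m n T S o, ∀ y ∈ offCols k m n S, Op o x y → Op o' x y) :
    offCluster m n T S o ⊆ offCluster m n T S o' := by
  rintro x ⟨t, ht, hx⟩
  refine hx.induction (P := fun x => x ∈ offCluster m n T S o') (fun h => ⟨t, ht, .refl h⟩) ?_
  rintro a b ha ⟨t', ht', ih⟩ hab hb
  exact ⟨t', ht', ih.tail (h a ⟨t, ht, ha⟩ b hb hab) hb⟩

theorem Joined.of_offCluster {x : Vertex k} (h : x ∈ offCluster m n T S o) :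
    ∃ t ∈ T, Reach (Op o) (lift k (mainRect m n)) t x := by
  obtain ⟨t, ht, h⟩ := h
  exact ⟨t, ht, h.mono_set fun v hv => hv.1⟩

/-- The result of opening a column of the shape and an edge between this column and the cluster of `T`. -/
structure IsOpening [Fintype σ] (fam : Family k (annulus m n (0, 0))) (arc : ∀ s, Family k (C s)) (T : Set (Vertex k)) (t : ℕ)
    (o o' : Set (Sym2 (Vertex k))) (S : Shape k) (a b : Vertex k) : Prop where
  sel : fam.sel o = some S
  not_joined : ¬ Joined o (lift k (mainRect m n)) T S.verts
  entry : Entry m n T S o a b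
  active : Active arc m n T S t o b
  eq : o' = o ∪ (edgesIn {x | x.1 = b.1} ∪ {s(a, b)})

/-- The rectangle is no higher than the inner box, so it meets the annulus only to the right of this
box, whereas the arches of a screen lie to the left of abscissa $m$. -/
theorem mainRect_annulus {z : ℤ × ℤ} (h : z ∈ mainRect m n) (h' : z ∈ annulus m n (0, 0)) : (m : ℤ) < z.1 ∧ z.1 ≤ n := by
  obtain ⟨⟨h1, h2⟩, h3, h4⟩ := h
  have h5 := mem_annulus.1 h'
  rw [mem_box, mem_box] at h5
  dsimp only at *
  omega

namespace IsOpening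

variable [Fintype σ] {fam : Family k (annulus m n (0, 0))} {arc : ∀ s, Family k (C s)} {t : ℕ} {o₁ o₂ : Set (Sym2 (Vertex k))}
  {S₁ S₂ : Shape k} {a₁ b₁ a₂ b₂ : Vertex k}

/-- Both the opened column and the additional edge touch the column of `b₁`. -/
theorem touches (h : IsOpening fam arc T t o o' S a₁ b₁) {x y : Vertex k} (hxy : s(x, y) ∈ o') (hx : x.1 ≠ b₁.1)
    (hy : y.1 ≠ b₁.1) : s(x, y) ∈ o := by
  rw [h.eq] at hxy
  rcases hxy with h1 | h1 | h1
  · exact h1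
  · exact absurd (mem_edgesIn.1 h1).2.1 hx
  · rw [Set.mem_singleton_iff, Sym2.eq_iff] at h1
    rcases h1 with ⟨-, rfl⟩ | ⟨rfl, -⟩
    · exact absurd rfl hy
    · exact absurd rfl hx

theorem column_lt (h : IsOpening fam arc T t o o' S a₁ b₁) : (m : ℤ) < b₁.1.1 := by
  obtain ⟨-, h1, v, hv, hvb⟩ := h.entry
  exact (mainRect_annulus h1 (hvb ▸ fam.cols h.sel v hv)).1

/-- The edges opened by one operation are open before another operation. -/
theorem open_before (h₁ : IsOpening fam arc T t o₁ o' S₁ a₁ b₁) (h₂ : IsOpening fam arc T t o₂ o' S₂ a₂ b₂)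
    (hne : b₁.1 ≠ b₂.1) : edgesIn {x : Vertex k | x.1 = b₂.1} ⊆ o₁ := by
  intro e he
  have h3 : e ∈ o' := by rw [h₂.eq]; exact Or.inr (Or.inl he)
  induction e with | _ x y =>
  obtain ⟨-, hx, hy⟩ := mem_edgesIn.1 he
  exact h₁.touches h3 (fun h => hne (h.symm.trans hx)) (fun h => hne (h.symm.trans hy))

theorem reach_column {z : ℤ × ℤ} (h : edgesIn {x : Vertex k | x.1 = z} ⊆ o) {x y : Vertex k} (hx : x.1 = z) (hy : y.1 = z) :
    Reach (Op o) {v | v.1 = z} x y := by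
  have hsub : seg x y ⊆ {v | v.1 = z} := fun v hv => hv.1.trans hx
  exact (reach_seg (g := y) ((edgesIn_mono hsub).trans h) ⟨hy.trans hx.symm, Set.right_mem_uIcc⟩).mono_set hsub

/-- The edge is open in the common result. It could be new for the first operation only as its
additional edge traversed backwards, but the outer end of that edge lies off the columns of `S₁`. -/
theorem entry_mem (h₁ : IsOpening fam arc T t o₁ o' S₁ a₁ b₁) (h₂ : IsOpening fam arc T t o₂ o' S₂ a₂ b₂)
    (hne : b₁.1 ≠ b₂.1) (hz : ∃ v ∈ S₁.verts, v.1 = b₂.1) : Op o₁ a₂ b₂ := by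
  refine ⟨h₂.entry.1.2, ?_⟩
  have h3 : s(a₂, b₂) ∈ o' := by rw [h₂.eq]; exact Or.inr (Or.inr rfl)
  rw [h₁.eq] at h3
  rcases h3 with h3 | h3 | h3
  · exact h3
  · exact absurd (mem_edgesIn.1 h3).2.2.symm hne
  · rw [Set.mem_singleton_iff, Sym2.eq_iff] at h3
    rcases h3 with ⟨-, rfl⟩ | ⟨-, rfl⟩
    · exact absurd rfl hne
    · obtain ⟨v, hv, hvb⟩ := hz
      exact absurd hvb ((offCluster_subset h₁.entry.1.1).2 v hv)

/-- The second column was completely open before the first operation and contains a vertex of `S₁`,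
to which `T` is not joined. -/
theorem not_reach (h₁ : IsOpening fam arc T t o₁ o' S₁ a₁ b₁) (h₂ : IsOpening fam arc T t o₂ o' S₂ a₂ b₂)
    (hne : b₁.1 ≠ b₂.1) (hz : ∃ v ∈ S₁.verts, v.1 = b₂.1) {t' : Vertex k} (ht' : t' ∈ T) :
    ¬ Reach (Op o₁) (lift k (mainRect m n)) t' b₂ := by
  intro h
  obtain ⟨v, hv, hvb⟩ := hz
  refine h₁.not_joined ⟨t', ht', v, hv, h.trans ((reach_column (h₁.open_before h₂ hne) rfl hvb).mono_set ?_)⟩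
  intro x hx
  rw [mem_lift, show x.1 = b₂.1 from hx]
  exact h₂.entry.2.1

theorem not_reach' (h₁ : IsOpening fam arc T t o₁ o' S₁ a₁ b₁) (h₂ : IsOpening fam arc T t o₂ o' S₂ a₂ b₂)
    (hne : b₁.1 ≠ b₂.1) (hz : ∃ v ∈ S₁.verts, v.1 = b₂.1) {t' : Vertex k} (ht' : t' ∈ T) :
    ¬ Reach (Op o₁) (lift k (mainRect m n)) t' a₂ := fun h =>
  h₁.not_reach h₂ hne hz ht' (h.tail (h₁.entry_mem h₂ hne hz) h₂.entry.2.1)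

/-- Different operations with the same result have different shapes. -/
theorem shape_ne (h₁ : IsOpening fam arc T t o₁ o' S₁ a₁ b₁) (h₂ : IsOpening fam arc T t o₂ o' S₂ a₂ b₂)
    (hne : b₁.1 ≠ b₂.1) : S₁ ≠ S₂ := by
  rintro rfl
  -- If the shapes were the same, the first operation would only change edges that touch a column of
  -- this shape, hence none that the exploration of the cluster of `T` follows. Then `T` would reach
  -- `a₂` before the first operation.
  have hsub : offCluster m n T S₁ o₂ ⊆ offCluster m n T S₁ o₁ := by
    refine offCluster_mono fun x hx y hy hxy => ⟨hxy.1, h₁.touches ?_ ?_ ?_⟩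
    · rw [h₂.eq]; exact Or.inl hxy.2
    · obtain ⟨v, hv, hvb⟩ := h₁.entry.2.2
      exact fun h => (offCluster_subset hx).2 v hv (hvb.trans h.symm)
    · obtain ⟨v, hv, hvb⟩ := h₁.entry.2.2
      exact fun h => hy.2 v hv (hvb.trans h.symm)
  obtain ⟨t', ht', h⟩ := Joined.of_offCluster (hsub h₂.entry.1.1)
  exact h₁.not_reach' h₂ hne h₂.entry.2.2 ht' h

/-- An edge of `S₁` that is closed in `o₂` is open in the result, so the second operation has opened
it. -/
theorem column_mem_of_not_subset (h₁ : IsOpening fam arc T t o₁ o' S₁ a₁ b₁) (h₂ : IsOpening fam arc T t o₂ o' S₂ a₂ b₂)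
    (h : ¬ S₁.edges ⊆ o₂) : ∃ v ∈ S₁.verts, v.1 = b₂.1 := by
  obtain ⟨e, he, he'⟩ := Set.not_subset.1 h
  have h3 : e ∈ o' := by rw [h₁.eq]; exact Or.inl (fam.isOpen h₁.sel he)
  have h4 := fam.edges_subset h₁.sel he
  induction e with | _ x y =>
  obtain ⟨-, hx, hy⟩ := mem_edgesIn.1 h4
  by_contra! hcon
  exact he' (h₂.touches h3 (hcon x hx) (hcon y hy))

theorem arc_sel (h : IsOpening fam arc T t o o' S a₁ b₁) {I : Set (Vertex k)} (hs : Screen m n I arc) (s : σ) :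
    (arc s).sel o = (arc s).sel o' := by
  refine (arc s).isLocal ?_
  ext e
  simp only [Set.mem_inter_iff, and_congr_left_iff]
  intro he
  refine ⟨fun h1 => by rw [h.eq]; exact Or.inl h1, fun h1 => ?_⟩
  induction e with | _ x y =>
  obtain ⟨-, hx, hy⟩ := mem_edgesIn.1 he
  have h2 := h.column_lt
  have h3 := (hs.sub s _ hx).2
  have h4 := (hs.sub s _ hy).2
  exact h.touches h1 (fun h => by rw [h] at h3; omega) (fun h => by rw [h] at h4; omega)

/-- By `not_reach'`, the connection from `T` to `a₂` in `o₂` has to use the column of `b₁`, so this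
column is part of the cluster of `T` there. If an arch were joined to both entries, then in `o₁` one
could go from `T` through an open entry to `b₁`, on to the arch, and from there to `b₂`: this last
piece avoids the cluster of `T` in `o₂`, hence the column of `b₁`, and is unaffected by the first
operation. This contradicts `not_reach`. -/
theorem disjoint_of_column (h₁ : IsOpening fam arc T t o₁ o' S₁ a₁ b₁) (h₂ : IsOpening fam arc T t o₂ o' S₂ a₂ b₂)
    (hne : b₁.1 ≠ b₂.1) (hz : ∃ v ∈ S₁.verts, v.1 = b₂.1) {I : Set (Vertex k)} (hs : Screen m n I arc) :
    Disjoint (strength arc m n T S₁ o₁ b₁) (strength arc m n T S₂ o₂ b₂) := by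
  -- the opened column belongs to the other cluster
  have hu : ∃ u ∈ offCluster m n T S₂ o₂, u.1 = b₁.1 := by
    by_contra! hcon
    obtain ⟨t', ht', h⟩ := h₂.entry.1.1
    have h3 : Reach (Op o₁) (lift k (mainRect m n)) t' a₂ := by
      refine h.induction (P := fun x => Reach (Op o₁) (lift k (mainRect m n)) t' x) (fun h => .refl h.1) fun x y hx ih hxy hy => ?_
      refine ih.tail ⟨hxy.1, h₁.touches ?_ (hcon x ⟨t', ht', hx⟩) (hcon y ⟨t', ht', hx.tail hxy hy⟩)⟩ hy.1
      rw [h₂.eq]; exact Or.inl hxy.2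
    exact h₁.not_reach' h₂ hne hz ht' h3
  obtain ⟨u, hu, hub⟩ := hu
  have hcol : ∀ x : Vertex k, x.1 = b₁.1 → x ∈ offCluster m n T S₂ o₂ := by
    intro x hx
    obtain ⟨t', ht', h⟩ := hu
    refine ⟨t', ht', h.trans ((reach_column (h₂.open_before h₁ hne.symm) hub hx).mono_set fun v hv => ?_)⟩
    have h3 := h.right_mem
    unfold offCols at *
    rw [Set.mem_ofPred_eq, show v.1 = u.1 from (show v.1 = b₁.1 from hv).trans hub.symm]
    exact h3
  rw [Finset.disjoint_left]
  intro s h3 h4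
  obtain ⟨O, hO, y, hy, hby⟩ := mem_strength.1 h3
  obtain ⟨O', hO', y', hy', hby'⟩ := mem_strength.1 h4
  have hOO : O' = O := by
    rw [h₂.arc_sel hs] at hO'
    rw [h₁.arc_sel hs, hO'] at hO
    exact Option.some.inj hO
  subst hOO
  obtain ⟨-, a', b', hent, hab, hbb⟩ := h₁.active
  obtain ⟨t', ht', h5⟩ := Joined.of_offCluster hent.1.1
  have h6 : Reach (Op o₁) (lift k (mainRect m n)) t' b₁ :=
    (h5.tail hab hent.2.1).trans ((hbb.symm Op.symm).mono_set Set.sdiff_subset)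
  have h7 : Reach (Op o₁) (lift k (mainRect m n)) t' y' :=
    (h6.trans (hby.mono_set Set.sdiff_subset)).trans ((hs.conn s o₁ O' hO y hy y' hy').mono_set
      fun x hx => (hs.sub s _ ((arc s).cols hO x hx)).1)
  have h8 : Reach (Op o₁) (lift k (mainRect m n)) y' b₂ := by
    refine (hby'.symm Op.symm).mono (fun x y hx hy hxy => ⟨hxy.1, h₁.touches ?_ ?_ ?_⟩) Set.sdiff_subset
    · rw [h₂.eq]; exact Or.inl hxy.2
    · exact fun h => hx.2 (hcol x h)
    · exact fun h => hy.2 (hcol y h)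
  exact h₁.not_reach h₂ hne hz ht' (h7.trans h8)

/-- Different operations with the same result involve disjoint sets of shapes of the screen. -/
theorem disjoint (h₁ : IsOpening fam arc T t o₁ o' S₁ a₁ b₁) (h₂ : IsOpening fam arc T t o₂ o' S₂ a₂ b₂)
    (hne : b₁.1 ≠ b₂.1) {I : Set (Vertex k)} (hs : Screen m n I arc) :
    Disjoint (strength arc m n T S₁ o₁ b₁) (strength arc m n T S₂ o₂ b₂) := by
  -- The shapes differ, so by the selection rule one of them was not open before the other
  -- operation, and it contains a vertex of the column opened there.
  by_cases h : S₁.edges ⊆ o₂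
  · have h' : ¬ S₂.edges ⊆ o₁ := fun h' => h₁.shape_ne h₂ hne (fam.antisymm h₁.sel h₂.sel h h')
    exact (h₂.disjoint_of_column h₁ hne.symm (h₂.column_mem_of_not_subset h₁ h') hs).symm
  · exact h₁.disjoint_of_column h₂ hne (h₁.column_mem_of_not_subset h₂ h) hs

end IsOpening
end Slab

/-! ### Configurations with many and with few active columns. -/

namespace Slab

variable {k m n : ℕ} {σ : Type*} {C : σ → Set (ℤ × ℤ)}

theorem finite_mainRect (m n : ℕ) : (mainRect m n).Finite := (Set.finite_Icc _ _).prod (Set.finite_Icc _ _)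

theorem finite_lift_mainRect (k m n : ℕ) : (lift k (mainRect m n)).Finite := by
  refine (((finite_mainRect m n).prod (Set.finite_univ (α := Fin (k + 1))))).subset ?_
  intro x hx
  exact ⟨hx, Set.mem_univ _⟩

section Active

theorem finite_activeCols [Fintype σ] (arc : ∀ s, Family k (C s)) (T : Set (Vertex k)) (S : Shape k) (t : ℕ) (o : Set (Sym2 (Vertex k))) :
    {z | ∃ a b, Entry m n T S o a b ∧ Active arc m n T S t o b ∧ b.1 = z}.Finite :=
  (finite_mainRect m n).subset (by rintro _ ⟨a, b, h, -, rfl⟩; exact h.2.1)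

/-- The columns of the shape that contain an active entry. -/
noncomputable def activeCols [Fintype σ] (arc : ∀ s, Family k (C s)) (m n : ℕ) (T : Set (Vertex k)) (S : Shape k) (t : ℕ)
    (o : Set (Sym2 (Vertex k))) : Finset (ℤ × ℤ) := (finite_activeCols (m := m) (n := n) arc T S t o).toFinset

theorem mem_activeCols [Fintype σ] {arc : ∀ s, Family k (C s)} {T : Set (Vertex k)} {S : Shape k} {t : ℕ} {o : Set (Sym2 (Vertex k))}
    {z : ℤ × ℤ} : z ∈ activeCols arc m n T S t o ↔ ∃ a b, Entry m n T S o a b ∧ Active arc m n T S t o b ∧ b.1 = z := by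
  simp [activeCols]

variable {fam : Family k (annulus m n (0, 0))} {arc : ∀ s, Family k (C s)} {T I : Set (Vertex k)} {S : Shape k} {t : ℕ}
  {o o' : Set (Sym2 (Vertex k))}

theorem activeCols_prop [Fintype σ] (hS : fam.sel o = some S) {z : ℤ × ℤ} (hz : z ∈ activeCols arc m n T S t o) :
    z ∈ mainRect m n ∧ (m : ℤ) < z.1 ∧ z.1 ≤ n := by
  obtain ⟨a, b, ⟨-, h1, v, hv, hvb⟩, -, rfl⟩ := mem_activeCols.1 hz
  exact ⟨h1, mainRect_annulus h1 (hvb ▸ fam.cols hS v hv)⟩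

theorem mem_colEdges_iff {z : ℤ × ℤ} {e : Sym2 (Vertex k)} (he : e ∈ colEdges k z) : ∃ x y : Vertex k, x.1 = z ∧ e = s(x, y) := by
  obtain ⟨⟨x, y⟩, hxy, rfl⟩ := Finset.mem_image.1 he
  simp only [Finset.mem_product, Finset.mem_singleton] at hxy
  exact ⟨x, y, hxy.1.1, rfl⟩

theorem edgesIn_mainRect {M : ℕ} (hM : mainRect m n ⊆ box M (0, 0)) :
    edgesIn (lift k (mainRect m n)) ⊆ (boxEdges k M : Set (Sym2 (Vertex k))) :=
  edgesIn_subset_boxEdges fun _ hx => hM hx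

open Classical in
/-- It is unlikely that there are many active columns. -/
theorem many_active [Fintype σ] {M : ℕ} (hM : mainRect m n ⊆ box M (0, 0)) {q : Sym2 (Vertex k) → ℝ} {δ : ℝ}
    (hq : IsWeight q) (hδ : 0 < δ) (hδ' : δ ≤ 1 / 2) (hs : Screen m n I arc)
    (hqδ : ∀ x y : Vertex k, x.1 ∈ mainRect m n → x.1.1 ≤ n → δ ≤ q s(x, y) ∧ q s(x, y) ≤ 1 - δ) (J : ℕ) :
    δ ^ (5 * (k + 1) ^ 2) * (J * Pr (boxEdges k M) q {o | ∃ S, fam.sel o = some S ∧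
      ¬ Joined o (lift k (mainRect m n)) T S.verts ∧ J ≤ (activeCols arc m n T S t o).card}) ≤
      ((Fintype.card σ / (t + 1) : ℕ) : ℝ) := by
  set E : Set (Set (Sym2 (Vertex k))) := {o | ∃ S, fam.sel o = some S ∧
      ¬ Joined o (lift k (mainRect m n)) T S.verts ∧ J ≤ (activeCols arc m n T S t o).card} with hE
  let A : Set (Sym2 (Vertex k)) → Finset (ℤ × ℤ) := fun o => (fam.sel o).elim ∅ fun S => activeCols arc m n T S t o
  -- For each active column one opening is chosen; the label of the surgery is the column alone.
  let φ : ℤ × ℤ → Set (Sym2 (Vertex k)) → Set (Sym2 (Vertex k)) := fun z o =>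
    if h : ∃ o', ∃ S a b, IsOpening fam arc T t o o' S a b ∧ b.1 = z then h.choose else o
  have hA : ∀ o S, fam.sel o = some S → A o = activeCols arc m n T S t o := fun o S h => by simp only [A, h, Option.elim]
  have hφ : ∀ o ∈ E, ∀ z ∈ A o, ∃ S a b, IsOpening fam arc T t o (φ z o) S a b ∧ b.1 = z := by
    rintro o ⟨S, hS, hj, -⟩ z hz
    rw [hA o S hS] at hz
    obtain ⟨a, b, h1, h2, h3⟩ := mem_activeCols.1 hz
    have hex : ∃ o', ∃ S a b, IsOpening fam arc T t o o' S a b ∧ b.1 = z :=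
      ⟨_, S, a, b, ⟨hS, hj, h1, h2, rfl⟩, h3⟩
    simp only [φ]
    rw [dif_pos hex]
    exact hex.choose_spec
  have key := surgery_bound (F := boxEdges k M) (E := E) (E' := Set.univ) (δ := δ) (C := 5 * (k + 1) ^ 2) (N := J)
    (L := Fintype.card σ / (t + 1)) hq hδ (by linarith) A (fun z => colEdges k z) φ ?_ ?_ ?_ ?_
  · refine key.trans ?_
    rw [Pr_univ, mul_one]
  · rintro o ⟨S, hS, -⟩ - z hz
    rw [hA o S hS] at hz
    refine ⟨card_colEdges_le z, fun e he _ => ?_⟩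
    obtain ⟨x, y, hx, rfl⟩ := mem_colEdges_iff he
    have h1 := activeCols_prop hS hz
    exact hqδ x y (hx ▸ h1.1) (hx ▸ h1.2.2)
  · intro o ho hoF z hz
    obtain ⟨S, a, b, h, rfl⟩ := hφ o ho z hz
    refine ⟨?_, ?_, Set.mem_univ _⟩
    · rw [h.eq]
      refine Set.union_subset hoF (Set.union_subset ?_ ?_)
      · refine (edgesIn_mono fun x hx => ?_).trans (edgesIn_mainRect hM)
        rw [mem_lift, show x.1 = b.1 from hx]
        exact h.entry.2.1
      · rintro _ rfl
        exact edgesIn_mainRect hM (mem_edgesIn.2 ⟨h.entry.1.2, (offCluster_subset h.entry.1.1).1, h.entry.2.1⟩)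
    · rw [h.eq, Set.union_sdiff_distrib, Set.union_eq_left]
      rintro e ⟨he | he, he'⟩
      · induction e with | _ x y =>
        obtain ⟨h1, hx, -⟩ := mem_edgesIn.1 he
        have hx : x.1 = b.1 := hx
        exact absurd (hx ▸ mem_colEdges h1) he'
      · rw [Set.mem_singleton_iff] at he
        subst he
        rw [Sym2.eq_swap] at he'
        exact absurd (mem_colEdges h.entry.1.2.symm) he'
  · rintro o ⟨S, hS, -, hJ⟩ -
    rw [hA o S hS]
    exact hJ
  -- The columns that lead to a given result carry pairwise disjoint sets of more than $t$ shapes of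
  -- the screen, so there are at most $|\sigma|/(t+1)$ of them.
  · intro o' _
    set P : Set (ℤ × ℤ) := {z | ∃ o S a b, IsOpening fam arc T t o o' S a b ∧ b.1 = z} with hP
    have hPfin : P.Finite := (finite_mainRect m n).subset (by rintro _ ⟨o, S, a, b, h, rfl⟩; exact h.entry.2.1)
    refine ⟨hPfin.toFinset, ?_, ?_⟩
    · have hch : ∀ z : P, ∃ X : Finset σ, t < X.card ∧ ∃ o S a b, IsOpening fam arc T t o o' S a b ∧ b.1 = z ∧
          X = strength arc m n T S o b := by
        rintro ⟨_, o, S, a, b, h, rfl⟩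
        exact ⟨_, h.active.1, o, S, a, b, h, rfl, rfl⟩
      choose X hX hX' using hch
      have := hPfin.fintype
      have h1 : (Finset.univ.biUnion X).card = ∑ z : P, (X z).card := by
        refine Finset.card_biUnion fun z _ z' _ hne => ?_
        obtain ⟨o, S, a, b, h, hb, hXz⟩ := hX' z
        obtain ⟨o₂, S₂, a₂, b₂, h₂, hb₂, hXz₂⟩ := hX' z'
        change Disjoint (X z) (X z')
        rw [hXz, hXz₂]
        exact h.disjoint h₂ (fun hbb => hne (Subtype.ext (hb.symm.trans (hbb.trans hb₂)))) hs
      have h2 : ∑ z : P, (t + 1) ≤ ∑ z : P, (X z).card := Finset.sum_le_sum fun z _ => hX z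
      rw [← h1, Finset.sum_const, smul_eq_mul, Finset.card_univ] at h2
      have h3 := h2.trans (Finset.card_le_univ _)
      rw [Nat.le_div_iff_mul_le (Nat.succ_pos t)]
      rwa [← Set.toFinset_card, ← hPfin.toFinset_eq_toFinset] at h3
    · intro o ho _ z hz hz'
      obtain ⟨S, a, b, h, rfl⟩ := hφ o ho z hz
      rw [hPfin.mem_toFinset]
      rw [hz'] at h
      exact ⟨o, S, a, b, h, rfl⟩

/-- The shape separates the inner box from `T`, and the cluster avoids all columns of the shape. -/
theorem offCluster_right (hfam : fam.Surrounds m n (0, 0)) (hT : ∀ t ∈ T, (n : ℤ) < t.1.1) (hS : fam.sel o' = some S)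
    {x : Vertex k} (hx : x ∈ offCluster m n T S o) : (m : ℤ) < x.1.1 := by
  by_contra! hcon
  have h1 := (offCluster_subset hx).1
  obtain ⟨t', ht', h⟩ := hx
  have h2 := ((h.symm Op.symm).mono (fun _ _ _ _ h => h.1) subset_rfl).fst_inter
  have h3 := hT t' ht'
  obtain ⟨v, hv, y, hy, hvy⟩ := hfam o' S hS _ _ _ h2 (by
    obtain ⟨⟨h4, h5⟩, h6, h7⟩ := h1
    rw [mem_box]; dsimp only; omega) (by dsimp only; omega)
  exact hy.2 v hv hvy.symm

theorem arc_subset_rest (hfam : fam.Surrounds m n (0, 0)) (hT : ∀ t ∈ T, (n : ℤ) < t.1.1) (hS : fam.sel o' = some S)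
    (hs : Screen m n I arc) {s : σ} {O : Shape k} {o'' : Set (Sym2 (Vertex k))} (hO : (arc s).sel o'' = some O) :
    O.verts ⊆ rest m n T S o := by
  intro x hx
  have h1 := hs.sub s _ ((arc s).cols hO x hx)
  refine ⟨h1.1, fun h => ?_⟩
  have := offCluster_right hfam hT hS h
  omega

/-- Shapes of the screen are connected and lie in the rest of the rectangle. Hence different sets of
the form `strength` are disjoint, and few of them have more than $t$ elements. -/
theorem reach_of_mem_strength [Fintype σ] (hfam : fam.Surrounds m n (0, 0)) (hT : ∀ t ∈ T, (n : ℤ) < t.1.1) (hS : fam.sel o' = some S)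
    (hs : Screen m n I arc) {s : σ} {v w : Vertex k} (hv : s ∈ strength arc m n T S o v) (hw : s ∈ strength arc m n T S o w) :
    Reach (Op o) (rest m n T S o) v w := by
  obtain ⟨O, hO, y, hy, hvy⟩ := mem_strength.1 hv
  obtain ⟨O', hO', y', hy', hwy⟩ := mem_strength.1 hw
  rw [hO] at hO'
  cases hO'
  exact (hvy.trans ((hs.conn s o O hO y hy y' hy').mono_set (arc_subset_rest hfam hT hS hs hO))).trans (hwy.symm Op.symm)

theorem strength_eq [Fintype σ] {v w : Vertex k} (h : Reach (Op o) (rest m n T S o) v w) :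
    strength arc m n T S o v = strength arc m n T S o w := by
  ext s
  rw [mem_strength, mem_strength]
  exact ⟨fun ⟨O, hO, y, hy, hr⟩ => ⟨O, hO, y, hy, (h.symm Op.symm).trans hr⟩,
    fun ⟨O, hO, y, hy, hr⟩ => ⟨O, hO, y, hy, h.trans hr⟩⟩

/-- The result of closing edges between the cluster of `T` and the columns of the shape. -/
structure IsClosing (fam : Family k (annulus m n (0, 0))) (T : Set (Vertex k)) (o o' : Set (Sym2 (Vertex k))) (S : Shape k) : Prop where
  sel : fam.sel o = some S
  sub : o' ⊆ o
  closed : ∀ e ∈ o, e ∉ o' → ∃ a b, Entry m n T S o a b ∧ e = s(a, b)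

namespace IsClosing

/-- A closed edge has an endpoint off the columns of the shape, so no edge of the shape is closed.
Closing edges offers no new shapes, and the selection rule keeps the old one. -/
theorem sel_eq (h : IsClosing fam T o o' S) : fam.sel o' = some S := by
  have h1 : S.edges ⊆ o' := by
    intro e he
    by_contra hcon
    obtain ⟨a, b, hab, rfl⟩ := h.closed e (fam.isOpen h.sel he) hcon
    exact (offCluster_subset hab.1.1).2 a (mem_edgesIn.1 (fam.edges_subset h.sel he)).2.1 rfl
  obtain ⟨S', hS'⟩ := fam.exists_of_open h.sel h1
  rw [hS', fam.antisymm h.sel hS' h1 ((fam.isOpen hS').trans h.sub)]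

theorem op_iff (h : IsClosing fam T o o' S) {x y : Vertex k} (hxy : ∀ a b, Entry m n T S o a b → s(x, y) ≠ s(a, b)) :
    Op o x y ↔ Op o' x y := by
  refine ⟨fun h1 => ⟨h1.1, ?_⟩, Op.mono h.sub⟩
  by_contra hcon
  obtain ⟨a, b, hab, he⟩ := h.closed _ h1.2 hcon
  exact hxy a b hab he

theorem offCluster_eq (h : IsClosing fam T o o' S) : offCluster m n T S o' = offCluster m n T S o := by
  refine subset_antisymm (offCluster_mono fun x _ y _ hxy => hxy.mono h.sub) (offCluster_mono fun x hx y hy hxy => ?_)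
  refine (h.op_iff fun a b hab he => ?_).1 hxy
  obtain ⟨v, hv, hvb⟩ := hab.2.2
  rcases Sym2.eq_iff.1 he with ⟨-, rfl⟩ | ⟨rfl, -⟩
  · exact hy.2 v hv hvb
  · exact (offCluster_subset hx).2 v hv hvb

theorem rest_eq (h : IsClosing fam T o o' S) : rest m n T S o' = rest m n T S o := by
  unfold rest; rw [h.offCluster_eq]

theorem entry_iff (h : IsClosing fam T o o' S) {a b : Vertex k} : Entry m n T S o' a b ↔ Entry m n T S o a b := by
  unfold Entry; rw [h.offCluster_eq]

/-- A closed edge has an endpoint in the cluster of `T`, hence outside the rest of the rectangle. -/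
theorem reach_iff (h : IsClosing fam T o o' S) {x y : Vertex k} :
    Reach (Op o') (rest m n T S o') x y ↔ Reach (Op o) (rest m n T S o) x y := by
  rw [h.rest_eq]
  refine ⟨fun h1 => h1.mono (fun _ _ _ _ h2 => h2.mono h.sub) subset_rfl, fun h1 => h1.mono (fun u v hu hv huv => ?_) subset_rfl⟩
  refine (h.op_iff fun a b hab he => ?_).1 huv
  rcases Sym2.eq_iff.1 he with ⟨rfl, -⟩ | ⟨-, rfl⟩
  · exact hu.2 hab.1.1
  · exact hv.2 hab.1.1

theorem arc_sel (h : IsClosing fam T o o' S) (hs : Screen m n I arc) (s : σ) : (arc s).sel o' = (arc s).sel o := by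
  refine (arc s).isLocal ?_
  ext e
  simp only [Set.mem_inter_iff, and_congr_left_iff]
  intro he
  refine ⟨fun h1 => h.sub h1, fun h1 => ?_⟩
  by_contra hcon
  obtain ⟨a, b, hab, rfl⟩ := h.closed e h1 hcon
  have h2 := (hs.sub s _ (mem_edgesIn.1 he).2.2).2
  obtain ⟨-, h3, v, hv, hvb⟩ := hab
  have := (mainRect_annulus h3 (hvb ▸ fam.cols h.sel v hv)).1
  omega

theorem strength_eq [Fintype σ] (h : IsClosing fam T o o' S) (hs : Screen m n I arc) (b : Vertex k) :
    strength arc m n T S o' b = strength arc m n T S o b := by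
  ext s
  rw [mem_strength, mem_strength]
  unfold MeetsShape
  simp only [h.arc_sel hs, h.reach_iff]

end IsClosing

open Classical in
/-- It is unlikely that there are few active columns, unless no entry with an open edge is joined to many shapes. -/
theorem few_active [Fintype σ] {M : ℕ} {q : Sym2 (Vertex k) → ℝ} {δ : ℝ}
    (hq : IsWeight q) (hδ : 0 < δ) (hδ' : δ ≤ 1 / 2) (hs : Screen m n I arc)
    (hfam : fam.Surrounds m n (0, 0)) (hT : ∀ t ∈ T, (n : ℤ) < t.1.1)
    (hqδ : ∀ x y : Vertex k, x.1 ∈ mainRect m n → x.1.1 ≤ n → δ ≤ q s(x, y) ∧ q s(x, y) ≤ 1 - δ) (J : ℕ) :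
    δ ^ (J * (5 * (k + 1) ^ 2)) * Pr (boxEdges k M) q {o | ∃ S, fam.sel o = some S ∧
      ¬ Joined o (lift k (mainRect m n)) T S.verts ∧ (activeCols arc m n T S t o).card < J} ≤
      2 ^ (Fintype.card σ / (t + 1)) * Pr (boxEdges k M) q {o | ∃ S, fam.sel o = some S ∧
        ¬ Joined o (lift k (mainRect m n)) T S.verts ∧
        ∀ a b, Entry m n T S o a b → Op o a b → (strength arc m n T S o b).card ≤ t} := by
  set E : Set (Set (Sym2 (Vertex k))) := {o | ∃ S, fam.sel o = some S ∧
      ¬ Joined o (lift k (mainRect m n)) T S.verts ∧ (activeCols arc m n T S t o).card < J} with hE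
  let U : Set (Sym2 (Vertex k)) → Finset (ℤ × ℤ) := fun o => (fam.sel o).elim ∅ fun S => activeCols arc m n T S t o
  have hU : ∀ o S, fam.sel o = some S → U o = activeCols arc m n T S t o := fun o S h => by simp only [U, h, Option.elim]
  -- All edges from the cluster of `T` to the active columns are closed at once, after which no open
  -- entry is joined to more than $t$ shapes.
  let φ : Finset (ℤ × ℤ) → Set (Sym2 (Vertex k)) → Set (Sym2 (Vertex k)) := fun V o =>
    o \ {e | ∃ S a b, fam.sel o = some S ∧ Entry m n T S o a b ∧ b.1 ∈ V ∧ e = s(a, b)}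
  have hφ : ∀ o S V, fam.sel o = some S → IsClosing fam T o (φ V o) S := by
    intro o S V hS
    refine ⟨hS, Set.sdiff_subset, fun e he he' => ?_⟩
    have h1 : e ∈ {e | ∃ S a b, fam.sel o = some S ∧ Entry m n T S o a b ∧ b.1 ∈ V ∧ e = s(a, b)} := by
      by_contra hcon
      exact he' ⟨he, hcon⟩
    obtain ⟨S', a, b, hS', hab, -, rfl⟩ := h1
    rw [hS] at hS'
    cases hS'
    exact ⟨a, b, hab, rfl⟩
  have key := surgery_bound (F := boxEdges k M) (E := E) (E' := {o | ∃ S, fam.sel o = some S ∧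
        ¬ Joined o (lift k (mainRect m n)) T S.verts ∧
        ∀ a b, Entry m n T S o a b → Op o a b → (strength arc m n T S o b).card ≤ t}) (δ := δ) (C := J * (5 * (k + 1) ^ 2)) (N := 1)
    (L := 2 ^ (Fintype.card σ / (t + 1))) (q := q) hq hδ (by linarith) (fun o => {U o}) (fun V => V.biUnion (colEdges k)) φ ?_ ?_ ?_ ?_
  · push_cast at key
    rwa [one_mul] at key
  · rintro o ⟨S, hS, -, hJ⟩ - V hV
    rw [Finset.mem_singleton, hU o S hS] at hV
    subst hV
    refine ⟨(Finset.card_biUnion_le.trans (Finset.sum_le_card_nsmul _ _ _ fun z _ => card_colEdges_le z)).trans ?_, fun e he _ => ?_⟩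
    · rw [smul_eq_mul]
      exact Nat.mul_le_mul_right _ hJ.le
    · obtain ⟨z, hz, he⟩ := Finset.mem_biUnion.1 he
      obtain ⟨x, y, hx, rfl⟩ := mem_colEdges_iff he
      have h1 := activeCols_prop hS hz
      exact hqδ x y (hx ▸ h1.1) (hx ▸ h1.2.2)
  · rintro o ⟨S, hS, hj, -⟩ hoF V hV
    rw [Finset.mem_singleton, hU o S hS] at hV
    have h := hφ o S V hS
    refine ⟨Set.sdiff_subset.trans hoF, ?_, S, h.sel_eq, fun h1 => hj ?_, fun a b hab hop => ?_⟩
    · ext e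
      refine ⟨fun h1 => ⟨h1.1.1, h1.2⟩, fun h1 => ⟨⟨h1.1, ?_⟩, h1.2⟩⟩
      rintro ⟨S', a, b, -, hab, hb, rfl⟩
      refine h1.2 (Finset.mem_coe.2 (Finset.mem_biUnion.2 ⟨b.1, hb, ?_⟩))
      rw [Sym2.eq_swap]
      exact mem_colEdges hab.1.2.symm
    · obtain ⟨a, ha, b, hb, hab⟩ := h1
      exact ⟨a, ha, b, hb, hab.mono (fun _ _ _ _ h2 => h2.mono h.sub) subset_rfl⟩
    · by_contra! hcon
      rw [h.strength_eq hs] at hcon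
      rw [h.entry_iff] at hab
      have hb : b.1 ∈ V := by
        rw [hV]
        refine mem_activeCols.2 ⟨a, b, hab, ⟨hcon, a, b, hab, hop.mono h.sub, .refl ⟨hab.2.1, fun h2 => ?_⟩⟩, rfl⟩
        obtain ⟨v, hv, hvb⟩ := hab.2.2
        exact (offCluster_subset h2).2 v hv hvb
      exact hop.2.2 ⟨S, a, b, hS, hab, hb, rfl⟩
  · intro o _ _
    simp
  · intro o' _
    rcases hsel : fam.sel o' with _ | S
    · refine ⟨∅, by simp, ?_⟩
      rintro o ⟨S, hS, -⟩ - V - hV'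
      have := (hφ o S V hS).sel_eq
      rw [hV', hsel] at this
      exact absurd this (by simp)
    -- the sets of shapes of the strong components
    set comps : Finset (Finset σ) := Finset.univ.filter fun X => t < X.card ∧ ∃ v, strength arc m n T S o' v = X with hcomps
    have hf : ∀ 𝒮 : Finset (Finset σ), {z | ∃ a b, Entry m n T S o' a b ∧ strength arc m n T S o' b ∈ 𝒮 ∧ b.1 = z}.Finite := fun 𝒮 =>
      (finite_mainRect m n).subset (by rintro _ ⟨a, b, h, -, rfl⟩; exact h.2.1)
    have hcard : comps.card ≤ Fintype.card σ / (t + 1) := by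
      have h1 : (comps.biUnion id).card = ∑ X ∈ comps, X.card := by
        refine Finset.card_biUnion fun X hX Y hY hne => ?_
        obtain ⟨-, -, v, rfl⟩ := Finset.mem_filter.1 hX
        obtain ⟨-, -, w, rfl⟩ := Finset.mem_filter.1 hY
        change Disjoint (strength arc m n T S o' v) (strength arc m n T S o' w)
        rw [Finset.disjoint_left]
        intro s h1 h2
        exact hne (strength_eq (reach_of_mem_strength hfam hT hsel hs h1 h2))
      have h2 : ∑ X ∈ comps, (t + 1) ≤ ∑ X ∈ comps, X.card := Finset.sum_le_sum fun X hX => (Finset.mem_filter.1 hX).2.1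
      rw [← h1, Finset.sum_const, smul_eq_mul] at h2
      rw [Nat.le_div_iff_mul_le (Nat.succ_pos t)]
      exact h2.trans (Finset.card_le_univ _)
    refine ⟨comps.powerset.image fun 𝒮 => (hf 𝒮).toFinset, ?_, ?_⟩
    · refine Finset.card_image_le.trans ?_
      rw [Finset.card_powerset]
      exact Nat.pow_le_pow_right (by norm_num) hcard
    · rintro o ⟨S', hS', -⟩ - V hV hV'
      rw [Finset.mem_singleton, hU o S' hS'] at hV
      have h := hφ o S' V hS'
      rw [hV'] at h
      have hSS : S' = S := by
        have := h.sel_eq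
        rw [hsel] at this
        exact (Option.some.inj this).symm
      subst hSS
      -- The cluster, the entries and the strengths can be recomputed from the result. The only lost
      -- information is which of the strong components were active, a subset of `comps`, and this
      -- subset determines the active columns.
      refine Finset.mem_image.2 ⟨comps.filter fun X => ∃ v, Active arc m n T S' t o v ∧ strength arc m n T S' o v = X,
        Finset.mem_powerset.2 (Finset.filter_subset _ _), ?_⟩
      ext z
      rw [Set.Finite.mem_toFinset, hV, mem_activeCols]
      constructor
      · rintro ⟨a, b, hab, hb, rfl⟩
        obtain ⟨hb1, v, ⟨hv1, a', b', hv2, hv3, hv4⟩, hv⟩ := Finset.mem_filter.1 hb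
        rw [h.strength_eq hs] at hb1 hv
        rw [h.entry_iff] at hab
        obtain ⟨-, hcardb, -⟩ := Finset.mem_filter.1 hb1
        obtain ⟨s, hs'⟩ := Finset.card_pos.1 (lt_of_le_of_lt (Nat.zero_le t) hcardb)
        have hs'' : s ∈ strength arc m n T S' o v := by rw [hv]; exact hs'
        exact ⟨a, b, hab, ⟨hcardb, a', b', hv2, hv3, (reach_of_mem_strength hfam hT hsel hs hs' hs'').trans hv4⟩, rfl⟩
      · rintro ⟨a, b, hab, hb, rfl⟩
        refine ⟨a, b, h.entry_iff.2 hab, ?_, rfl⟩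
        rw [h.strength_eq hs]
        exact Finset.mem_filter.2 ⟨Finset.mem_filter.2 ⟨Finset.mem_univ _, hb.1, b, h.strength_eq hs b⟩, b, hb, rfl⟩

end Active
end Slab

/-! ### The bound for the probability that `T` misses the circuit. -/

namespace Slab

variable {k m n : ℕ} {σ : Type*} {C : σ → Set (ℤ × ℤ)} {fam : Family k (annulus m n (0, 0))}
  {arc : ∀ s, Family k (C s)} {T I : Set (Vertex k)} {S : Shape k} {t : ℕ} {o o' : Set (Sym2 (Vertex k))}

open Classical in
/-- The edges of the box that do not touch the regions of the screen. -/
noncomputable def farEdges (k M : ℕ) (C : σ → Set (ℤ × ℤ)) : Finset (Sym2 (Vertex k)) :=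
  (boxEdges k M).filter fun e => ∀ s, ∀ x ∈ e, x.1 ∉ C s

theorem mem_farEdges_iff {M : ℕ} {e : Sym2 (Vertex k)} :
    e ∈ farEdges k M C ↔ e ∈ boxEdges k M ∧ ∀ s, ∀ x ∈ e, x.1 ∉ C s := by
  simp [farEdges]

theorem mem_farEdges {M : ℕ} (hM : mainRect m n ⊆ box M (0, 0)) (hs : Screen m n I arc) {x y : Vertex k}
    (hxy : (graph k).Adj x y) (hx : x.1 ∈ mainRect m n) (hy : y.1 ∈ mainRect m n) (hmx : (m : ℤ) < x.1.1) :
    s(x, y) ∈ farEdges k M C := by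
  refine mem_farEdges_iff.2 ⟨edgesIn_mainRect hM (mem_edgesIn.2 ⟨hxy, hx, hy⟩), fun s v hv hvC => ?_⟩
  have h1 := (hs.sub s _ hvC).2
  have h2 := PAdj.fst_le _ _ (pAdj_of_adj hxy.symm)
  rcases Sym2.mem_iff.1 hv with rfl | rfl <;> omega

theorem op_iff_of_far {M : ℕ} (hM : mainRect m n ⊆ box M (0, 0)) (hs : Screen m n I arc)
    (h : o ∩ farEdges k M C = o' ∩ farEdges k M C) {x y : Vertex k}
    (hx : x.1 ∈ mainRect m n) (hy : y.1 ∈ mainRect m n) (hmx : (m : ℤ) < x.1.1) : Op o x y ↔ Op o' x y := by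
  refine and_congr_right fun hxy => ?_
  have h1 := mem_farEdges hM hs hxy hx hy hmx
  have h2 : s(x, y) ∈ o ∩ farEdges k M C ↔ s(x, y) ∈ o' ∩ farEdges k M C := by rw [h]
  simpa [h1] using h2

theorem offCluster_eq_of_far {M : ℕ} (hM : mainRect m n ⊆ box M (0, 0)) (hs : Screen m n I arc)
    (hfam : fam.Surrounds m n (0, 0)) (hT : ∀ t ∈ T, (n : ℤ) < t.1.1) {o'' : Set (Sym2 (Vertex k))} (hS : fam.sel o'' = some S)
    (h : o ∩ farEdges k M C = o' ∩ farEdges k M C) : offCluster m n T S o = offCluster m n T S o' :=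
  subset_antisymm
    (offCluster_mono fun _ hx _ hy hxy => (op_iff_of_far hM hs h (offCluster_subset hx).1 hy.1 (offCluster_right hfam hT hS hx)).1 hxy)
    (offCluster_mono fun _ hx _ hy hxy => (op_iff_of_far hM hs h (offCluster_subset hx).1 hy.1 (offCluster_right hfam hT hS hx)).2 hxy)

theorem sel_eq_of_far {M : ℕ} (hM' : annulus m n (0, 0) ⊆ box M (0, 0)) (hs : Screen m n I arc)
    (h : o ∩ farEdges k M C = o' ∩ farEdges k M C) : fam.sel o = fam.sel o' := by
  refine fam.isLocal ?_
  have hsub : edgesIn (lift k (annulus m n (0, 0))) ⊆ (farEdges k M C : Set (Sym2 (Vertex k))) := by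
    intro e he
    refine Finset.mem_coe.2 (mem_farEdges_iff.2 ⟨edgesIn_subset_boxEdges (fun x hx => hM' hx) he, fun s v hv hvC => ?_⟩)
    obtain ⟨h1, h2⟩ := hs.sub s _ hvC
    have := (mainRect_annulus h1 (he.2 v hv)).1
    omega
  rw [← Set.inter_eq_self_of_subset_right hsub, ← Set.inter_assoc, h, Set.inter_assoc]

/-- A path from `T` to the left part leaves the cluster of `T` through an open entry. -/
theorem exists_open_entry (hfam : fam.Surrounds m n (0, 0)) (hT : ∀ t ∈ T, (n : ℤ) < t.1.1) (hS : fam.sel o' = some S)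
    (hI : ∀ i ∈ I, i.1.1 ≤ m) (h : Joined o (lift k (mainRect m n)) T I) :
    ∃ a b, Entry m n T S o a b ∧ Op o a b ∧ ∃ i ∈ I, Reach (Op o) (rest m n T S o) b i := by
  obtain ⟨t', ht', i, hi, h⟩ := h
  have hin : ∀ i ∈ I, i ∉ offCluster m n T S o := fun i hi hic => by
    have h1 := offCluster_right hfam hT hS hic
    have h2 := hI i hi
    omega
  have ht : t' ∈ offCluster m n T S o := by
    refine ⟨t', ht', .refl ⟨h.left_mem, fun v hv hvt => ?_⟩⟩
    have h1 := (mem_box.1 (annulus_subset _ _ _ (fam.cols hS v hv))).1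
    have h2 := hT t' ht'
    rw [hvt] at h1
    dsimp only at h1
    omega
  rcases (h.symm Op.symm).first_entry (offCluster m n T S o) ht with h1 | ⟨b, a, h1, h2, h3, -⟩
  · exact absurd h1 (hin i hi)
  · have hb := h1.right_mem
    refine ⟨a, b, ⟨⟨h3, h2.1.symm⟩, hb.1, ?_⟩, Op.symm _ _ h2, i, hi, h1.symm Op.symm⟩
    by_contra! hcon
    obtain ⟨t'', ht'', h4⟩ := h3
    exact hb.2 ⟨t'', ht'', h4.tail (Op.symm _ _ h2) ⟨hb.1, hcon⟩⟩

open Classical in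
/-- Open entries are joined to many shapes of the screen. -/
theorem weak_entries [Fintype σ] {M : ℕ} (hmn : m ≤ n) (hM : mainRect m n ⊆ box M (0, 0)) (hM' : annulus m n (0, 0) ⊆ box M (0, 0))
    {q : Sym2 (Vertex k) → ℝ} {δ : ℝ}
    (hq : IsWeight q) (hδ : 0 < δ) (hδ' : δ ≤ 1 / 2) (hs : Screen m n I arc)
    (hfam : fam.Surrounds m n (0, 0)) (hT : ∀ t ∈ T, (n : ℤ) < t.1.1)
    (hqδ : ∀ x y : Vertex k, x.1 ∈ mainRect m n → x.1.1 ≤ n → δ ≤ q s(x, y) ∧ q s(x, y) ≤ 1 - δ) (r g : ℕ) (hr : 1 ≤ r) :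
    δ ^ (r * (10 * (k + 1) ^ 2)) * (g.choose r : ℕ) * Pr (boxEdges k M) q {o | (∃ S, fam.sel o = some S ∧
        ∀ a b, Entry m n T S o a b → Op o a b → (strength arc m n T S o b).card ≤ t) ∧
        Joined o (lift k (mainRect m n)) T I ∧ 2 * (g + t) ≤ (Finset.univ.filter (HasShape arc o)).card} ≤
      2 * ((r + t).choose r : ℕ) := by
  set E : Set (Set (Sym2 (Vertex k))) := {o | (∃ S, fam.sel o = some S ∧
        ∀ a b, Entry m n T S o a b → Op o a b → (strength arc m n T S o b).card ≤ t) ∧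
        Joined o (lift k (mainRect m n)) T I ∧ 2 * (g + t) ≤ (Finset.univ.filter (HasShape arc o)).card} with hE
  -- Once the edges that do not touch the regions of the screen are frozen, the selected shape, the
  -- cluster of `T` and its open entries are deterministic, while the edges at the arches keep their
  -- randomness.
  have hG : farEdges k M C ⊆ boxEdges k M := fun e he => (mem_farEdges_iff.1 he).1
  have key := Pr_le_of_freeze (F := boxEdges k M) (E := E) (E' := Set.univ) (a := δ ^ (r * (10 * (k + 1) ^ 2)) * (g.choose r : ℕ))
    (b := 2 * ((r + t).choose r : ℕ)) hq hG ?_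
  · rwa [Pr_univ, mul_one] at key
  intro ξ _
  rw [Pr_univ, mul_one]
  have hw := isWeight_freeze hq (farEdges k M C) ξ
  rcases hsel : fam.sel ξ with _ | S
  · have h0 : Pr (boxEdges k M) (freeze q (farEdges k M C) ξ) E ≤ 0 := by
      refine (Pr_freeze_mono hq hG (E' := ∅) fun o _ ho hoE => ?_).trans (by simp [Pr, Ex])
      obtain ⟨⟨S, hS, -⟩, -⟩ := hoE
      rw [sel_eq_of_far hM' hs ho, hsel] at hS
      exact absurd hS (by simp)
    have h1 : δ ^ (r * (10 * (k + 1) ^ 2)) * (g.choose r : ℕ) * Pr (boxEdges k M) (freeze q (farEdges k M C) ξ) E ≤ 0 :=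
      mul_nonpos_of_nonneg_of_nonpos (by positivity) h0
    exact h1.trans (by positivity)
  -- Two-sided surgery is applied inside the rest of the rectangle, between the ends of the open
  -- entries and `I`. The screen separates these two sets, and its columns lie entirely in `D`.
  set D := rest m n T S ξ with hD
  set A : Set (Vertex k) := {b | ∃ a, Entry m n T S ξ a b ∧ Op ξ a b} with hA
  have hAm : ∀ a ∈ A, (m : ℤ) < a.1.1 := by
    rintro b ⟨a, ⟨-, h1, v, hv, hvb⟩, -⟩
    exact (mainRect_annulus h1 (hvb ▸ fam.cols hsel v hv)).1
  have hcolD : ∀ s, ∀ z ∈ C s, ∀ j, ((z, j) : Vertex k) ∈ D := by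
    intro s z hz j
    have h1 := hs.sub s z hz
    refine ⟨h1.1, fun h => ?_⟩
    have := offCluster_right hfam hT hsel h
    dsimp only at this
    omega
  have h2 := two_sided_surgery (fam := arc) (D := D) (A := A) (I := I) (F := boxEdges k M) (q := freeze q (farEdges k M C) ξ) (δ := δ)
    hw hδ hδ' ((finite_lift_mainRect k m n).subset Set.sdiff_subset) boxEdges_subset hs.disj ?_ hs.avoid ?_ ?_ ?_ ?_ r g t hr
  · rw [← mul_assoc] at h2
    refine le_trans (mul_le_mul_of_nonneg_left (Pr_freeze_mono hq hG fun o _ ho hoE => ?_) (by positivity)) h2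
    obtain ⟨⟨S', hS', hweak⟩, hj, hcard⟩ := hoE
    rw [sel_eq_of_far hM' hs ho, hsel] at hS'
    cases hS'
    have hoff := offCluster_eq_of_far hM hs hfam hT hsel ho
    have hrest : rest m n T S o = D := by rw [hD]; unfold rest; rw [hoff]
    have hent : ∀ a b, Entry m n T S o a b ↔ Entry m n T S ξ a b := fun a b => by unfold Entry; rw [hoff]
    have hop : ∀ a b, Entry m n T S ξ a b → (Op o a b ↔ Op ξ a b) := fun a b hab =>
      op_iff_of_far hM hs ho (offCluster_subset hab.1.1).1 hab.2.1 (offCluster_right hfam hT hsel hab.1.1)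
    refine ⟨?_, hcard, ?_⟩
    · obtain ⟨a, b, h3, h4, i, hi, h5⟩ := exists_open_entry hfam hT hsel hs.left hj
      rw [hent] at h3
      exact ⟨b, ⟨a, h3, (hop a b h3).1 h4⟩, i, hi, hrest ▸ h5⟩
    · rintro b ⟨a, h3, h4⟩ -
      have h5 := hweak a b ((hent a b).2 h3) ((hop a b h3).2 h4)
      unfold strength at h5
      rw [hrest] at h5
      exact h5
  · intro s a ha haC
    have h1 := hAm a ha
    have h3 := (hs.sub s _ haC).2
    omega
  · intro s o O hO x hx y hy
    exact (hs.conn s o O hO x hx y hy).mono_set (arc_subset_rest hfam hT hsel hs hO)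
  · rintro s o O hO Λ hΛ ⟨a, ha, i, hi, hr⟩
    obtain ⟨x, hx, y, hy, hxy⟩ := hs.sep s o O hO Λ (fun v hv => (hΛ hv).1) a hr.left_mem i hi (hAm a ha) hr
    refine ⟨x, hx, y, hy, hxy, hcolD s _ ?_⟩
    rw [hxy]
    exact (arc s).cols hO y hy
  · intro s x y hx hxy _ hadj
    exact edgesIn_mainRect hM (mem_edgesIn.2 ⟨hadj, (hs.sub s _ hx).1, mem_lift.2 (hxy ▸ (hs.sub s _ hx).1)⟩)
  · intro s x y hx _ _ _
    have h1 : s(x, y) ∉ farEdges k M C := fun h => (mem_farEdges_iff.1 h).2 s x (Sym2.mem_mk_left x y) hx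
    rw [freeze_of_notMem h1]
    have h3 := hs.sub s _ hx
    exact hqδ x y h3.1 (by omega)

open Classical in
/-- A set that is likely to be connected to the left side is likely to be connected to the surrounding shape. -/
theorem disconnection_bound [Fintype σ] {M : ℕ} (hmn : m ≤ n) (hM : mainRect m n ⊆ box M (0, 0)) (hM' : annulus m n (0, 0) ⊆ box M (0, 0))
    {q : Sym2 (Vertex k) → ℝ} {δ : ℝ}
    (hq : IsWeight q) (hδ : 0 < δ) (hδ' : δ ≤ 1 / 2) (hs : Screen m n I arc)
    (hfam : fam.Surrounds m n (0, 0)) (hT : ∀ t ∈ T, (n : ℤ) < t.1.1)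
    (hqδ : ∀ x y : Vertex k, x.1 ∈ mainRect m n → x.1.1 ≤ n → δ ≤ q s(x, y) ∧ q s(x, y) ≤ 1 - δ)
    (J r g t : ℕ) (hJ : 1 ≤ J) (hr : 1 ≤ r) (hrg : r ≤ g) :
    Pr (boxEdges k M) q {o | ∃ S, fam.sel o = some S ∧ ¬ Joined o (lift k (mainRect m n)) T S.verts} ≤
      ((Fintype.card σ / (t + 1) : ℕ) : ℝ) / (δ ^ (5 * (k + 1) ^ 2) * J) + 2 ^ (Fintype.card σ / (t + 1)) / δ ^ (J * (5 * (k + 1) ^ 2)) *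
      (Pr (boxEdges k M) q {o | ¬ Joined o (lift k (mainRect m n)) T I} +
        Pr (boxEdges k M) q {o | (Finset.univ.filter (HasShape arc o)).card < 2 * (g + t)} +
        2 * ((r + t).choose r : ℕ) / (δ ^ (r * (10 * (k + 1) ^ 2)) * (g.choose r : ℕ))) := by
  have hgr : (0 : ℝ) < (g.choose r : ℕ) := by exact_mod_cast Nat.choose_pos hrg
  have hJ0 : (0 : ℝ) < J := by exact_mod_cast hJ
  have h1 := many_active (fam := fam) (T := T) (t := t) hM hq hδ hδ' hs hqδ J
  have h2 := few_active (M := M) (t := t) hq hδ hδ' hs hfam hT hqδ J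
  have h3 := weak_entries (t := t) hmn hM hM' hq hδ hδ' hs hfam hT hqδ r g hr
  set E₁ : Set (Set (Sym2 (Vertex k))) := {o | ∃ S, fam.sel o = some S ∧
      ¬ Joined o (lift k (mainRect m n)) T S.verts ∧ J ≤ (activeCols arc m n T S t o).card}
  set E₂ : Set (Set (Sym2 (Vertex k))) := {o | ∃ S, fam.sel o = some S ∧
      ¬ Joined o (lift k (mainRect m n)) T S.verts ∧ (activeCols arc m n T S t o).card < J}
  set E₃ : Set (Set (Sym2 (Vertex k))) := {o | ∃ S, fam.sel o = some S ∧
        ¬ Joined o (lift k (mainRect m n)) T S.verts ∧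
        ∀ a b, Entry m n T S o a b → Op o a b → (strength arc m n T S o b).card ≤ t}
  set E₄ : Set (Set (Sym2 (Vertex k))) := {o | (∃ S, fam.sel o = some S ∧
        ∀ a b, Entry m n T S o a b → Op o a b → (strength arc m n T S o b).card ≤ t) ∧
        Joined o (lift k (mainRect m n)) T I ∧ 2 * (g + t) ≤ (Finset.univ.filter (HasShape arc o)).card}
  set N₁ : Set (Set (Sym2 (Vertex k))) := {o | ¬ Joined o (lift k (mainRect m n)) T I}
  set N₂ : Set (Set (Sym2 (Vertex k))) := {o | (Finset.univ.filter (HasShape arc o)).card < 2 * (g + t)}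
  -- If no open entry is joined to many arches, then `T` misses `I`, or the screen is incomplete, or
  -- the situation of `weak_entries` occurs.
  have h4 : Pr (boxEdges k M) q E₃ ≤ Pr (boxEdges k M) q N₁ + Pr (boxEdges k M) q N₂ + Pr (boxEdges k M) q E₄ := by
    refine (Pr_mono hq (E' := (N₁ ∪ N₂) ∪ E₄) ?_).trans ((Pr_union_le hq).trans (add_le_add_left (Pr_union_le hq) _))
    rintro o - ⟨S, hS, -, hweak⟩
    by_cases hj : Joined o (lift k (mainRect m n)) T I
    · by_cases hc : (Finset.univ.filter (HasShape arc o)).card < 2 * (g + t)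
      · exact Or.inl (Or.inr hc)
      · exact Or.inr ⟨⟨S, hS, hweak⟩, hj, not_lt.1 hc⟩
    · exact Or.inl (Or.inl hj)
  have h5 : Pr (boxEdges k M) q E₁ ≤ ((Fintype.card σ / (t + 1) : ℕ) : ℝ) / (δ ^ (5 * (k + 1) ^ 2) * J) := by
    rw [le_div_iff₀ (by positivity)]
    linarith
  have h6 : Pr (boxEdges k M) q E₂ ≤ 2 ^ (Fintype.card σ / (t + 1)) / δ ^ (J * (5 * (k + 1) ^ 2)) * Pr (boxEdges k M) q E₃ := by
    rw [div_mul_eq_mul_div, le_div_iff₀ (by positivity)]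
    linarith
  have h7 : Pr (boxEdges k M) q E₄ ≤ 2 * ((r + t).choose r : ℕ) / (δ ^ (r * (10 * (k + 1) ^ 2)) * (g.choose r : ℕ)) := by
    rw [le_div_iff₀ (by positivity)]
    linarith
  have h8 : Pr (boxEdges k M) q {o | ∃ S, fam.sel o = some S ∧ ¬ Joined o (lift k (mainRect m n)) T S.verts} ≤
      Pr (boxEdges k M) q E₁ + Pr (boxEdges k M) q E₂ := by
    refine (Pr_mono hq ?_).trans (Pr_union_le hq)
    rintro o - ⟨S, hS, hj⟩
    rcases le_or_gt J (activeCols arc m n T S t o).card with h | h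
    · exact Or.inl ⟨S, hS, hj, h⟩
    · exact Or.inr ⟨S, hS, hj, h⟩
  refine h8.trans (add_le_add h5 (h6.trans (mul_le_mul_of_nonneg_left ?_ (by positivity))))
  linarith

end Slab

/-! ### Arches in nested half-annuli, clipped to the rectangle. -/

namespace Slab

variable {k : ℕ}

/-- The part of a path after its last visit above a given level. -/
theorem Reach.clip {V : Type*} {r : V → V → Prop} {D : Set V} {x y : V} (hr : ∀ a b, r a b → r b a) {f : V → ℤ}
    (hf : ∀ a b, r a b → f b ≤ f a + 1) (h : Reach r D x y) {c : ℤ} (hy : f y ≤ c) :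
    ∃ x', (x' = x ∨ f x' = c) ∧ Reach r (D ∩ {z | f z ≤ c}) x' y := by
  rcases h.stays_or {z | f z ≤ c} with h1 | ⟨v, hv, hvc, -, h1⟩
  · exact ⟨x, .inl rfl, h1⟩
  · have : ¬ f v ≤ c := hvc
    obtain ⟨w, hw, h2, -⟩ := (h1.symm hr).until hf hy (by omega)
    exact ⟨w, .inr hw, h2.symm hr⟩

section Arches

/-- The part inside the rectangle of the half-annulus of size `U` around `(0, y)`. -/
def archRegion (m n : ℕ) (y U : ℤ) : Set (ℤ × ℤ) := {z | z ∈ mainRect m n ∧ (z.1, z.2 - y) ∈ Scale.halfAnnulus U}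

/-- The boundary of the rectangle above `(0, y)`. -/
def archTop (m : ℕ) (y : ℤ) : Set (ℤ × ℤ) := {z | z.1 = 0 ∧ y < z.2 ∨ z.2 = m}

/-- The boundary of the rectangle below `(0, y)`. -/
def archBot (m : ℕ) (y : ℤ) : Set (ℤ × ℤ) := {z | z.1 = 0 ∧ z.2 < y ∨ z.2 = -m}

theorem mem_mainRect {m n : ℕ} {z : ℤ × ℤ} : z ∈ mainRect m n ↔ (0 ≤ z.1 ∧ z.1 ≤ 3 * n) ∧ -m ≤ z.2 ∧ z.2 ≤ m := Iff.rfl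

theorem mem_archRegion {m n : ℕ} {y U : ℤ} {z : ℤ × ℤ} : z ∈ archRegion m n y U ↔ z ∈ mainRect m n ∧
    (0 ≤ z.1 ∧ z.1 ≤ 60 * U ∧ -(60 * U) ≤ z.2 - y ∧ z.2 - y ≤ 60 * U) ∧
    (20 * U ≤ z.1 ∨ 20 * U ≤ z.2 - y ∨ z.2 - y ≤ -(20 * U)) := Iff.rfl

theorem disjoint_archRegion {m n : ℕ} {y U U' : ℤ} (hU' : 1 ≤ U') (h : 4 * U' ≤ U) {z : ℤ × ℤ}
    (hz : z ∈ archRegion m n y U) : z ∉ archRegion m n y U' := by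
  rw [mem_archRegion] at *
  omega

theorem Pr_arch {M m n : ℕ} {p : ℝ} (hp : 0 ≤ p ∧ p ≤ 1) {y U : ℤ} (hy : -m ≤ y ∧ y ≤ m) (hU : 1 ≤ U) (hn : 60 * U ≤ 3 * n)
    (hM : m + 60 * U ≤ M) :
    Pr (boxEdges k M) (fun _ => p) {o | PJ o (Scale.halfAnnulus U) (vseg 0 (20 * U) (60 * U)) (vseg 0 (-(60 * U)) (-(20 * U)))} ≤
    Pr (boxEdges k M) (fun _ => p) {o | PJ o (archRegion m n y U) (archTop m y) (archBot m y)} := by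
  have hbox : ∀ z ∈ Scale.halfAnnulus U, (0 ≤ z.1 ∧ z.1 ≤ 60 * U ∧ -(60 * U) ≤ z.2 ∧ z.2 ≤ 60 * U) ∧
    (20 * U ≤ z.1 ∨ 20 * U ≤ z.2 ∨ z.2 ≤ -(20 * U)) := fun z hz => hz
  rw [← Pr_pj (isPlanarIsometry_shift (0, y)) (T' := {z | (z.1, z.2 - y) ∈ Scale.halfAnnulus U})
    (A' := {z | z.1 = 0 ∧ y < z.2}) (B' := {z | z.1 = 0 ∧ z.2 < y})]
  · refine Pr_mono (fun _ => hp) fun o _ ho => ?_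
    obtain ⟨a, ha, b, hb, hab⟩ := ho
    change a.1.1 = 0 ∧ y < a.1.2 at ha
    change b.1.1 = 0 ∧ b.1.2 < y at hb
    -- The half-annulus may protrude from the rectangle. Cutting the arch at suitable visits to the
    -- levels $m$ and $-m$ leaves a piece inside whose ends lie on the boundary of the rectangle,
    -- one above and one below the centre.
    obtain ⟨a', ha', h1⟩ := hab.clip Op.symm (f := fun v => v.1.2) Op.snd_le (c := m) (by omega)
    obtain ⟨b', hb', h2⟩ := (h1.symm Op.symm).clip Op.symm (f := fun v => -v.1.2)
      (fun u v huv => by have := Op.snd_le _ _ (Op.symm _ _ huv); omega) (c := m) (by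
        rcases ha' with rfl | ha' <;> omega)
    refine ⟨a', ?_, b', ?_, (h2.symm Op.symm).mono_set ?_⟩
    · change _ ∨ _
      rcases ha' with rfl | ha'
      · exact .inl ha
      · exact .inr ha'
    · change _ ∨ _
      rcases hb' with rfl | hb'
      · exact .inl hb
      · exact .inr (by omega)
    · rintro z ⟨⟨hz, h3⟩, h4⟩
      have h3 : z.1.2 ≤ m := h3
      have h4 : -z.1.2 ≤ m := h4
      have h5 := hbox _ hz
      dsimp only at h5
      exact ⟨mem_mainRect.2 (by omega), hz⟩
  · intro z hz
    have := hbox z hz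
    rw [mem_box]; dsimp only; omega
  · intro z hz
    have := hbox _ hz
    rw [mem_box]; dsimp only at *; omega
  · intro z; simp [shift_apply]
  · intro z hz
    have := hbox z hz
    change (z.1 + 0 = 0 ∧ y < z.2 + y) ↔ _
    rw [mem_vseg]; omega
  · intro z hz
    have := hbox z hz
    change (z.1 + 0 = 0 ∧ z.2 + y < y) ↔ _
    rw [mem_vseg]; omega

/-- A path between the two boundary parts of a rectangle above and below a point of its left side meets every
path from this point to the right side. -/
theorem sides_inter {m : ℕ} {w s : ℤ} {P Q : Set (ℤ × ℤ)} (hP : P ⊆ rect 0 w (-m) m) (hQ : Q ⊆ rect 0 w (-m) m)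
    {x y z : ℤ × ℤ} (hp : Reach PAdj P x y) (hx : x ∈ archTop m s) (hy : y ∈ archBot m s)
    (hq : Reach PAdj Q (0, s) z) (hz : z.1 = w) : ∃ v ∈ P, v ∈ Q := by
  have g1 := mem_rect.1 (hQ hq.left_mem)
  dsimp only at g1
  -- Ends on the left side are prolonged along an additional column to the corners; the point
  -- $(-1,s)$ of this column is left free for the prolongation of `Q`.
  set P' := P ∪ (vseg (-1) (s + 1) m ∪ vseg (-1) (-m) (s - 1)) with hP'
  have hp' : Reach PAdj P' x y := hp.mono_set Set.subset_union_left
  obtain ⟨x', hx', h1⟩ : ∃ x' : ℤ × ℤ, x'.2 = m ∧ Reach PAdj P' x' x := by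
    rcases hx with hx | hx
    · have hxm := mem_rect.1 (hP hp.left_mem)
      refine ⟨(-1, m), rfl, ((reach_vseg (x := -1) (c := s + 1) (d := m) (y := m) (y' := x.2) (by omega) (by omega)).mono_set ?_).tail ?_ hp'.left_mem⟩
      · exact fun v hv => .inr (.inl hv)
      · rw [pAdj_iff']; dsimp only; omega
    · exact ⟨x, hx, .refl hp'.left_mem⟩
  obtain ⟨y', hy', h2⟩ : ∃ y' : ℤ × ℤ, y'.2 = -m ∧ Reach PAdj P' y' y := by
    rcases hy with hy | hy
    · have hxm := mem_rect.1 (hP hp.right_mem)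
      refine ⟨(-1, -m), rfl, ((reach_vseg (x := -1) (c := -m) (d := s - 1) (y := -m) (y' := y.2) (by omega) (by omega)).mono_set ?_).tail ?_ hp'.right_mem⟩
      · exact fun v hv => .inr (.inr hv)
      · rw [pAdj_iff']; dsimp only; omega
    · exact ⟨y, hy, .refl hp'.right_mem⟩
  have hq' : Reach PAdj ({(-1, s)} ∪ Q) (-1, s) z := by
    refine (Reach.refl (Set.mem_singleton _)).append hq ?_
    rw [pAdj_iff']; dsimp only; omega
  have key := Scale.crossing_rect (a₀ := -1) (a₁ := w) (b₀ := -m) (b₁ := m) ?_ ?_ hq' rfl hz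
    ((h1.trans (hp'.trans (h2.symm PAdj.symm))).symm PAdj.symm) hy' hx'
  · obtain ⟨v, hv, hv'⟩ := key
    rcases hv with hv | hv <;> rcases hv' with hv' | hv' | hv'
    all_goals first
      | exact ⟨v, hv', hv⟩
      | exfalso
        try have i1 := mem_rect.1 (hP hv')
        try have i2 := mem_rect.1 (hQ hv)
        try rw [mem_vseg] at hv'
        try rw [Set.mem_singleton_iff, Prod.ext_iff] at hv
        try dsimp only at *
        omega
  · rintro v (hv | hv)
    · rw [Set.mem_singleton_iff] at hv
      rw [hv, mem_rect]; dsimp only; omega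
    · have := mem_rect.1 (hQ hv)
      rw [mem_rect]; omega
  · rintro v (hv | hv | hv)
    · have := mem_rect.1 (hP hv)
      rw [mem_rect]; omega
    · rw [mem_vseg] at hv; rw [mem_rect]; omega
    · rw [mem_vseg] at hv; rw [mem_rect]; omega

/-- Independent events are unlikely to fail simultaneously. -/
theorem Pr_forall_notMem_le {ι : Type*} {F : Finset ι} {q : ι → ℝ} (hq : IsWeight q) {c : ℝ} {A : ℕ → Set (Set ι)}
    {D : ℕ → Set ι} : ∀ s : ℕ, (∀ j < s, DependsOnly (D j) (A j)) → (∀ j < s, ∀ j' < s, j ≠ j' → Disjoint (D j) (D j')) →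
      (∀ j < s, c ≤ Pr F q (A j)) → Pr F q {o | ∀ j < s, o ∉ A j} ≤ (1 - c) ^ s := by
  intro s
  induction s with
  | zero => intro _ _ _; simpa using Pr_le_one hq
  | succ s ih =>
    intro hA hD hc
    have h1 : {o | ∀ j < s + 1, o ∉ A j} = {o | ∀ j < s, o ∉ A j} ∩ (A s)ᶜ := by
      ext o
      simp only [Set.mem_ofPred_eq, Set.mem_inter_iff, Set.mem_compl_iff]
      exact Nat.forall_lt_succ_right
    rw [h1, Pr_inter_of_disjoint (S := ⋃ j ∈ Finset.range s, D j) (S' := D s), pow_succ, Pr_compl]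
    · refine mul_le_mul (ih (fun j hj => hA j (by omega)) (fun j hj j' hj' => hD j (by omega) j' (by omega))
        fun j hj => hc j (by omega)) (by linarith [hc s (by omega)]) ?_ ?_
      · linarith [Pr_le_one (F := F) (E := A s) hq]
      · exact pow_nonneg (by linarith [hc s (by omega), Pr_le_one (F := F) (E := A s) hq]) _
    · intro o o' h ho j hj hoj
      refine ho j hj (hA j (by omega) o' o ?_ hoj)
      have hsub : D j ⊆ ⋃ j ∈ Finset.range s, D j := Set.subset_biUnion_of_mem (u := D) (Finset.mem_coe.2 (Finset.mem_range.2 hj))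
      rw [← Set.inter_eq_self_of_subset_right hsub, ← Set.inter_assoc, ← Set.inter_assoc, h]
    · exact (hA s (by omega)).compl
    · simp only [Set.disjoint_iUnion_left, Finset.mem_range]
      exact fun j hj => hD j (by omega) s (by omega) (by omega)

end Arches

/-- The distances `m / (1000 * 4 ^ l)`. -/
def dist (m l : ℕ) : ℕ := m / (1000 * 4 ^ l)

theorem dist_le (m l : ℕ) : 1000 * dist m l ≤ m := by
  calc 1000 * dist m l ≤ 1000 * (m / 1000) := Nat.mul_le_mul_left _ (Nat.div_le_div_left (Nat.le_mul_of_pos_right _ (by positivity)) (by norm_num))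
    _ ≤ m := Nat.mul_div_le _ _

theorem one_le_dist {m l : ℕ} (h : 1000 * 4 ^ l ≤ m) : 1 ≤ dist m l := (Nat.one_le_div_iff (by positivity)).2 h

theorem dist_lt {m l l' : ℕ} (h : l < l') : 4 * dist m l' ≤ dist m l := by
  have h1 : dist m l' ≤ dist m l / 4 := by
    rw [dist, dist, Nat.div_div_eq_div_mul, mul_assoc, ← pow_succ]
    exact Nat.div_le_div_left (Nat.mul_le_mul_left _ (Nat.pow_le_pow_right (by norm_num) h)) (by positivity)
  omega

theorem le_mul_dist {m l : ℕ} (h : 1000 * 4 ^ l ≤ m) : 2 * m ≤ 4000 * 4 ^ l * dist m l := by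
  have h1 := Nat.lt_mul_div_succ m (show 0 < 1000 * 4 ^ l by positivity)
  have h2 := one_le_dist h
  rw [dist] at *
  nlinarith [show 0 < 1000 * 4 ^ l by positivity]

end Slab

/-! ### Sequences of models in which the left side is reached with probability tending to one. -/

namespace Slab

/-- A family of shapes that surround a box, a set at distance from the box, and a percolation model that is
homogeneous outside of the neighbourhood of this set. -/
structure Setup (ε : ℝ) (k : ℕ) where
  p : ℝ
  m : ℕ
  n : ℕ
  fam : Family k (annulus m n (0, 0))
  T : Set (Vertex k)
  q : Sym2 (Vertex k) → ℝ
  hp : ε ≤ p ∧ p ≤ 1 - ε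
  le : m ≤ n
  surrounds : fam.Surrounds m n (0, 0)
  far : ∀ t ∈ T, (n : ℤ) < t.1.1
  weight : IsWeight q
  eq_p : ∀ x y : Vertex k, x.1.1 ≤ n → q s(x, y) = p

namespace Setup

variable {ε : ℝ} {k : ℕ}

/-- The probability of an event. -/
noncomputable def pr (X : Setup ε k) (E : Set (Set (Sym2 (Vertex k)))) : ℝ := Pr (boxEdges k (4 * X.n)) X.q E

/-- The set `T` is joined to `I` inside the rectangle. -/
def join (X : Setup ε k) (I : Set (Vertex k)) : Set (Set (Sym2 (Vertex k))) :=
  {o | Joined o (lift k (mainRect X.m X.n)) X.T I}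

theorem pr_pj (X : Setup ε k) {M : ℕ} {D A B : Set (ℤ × ℤ)} (hD : ∀ z ∈ D, z.1 ≤ X.n) (h : D ⊆ box (4 * X.n) (0, 0))
    (h' : D ⊆ box M (0, 0)) : X.pr {o | PJ o D A B} = Pr (boxEdges k M) (fun _ => X.p) {o | PJ o D A B} := by
  classical
  have hd := dependsOnly_pj (k := k) D A B
  have h1 : ∀ e ∈ edgesIn (lift k D), e ∈ boxEdges k (4 * X.n) := fun e he => lift_box_subset h he
  have h2 : ∀ e ∈ edgesIn (lift k D), e ∈ boxEdges k M := fun e he => lift_box_subset h' he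
  set G := (boxEdges k M).filter (· ∈ edgesIn (lift k D)) with hG
  rw [pr, Pr_eq_of_dependsOnly (G := G) hd fun e he => by simp [hG, he, h1 e he, h2 e he],
    Pr_eq_of_dependsOnly (F := boxEdges k M) (G := G) hd fun e he => by simp [hG, he]]
  refine Ex_congr_weight fun e he => ?_
  have he := (Finset.mem_filter.1 he).2
  induction e using Sym2.ind with
  | _ x y => exact X.eq_p x y (hD _ (mem_edgesIn.1 he).2.1)

/-- Closing all edges that touch the columns of the left side isolates it from `T`; there are $2m+1$
columns with at most $5(k+1)^2$ edges each. -/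
theorem pr_join_le (hε : 0 < ε) (X : Setup ε k) : X.pr (X.join (mainLeft k X.m)) ≤ 1 - ε ^ (5 * (k + 1) ^ 2 * (2 * X.m + 1)) := by
  classical
  set G := (Finset.Icc (-(X.m : ℤ)) X.m).biUnion fun y => colEdges k (0, y) with hG
  have hcard : G.card ≤ 5 * (k + 1) ^ 2 * (2 * X.m + 1) := by
    refine (Finset.card_biUnion_le_card_mul _ _ _ fun y _ => card_colEdges_le _).trans_eq ?_
    rw [Int.card_Icc, mul_comm]
    congr 1
    omega
  have hp1 : ε ≤ 1 := by linarith [X.hp.1, X.hp.2]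
  have key := surgery_bound (F := boxEdges k (4 * X.n)) (E := Set.univ) (E' := (X.join (mainLeft k X.m))ᶜ) (N := 1) (L := 1) (C := G.card)
    (α := Unit) X.weight hε hp1 (fun _ => {()}) (fun _ => G) (fun _ o => o \ G) ?_ ?_ (fun _ _ _ => by simp)
    (fun o _ => ⟨{()}, by simp, fun _ _ _ a _ _ => by simp⟩)
  · rw [Pr_univ, Pr_compl] at key
    have h1 := pow_le_pow_of_le_one hε.le hp1 hcard
    simp only [Nat.cast_one, one_mul, mul_one] at key
    unfold pr
    linarith
  · refine fun o _ _ _ _ => ⟨le_rfl, fun e he _ => ?_⟩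
    obtain ⟨y, hy, he⟩ := Finset.mem_biUnion.1 he
    obtain ⟨x, hx, z, rfl⟩ : ∃ x : Vertex k, x.1.1 ≤ X.n ∧ ∃ z, e = s(x, z) := by
      obtain ⟨⟨x, z⟩, hx, rfl⟩ := Finset.mem_image.1 he
      simp only [Finset.mem_product, Finset.mem_singleton] at hx
      exact ⟨x, by rw [hx.1.1]; exact Int.natCast_nonneg _, z, rfl⟩
    rw [X.eq_p x z hx]
    exact X.hp
  · refine fun o _ ho _ _ => ⟨Set.sdiff_subset.trans ho, by rw [Set.sdiff_sdiff, Set.union_self], ?_⟩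
    rintro ⟨t, ht, l, ⟨hl, hl'⟩, h⟩
    rw [Set.mem_singleton_iff] at hl
    have h2 := (h.symm Op.symm).closed (P := fun v => v.1.1 = 0) hl fun a b ha _ hPa hab => ?_
    · have h3 := X.far t ht
      omega
    · refine absurd (Finset.mem_coe.2 (Finset.mem_biUnion.2 ⟨a.1.2, Finset.mem_Icc.2 (mem_mainRect.1 ha).2, ?_⟩)) hab.2.2
      have := mem_colEdges hab.1
      rwa [show a.1 = (0, a.1.2) from Prod.ext hPa rfl] at this

/-- The points of a subdivision of the left side. -/
def pt (X : Setup ε k) (l j : ℕ) : ℤ := min X.m (-X.m + j * dist X.m l)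

/-- The segments of a subdivision of the left side. -/
def bin (X : Setup ε k) (l j : ℕ) : Set (ℤ × ℤ) := vseg 0 (X.pt l j) (X.pt l j + dist X.m l)

theorem pt_mem (X : Setup ε k) (l j : ℕ) : -X.m ≤ X.pt l j ∧ X.pt l j ≤ X.m := by
  have : (0 : ℤ) ≤ j * dist X.m l := by positivity
  rw [pt]
  omega

theorem join_subset_bin (X : Setup ε k) {l : ℕ} (h : 1000 * 4 ^ l ≤ X.m) :
    X.join (mainLeft k X.m) ⊆ ⋃ j ∈ Finset.range (4000 * 4 ^ l + 1), X.join (lift k (X.bin l j)) := by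
  rintro o ⟨t, ht, x, ⟨hx, hx'⟩, hj⟩
  rw [Set.mem_singleton_iff] at hx
  have hx' : -(X.m : ℤ) ≤ x.1.2 ∧ x.1.2 ≤ X.m := hx'
  have h1 : (1 : ℤ) ≤ dist X.m l := by exact_mod_cast one_le_dist h
  have h2 : 2 * (X.m : ℤ) ≤ 4000 * 4 ^ l * dist X.m l := by exact_mod_cast le_mul_dist h
  set d : ℤ := ((dist X.m l : ℕ) : ℤ)
  obtain ⟨j, hj'⟩ := Int.eq_ofNat_of_zero_le (Int.ediv_nonneg (show 0 ≤ x.1.2 + X.m by omega) (show 0 ≤ d by omega))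
  have h3 := Int.mul_ediv_self_le (x := x.1.2 + X.m) (k := d) (by omega)
  have h4 := Int.lt_mul_ediv_self_add (x := x.1.2 + X.m) (k := d) (by omega)
  rw [hj', mul_comm] at h3 h4
  refine Set.mem_iUnion₂.2 ⟨j, Finset.mem_range.2 ?_, t, ht, x, ?_, hj⟩
  · have : (j : ℤ) < 4000 * 4 ^ l + 1 := by
      by_contra! hcon
      nlinarith
    exact_mod_cast this
  · refine mem_vseg.2 ⟨hx, ?_⟩
    have : X.pt l j = -X.m + j * d := min_eq_right (by change -(X.m : ℤ) + j * d ≤ X.m; omega)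
    change _ ∧ _ ≤ _ + d
    rw [this]
    omega

/-- The homogeneous models at a given scale. -/
noncomputable def scale (X : ℕ → Setup ε k) (hε : 0 < ε) (l : ℕ) : Scale ε where
  p i := (X i).p
  M i := 4 * (X i).n + 1000
  u i := max 1 (dist (X i).m l)
  pos := hε
  le_half := by linarith [(X 0).hp.1, (X 0).hp.2]
  hp i := (X i).hp
  hu i := le_max_left _ _
  hM i := by
    have h1 := dist_le (X i).m l
    have h2 := (X i).le
    omega

variable {X : ℕ → Setup ε k} {𝒰 : Ultrafilter ℕ}

/-- The event has high probability along the sequence. -/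
def High (𝒰 : Ultrafilter ℕ) (X : ℕ → Setup ε k) (E : ℕ → Set (Set (Sym2 (Vertex k)))) : Prop :=
  Whp 𝒰 (fun i => boxEdges k (4 * (X i).n)) (fun i => (X i).q) E

/-- For bounded $m$ the left side is isolated with probability bounded below. -/
theorem tendsto_size (hε : 0 < ε) (h : High 𝒰 X fun i => (X i).join (mainLeft k (X i).m)) (B : ℕ) :
    ∀ᶠ i in 𝒰, B ≤ (X i).m := by
  filter_upwards [(whp_iff fun i => (X i).weight).1 h (ε ^ (5 * (k + 1) ^ 2 * (2 * B + 1)) / 2) (by positivity)] with i hi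
  by_contra! hB
  have h1 := pr_join_le hε (X i)
  have h2 := pow_le_pow_of_le_one hε.le (by linarith [(X i).hp.1, (X i).hp.2] : ε ≤ 1)
    (Nat.mul_le_mul_left (5 * (k + 1) ^ 2) (show 2 * (X i).m + 1 ≤ 2 * B + 1 by omega))
  have h3 : 0 < ε ^ (5 * (k + 1) ^ 2 * (2 * B + 1)) := by positivity
  rw [pr] at h1
  linarith

/-- The number of bins depends only on `l`, so the square root trick for finitely many increasing
events selects one of them. -/
theorem exists_bin (hε : 0 < ε) (h : High 𝒰 X fun i => (X i).join (mainLeft k (X i).m)) (l : ℕ) :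
    ∃ j, High 𝒰 X fun i => (X i).join (lift k ((X i).bin l j)) := by
  obtain ⟨j, -, hj⟩ := Whp.exists_fin (fun i => (X i).weight) (4000 * 4 ^ l + 1)
    (A := fun j i => (X i).join (lift k ((X i).bin l j))) (fun j i => isUpperSet_joined _ _ _)
    (h.mono (fun i => (X i).weight) ((tendsto_size hε h (1000 * 4 ^ l)).mono fun i hi _ ho => join_subset_bin (X i) hi ho))
  exact ⟨j, hj⟩

/-- The wide rectangles at a given scale are likely to be crossed. -/
theorem window (hε : 0 < ε) (hm : ∀ B, ∀ᶠ i in 𝒰, B ≤ (X i).m) {l j : ℕ}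
    (h : High 𝒰 X fun i => (X i).join (lift k ((X i).bin l j))) {w : ℕ} (hw : w ≤ 40) :
    (scale X hε l).W 𝒰 (Scale.hEvent k (fun U => w * U) fun U => (2 * w + 1 : ℕ) * U) := by
  have hU : ∀ᶠ i in 𝒰, (((scale X hε l).u i : ℤ) = dist (X i).m l ∧ (1 : ℤ) ≤ dist (X i).m l) ∧ 1000 * (dist (X i).m l : ℤ) ≤ (X i).m ∧
      ((X i).m : ℤ) ≤ (X i).n ∧ ((scale X hε l).M i : ℤ) = 4 * (X i).n + 1000 ∧ (scale X hε l).p i = (X i).p := by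
    filter_upwards [hm (1000 * 4 ^ l)] with i hi
    have h1 := one_le_dist hi
    refine ⟨⟨by exact_mod_cast max_eq_right h1, by exact_mod_cast h1⟩, by exact_mod_cast dist_le _ _, by exact_mod_cast (X i).le, ?_⟩
    exact ⟨by simp [scale], rfl⟩
  generalize scale X hε l = S at hU ⊢
  set E : ℕ → ℤ → ℤ → Set (Set (Sym2 (Vertex k))) := fun i a b =>
    {o | PJ o (rect 0 (w * dist (X i).m l) ((X i).pt l j + a * dist (X i).m l) ((X i).pt l j + b * dist (X i).m l))
      (hline ((X i).pt l j + a * dist (X i).m l)) (hline ((X i).pt l j + b * dist (X i).m l))}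
  -- A path from the bin to `T` is followed up to abscissa `w * d`, where `d` is the length of the
  -- bin. It stays within distance `w * d` above and below the bin, or it leaves this window and
  -- crosses vertically a square of side `w * d`. Clipping by the top or bottom of the rectangle
  -- does no harm, as crossing probabilities are compared with those of unclipped rectangles.
  have key : Whp 𝒰 (fun i => boxEdges k (S.M i)) (fun i _ => S.p i) fun i =>
      {o | PJ o (rect 0 (w * dist (X i).m l) ((X i).pt l j - w * dist (X i).m l) ((X i).pt l j + (w + 1) * dist (X i).m l))
        (vline 0) (vline (w * dist (X i).m l))} ∪ (E i (-w) 0 ∪ E i 1 (w + 1)) := by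
    refine h.of_le (fun i => (X i).weight) S.isWeight (hU.mono fun i hi => ?_)
    obtain ⟨⟨-, h1⟩, h2, h3, h4, h0⟩ := hi
    have hpt := (X i).pt_mem l j
    set y := (X i).pt l j
    set d : ℤ := ((dist (X i).m l : ℕ) : ℤ)
    have hwd : 0 ≤ w * d ∧ w * d ≤ 40 * d := ⟨by positivity, by nlinarith [(by exact_mod_cast hw : (w : ℤ) ≤ 40)]⟩
    set D := rect 0 (w * d) (-(X i).m) (X i).m with hD
    have hbox : ∀ M : ℕ, 4 * ((X i).n : ℤ) ≤ M → D ⊆ box M (0, 0) := fun M hM =>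
      rect_subset_box (by omega) (by omega) (by omega) (by omega)
    calc Pr (boxEdges k (4 * (X i).n)) (X i).q ((X i).join (lift k ((X i).bin l j)))
        ≤ (X i).pr {o | PJ o D ((X i).bin l j) (vline (w * d))} := by
          refine Pr_mono (X i).weight ?_
          rintro o - ⟨t, ht, x, hx, htx⟩
          have hx1 := mem_vseg.1 hx
          have ht1 := (X i).far t ht
          obtain ⟨v, hv, h5, -⟩ := (htx.symm Op.symm).until (f := fun v => v.1.1) Op.fst_le (c := w * d)
            (by omega) (by omega)
          exact ⟨x, hx, v, hv, h5.mono_set fun z hz => ⟨⟨(mem_mainRect.1 hz.1).1.1, hz.2⟩, (mem_mainRect.1 hz.1).2⟩⟩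
      _ = Pr (boxEdges k (S.M i)) (fun _ => S.p i) {o | PJ o D ((X i).bin l j) (vline (w * d))} :=
          h0 ▸ (X i).pr_pj (fun z hz => by have := mem_rect.1 hz; omega) (hbox _ (by push_cast; rfl)) (hbox _ (by omega))
      _ ≤ _ := by
          refine Pr_mono (S.isWeight i) ?_
          rintro o - ⟨x, hx, v, hv, hxv⟩
          have hx1 : x.1.1 = 0 ∧ y ≤ x.1.2 ∧ x.1.2 ≤ y + d := hx
          have hexp : (w + 1) * d = w * d + d := by ring
          rcases hxv.stays_or {u | u.1.2 ≤ y + (w + 1) * d} with h5 | ⟨u, hu, hub, h5, -⟩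
          · rcases h5.stays_or {u | y - w * d ≤ u.1.2} with h6 | ⟨u, hu, hub, h6, -⟩
            · exact .inl ⟨x, hx1.1, v, hv, h6.mono_set fun z hz => ⟨hz.1.1.1, hz.2, hz.1.2⟩⟩
            · have hub : ¬ y - w * d ≤ u.1.2 := hub
              have h7 : PJ o D {u.1} {x.1} := ⟨u, rfl, x, rfl, (h6.symm Op.symm).mono_set Set.inter_subset_left⟩
              refine .inr (.inl (PJ.mono (h7.between_snd (a := y + (-w) * d) (b := y + 0 * d) (by linarith) ?_ ?_) ?_
                (fun _ _ h => h) (fun _ _ h => h)))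
              · rintro z - rfl; linarith
              · rintro z - rfl; linarith
              · exact fun z hz => ⟨hz.1.1, hz.2⟩
          · have hub : ¬ u.1.2 ≤ y + (w + 1) * d := hub
            have h7 : PJ o D {x.1} {u.1} := ⟨x, rfl, u, rfl, h5⟩
            refine .inr (.inr (PJ.mono (h7.between_snd (a := y + 1 * d) (b := y + (w + 1) * d) (by linarith) ?_ ?_) ?_
              (fun _ _ h => h) (fun _ _ h => h)))
            · rintro z - rfl; linarith
            · rintro z - rfl; linarith
            · exact fun z hz => ⟨hz.1.1, hz.2⟩
  have hv : ∀ a b : ℤ, -w ≤ a → b ≤ w + 1 → b - a = w → Whp 𝒰 (fun i => boxEdges k (S.M i)) (fun i _ => S.p i) (fun i => E i a b) →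
      S.W 𝒰 (Scale.hEvent k (fun U => w * U) fun U => (2 * w + 1 : ℕ) * U) := by
    intro a b ha hb hab hE
    refine hE.mono' S.isWeight (hU.mono fun i hi => ?_)
    obtain ⟨⟨h0, h1⟩, h2, h3, h4, -⟩ := hi
    have hpt := (X i).pt_mem l j
    have h5 : (b - a) * (dist (X i).m l : ℤ) = w * dist (X i).m l := by rw [hab]
    have hw' : (w : ℤ) ≤ 40 := by exact_mod_cast hw
    rw [Pr_vcross_eq (by nlinarith) (by nlinarith) (by nlinarith) (by nlinarith) (by nlinarith) (by nlinarith)]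
    change _ ≤ cr k _ _ (w * (S.u i : ℤ)) ((2 * w + 1 : ℕ) * (S.u i : ℤ))
    rw [h0]
    exact cr_mono (S.unit i) (by positivity) (by nlinarith) (by push_cast; nlinarith)
  rcases key.or S.isWeight (fun _ => isUpperSet_pj _ _ _) (fun _ => (isUpperSet_pj _ _ _).union (isUpperSet_pj _ _ _)) with h1 | h1
  · refine h1.mono' S.isWeight (hU.mono fun i hi => ?_)
    obtain ⟨⟨h0, h1⟩, h2, h3, h4, -⟩ := hi
    have hpt := (X i).pt_mem l j
    have hw' : (w : ℤ) ≤ 40 := by exact_mod_cast hw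
    rw [Pr_hcross_eq (by omega) (by nlinarith) (by nlinarith) (by nlinarith) (by nlinarith) (by nlinarith)]
    change _ ≤ cr k _ _ (w * (S.u i : ℤ)) ((2 * w + 1 : ℕ) * (S.u i : ℤ))
    rw [h0]
    exact cr_mono (S.unit i) (by positivity) (by nlinarith) (by push_cast; nlinarith)
  · rcases h1.or S.isWeight (fun _ => isUpperSet_pj _ _ _) (fun _ => isUpperSet_pj _ _ _) with h1 | h1
    · exact hv _ _ le_rfl (by positivity) (by ring) h1
    · exact hv _ _ (by linarith [(by positivity : (0 : ℤ) ≤ w)]) le_rfl (by ring) h1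

end Setup
end Slab

/-! ### Screens of arches, and the choice of the parameters. -/

namespace Slab

variable {k : ℕ}

/-- The union of every `N`-th of the nested half-annuli around `(0, y)`, starting with the `b`-th. -/
def blockRegion (m n : ℕ) (y : ℤ) (N s : ℕ) (b : Fin N) : Set (ℤ × ℤ) :=
  {z | ∃ j < s, z ∈ archRegion m n y (dist m (b + N * j))}

/-- The arches in the half-annuli of a block. -/
noncomputable def arches (k m n : ℕ) (y : ℤ) (N s : ℕ) (b : Fin N) : Family k (blockRegion m n y N s b) :=
  pathFamily _ (lift k (blockRegion m n y N s b)) (lift k (archTop m y)) (lift k (archBot m y)) subset_rfl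

theorem level_lt {N s b j : ℕ} (hb : b < N) (hj : j < s) : b + N * j < N * s := by nlinarith

theorem level_inj {N j j' : ℕ} {b b' : Fin N} (h : (b : ℕ) + N * j = b' + N * j') : b = b' ∧ j = j' := by
  have hb : b = b' := by
    have := congrArg (· % N) h
    simpa [Nat.mod_eq_of_lt, Fin.val_inj] using this
  subst hb
  exact ⟨rfl, Nat.eq_of_mul_eq_mul_left b.pos (by omega)⟩

theorem disjoint_level {m n L l l' : ℕ} (hm : 1000 * 4 ^ L ≤ m) {y : ℤ} (hl : l < L) (hl' : l' < L) (h : l ≠ l') {z : ℤ × ℤ}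
    (hz : z ∈ archRegion m n y (dist m l)) : z ∉ archRegion m n y (dist m l') := by
  have h1 : ∀ {l}, l < L → (1 : ℤ) ≤ dist m l := fun hl => by
    exact_mod_cast one_le_dist (hm.trans' (Nat.mul_le_mul_left _ (Nat.pow_le_pow_right (by norm_num) hl.le)))
  rcases h.lt_or_gt with h | h
  · exact disjoint_archRegion (h1 hl') (by exact_mod_cast dist_lt h) hz
  · exact fun hz' => disjoint_archRegion (h1 hl) (by exact_mod_cast dist_lt h) hz' hz

/-- The half-annuli have scales at least four times the length of the bin, so the bin lies in their
inner holes, and different blocks use disjoint half-annuli. Every path from the bin to the right of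
abscissa $m$ meets the projection of each arch by `sides_inter`. -/
theorem screen_arches {m n : ℕ} {y : ℤ} {N s : ℕ} (hm : 1000 * 4 ^ (N * s) ≤ m) :
    Screen m n (lift k (vseg 0 y (y + dist m (N * s)))) (arches k m n y N s) := by
  have hm1 : 1 ≤ m := hm.trans' (Nat.one_le_iff_ne_zero.2 (by positivity))
  have hreg : ∀ b : Fin N, ∀ z ∈ blockRegion m n y N s b, ∃ U : ℤ, 1 ≤ U ∧ 4 * (dist m (N * s) : ℤ) ≤ U ∧ 1000 * U ≤ m ∧
      z ∈ archRegion m n y U := by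
    rintro b z ⟨j, hj, hz⟩
    have h1 := dist_lt (m := m) (level_lt b.2 hj)
    have h2 := one_le_dist hm
    have h3 := dist_le m (b + N * j)
    exact ⟨_, by omega, by omega, by omega, hz⟩
  refine ⟨fun b b' hb => Set.disjoint_left.2 ?_, ?_, ?_, ?_, ?_, ?_⟩
  · rintro z ⟨j, hj, hz⟩ ⟨j', hj', hz'⟩
    exact disjoint_level hm (level_lt b.2 hj) (level_lt b'.2 hj') (fun h => hb (level_inj h).1) hz hz'
  · intro b z hz
    obtain ⟨U, h1, -, h2, h3⟩ := hreg b z hz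
    rw [mem_archRegion] at h3
    exact ⟨h3.1, by omega⟩
  · intro b i hi hib
    obtain ⟨U, h1, h4, h2, h3⟩ := hreg b _ hib
    have hi := mem_vseg.1 hi
    rw [mem_archRegion] at h3
    omega
  · intro i hi
    have hi := mem_vseg.1 hi
    omega
  · intro b o S hS x hx z hz
    exact ((pathFamily_mem hS).2.2.2.2 x hx z hz).mono (fun _ _ _ _ => Op.mono ((arches k m n y N s b).isOpen hS)) subset_rfl
  · intro b o S hS Λ hΛ a ha i hi hma h
    obtain ⟨g1, g2, ⟨x, hx, hxS⟩, ⟨z, hz, hzS⟩, g3⟩ := pathFamily_mem hS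
    have h4 := ((g3 x hxS z hzS).mono (fun _ _ _ _ h => h.1) subset_rfl).fst_inter
    have hi' : i.1.1 = 0 ∧ y ≤ i.1.2 ∧ i.1.2 ≤ y + dist m (N * s) := hi
    obtain ⟨v, hv, h5, -⟩ := (h.fst_inter.symm PAdj.symm).until (f := fun z => z.1) PAdj.fst_le (c := m) (by omega) (by omega)
    rw [show i.1 = (0, i.1.2) from Prod.ext hi'.1 rfl] at h5
    have hend : ∀ v ∈ S.verts, v.1.1 = 0 → v.1.2 < y ∨ i.1.2 < v.1.2 := by
      intro v hv hv0
      obtain ⟨U, h6, h7, h8, h9⟩ := hreg b _ (g1 hv)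
      rw [mem_archRegion] at h9
      omega
    have key := sides_inter (m := m) ?_ ?_ h4 ?_ ?_ h5 hv
    · obtain ⟨_, ⟨u, hu, rfl⟩, ⟨u', hu', huu⟩, -⟩ := key
      exact ⟨u', hu', u, hu, huu⟩
    · rintro _ ⟨u, hu, rfl⟩
      obtain ⟨U, h6, h7, h8, h9⟩ := hreg b _ (g1 hu)
      rw [mem_archRegion] at h9
      exact ⟨by omega, h9.1.2⟩
    · rintro _ ⟨⟨u, hu, rfl⟩, hum⟩
      have := mem_mainRect.1 (hΛ hu)
      exact ⟨⟨this.1.1, hum⟩, this.2⟩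
    · refine hx.imp_left fun hx => ?_
      have := hend x hxS hx.1
      omega
    · refine hz.imp_left fun hz => ?_
      omega

/-- Each block contains `s` disjoint half-annuli and thus `s` independent chances for an arch, so
that all `N` blocks are occupied with high probability although one half-annulus is occupied only
with probability `c`. -/
theorem Pr_arches {F : Finset (Sym2 (Vertex k))} {q : Sym2 (Vertex k) → ℝ} (hq : IsWeight q) {m n N s : ℕ} {y : ℤ} {c : ℝ}
    (hm : 1000 * 4 ^ (N * s) ≤ m)
    (hc : ∀ l < N * s, c ≤ Pr F q {o | PJ o (archRegion m n y (dist m l)) (archTop m y) (archBot m y)}) :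
    Pr F q {o | ∃ b, ¬ HasShape (arches k m n y N s) o b} ≤ N * (1 - c) ^ s := by
  have h1 : ∀ b : Fin N, Pr F q {o | ¬ HasShape (arches k m n y N s) o b} ≤ (1 - c) ^ s := by
    intro b
    refine (Pr_mono hq ?_).trans (Pr_forall_notMem_le hq (c := c)
      (A := fun j => {o | PJ o (archRegion m n y (dist m (b + N * j))) (archTop m y) (archBot m y)})
      (D := fun j => edgesIn (lift k (archRegion m n y (dist m (b + N * j))))) s (fun j _ => dependsOnly_pj _ _ _) ?_
      fun j hj => hc _ (level_lt b.2 hj))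
    · intro o _ ho j hj hoj
      exact ho (pathFamily_isSome.2 (PJ.mono hoj (fun z hz => ⟨j, hj, hz⟩) (fun _ _ h => h) (fun _ _ h => h)))
    · refine fun j hj j' hj' hjj => Set.disjoint_left.2 fun e he he' => ?_
      induction e using Sym2.ind with
      | _ u v =>
        exact disjoint_level hm (level_lt b.2 hj) (level_lt b.2 hj') (fun h => hjj (level_inj (b := b) (b' := b) h).2)
          (mem_edgesIn.1 he).2.1 (mem_edgesIn.1 he').2.1
  have h2 : {o | ∃ b, ¬ HasShape (arches k m n y N s) o b} = ⋃ b ∈ Finset.univ, {o | ¬ HasShape (arches k m n y N s) o b} := by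
    ext o; simp
  rw [h2]
  refine (Pr_iUnion_le hq _ _).trans ((Finset.sum_le_sum fun b _ => h1 b).trans_eq ?_)
  rw [Finset.sum_const, Finset.card_univ, Fintype.card_fin, nsmul_eq_mul]

theorem pow_le_choose_mul (K r : ℕ) : K ^ r ≤ ((K + 1) * r).choose r := by
  rcases Nat.eq_zero_or_pos r with rfl | hr
  · simp
  have h1 := Nat.pow_sub_le_descFactorial ((K + 1) * r) r
  rw [Nat.descFactorial_eq_factorial_mul_choose] at h1
  have h2 : (K * r) ^ r ≤ ((K + 1) * r + 1 - r) ^ r := Nat.pow_le_pow_left (by rw [add_mul]; omega) _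
  have h3 := Nat.mul_le_mul_right (((K + 1) * r).choose r) (Nat.factorial_le_pow r)
  rw [mul_pow, mul_comm] at h2
  exact Nat.le_of_mul_le_mul_left (h2.trans (h1.trans h3)) (by positivity)

/-- The choice of the parameters of the bound for the probability of disconnection. -/
theorem exists_parameters {a b c η : ℝ} (ha : 0 < a) (hb : 0 < b) (hc : 0 < c) (hη : 0 < η) :
    ∃ J r g s N : ℕ, N = 2 * (g + r) ∧ 1 ≤ J ∧ 1 ≤ r ∧ r ≤ g ∧ ∃ η' > (0 : ℝ), ∀ x y : ℝ, 0 ≤ x → x ≤ η' → y ≤ N * (1 - c) ^ s →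
      ((N / (r + 1) : ℕ) : ℝ) / (a * J) + 2 ^ (N / (r + 1)) / a ^ J * (x + y + 2 * ((r + r).choose r : ℕ) / (b ^ r * (g.choose r : ℕ))) ≤ η := by
  -- With $g=(K+1)r$ one has $\binom gr\ge K^r$, so $K\ge8/b$ makes $b^r\binom gr\ge8^r$, against
  -- $\binom{2r}r\le4^r$.
  obtain ⟨K, hK⟩ := exists_nat_ge (8 / b)
  obtain ⟨J, hJ⟩ := exists_nat_ge (max 1 (4 * (2 * (K + 2)) / (a * η)))
  set B : ℝ := 2 ^ (2 * (K + 2)) / a ^ J with hB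
  have hB0 : 0 < B := by positivity
  -- Order of the choices: `K` fixes a bound for the number of strong components, `J` makes the
  -- first term small, this fixes the factor `B`, and only then are `r` and `s` taken large
  -- depending on `B`.
  obtain ⟨r, hr⟩ := exists_pow_lt_of_lt_one (show 0 < η / (8 * B) by positivity) (show (1 / 2 : ℝ) < 1 by norm_num)
  set g := (K + 1) * (r + 1) with hg
  set N := 2 * (g + (r + 1)) with hN
  have hN0 : (0 : ℝ) < N := by exact_mod_cast (show 0 < N by omega)
  obtain ⟨s, hs⟩ := exists_pow_lt_of_lt_one (show 0 < η / (4 * B * N) by positivity) (show 1 - c < 1 by linarith)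
  -- The number of strong components is bounded independently of `r`, because the threshold for
  -- strength grows in proportion to the number of arches.
  have hNr : N / (r + 1 + 1) ≤ 2 * (K + 2) := Nat.div_le_of_le_mul (by nlinarith)
  refine ⟨J, r + 1, g, s, N, rfl, by exact_mod_cast (le_max_left _ _).trans hJ, by omega, by nlinarith, η / (4 * B), by positivity, fun x y hx0 hx hy => ?_⟩
  have hJ0 : (0 : ℝ) < J := lt_of_lt_of_le one_pos ((le_max_left _ _).trans hJ)
  have h1 : ((N / (r + 1 + 1) : ℕ) : ℝ) / (a * J) ≤ η / 4 := by
    have h2 : ((N / (r + 1 + 1) : ℕ) : ℝ) ≤ 2 * (K + 2) := by exact_mod_cast hNr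
    have h3 := (le_max_right _ _).trans hJ
    rw [div_le_iff₀ (by positivity)] at h3
    rw [div_le_iff₀ (by positivity)]
    nlinarith
  have h4 : (2 : ℝ) ^ (N / (r + 1 + 1)) / a ^ J ≤ B :=
    div_le_div_of_nonneg_right (pow_le_pow_right₀ (by norm_num) hNr) (by positivity)
  have h5 : 2 * (((r + 1) + (r + 1)).choose (r + 1) : ℕ) / (b ^ (r + 1) * (g.choose (r + 1) : ℕ)) ≤ η / (4 * B) := by
    have h6 : (((r + 1) + (r + 1)).choose (r + 1) : ℝ) ≤ 4 ^ (r + 1) := by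
      have := Nat.choose_le_two_pow ((r + 1) + (r + 1)) (r + 1)
      rw [← two_mul, pow_mul] at this
      rw [← two_mul]
      exact_mod_cast this
    have h7 : (K : ℝ) ^ (r + 1) ≤ (g.choose (r + 1) : ℕ) := by exact_mod_cast pow_le_choose_mul K (r + 1)
    have h8 : (8 : ℝ) ^ (r + 1) ≤ b ^ (r + 1) * (g.choose (r + 1) : ℕ) := by
      refine le_trans ?_ (mul_le_mul_of_nonneg_left h7 (by positivity))
      rw [← mul_pow]
      refine pow_le_pow_left₀ (by norm_num) ?_ _
      rw [div_le_iff₀ hb] at hK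
      linarith
    calc 2 * ((((r + 1) + (r + 1)).choose (r + 1) : ℕ) : ℝ) / (b ^ (r + 1) * (g.choose (r + 1) : ℕ))
        ≤ 2 * 4 ^ (r + 1) / 8 ^ (r + 1) := div_le_div₀ (by positivity) (by linarith) (by positivity) h8
      _ = (1 / 2) ^ r := by
        rw [show (8 : ℝ) = 4 * 2 by norm_num, mul_pow, pow_succ 2, one_div, inv_pow]
        field_simp
      _ ≤ η / (4 * B) := hr.le.trans (div_le_div_of_nonneg_left hη.le (by positivity) (by linarith))
  have h9 : y ≤ η / (4 * B) := by
    refine hy.trans ?_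
    rw [lt_div_iff₀ (by positivity)] at hs
    rw [le_div_iff₀ (by positivity)]
    linarith
  have h10 : x + y + 2 * (((r + 1) + (r + 1)).choose (r + 1) : ℕ) / (b ^ (r + 1) * (g.choose (r + 1) : ℕ)) ≤ 3 * (η / (4 * B)) := by linarith
  have h11 : B * (3 * (η / (4 * B))) = 3 * (η / 4) := by field_simp
  have h12 := (mul_le_mul_of_nonneg_left h10 (by positivity : 0 ≤ (2 : ℝ) ^ (N / (r + 1 + 1)) / a ^ J)).trans
    (mul_le_mul_of_nonneg_right h4 (by positivity))
  linarith

namespace Setup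

variable {ε : ℝ}

open Classical in
/-- If the far set is likely to be joined to the left side, then it is likely to be joined to the surrounding shape. -/
theorem exists_bound (hε : 0 < ε) (k : ℕ) {η : ℝ} (hη : 0 < η) : ∃ δ > 0, ∀ X : Setup ε k, 1 - δ ≤ X.pr (X.join (mainLeft k X.m)) →
    X.pr {o | ∃ S, X.fam.sel o = some S ∧ ¬ Joined o (lift k (mainRect X.m X.n)) X.T S.verts} ≤ η := by
  -- Compactness: a sequence of counterexamples with $\delta=1/(i+1)$. Along an ultrafilter every
  -- finite choice of bins and of alternatives can be made once for the whole sequence.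
  by_contra! hcon
  choose X hX hX' using fun i : ℕ => hcon (1 / ((i : ℝ) + 1)) Nat.one_div_pos_of_nat
  set 𝒰 := hyperfilter ℕ
  have hε2 : ε ≤ 1 / 2 := by linarith [(X 0).hp.1, (X 0).hp.2]
  have hJ : High 𝒰 X fun i => (X i).join (mainLeft k (X i).m) := by
    refine (whp_iff fun i => (X i).weight).2 fun θ hθ => ?_
    have h1 := (tendsto_one_div_add_atTop_nhds_zero_nat (𝕜 := ℝ)).eventually (gt_mem_nhds hθ)
    filter_upwards [h1.filter_mono Nat.hyperfilter_le_atTop] with i hi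
    have := hX i
    rw [pr] at this
    linarith
  have hm := tendsto_size hε hJ
  obtain ⟨c, hc, hQ⟩ := Scale.exists_halfAnnulus hε k
  -- The bound for arches is uniform in the height `y`, since the bins that were used to derive it
  -- at the larger scales need not be near the small bin that is to be screened.
  have hA : ∀ l, ∀ᶠ i in 𝒰, ∀ y : ℤ, -(X i).m ≤ y → y ≤ (X i).m →
      c ≤ (X i).pr {o | PJ o (archRegion (X i).m (X i).n y (dist (X i).m l)) (archTop (X i).m y) (archBot (X i).m y)} := by
    intro l
    obtain ⟨j, hj⟩ := exists_bin hε hJ l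
    have hW : ∀ w : ℕ, 1 ≤ w → w ≤ 40 → (scale X hε l).W 𝒰 (Scale.hEvent k (fun U => w * U) fun U => (w + 1) * U) := fun w hw hw' =>
      Scale.hEvent_narrow (by omega) (2 * w + 1) (by omega) (by omega) (window hε hm hj hw')
    have h1 := hQ (scale X hε l) 𝒰 (by simpa using hW 20 (by norm_num) (by norm_num))
      (by simpa using hW 39 (by norm_num) (by norm_num)) (by simpa using hW 40 (by norm_num) (by norm_num))
    filter_upwards [h1, hm (1000 * 4 ^ l)] with i h1 h2 y hy hy'
    have h3 := one_le_dist h2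
    have h4 := dist_le (X i).m l
    have h5 := (X i).le
    have hu : ((scale X hε l).u i : ℤ) = dist (X i).m l := by exact_mod_cast max_eq_right h3
    have hM : (scale X hε l).M i = 4 * (X i).n + 1000 := by simp [scale]
    rw [hu, show (scale X hε l).p i = (X i).p from rfl] at h1
    generalize (scale X hε l).M i = M at h1 hM
    have hbox : ∀ M' : ℕ, 4 * (X i).n ≤ M' → archRegion (X i).m (X i).n y (dist (X i).m l) ⊆ box M' (0, 0) := by
      rintro M' hM' z ⟨hz, -⟩
      have := mem_mainRect.1 hz
      rw [mem_box]
      dsimp only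
      omega
    rw [(X i).pr_pj (M := M) ?_ (hbox _ le_rfl) (hbox _ (by omega))]
    · exact h1.trans (Pr_arch (Scale.unit (scale X hε l) i) ⟨hy, hy'⟩ (by omega) (by omega) (by omega))
    · intro z hz
      rw [mem_archRegion] at hz
      omega
  -- The lower bound `c` for arches does not depend on the sequence or on the scale, so the
  -- parameters are fixed first. They determine the scale `N * s` of the bin, and then one index `i`
  -- satisfies the finitely many conditions.
  obtain ⟨J, r, g, s, N, hN, hJ1, hr, hrg, η', hη', hbound⟩ := exists_parameters (a := ε ^ (5 * (k + 1) ^ 2)) (b := ε ^ (10 * (k + 1) ^ 2))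
    (by positivity) (by positivity) hc hη
  obtain ⟨j, hj⟩ := exists_bin hε hJ (N * s)
  obtain ⟨i, h1, h2, h3⟩ := ((hm (1000 * 4 ^ (N * s))).and (((whp_iff fun i => (X i).weight).1 hj η' hη').and
    ((Filter.eventually_all_finset (Finset.range (N * s))).2 fun l _ => hA l))).exists
  have hpt := (X i).pt_mem (N * s) j
  have key := disconnection_bound (T := (X i).T) (fam := (X i).fam) (X i).le (mainRect_subset (X i).le) annulus_subset_left (X i).weight hε hε2
    (screen_arches (k := k) (n := (X i).n) (y := (X i).pt (N * s) j) h1) (X i).surrounds (X i).far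
    (fun x y _ hx => by rw [(X i).eq_p x y hx]; exact (X i).hp) J r g r hJ1 hr hrg
  have h4 : Pr (boxEdges k (4 * (X i).n)) (X i).q {o | ¬ Joined o (lift k (mainRect (X i).m (X i).n)) (X i).T
      (lift k (vseg 0 ((X i).pt (N * s) j) ((X i).pt (N * s) j + dist (X i).m (N * s))))} ≤ η' := by
    have h5 := Pr_compl (F := boxEdges k (4 * (X i).n)) (q := (X i).q) (E := (X i).join (lift k ((X i).bin (N * s) j)))
    refine le_trans (le_of_eq h5) (by linarith)
  have h5 : Pr (boxEdges k (4 * (X i).n)) (X i).q {o | (Finset.univ.filter (HasShape (arches k (X i).m (X i).n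
      ((X i).pt (N * s) j) N s) o)).card < 2 * (g + r)} ≤ N * (1 - c) ^ s := by
    refine (Pr_mono (X i).weight fun o _ ho => ?_).trans (Pr_arches (X i).weight h1 fun l hl => h3 l (Finset.mem_range.2 hl) _ hpt.1 hpt.2)
    by_contra! hall
    have h6 : (Finset.univ.filter (HasShape (arches k (X i).m (X i).n ((X i).pt (N * s) j) N s) o)).card < 2 * (g + r) := ho
    rw [Finset.filter_true_of_mem fun b _ => not_not.1 fun h => hall ⟨b, h⟩, Finset.card_univ, Fintype.card_fin] at h6
    omega
  refine absurd (hX' i) (not_lt.2 (le_trans key (le_trans (le_of_eq ?_) (hbound _ _ (Pr_nonneg (X i).weight) h4 h5))))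
  rw [Fintype.card_fin, pow_mul' ε J, pow_mul' ε r]

end Setup
end Slab

/-! ### Both ends of the rectangle: reflection, conditioning and conclusion. -/

namespace Slab

variable {k : ℕ}

/-- The image of a family of shapes under a planar isometry. -/
noncomputable def Family.image {C C' : Set (ℤ × ℤ)} (fam : Family k C) {σ : (ℤ × ℤ) ≃ (ℤ × ℤ)} (hσ : IsPlanarIsometry σ)
    (hC : ∀ z ∈ C, σ z ∈ C') : Family k C' where
  sel o := (fam.sel (emap k σ ⁻¹' o)).map fun S => ⟨vmap k σ '' S.verts, emap k σ '' S.edges⟩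
  isOpen h := by
    obtain ⟨S, hS, rfl⟩ := Option.map_eq_some_iff.1 h
    exact Set.image_subset_iff.2 (fam.isOpen hS)
  cols h := by
    obtain ⟨S, hS, rfl⟩ := Option.map_eq_some_iff.1 h
    rintro _ ⟨x, hx, rfl⟩
    exact hC _ (fam.cols hS x hx)
  edges_subset h := by
    obtain ⟨S, hS, rfl⟩ := Option.map_eq_some_iff.1 h
    rintro _ ⟨e, he, rfl⟩
    exact (mem_edgesIn_image hσ).2 ⟨e, fam.edges_subset hS he, rfl⟩
  isLocal {o o'} h := by
    refine congrArg _ (fam.isLocal (Set.ext fun e => and_congr_left fun he => ?_))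
    have h1 : emap k σ e ∈ edgesIn (lift k C') :=
      edgesIn_mono (Set.image_subset_iff.2 fun x hx => hC x.1 hx) ((mem_edgesIn_image hσ).2 ⟨e, he, rfl⟩)
    have h2 : emap k σ e ∈ o ∩ edgesIn (lift k C') ↔ emap k σ e ∈ o' ∩ edgesIn (lift k C') := by rw [h]
    exact ⟨fun h => (h2.1 ⟨h, h1⟩).1, fun h => (h2.2 ⟨h, h1⟩).1⟩
  antisymm h h' ho ho' := by
    obtain ⟨S, hS, rfl⟩ := Option.map_eq_some_iff.1 h
    obtain ⟨S', hS', rfl⟩ := Option.map_eq_some_iff.1 h'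
    rw [fam.antisymm hS hS' (Set.image_subset_iff.1 ho) (Set.image_subset_iff.1 ho')]
  exists_of_open h ho := by
    obtain ⟨S, hS, rfl⟩ := Option.map_eq_some_iff.1 h
    obtain ⟨S', hS'⟩ := fam.exists_of_open hS (Set.image_subset_iff.1 ho)
    exact ⟨_, Option.map_eq_some_iff.2 ⟨S', hS', rfl⟩⟩

variable {m n : ℕ}

theorem flip_annulus {z : ℤ × ℤ} (hz : z ∈ annulus m n (3 * (n : ℤ), 0)) : flipFst (3 * n) z ∈ annulus m n (0, 0) := by
  rw [mem_annulus, mem_box, mem_box] at *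
  rw [flipFst_apply]
  dsimp only at *
  omega

theorem flip_mainRect {z : ℤ × ℤ} : flipFst (3 * n) z ∈ mainRect m n ↔ z ∈ mainRect m n := by
  rw [mem_mainRect, mem_mainRect, flipFst_apply]
  dsimp only
  omega

theorem image_flip_mainRect : vmap k (flipFst (3 * n)) '' lift k (mainRect m n) = lift k (mainRect m n) := by
  rw [vmap_image_lift]
  congr 1
  refine Set.Subset.antisymm (Set.image_subset_iff.2 fun z hz => flip_mainRect.2 hz) fun z hz => ?_
  exact ⟨(flipFst (3 * n)).symm z, flip_mainRect.1 (by simpa using hz), by simp⟩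

/-- The mirror image of the situation at the right end of the rectangle. -/
noncomputable def mirrorSetup {ε : ℝ} {p : ℝ} (hε : 0 < ε) (hp : ε ≤ p ∧ p ≤ 1 - ε) (hm : 1 ≤ m) (hmn : m ≤ n)
    (fam : Family k (annulus m n (3 * (n : ℤ), 0))) (hfam : fam.Surrounds m n (3 * (n : ℤ), 0)) : Setup ε k where
  p := p
  m := m
  n := n
  fam := fam.image (isPlanarIsometry_flipFst (3 * n)) fun _ => flip_annulus
  T := vmap k (flipFst (3 * n)) '' mainLeft k m
  q _ := p
  hp := hp
  le := hmn
  surrounds := by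
    intro o S h P x y hP hx hy
    obtain ⟨S, hS, rfl⟩ := Option.map_eq_some_iff.1 h
    have hP' : Reach PAdj (flipFst (3 * (n : ℤ)) ⁻¹' P) (flipFst (3 * n) x) (flipFst (3 * n) y) := by
      refine hP.induction (P := fun y => Reach PAdj (flipFst (3 * (n : ℤ)) ⁻¹' P) (flipFst (3 * n) x) (flipFst (3 * n) y))
        (fun hx => .refl ?_) fun a b _ ih hab hb => ih.tail ?_ ?_
      · simpa [flipFst_apply] using hx
      · rw [pAdj_iff'] at *; simp only [flipFst_apply]; omega
      · simpa [flipFst_apply] using hb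
    obtain ⟨v, hv, hvP⟩ := hfam _ S hS _ _ _ hP' (by rw [mem_box] at *; simp only [flipFst_apply]; dsimp only at *; omega)
      (by simp only [flipFst_apply]; dsimp only at *; omega)
    exact ⟨_, ⟨v, hv, rfl⟩, hvP⟩
  far := by
    rintro _ ⟨x, ⟨hx, -⟩, rfl⟩
    rw [Set.mem_singleton_iff] at hx
    rw [vmap_fst, flipFst_apply]
    dsimp only
    omega
  weight _ := ⟨by linarith, by linarith⟩
  eq_p _ _ _ := rfl

/-- `Setup.exists_bound` in the reflected picture: the left side of the rectangle becomes the far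
set, and the right annulus takes the place of the left one. The reflected family is used only as an
abstract selection rule, so its order need not be the order on circuits. -/
theorem mirror_bound {ε : ℝ} (hε : 0 < ε) (k : ℕ) {η : ℝ} (hη : 0 < η) : ∃ δ > 0, ∀ p : ℝ, ε ≤ p ∧ p ≤ 1 - ε → ∀ m n : ℕ, 1 ≤ m → m ≤ n →
    ∀ fam : Family k (annulus m n (3 * (n : ℤ), 0)), fam.Surrounds m n (3 * (n : ℤ), 0) →
    1 - δ ≤ Pr (boxEdges k (4 * n)) (fun _ => p) {o | Joined o (lift k (mainRect m n)) (mainLeft k m) (mainRight k m n)} →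
    Pr (boxEdges k (4 * n)) (fun _ => p) {o | ∃ S, fam.sel o = some S ∧ ¬ Joined o (lift k (mainRect m n)) (mainLeft k m) S.verts} ≤ η := by
  obtain ⟨δ, hδ, h⟩ := Setup.exists_bound hε k hη
  refine ⟨δ, hδ, fun p hp m n hm hmn fam hfam hc => ?_⟩
  have hσ := isPlanarIsometry_flipFst (3 * n)
  have key := h (mirrorSetup hε hp hm hmn fam hfam) (hc.trans (Pr_mono (fun _ => ⟨by linarith, by linarith⟩) fun o _ ho => ?_))
  · refine le_of_eq_of_le ?_ key
    rw [← Pr_vmap hσ (D := lift k (mainRect m n ∪ annulus m n (3 * (n : ℤ), 0))) (F := boxEdges k (4 * n)) (G := boxEdges k (4 * n))]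
    · refine Pr_congr fun o _ => ⟨?_, ?_⟩
      · rintro ⟨S, hS, hj⟩
        refine ⟨_, Option.map_eq_some_iff.2 ⟨S, hS, rfl⟩, fun h => hj ?_⟩
        rw [joined_vmap hσ, image_flip_mainRect]
        exact h
      · rintro ⟨_, hS', hj⟩
        obtain ⟨S, hS, rfl⟩ := Option.map_eq_some_iff.1 hS'
        refine ⟨S, hS, fun h => hj ?_⟩
        rw [joined_vmap hσ, image_flip_mainRect] at h
        exact h
    · intro o o' hoo
      have h1 : ∀ {D : Set (Vertex k)}, D ⊆ lift k (mainRect m n ∪ annulus m n (3 * (n : ℤ), 0)) → o ∩ edgesIn D = o' ∩ edgesIn D := fun hD => by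
        rw [← Set.inter_eq_self_of_subset_right (edgesIn_mono hD), ← Set.inter_assoc, ← Set.inter_assoc, hoo]
      rintro ⟨S, hS, hj⟩
      refine ⟨S, (fam.isLocal (h1 fun x hx => .inr hx)).symm.trans hS, fun h => hj ?_⟩
      exact dependsOnly_joined _ _ _ o' o (h1 fun x hx => .inl hx).symm h
    · exact edgesIn_subset_boxEdges fun x hx => hx.elim (fun h => mainRect_subset hmn h) fun h => annulus_subset_right h
    · refine edgesIn_subset_boxEdges ?_
      rintro _ ⟨x, hx | hx, rfl⟩
      · exact mainRect_subset hmn (flip_mainRect.2 hx)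
      · exact annulus_subset_left (flip_annulus hx)
  · refine (Joined.symm ho).mono subset_rfl subset_rfl (fun x hx => ?_) (fun _ h => h)
    obtain ⟨hx1, hx2⟩ : x.1.1 = 3 * (n : ℤ) ∧ x.1.2 ∈ Set.Icc (-(m : ℤ)) m := hx
    refine ⟨((0, x.1.2), x.2), ⟨rfl, hx2⟩, Prod.ext (Prod.ext ?_ rfl) rfl⟩
    rw [vmap_fst, flipFst_apply, hx1]
    simp

/-- Given the configuration near the right circuit, the left circuit is likely to be joined to it whenever the left side is. -/
theorem disconnected_freeze_le {ε δ η p : ℝ} (hε : 0 < ε) (hp : ε ≤ p ∧ p ≤ 1 - ε) (hδ : 0 < δ) (hη : 0 < η) (hm : 1 ≤ m) (hmn : m ≤ n)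
    (h : ∀ X : Setup ε k, 1 - δ ≤ X.pr (X.join (mainLeft k X.m)) →
      X.pr {o | ∃ S, X.fam.sel o = some S ∧ ¬ Joined o (lift k (mainRect X.m X.n)) X.T S.verts} ≤ η)
    {fam : Family k (annulus m n (0, 0))} (hfam : fam.Surrounds m n (0, 0)) (fam' : Family k (annulus m n (3 * (n : ℤ), 0)))
    (ξ : Set (Sym2 (Vertex k))) :
    Pr (boxEdges k (4 * n)) (freeze (fun _ => p) (annulusEdges k m n (3 * (n : ℤ), 0)) ξ)
      {o | ∃ S S', fam.sel o = some S ∧ fam'.sel o = some S' ∧ ¬ Joined o (lift k (mainRect m n)) S.verts S'.verts} ≤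
    η + δ⁻¹ * Pr (boxEdges k (4 * n)) (freeze (fun _ => p) (annulusEdges k m n (3 * (n : ℤ), 0)) ξ)
      {o | ¬ ∃ S, fam'.sel o = some S ∧ Joined o (lift k (mainRect m n)) (mainLeft k m) S.verts} := by
  have hw : IsWeight fun _ : Sym2 (Vertex k) => p := fun _ => ⟨by linarith, by linarith⟩
  have hG : annulusEdges k m n (3 * (n : ℤ), 0) ⊆ boxEdges k (4 * n) := annulusEdges_subset annulus_subset_right
  set G := annulusEdges k m n (3 * (n : ℤ), 0)
  have hwξ := isWeight_freeze hw G ξ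
  set A := {o | ¬ ∃ S, fam'.sel o = some S ∧ Joined o (lift k (mainRect m n)) (mainLeft k m) S.verts} with hA
  have h0 := Pr_nonneg (F := boxEdges k (4 * n)) (E := A) hwξ
  have h1 : 0 ≤ δ⁻¹ * Pr (boxEdges k (4 * n)) (freeze (fun _ => p) G ξ) A := by positivity
  rcases hξ : fam'.sel ξ with _ | S'
  · refine (Pr_freeze_mono hw hG (E' := ∅) fun o _ ho h => ?_).trans (by rw [Pr_empty]; linarith)
    obtain ⟨S, S', -, hS', -⟩ := h
    rw [sel_eq_of_freeze fam' ho, hξ] at hS'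
    cases hS'
  -- Markov's inequality, in conditional form: the conditional estimate applies where the left side
  -- is likely to be joined to the frozen shape, and elsewhere the second term exceeds $1$.
  by_cases hsmall : Pr (boxEdges k (4 * n)) (freeze (fun _ => p) G ξ) A ≤ δ
  · have key := h ⟨p, m, n, fam, S'.verts, freeze (fun _ => p) G ξ, hp, hmn, hfam, ?_, hwξ, ?_⟩ ?_
    · refine le_trans (Pr_freeze_mono hw hG fun o _ ho => ?_) (key.trans (by linarith))
      rintro ⟨S, S'', hS, hS'', hj⟩
      rw [sel_eq_of_freeze fam' ho, hξ] at hS''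
      cases hS''
      exact ⟨S, hS, fun h => hj h.symm⟩
    · intro t ht
      have := mem_box.1 (annulus_subset _ _ _ (fam'.cols hξ t ht))
      dsimp only at *
      omega
    · intro x y hx
      refine freeze_of_notMem (notMem_annulusEdges fun hx' => ?_)
      have := mem_box.1 (annulus_subset _ _ _ hx')
      dsimp only at *
      omega
    · have h2 : Pr (boxEdges k (4 * n)) (freeze (fun _ => p) G ξ) {o | Joined o (lift k (mainRect m n)) S'.verts (mainLeft k m)}ᶜ ≤
          Pr (boxEdges k (4 * n)) (freeze (fun _ => p) G ξ) A := by
        refine Pr_freeze_mono hw hG fun o _ ho hj => ?_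
        rintro ⟨S, hS, hj'⟩
        rw [sel_eq_of_freeze fam' ho, hξ] at hS
        cases hS
        exact hj hj'.symm
      rw [Pr_compl] at h2
      change 1 - δ ≤ Pr (boxEdges k (4 * n)) (freeze (fun _ => p) G ξ) {o | Joined o (lift k (mainRect m n)) S'.verts (mainLeft k m)}
      linarith
  · have h2 : 1 ≤ δ⁻¹ * Pr (boxEdges k (4 * n)) (freeze (fun _ => p) G ξ) A := by
      rw [inv_mul_eq_div, one_le_div hδ]
      exact (not_le.1 hsmall).le
    exact (Pr_le_one hwξ).trans (by linarith)

/-- The lower bound in the regime of probabilities close to one. -/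
theorem connectionProb_near_one (ε : ℝ) (hε : 0 < ε) (k : ℕ) :
    ∀ η > (0 : ℝ), ∃ δ > (0 : ℝ), ∀ p : unitInterval, ε ≤ (p : ℝ) → (p : ℝ) ≤ 1 - ε →
      ∀ m n : ℕ, 3 ≤ m → m ≤ n →
        1 - δ ≤ crossProb k p (3 * n) (2 * m) * circuitProb k p m n ^ 2 →
          1 - η ≤ connectionProb k p m n := by
  intro η hη
  obtain ⟨δ₂, hδ₂, hB⟩ := Setup.exists_bound hε k (η := η / 4) (by positivity)
  obtain ⟨δ₁, hδ₁, hA⟩ := mirror_bound hε k (η := δ₂ * η / 8) (by positivity)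
  -- The existence of the circuits costs at most $\eta/8$ each, the failure of the left side to
  -- reach $\Gamma_2$ costs at most $\delta_2\eta/4$, which becomes $\eta/4$ after division by
  -- $\delta_2$, and the conditional estimate costs another $\eta/4$.
  refine ⟨min δ₁ (min (η / 8) (δ₂ * η / 8)), by positivity, fun p hp hp' m n hm hmn hδ => ?_⟩
  have hw : IsWeight fun _ : Sym2 (Vertex k) => (p : ℝ) := fun _ => ⟨p.2.1, p.2.2⟩
  have e1 := min_le_left δ₁ (min (η / 8) (δ₂ * η / 8))
  have e2 := (min_le_right δ₁ (min (η / 8) (δ₂ * η / 8))).trans (min_le_left _ _)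
  have e3 := (min_le_right δ₁ (min (η / 8) (δ₂ * η / 8))).trans (min_le_right _ _)
  set δ := min δ₁ (min (η / 8) (δ₂ * η / 8))
  have c1 : circuitProb k p m n ≤ 1 := (circuitProb_eq p).trans_le (Pr_le_one hw)
  have c0 : 0 ≤ circuitProb k p m n := measureReal_nonneg
  have f1 : crossProb k p (3 * n) (2 * m) ≤ 1 := (crossProb_eq p hmn).trans_le (Pr_le_one hw)
  have f0 : 0 ≤ crossProb k p (3 * n) (2 * m) := measureReal_nonneg
  have hc : 1 - δ ≤ circuitProb k p m n := by
    refine hδ.trans ((mul_le_of_le_one_left (by positivity) f1).trans ?_)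
    nlinarith
  have hf : 1 - δ ≤ crossProb k p (3 * n) (2 * m) := hδ.trans (mul_le_of_le_one_right f0 (pow_le_one₀ c0 c1))
  have hc' := hc.trans (circuitProb_le p)
  rw [circuitProb_eq] at hc
  rw [crossProb_eq p hmn] at hf
  set F := boxEdges k (4 * n)
  set D := lift k (mainRect m n)
  set f₁ := circuitFamily k m n (0, 0)
  set f₂ := circuitFamily k m n (3 * (n : ℤ), 0)
  have h1 := hA p ⟨hp, hp'⟩ m n (by omega) hmn f₂ (circuitFamily_surrounds m n _) (by linarith)
  set A := {o | ¬ ∃ S, f₂.sel o = some S ∧ Joined o D (mainLeft k m) S.verts}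
  set B := {o | ∃ S S', f₁.sel o = some S ∧ f₂.sel o = some S' ∧ ¬ Joined o D S.verts S'.verts}
  have h2 : Pr F (fun _ => (p : ℝ)) A ≤ δ₂ * η / 4 := by
    have h3 : Pr F (fun _ => (p : ℝ)) A ≤ Pr F (fun _ => (p : ℝ)) ({o | ∃ S, f₂.sel o = some S}ᶜ ∪
        {o | ∃ S, f₂.sel o = some S ∧ ¬ Joined o D (mainLeft k m) S.verts}) := by
      refine Pr_mono hw fun o _ ho => ?_
      by_cases h : ∃ S, f₂.sel o = some S
      · obtain ⟨S, hS⟩ := h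
        exact .inr ⟨S, hS, fun hj => ho ⟨S, hS, hj⟩⟩
      · exact .inl h
    have h4 := h3.trans (Pr_union_le hw)
    rw [Pr_compl] at h4
    linarith
  have h5 : Pr F (fun _ => (p : ℝ)) B ≤ η / 4 + δ₂⁻¹ * Pr F (fun _ => (p : ℝ)) A := by
    have hG : annulusEdges k m n (3 * (n : ℤ), 0) ⊆ F := annulusEdges_subset annulus_subset_right
    rw [Pr_eq_Ex_freeze hG B, Pr_eq_Ex_freeze hG A, ← Ex_mul_left, ← Ex_const (F := annulusEdges k m n (3 * (n : ℤ), 0))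
      (q := fun _ => (p : ℝ)) (η / 4), ← Ex_add]
    exact Ex_mono hw fun ξ _ => disconnected_freeze_le hε ⟨hp, hp'⟩ hδ₂ (by positivity) (by omega) hmn hB
      (circuitFamily_surrounds m n _) f₂ ξ
  have h6 : δ₂⁻¹ * Pr F (fun _ => (p : ℝ)) A ≤ η / 4 := by
    rw [inv_mul_le_iff₀ hδ₂]
    linarith
  have h7 : Pr F (fun _ => (p : ℝ)) {o | ∃ S₁ S₂, f₁.sel o = some S₁ ∧ f₂.sel o = some S₂ ∧ Joined o D S₁.verts S₂.verts}ᶜ ≤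
      Pr F (fun _ => (p : ℝ)) ({o | ∃ S, f₁.sel o = some S}ᶜ ∪ ({o | ∃ S, f₂.sel o = some S}ᶜ ∪ B)) := by
    refine Pr_mono hw fun o _ ho => ?_
    by_cases h : ∃ S, f₁.sel o = some S
    · by_cases h' : ∃ S, f₂.sel o = some S
      · obtain ⟨S, hS⟩ := h
        obtain ⟨S', hS'⟩ := h'
        exact .inr (.inr ⟨S, S', hS, hS', fun hj => ho ⟨S, S', hS, hS', hj⟩⟩)
      · exact .inr (.inl h')
    · exact .inl h
  have h8 := h7.trans ((Pr_union_le hw).trans (add_le_add le_rfl (Pr_union_le hw)))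
  rw [Pr_compl, Pr_compl, Pr_compl] at h8
  rw [connectionProb_eq p hmn]
  linarith

end Slab

/-! ### The theorem: the two estimates applied to all pairs that occur. -/

theorem theorem3p6 (ε : ℝ) (hε : 0 < ε) (k : ℕ) (hk : 1 ≤ k) :
    ∃ h : ℝ → ℝ, Slab.IsGluingFunction h ∧
      ∀ p : unitInterval, ε ≤ (p : ℝ) → (p : ℝ) ≤ 1 - ε →
      ∀ m n : ℕ, 3 ≤ m → m ≤ n →
        h (Slab.crossProb k p (3 * n) (2 * m) * Slab.circuitProb k p m n ^ 2) ≤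
          (Slab.perc k p).real {ω | Slab.Connected ω
            (Slab.minCircuit ω m n (0, 0))
            (Slab.lift k (Set.Icc 0 (3 * (n : ℤ)) ×ˢ Set.Icc (-(m : ℤ)) (m : ℤ)))
            (Slab.minCircuit ω m n (3 * (n : ℤ), 0))} := by
  classical
  obtain ⟨c, hc, hc1, hlow⟩ := Slab.exists_mul_le_connectionProb ε hε k
  have hnear := Slab.connectionProb_near_one ε hε k
  set S : Set (ℝ × ℝ) := {z | ∃ p : unitInterval, ε ≤ (p : ℝ) ∧ (p : ℝ) ≤ 1 - ε ∧ ∃ m n : ℕ, 3 ≤ m ∧ m ≤ n ∧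
      z = (Slab.crossProb k p (3 * n) (2 * m) * Slab.circuitProb k p m n ^ 2,
        Slab.connectionProb k p m n)}
  have hS : ∀ z ∈ S, z.1 ∈ Set.Icc (0 : ℝ) 1 := by
    rintro _ ⟨p, -, -, m, n, -, -, rfl⟩
    have : IsProbabilityMeasure (Slab.perc k p) := by unfold Slab.perc; infer_instance
    have h1 : 0 ≤ Slab.circuitProb k p m n := measureReal_nonneg
    have h2 : Slab.circuitProb k p m n ≤ 1 := measureReal_le_one
    have h3 : 0 ≤ Slab.crossProb k p (3 * n) (2 * m) := measureReal_nonneg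
    have h4 : Slab.crossProb k p (3 * n) (2 * m) ≤ 1 := measureReal_le_one
    exact ⟨by positivity, mul_le_one₀ h4 (by positivity) (pow_le_one₀ h1 h2)⟩
  have hlow' : ∀ z ∈ S, c * z.1 ≤ z.2 := by
    rintro _ ⟨p, hp, hp', m, n, hm, hn, rfl⟩
    exact hlow p hp hp' m n hm hn
  have hnear' : ∀ η > (0 : ℝ), ∃ δ > (0 : ℝ), ∀ z ∈ S, 1 - δ ≤ z.1 → 1 - η ≤ z.2 := by
    intro η hη
    obtain ⟨δ, hδ, hd⟩ := hnear η hη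
    refine ⟨δ, hδ, ?_⟩
    rintro _ ⟨p, hp, hp', m, n, hm, hn, rfl⟩ hz
    exact hd p hp hp' m n hm hn hz
  obtain ⟨h, hh, hle⟩ := Slab.exists_isGluingFunction_le hc hc1 hS hlow' hnear'
  exact ⟨h, hh, fun p hp hp' m n hm hn => hle _ ⟨p, hp, hp', m, n, hm, hn, rfl⟩⟩
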